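/- Let $d\ge 2$ and let $\mathscr F_d$ be the set of triples $(P,Q,R)$ of homogeneous polynomials of degree $d$ in $\mathbb C[z,w]$ such that $(0,0)$ is the only common zero of $P$ and $Q$ (a Zariski open subset of the affine space $\mathbb C^{3(d+1)}$ of coefficients). Definitions. Let $f$ be a holomorphic endomorphism of $\mathbb P^k=\mathbb P^k(\mathbb C)$ of algebraic degree $d$. A set $\mathscr A\subset\mathbb P^k$ is an *attracting set* of $f$ if there is an open set $U$ (a *trapping region* for $\mathscr A$) with $f(U)\Subset U$ and $\mathscr A=\bigcap_{n\ge 0}f^n(U)$. It is *of dimension* $s$ if it supports a nonzero positive closed current of bidimension $(s,s)$ but none of bidimension $(l,l)$ with $l>s$. The map $f$ is *of small topological degree* on an attracting set $\mathscr A$ of dimension $s$ if there is a trapping region $U$ for $\mathscr A$ such that $\limsup_{n\to\infty}\bigl(\operatorname{card}(f^{-n}(p)\cap U)\bigr)^{1/n}<d^{s}$ for every $p\in f(U)$. Theorem. There is a non-empty Zariski open set $\Omega\subset\mathscr F_d$ such that for every $(P,Q,R)\in\Omega$ there are real numbers $\varepsilon_1(P,Q,R)>0$ and $\varepsilon_2(P,Q,R)>0$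 with the following property. For all $\varepsilon_1,\varepsilon_2\in\mathbb C$ with $0<|\varepsilon_1|<\varepsilon_1(P,Q,R)$ and $0<|\varepsilon_2|<\varepsilon_2(P,Q,R)$, the endomorphism of $\mathbb P^3$ given by $$f:[z:w:t:u]\mapsto\bigl[P(z,w):Q(z,w):t^d+\varepsilon_1R(z,w):u^d+\varepsilon_2Q(z,w)-\varepsilon_2^d\,w^d\bigr]$$ is of small topological degree on an attracting set $\mathscr A$ of dimension $1$ which is contained in the hyperplane $\{[z:w:t:u]\;;\;u=\varepsilon_2w\}$. Moreover $\mathscr A$ is not an algebraic subset of $\mathbb P^3$, although it is contained in a hyperplane. -/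

import Mathlib

open scoped LinearAlgebra.Projectivization ContDiff ENNReal Topology ComplexConjugate

noncomputable section

namespace AttractingSets

/-! ### Complex projective space and its holomorphic endomorphisms -/

/-- The affine cone `ℂ^(k+1)` over `ℙ^k`. -/
abbrev Cone (k : ℕ) : Type := Fin (k + 1) → ℂ

/-- Complex projective space `ℙ^k`. -/
abbrev PSpace (k : ℕ) : Type := ℙ ℂ (Cone k)

/-- The usual topology of `ℙ^k`: the quotient topology of `ℂ^(k+1) ∖ {0}`. -/
instance PSpace.instTopologicalSpace (k : ℕ) : TopologicalSpace (PSpace k) :=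
  TopologicalSpace.coinduced (Projectivization.mk' ℂ (V := Cone k)) inferInstance

/-- A holomorphic endomorphism of `ℙ^k` of algebraic degree `d`, given by `k + 1` homogeneous
polynomials of degree `d` whose only common zero is the origin. -/
structure Endo (k d : ℕ) where
  /-- The components. -/
  poly : Fin (k + 1) → MvPolynomial (Fin (k + 1)) ℂ
  isHomogeneous : ∀ i, (poly i).IsHomogeneous d
  eq_zero_of_eval : ∀ x : Cone k, (∀ i, MvPolynomial.eval x (poly i) = 0) → x = 0

theorem eval_smul_of_isHomogeneous {σ : Type} {G : MvPolynomial σ ℂ} {d : ℕ}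
    (hG : G.IsHomogeneous d) (c : ℂ) (x : σ → ℂ) :
    MvPolynomial.eval (c • x) G = c ^ d * MvPolynomial.eval x G := by
  rw [MvPolynomial.eval_eq, MvPolynomial.eval_eq, Finset.mul_sum]
  refine Finset.sum_congr rfl fun m hm => ?_
  have hm' : m.degree = d := by
    by_contra h
    exact (MvPolynomial.mem_support_iff.mp hm) (hG.coeff_eq_zero h)
  simp only [Pi.smul_apply, smul_eq_mul, mul_pow, Finset.prod_mul_distrib]
  rw [Finset.prod_pow_eq_pow_sum, ← hm', Finsupp.degree_apply]
  ring

namespace Endo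

variable {k d : ℕ}

/-- The lift of an endomorphism to the cone. -/
def coneMap (f : Endo k d) (x : Cone k) : Cone k := fun i => MvPolynomial.eval x (f.poly i)

theorem coneMap_ne_zero (f : Endo k d) {x : Cone k} (hx : x ≠ 0) : f.coneMap x ≠ 0 :=
  fun h => hx (f.eq_zero_of_eval x fun i => congrFun h i)

/-- The self-map `[x] ↦ [F₀(x) : ⋯ : F_k(x)]` of `ℙ^k`. -/
def toFun (f : Endo k d) : PSpace k → PSpace k :=
  Projectivization.lift
    (fun x : { v : Cone k // v ≠ 0 } =>
      Projectivization.mk ℂ (f.coneMap x.1) (f.coneMap_ne_zero x.2))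
    (by
      intro a b t hab
      rw [Projectivization.mk_eq_mk_iff']
      refine ⟨t ^ d, ?_⟩
      funext i
      simp only [coneMap, hab, Pi.smul_apply, smul_eq_mul]
      exact (eval_smul_of_isHomogeneous (f.isHomogeneous i) t b.1).symm)

instance : CoeFun (Endo k d) (fun _ => PSpace k → PSpace k) := ⟨toFun⟩

theorem apply_mk (f : Endo k d) (x : Cone k) (hx : x ≠ 0) :
    f (Projectivization.mk ℂ x hx) =
      Projectivization.mk ℂ (f.coneMap x) (f.coneMap_ne_zero hx) := rfl

end Endo

/-- Algebraic subsets of `ℙ^k`: common zero sets of families of homogeneous polynomials. -/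
def IsAlgebraicSet {k : ℕ} (A : Set (PSpace k)) : Prop :=
  ∃ S : Set (MvPolynomial (Fin (k + 1)) ℂ),
    (∀ G ∈ S, ∃ m, G.IsHomogeneous m) ∧ A = {p | ∀ G ∈ S, MvPolynomial.eval p.rep G = 0}

/-! ### Differential forms and currents on `ℙ^k`

The projection `π : ℂ^(k+1) ∖ {0} → ℙ^k` is a principal `ℂˣ`-bundle, so pull-back by `π` identifies
the smooth `n`-forms on `ℙ^k` with the smooth `n`-forms on `ℂ^(k+1) ∖ {0}` which are invariant
under the homotheties `x ↦ c • x`, `c ≠ 0`, and vanish as soon as one argument is tangent to the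
fibre, i.e. is a complex multiple of the base point. Pull-back by `π` commutes with `d` and respects
bidegree, positivity and supports, and all these are expressed below on `ℂ^(k+1) ∖ {0}`. -/

/-- Smooth complex-valued `n`-forms on `ℙ^k`. (The irrelevant value at the origin of the cone is
normalized to be `0`.) -/
def SmoothForm (k n : ℕ) : Submodule ℂ (Cone k → Cone k [⋀^Fin n]→L[ℝ] ℂ) where
  carrier := {α | α 0 = 0 ∧ ContDiffOn ℝ ∞ α {0}ᶜ ∧
    (∀ c : ℂ, c ≠ 0 → ∀ x, x ≠ 0 → ∀ v : Fin n → Cone k,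
      α (c • x) (fun i => c • v i) = α x v) ∧
    (∀ x, x ≠ 0 → ∀ v : Fin n → Cone k, (∃ i, ∃ c : ℂ, v i = c • x) → α x v = 0)}
  add_mem' := by
    rintro α β ⟨h1, h2, h3, h4⟩ ⟨g1, g2, g3, g4⟩
    refine ⟨by simp [h1, g1], h2.add g2, ?_, ?_⟩
    · intro c hc x hx v
      simp [h3 c hc x hx v, g3 c hc x hx v]
    · intro x hx v hv
      simp [h4 x hx v hv, g4 x hx v hv]
  zero_mem' := ⟨rfl, contDiffOn_const, fun _ _ _ _ _ => rfl, fun _ _ _ _ => rfl⟩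
  smul_mem' := by
    rintro a α ⟨h1, h2, h3, h4⟩
    refine ⟨by simp [h1], h2.const_smul a, ?_, ?_⟩
    · intro c hc x hx v
      simp [h3 c hc x hx v]
    · intro x hx v hv
      simp [h4 x hx v hv]

namespace SmoothForm

variable {k n : ℕ}

/-- `α` is of bidegree `(p, q)` (for an `n`-form, where `n = p + q` unless `α = 0`). -/
def IsBidegree (α : SmoothForm k n) (p q : ℕ) : Prop :=
  p + q = n ∧ ∀ x, x ≠ 0 → ∀ (c : ℂ) (v : Fin n → Cone k),
    α.1 x (fun i => c • v i) = c ^ p * conj c ^ q * α.1 x v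

/-- The support of a form, as a closed subset of `ℙ^k`. -/
def support (α : SmoothForm k n) : Set (PSpace k) := closure {p | α.1 p.rep ≠ 0}

/-- `γ = dβ`. -/
def IsExteriorDerivative (γ : SmoothForm k (n + 1)) (β : SmoothForm k n) : Prop :=
  ∀ x, x ≠ 0 → γ.1 x = extDeriv β.1 x

/-- The `2l`-tuple `(v₁, i v₁, …, v_l, i v_l)`. -/
def complexTuple {l : ℕ} (v : Fin l → Cone k) : Fin (2 * l) → Cone k :=
  fun j => Complex.I ^ (j.1 % 2) • v ⟨j.1 / 2, by omega⟩

/-- Positive `(l, l)`-forms: those whose restriction to each `l`-dimensional complex subspace of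
each tangent space is a nonnegative volume form. (In complex dimension at most `3`, hence on `ℙ^3`,
the weak and the strong notion of positivity coincide in every bidegree, for forms and for
currents.) -/
def IsPositive {l : ℕ} (α : SmoothForm k (2 * l)) : Prop :=
  IsBidegree α l l ∧ ∀ x, x ≠ 0 → ∀ v : Fin l → Cone k,
    0 ≤ (α.1 x (complexTuple v)).re ∧ (α.1 x (complexTuple v)).im = 0

end SmoothForm

/-- Currents of (real) dimension `n` on `ℙ^k`: linear forms on smooth `n`-forms which are continuous
for the `C^∞` topology. The derivatives of (the pull-back to the cone of) a form up to order `N` are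
controlled by those at the points of the unit sphere, which is compact and meets each fibre. -/
structure Current (k n : ℕ) where
  /-- The pairing with test forms. -/
  toLinearMap : SmoothForm k n →ₗ[ℂ] ℂ
  continuous' : ∃ (N : ℕ) (C : ℝ), ∀ (α : SmoothForm k n) (M : ℝ),
    (∀ j ≤ N, ∀ x : Cone k, ‖x‖ = 1 → ‖iteratedFDeriv ℝ j α.1 x‖ ≤ M) →
      ‖toLinearMap α‖ ≤ C * M

namespace Current

variable {k : ℕ}

/-- `T` is closed: it vanishes on exact forms. -/
def IsClosed : {n : ℕ} → Current k n → Prop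
  | 0, _ => True
  | n + 1, T => ∀ (β : SmoothForm k n) (γ : SmoothForm k (n + 1)),
      SmoothForm.IsExteriorDerivative γ β → T.toLinearMap γ = 0

/-- `T` is of bidimension `(l, l)`: it vanishes on forms of any other bidegree. -/
def IsBidimension {l : ℕ} (T : Current k (2 * l)) : Prop :=
  ∀ p q : ℕ, (p, q) ≠ (l, l) → ∀ α : SmoothForm k (2 * l), SmoothForm.IsBidegree α p q →
    T.toLinearMap α = 0

/-- `T` is positive: it is nonnegative on positive `(l, l)`-forms. -/
def IsPositive {l : ℕ} (T : Current k (2 * l)) : Prop :=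
  ∀ α : SmoothForm k (2 * l), SmoothForm.IsPositive α →
    0 ≤ (T.toLinearMap α).re ∧ (T.toLinearMap α).im = 0

/-- The support of a current: the complement of the union of the open sets on which it vanishes. -/
def support {n : ℕ} (T : Current k n) : Set (PSpace k) :=
  (⋃₀ {V | IsOpen V ∧ ∀ α : SmoothForm k n, SmoothForm.support α ⊆ V → T.toLinearMap α = 0})ᶜ

end Current

/-- `A` supports a (nonzero) positive closed current of bidimension `(l, l)`. -/
def SupportsPositiveClosedCurrent {k : ℕ} (A : Set (PSpace k)) (l : ℕ) : Prop :=
  ∃ T : Current k (2 * l), T.toLinearMap ≠ 0 ∧ T.IsBidimension ∧ T.IsPositive ∧ T.IsClosed ∧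
    T.support ⊆ A

/-! ### Attracting sets and small topological degree -/

/-- `U` is a trapping region of `f` for the attracting set `A`: `U` is open, `f(U)` is relatively
compact in `U` (recall that `ℙ^k` is compact) and `A = ⋂ₙ fⁿ(U)`. -/
def IsTrappingRegion {k d : ℕ} (f : Endo k d) (U A : Set (PSpace k)) : Prop :=
  IsOpen U ∧ closure (f '' U) ⊆ U ∧ A = ⋂ n : ℕ, f^[n] '' U

/-- `A` is an attracting set of `f`. -/
def IsAttractingSet {k d : ℕ} (f : Endo k d) (A : Set (PSpace k)) : Prop :=
  ∃ U, IsTrappingRegion f U A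

/-- The dimension of an attracting set: `A` supports a positive closed current of bidimension
`(s, s)` but none of bidimension `(l, l)` with `l > s`. -/
def HasDimension {k : ℕ} (A : Set (PSpace k)) (s : ℕ) : Prop :=
  SupportsPositiveClosedCurrent A s ∧ ∀ l, s < l → ¬ SupportsPositiveClosedCurrent A l

/-- `f` is asymptotically of small topological degree on the trapping region `U` (of an attracting
set of dimension `s`): `limsup (card (f⁻ⁿ(p) ∩ U))^(1/n) < d^s` for all `p ∈ f(U)`. -/
def IsAsymptoticallySmallDegree {k d : ℕ} (f : Endo k d) (U : Set (PSpace k)) (s : ℕ) : Prop :=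
  ∀ p ∈ f '' U,
    Filter.limsup
      (fun n : ℕ => (((f^[n] ⁻¹' {p} ∩ U).encard : ℕ∞) : ℝ≥0∞) ^ (1 / (n : ℝ))) Filter.atTop
      < (d : ℝ≥0∞) ^ s

/-- `f` is of small topological degree on the attracting set `A`. -/
def IsSmallTopologicalDegreeOn {k d : ℕ} (f : Endo k d) (A : Set (PSpace k)) : Prop :=
  ∃ (s : ℕ) (U : Set (PSpace k)), HasDimension A s ∧ IsTrappingRegion f U A ∧
    IsAsymptoticallySmallDegree f U s

/-! ### The family of maps -/

/-- The set `𝓕_d` of triples `(P, Q, R)` of homogeneous polynomials of degree `d` in two variables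
such that `(0, 0)` is the only common zero of `P` and `Q`. -/
structure Triple (d : ℕ) where
  /-- The first polynomial. -/
  P : MvPolynomial (Fin 2) ℂ
  /-- The second polynomial. -/
  Q : MvPolynomial (Fin 2) ℂ
  /-- The third polynomial. -/
  R : MvPolynomial (Fin 2) ℂ
  homP : P.IsHomogeneous d
  homQ : Q.IsHomogeneous d
  homR : R.IsHomogeneous d
  eq_zero_of_eval : ∀ x : Fin 2 → ℂ, MvPolynomial.eval x P = 0 → MvPolynomial.eval x Q = 0 → x = 0

namespace Triple

variable {d : ℕ}

/-- The coefficients of `z^i w^(d-i)`, `0 ≤ i ≤ d`, in `P`, `Q` and `R`, as a point of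
`ℂ^(3(d+1))`. -/
def coeffs (τ : Triple d) : Fin 3 × Fin (d + 1) → ℂ := fun ji =>
  MvPolynomial.coeff (Finsupp.single 0 ji.2.1 + Finsupp.single 1 (d - ji.2.1))
    (![τ.P, τ.Q, τ.R] ji.1)

/-- Zariski open subsets of `𝓕_d`: complements of common zero sets of polynomials in the
coefficients. -/
def IsZariskiOpen (Ω : Set (Triple d)) : Prop :=
  ∃ S : Set (MvPolynomial (Fin 3 × Fin (d + 1)) ℂ),
    Ω = {τ | ∃ G ∈ S, MvPolynomial.eval τ.coeffs G ≠ 0}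

/-- A binary form seen as a polynomial in the first two of the coordinates `z, w, t, u`. -/
def inZW (G : MvPolynomial (Fin 2) ℂ) : MvPolynomial (Fin (3 + 1)) ℂ :=
  MvPolynomial.rename ![0, 1] G

theorem eval_inZW (G : MvPolynomial (Fin 2) ℂ) (x : Cone 3) :
    MvPolynomial.eval x (inZW G) = MvPolynomial.eval ![x 0, x 1] G := by
  rw [inZW, MvPolynomial.eval_rename]
  congr 2
  funext i
  fin_cases i <;> rfl

theorem inZW_isHomogeneous {G : MvPolynomial (Fin 2) ℂ} (hG : G.IsHomogeneous d) :
    (inZW G).IsHomogeneous d := hG.rename_isHomogeneous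

open MvPolynomial in
/-- The endomorphism of `ℙ^3` given by
`[z:w:t:u] ↦ [P(z,w) : Q(z,w) : t^d + ε₁ R(z,w) : u^d + ε₂ Q(z,w) - ε₂^d w^d]`. -/
def toEndo (τ : Triple d) (hd : 2 ≤ d) (ε₁ ε₂ : ℂ) : Endo 3 d where
  poly := ![inZW τ.P, inZW τ.Q, X 2 ^ d + C ε₁ * inZW τ.R,
    X 3 ^ d + C ε₂ * inZW τ.Q - C (ε₂ ^ d) * X 1 ^ d]
  isHomogeneous := by
    have hC : ∀ (a : ℂ) {G : MvPolynomial (Fin (3 + 1)) ℂ}, G.IsHomogeneous d →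
        (C a * G).IsHomogeneous d := fun a G hG => by
      simpa using (isHomogeneous_C _ a).mul hG
    intro i
    fin_cases i
    · exact inZW_isHomogeneous τ.homP
    · exact inZW_isHomogeneous τ.homQ
    · exact (isHomogeneous_X_pow _ _).add (hC _ (inZW_isHomogeneous τ.homR))
    · exact ((isHomogeneous_X_pow _ _).add (hC _ (inZW_isHomogeneous τ.homQ))).sub
        (hC _ (isHomogeneous_X_pow _ _))
  eq_zero_of_eval := by
    intro x hx
    have hd0 : d ≠ 0 := by omega
    have h0 := hx 0
    have h1 := hx 1
    have h2 := hx 2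
    have h3 := hx 3
    simp only [Matrix.cons_val, eval_inZW, map_add, map_sub, map_mul, map_pow, eval_X,
      eval_C] at h0 h1 h2 h3
    have hzw := τ.eq_zero_of_eval _ h0 h1
    have hz : x 0 = 0 := congrFun hzw 0
    have hw : x 1 = 0 := congrFun hzw 1
    have hR : eval ![x 0, x 1] τ.R = 0 := by
      have := eval_smul_of_isHomogeneous τ.homR 0 ![x 0, x 1]
      rw [zero_smul, zero_pow hd0, zero_mul] at this
      rw [hzw]
      exact this
    have ht : x 2 = 0 := by simpa [hR, hd0] using h2
    have hu : x 3 = 0 := by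
      rw [h1, hw, zero_pow hd0] at h3
      simpa [hd0] using h3
    funext i
    fin_cases i <;> assumption

end Triple

end AttractingSets

end

open scoped LinearAlgebra.Projectivization ContDiff ENNReal Topology ComplexConjugate

noncomputable section

namespace AttractingSets

/-! ### The topology of projective space -/

namespace PSpace

variable {k : ℕ}

/-! Write t = ε₁S, u = ε₂V, Y = (z, w) and F = (P, Q). In these coordinates the map is (Y, S, V) ↦
(F(Y), R(Y) + ε₁^(d-1) S^d, Q(Y) + ε₂^(d-1)(V^d − w^d)) (`Triple.coneMap_unscale`), a small
perturbation of a map depending on Y only. For a suitable ρ and small parameters the tube |S|, |V| <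
ρ|Y| around the line t = u = 0 is a trapping region U (`Triple.Adapted.step_mem`). The difference V
− w is sent to ε₂^(d-1)(V^d − w^d), so it is contracted relative to |Y| and vanishes on the
attracting set A (`Triple.Adapted.snd_snd_eq`): A lies in u = ε₂w.

Dimension. The tube contains the line t = u = 0. Integration over its successive images, normalized
to Fubini–Study mass 1, has weak limits, which are positive closed currents of bidimension (1,1)
supported by A (`supportsPositiveClosedCurrent_one`). For bidimension (2,2) and (3,3), the exterior
derivative of a form contracted with the linear field (0, 0, t, u) is strictly positive on the line,
hence near it. A closed current kills this exact form, so a positive one supported nearby is zero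
(`Current.eq_zero_of_isStrictlyPositiveOn`,
`exists_isOpen_forall_not_supportsPositiveClosedCurrent`). When the parameters are small, A lies in
the neighbourhood where this applies.

Small topological degree. On f(U), S is close to R and V is close to w, both evaluated at suitable
lifts. If two points of f²(U) have the same image, comparing coordinates shows that a nearby term of
the orbit of Y under F is close to a bad set of the projective line: w = 0, or R = 0, or R(Z)^d =
R(Y)^d for a conjugate point Z with F(Z) = F(Y) (`Triple.Adapted.nearBad_of_iterate_eq`). For a
generic triple at most one of ten consecutive points of an orbit of F is bad, and by compactness the
same holds for a neighbourhood of the bad set (`Triple.IsGeneric.exists_nearBad`). Hence nine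
consecutive steps involve at most two branchings, each among at most d^4 points, and yield at most
d^8 < d^9 preimages (`Triple.Adapted.encard_window_le`).

Non-algebraicity. Over a fixed point Y of F the map acts on S by a contraction. If A were algebraic,
its fibre over Y would be finite, so orbits in it would end at a fixed point of f. Since Y is not
bad, this fixed point has no other preimage in A; but a point of A over a conjugate of Y is
eventually mapped to it (`Triple.Adapted.not_isAlgebraicSet`).

Genericity. The failure of genericity is the solvability of a system of equations homogeneous in
each of three blocks of variables. A Nullstellensatz argument makes its unsolvability a Zariski open
condition (`exists_eval_ne_zero_of_forall_block`). Non-emptiness comes from an explicit F with an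
invariant disc which contains the image of every bad point but no bad point
(`Triple.exists_forall_windowSystem`). -/

theorem exists_rep_mk (x : Cone k) (hx : x ≠ 0) :
    ∃ c : ℂ, c ≠ 0 ∧ (Projectivization.mk ℂ x hx).rep = c • x := by
  obtain ⟨a, ha⟩ := Projectivization.exists_smul_eq_mk_rep ℂ x hx
  exact ⟨a, a.ne_zero, ha.symm⟩

theorem exists_mk_eq (p : PSpace k) : ∃ (x : Cone k) (hx : x ≠ 0), p = Projectivization.mk ℂ x hx :=
  ⟨p.rep, p.rep_nonzero, p.mk_rep.symm⟩

theorem mk_smul (x : Cone k) (hx : x ≠ 0) (c : ℂ) (hc : c • x ≠ 0) :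
    Projectivization.mk ℂ (c • x) hc = Projectivization.mk ℂ x hx :=
  (Projectivization.mk_eq_mk_iff' ℂ _ _ _ _).2 ⟨c, rfl⟩

theorem continuous_mk' : Continuous (Projectivization.mk' ℂ (V := Cone k)) :=
  continuous_coinduced_rng

theorem isOpen_of_cone {S : Set (Cone k)} (hS : IsOpen S) {U : Set (PSpace k)}
    (h : ∀ x (hx : x ≠ 0), Projectivization.mk ℂ x hx ∈ U ↔ x ∈ S) : IsOpen U := by
  refine isOpen_coinduced.2 ?_
  have : Projectivization.mk' ℂ (V := Cone k) ⁻¹' U = Subtype.val ⁻¹' S := by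
    ext x
    exact h x.1 x.2
  rw [this]
  exact hS.preimage continuous_subtype_val

theorem isClosed_of_cone {S : Set (Cone k)} (hS : IsClosed S) {U : Set (PSpace k)}
    (h : ∀ x (hx : x ≠ 0), Projectivization.mk ℂ x hx ∈ U ↔ x ∈ S) : IsClosed U := by
  rw [← isOpen_compl_iff]
  exact isOpen_of_cone hS.isOpen_compl fun x hx => by simp [h x hx]

/-- The unit sphere of the cone is compact and meets every fibre. -/
instance : CompactSpace (PSpace k) := by
  have hc : IsCompact (Set.univ : Set (Metric.sphere (0 : Cone k) 1)) :=
    isCompact_univ_iff.2 (isCompact_iff_compactSpace.1 (isCompact_sphere _ _))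
  let g : Metric.sphere (0 : Cone k) 1 → {v : Cone k // v ≠ 0} := fun x =>
    ⟨x.1, fun h => by simpa [h] using x.2⟩
  have hg : Continuous g := by fun_prop
  refine ⟨?_⟩
  have : (Set.univ : Set (PSpace k)) = (fun x => Projectivization.mk' ℂ (g x)) '' Set.univ := by
    symm
    rw [Set.image_univ, Set.range_eq_univ]
    intro p
    obtain ⟨x, hx, rfl⟩ := exists_mk_eq p
    have hn : (‖x‖ : ℂ)⁻¹ ≠ 0 := by simpa using hx
    refine ⟨⟨(‖x‖ : ℂ)⁻¹ • x, ?_⟩, ?_⟩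
    · simp [norm_smul, hx]
    · exact mk_smul x hx _ _
  rw [this]
  exact hc.image (continuous_mk'.comp hg)

/-- The square of the euclidean norm. -/
def normSq (x : Cone k) : ℝ := ∑ i, Complex.normSq (x i)

theorem normSq_pos {x : Cone k} (hx : x ≠ 0) : 0 < normSq x := by
  obtain ⟨i, hi⟩ := Function.ne_iff.1 hx
  exact Finset.sum_pos' (fun i _ => Complex.normSq_nonneg _)
    ⟨i, Finset.mem_univ i, Complex.normSq_pos.2 hi⟩

theorem normSq_smul (c : ℂ) (x : Cone k) : normSq (c • x) = Complex.normSq c * normSq x := by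
  simp [normSq, Finset.mul_sum]

theorem contDiff_normSq : ContDiff ℝ ∞ (normSq : Cone k → ℝ) := by
  unfold normSq
  simp only [Complex.normSq_apply]
  have hre : ContDiff ℝ ∞ Complex.re := Complex.reCLM.contDiff
  have him : ContDiff ℝ ∞ Complex.im := Complex.imCLM.contDiff
  refine ContDiff.sum fun i _ => ?_
  have hi : ContDiff ℝ ∞ fun x : Cone k => x i := contDiff_apply ℝ ℂ i
  exact ((hre.comp hi).mul (hre.comp hi)).add ((him.comp hi).mul (him.comp hi))

/-- The orthogonal projector onto the line through `x`. -/
def projector (x : Cone k) : Fin (k + 1) → Fin (k + 1) → ℂ :=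
  fun i j => ((normSq x)⁻¹ : ℝ) • (x i * conj (x j))

theorem projector_smul {c : ℂ} (hc : c ≠ 0) (x : Cone k) : projector (c • x) = projector x := by
  funext i j
  have hc' : Complex.normSq c ≠ 0 := by simpa using hc
  by_cases hx : x = 0
  · simp [hx]
  have hx' := (normSq_pos hx).ne'
  simp only [projector, normSq_smul, Pi.smul_apply, smul_eq_mul, map_mul, Complex.real_smul]
  have h := Complex.mul_conj c
  push_cast
  have h1 : (Complex.normSq c : ℂ) ≠ 0 := by exact_mod_cast hc'
  have h2 : (normSq x : ℂ) ≠ 0 := by exact_mod_cast hx'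
  field_simp
  rw [← h]
  ring

theorem contDiffOn_projector : ContDiffOn ℝ ∞ (projector : Cone k → _) {0}ᶜ := by
  refine contDiffOn_pi.2 fun i => contDiffOn_pi.2 fun j => ?_
  refine ContDiffOn.smul (f := fun x : Cone k => (normSq x)⁻¹)
    (g := fun x : Cone k => x i * conj (x j)) ?_ ?_
  · exact contDiff_normSq.contDiffOn.inv fun x hx => (normSq_pos hx).ne'
  · refine ContDiff.contDiffOn ?_
    have h : ∀ i, ContDiff ℝ ∞ fun x : Cone k => x i := contDiff_apply ℝ ℂ
    have hc : ContDiff ℝ ∞ (fun z : ℂ => conj z) := Complex.conjCLE.contDiff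
    exact (h i).mul (hc.comp (h j))

/-- The embedding of projective space by orthogonal projectors. -/
def embed (p : PSpace k) : Fin (k + 1) → Fin (k + 1) → ℂ := projector p.rep

theorem embed_mk (x : Cone k) (hx : x ≠ 0) : embed (Projectivization.mk ℂ x hx) = projector x := by
  obtain ⟨c, hc, h⟩ := exists_rep_mk x hx
  rw [embed, h, projector_smul hc]

theorem continuous_embed : Continuous (embed : PSpace k → _) := by
  refine continuous_coinduced_dom.2 ?_
  have : embed ∘ Projectivization.mk' ℂ (V := Cone k) = fun x => projector x.1 := by
    funext x
    exact embed_mk x.1 x.2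
  rw [this]
  exact contDiffOn_projector.continuousOn.comp_continuous continuous_subtype_val fun x => x.2

/-- A line is recovered from its projector as the span of any non-zero column; comparing the `j`-th
columns of two equal projectors gives the factor between the representatives. -/
theorem embed_injective : Function.Injective (embed : PSpace k → _) := by
  intro p q h
  obtain ⟨x, hx, rfl⟩ := exists_mk_eq p
  obtain ⟨y, hy, rfl⟩ := exists_mk_eq q
  rw [embed_mk, embed_mk] at h
  have hxn : ((normSq x : ℝ) : ℂ) ≠ 0 := by exact_mod_cast (normSq_pos hx).ne'
  have hyn : ((normSq y : ℝ) : ℂ) ≠ 0 := by exact_mod_cast (normSq_pos hy).ne'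
  obtain ⟨j, hj⟩ := Function.ne_iff.1 hx
  have hj' : conj (x j) ≠ 0 := by simpa using hj
  refine (Projectivization.mk_eq_mk_iff' ℂ _ _ _ _).2
    ⟨(normSq x : ℂ) * conj (y j) / (normSq y * conj (x j)), ?_⟩
  funext i
  have hij := congrFun (congrFun h i) j
  simp only [projector, Complex.real_smul] at hij
  push_cast at hij
  field_simp at hij
  simp only [Pi.smul_apply, smul_eq_mul]
  field_simp
  linear_combination -hij

instance : T2Space (PSpace k) := T2Space.of_injective_continuous embed_injective continuous_embed

/-- This allows separation properties and smooth cut-off functions to be imported from a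
finite-dimensional vector space. -/
theorem isClosedEmbedding_embed : Topology.IsClosedEmbedding (embed : PSpace k → _) :=
  continuous_embed.isClosedEmbedding embed_injective

end PSpace

theorem Endo.continuous_coneMap {k d : ℕ} (f : Endo k d) : Continuous f.coneMap :=
  continuous_pi fun i => MvPolynomial.continuous_eval (f.poly i)

theorem Endo.continuous_toFun {k d : ℕ} (f : Endo k d) : Continuous f.toFun := by
  refine continuous_coinduced_dom.2 ?_
  have h : Continuous fun x : {v : Cone k // v ≠ 0} =>
      (⟨f.coneMap x.1, f.coneMap_ne_zero x.2⟩ : {v : Cone k // v ≠ 0}) :=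
    Continuous.subtype_mk (f.continuous_coneMap.comp continuous_subtype_val) _
  exact PSpace.continuous_mk'.comp h

theorem Endo.coneMap_smul {k d : ℕ} (f : Endo k d) (c : ℂ) (x : Cone k) :
    f.coneMap (c • x) = c ^ d • f.coneMap x := by
  funext i
  exact eval_smul_of_isHomogeneous (f.isHomogeneous i) c x

/-! ### Smooth functions on projective space -/

/-- `χ` is the pull-back to the cone of a smooth function on `ℙ^k`. -/
structure IsSmoothFunction {k : ℕ} (χ : Cone k → ℝ) : Prop where
  contDiffOn : ContDiffOn ℝ ∞ χ {0}ᶜ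
  smul : ∀ c : ℂ, c ≠ 0 → ∀ x, χ (c • x) = χ x

/-- The images of the two sets under the closed embedding are disjoint and closed, so a smooth
Urysohn function of the space of matrices, composed with the projector, separates them. No manifold
structure on projective space is needed. -/
theorem exists_isSmoothFunction {k : ℕ} {K L : Set (PSpace k)} (hK : IsClosed K) (hL : IsClosed L)
    (hKL : Disjoint K L) : ∃ χ : Cone k → ℝ, IsSmoothFunction χ ∧ (∀ x, χ x ∈ Set.Icc 0 1) ∧
      (∀ x (hx : x ≠ 0), Projectivization.mk ℂ x hx ∈ K → χ x = 1) ∧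
      ∀ x (hx : x ≠ 0), Projectivization.mk ℂ x hx ∈ L → χ x = 0 := by
  have hc := PSpace.isClosedEmbedding_embed (k := k)
  obtain ⟨g, h1, h2⟩ := exists_contMDiffMap_zero_one_of_isClosed (n := (⊤ : ℕ∞))
    (modelWithCornersSelf ℝ (Fin (k + 1) → Fin (k + 1) → ℂ))
    (hc.isClosedMap _ hL) (hc.isClosedMap _ hK)
    ((Set.disjoint_image_iff hc.injective).2 hKL.symm)
  refine ⟨fun x => g (PSpace.projector x), ⟨?_, ?_⟩, fun x => h2.2 _, ?_, ?_⟩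
  · exact g.contMDiff.contDiff.comp_contDiffOn PSpace.contDiffOn_projector
  · intro c hc x
    simp only [PSpace.projector_smul hc]
  · intro x hx hm
    simp only [← PSpace.embed_mk x hx]
    exact h2.1 (Set.mem_image_of_mem _ hm)
  · intro x hx hm
    simp only [← PSpace.embed_mk x hx]
    exact h1 (Set.mem_image_of_mem _ hm)

/-! ### Smooth forms: pointwise criteria and operations -/

/-- Evaluation on tuples of basis vectors is an injective linear map between finite-dimensional
spaces, so it has a continuous linear left inverse. -/
theorem contDiffOn_alternating_of_apply {E X : Type*} [NormedAddCommGroup E] [NormedSpace ℝ E]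
    [FiniteDimensional ℝ E] [NormedAddCommGroup X] [NormedSpace ℝ X] {n : ℕ} {N : WithTop ℕ∞}
    {η : X → E [⋀^Fin n]→L[ℝ] ℂ} {s : Set X}
    (h : ∀ v, ContDiffOn ℝ N (fun x => η x v) s) : ContDiffOn ℝ N η s := by
  let b := Module.finBasis ℝ E
  let ev : (E [⋀^Fin n]→L[ℝ] ℂ) →ₗ[ℝ] ((Fin n → Fin (Module.finrank ℝ E)) → ℂ) :=
    { toFun := fun α s => α fun i => b (s i)
      map_add' := fun _ _ => rfl
      map_smul' := fun _ _ => rfl }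
  have hev : LinearMap.ker ev = ⊥ := by
    refine LinearMap.ker_eq_bot.2 fun α β hαβ => ?_
    refine ContinuousAlternatingMap.toAlternatingMap_injective ?_
    refine Module.Basis.ext_alternating b fun v _ => ?_
    exact congrFun hαβ v
  obtain ⟨g, hg⟩ := LinearMap.exists_leftInverse_of_injective ev hev
  have hη : η = fun x => (LinearMap.toContinuousLinearMap g) (ev (η x)) := by
    funext x
    exact (LinearMap.congr_fun hg (η x)).symm
  rw [hη]
  refine (LinearMap.toContinuousLinearMap g).contDiff.comp_contDiffOn (contDiffOn_pi.2 fun s => ?_)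
  exact h _

theorem contDiffOn_alternating_apply {E X : Type*} [NormedAddCommGroup E] [NormedSpace ℝ E]
    [FiniteDimensional ℝ E] [NormedAddCommGroup X] [NormedSpace ℝ X] {n : ℕ} {N : WithTop ℕ∞}
    {η : X → E [⋀^Fin n]→L[ℝ] ℂ} {g : Fin n → X → E} {s : Set X}
    (h : ContDiffOn ℝ N η s) (hg : ∀ i, ContDiffOn ℝ N (g i) s) :
    ContDiffOn ℝ N (fun x => η x fun i => g i x) s := by
  let b := Module.finBasis ℝ E
  have h1 : (fun x => η x fun i => g i x) = fun x =>
      ∑ r : Fin n → Fin (Module.finrank ℝ E), (∏ i, b.repr (g i x) (r i)) • η x fun i => b (r i) := by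
    funext x
    conv_lhs => rw [show (fun i => g i x) = fun i => ∑ j, b.repr (g i x) j • b j from
      funext fun i => (b.sum_repr (g i x)).symm]
    rw [(η x).map_sum]
    exact Finset.sum_congr rfl fun r _ => (η x).map_smul_univ _ _
  rw [h1]
  refine ContDiffOn.sum fun r _ => ContDiffOn.smul
    (f := fun x => ∏ i, b.repr (g i x) (r i)) (g := fun x => η x fun i => b (r i))
    (contDiffOn_prod fun i _ => ?_) ?_
  · have : ContDiff ℝ N fun y => b.repr y (r i) :=
      (LinearMap.toContinuousLinearMap (b.coord (r i))).contDiff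
    exact this.comp_contDiffOn (hg i)
  · have : ContDiff ℝ N fun a : E [⋀^Fin n]→L[ℝ] ℂ => a fun i => b (r i) :=
      (ContinuousAlternatingMap.apply ℝ E ℂ fun i => b (r i)).contDiff
    exact this.comp_contDiffOn h

/-- Lie derivative along a linear vector field, in Cartan's form. -/
theorem extDeriv_curryLeft_add {E : Type*} [NormedAddCommGroup E] [NormedSpace ℝ E] {n : ℕ}
    {η : E → E [⋀^Fin (n + 1)]→L[ℝ] ℂ} {x : E} (hη : DifferentiableAt ℝ η x) (A : E →L[ℝ] E)
    (v : Fin (n + 1) → E) :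
    extDeriv (fun y => (η y).curryLeft (A y)) x v + extDeriv η x (Matrix.vecCons (A x) v) =
      fderiv ℝ η x (A x) v + ∑ i, η x (Function.update v i (A (v i))) := by
  have hc : DifferentiableAt ℝ (fun y => (η y).curryLeft (A y)) x := by
    have h0 : IsBoundedLinearMap ℝ fun a : E [⋀^Fin (n + 1)]→L[ℝ] ℂ => a.curryLeft :=
      IsLinearMap.with_bound (f := fun a : E [⋀^Fin (n + 1)]→L[ℝ] ℂ => a.curryLeft)
        ⟨fun _ _ => rfl, fun _ _ => rfl⟩ 1 (by simp)
    have h2 : Differentiable ℝ fun a : E [⋀^Fin (n + 1)]→L[ℝ] ℂ => a.curryLeft :=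
      IsBoundedLinearMap.differentiable (𝕜 := ℝ)
        (f := fun a : E [⋀^Fin (n + 1)]→L[ℝ] ℂ => a.curryLeft)
        (E := E [⋀^Fin (n + 1)]→L[ℝ] ℂ) (F := E →L[ℝ] E [⋀^Fin n]→L[ℝ] ℂ) h0
    have h1 : DifferentiableAt ℝ (fun y => (η y).curryLeft) x :=
      DifferentiableAt.comp (g := fun a : E [⋀^Fin (n + 1)]→L[ℝ] ℂ => a.curryLeft) x (h2 _) hη
    exact h1.clm_apply A.differentiableAt
  have hd : ∀ u : Fin (n + 1) → E, ∀ w, fderiv ℝ (fun y => η y u) x w = fderiv ℝ η x w u := by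
    intro u w
    rw [fderiv_continuousAlternatingMap_apply_const_apply hη]
  rw [extDeriv_apply hc, extDeriv_apply hη, Fin.sum_univ_succ (n := n + 1)]
  -- Product rule: one term differentiates the form, the other the linear field, whose derivative is
  -- itself.
  have e1 : ∀ i : Fin (n + 1), fderiv ℝ (fun y => ((η y).curryLeft (A y)) (i.removeNth v)) x (v i)
      = fderiv ℝ η x (v i) (Matrix.vecCons (A x) (i.removeNth v)) +
        η x (Matrix.vecCons (A (v i)) (i.removeNth v)) := by
    intro i
    have hg : ∀ j : Fin (n + 1), HasFDerivAt
        (fun y => (Matrix.vecCons (A y) (i.removeNth v) : Fin (n + 1) → E) j)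
        ((Fin.cons A (fun _ => 0) : Fin (n + 1) → E →L[ℝ] E) j) x := by
      intro j
      refine Fin.cases ?_ (fun j => ?_) j
      · exact A.hasFDerivAt
      · exact hasFDerivAt_const _ _
    have := (hη.hasFDerivAt.continuousAlternatingMap_apply hg).fderiv
    simp only [ContinuousAlternatingMap.curryLeft_apply_apply]
    rw [this]
    simp only [add_apply, ContinuousLinearMap.comp_apply,
      sum_apply]
    congr 1
    rw [Fin.sum_univ_succ]
    simp only [Fin.cons_zero, Fin.cons_succ, zero_apply, map_zero,
      Finset.sum_const_zero, add_zero]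
    show η x (Function.update _ 0 (A (v i))) = _
    congr 1
    funext j
    refine Fin.cases ?_ (fun j => ?_) j <;> simp
  have e2 : ∀ i : Fin (n + 1), (i.succ.removeNth (Matrix.vecCons (A x) v : Fin (n + 2) → E)) =
      Matrix.vecCons (A x) (i.removeNth v) := by
    intro i
    funext j
    refine Fin.cases ?_ (fun j => ?_) j
    · simp [Fin.removeNth]
    · simp [Fin.removeNth]
  have e3 : ∀ i : Fin (n + 1), (-1 : ℝ) ^ (i : ℕ) • η x (Matrix.vecCons (A (v i)) (i.removeNth v)) =
      η x (Function.update v i (A (v i))) := by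
    intro i
    have := (η x).map_insertNth i (A (v i)) (i.removeNth v)
    rw [Fin.insertNth_removeNth] at this
    rw [this]
    rcases Nat.even_or_odd (i : ℕ) with h | h <;> simp [h.neg_one_pow]
  simp only [e1, e2, hd, Fin.val_succ, Matrix.cons_val_succ]
  simp only [Fin.val_zero, pow_zero, one_smul, Matrix.cons_val_zero]
  have e0 : (0 : Fin (n + 2)).removeNth (Matrix.vecCons (A x) v : Fin (n + 2) → E) = v := by
    funext j
    simp [Fin.removeNth]
  rw [e0, ← Finset.sum_congr rfl fun i _ => e3 i]
  -- The derivatives of `η` along the `v i` occur in the two exterior derivatives with opposite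
  -- signs and cancel.
  rw [add_left_comm, ← Finset.sum_add_distrib]
  congr 1
  refine Finset.sum_congr rfl fun i _ => ?_
  rw [pow_succ, smul_add]
  simp

namespace SmoothForm

variable {k n : ℕ}

theorem contDiffOn (α : SmoothForm k n) : ContDiffOn ℝ ∞ α.1 {0}ᶜ := α.2.2.1

theorem contDiffAt (α : SmoothForm k n) {x : Cone k} (hx : x ≠ 0) : ContDiffAt ℝ ∞ α.1 x :=
  ContDiffOn.contDiffAt α.2.2.1 (isOpen_compl_singleton.mem_nhds hx)

theorem differentiableAt (α : SmoothForm k n) {x : Cone k} (hx : x ≠ 0) :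
    DifferentiableAt ℝ α.1 x :=
  (contDiffAt α hx).differentiableAt (by simp)

theorem apply_smul (α : SmoothForm k n) {c : ℂ} (hc : c ≠ 0) {x : Cone k} (hx : x ≠ 0)
    (v : Fin n → Cone k) : α.1 (c • x) (fun i => c • v i) = α.1 x v := α.2.2.2.1 c hc x hx v

theorem apply_eq_zero (α : SmoothForm k n) {x : Cone k} (hx : x ≠ 0) {v : Fin n → Cone k}
    (i : Fin n) (c : ℂ) (h : v i = c • x) : α.1 x v = 0 := α.2.2.2.2 x hx v ⟨i, c, h⟩

theorem ext_apply {α β : SmoothForm k n} (h : ∀ x, x ≠ 0 → ∀ v, α.1 x v = β.1 x v) : α = β := by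
  refine Subtype.ext (funext fun x => ?_)
  by_cases hx : x = 0
  · rw [hx, α.2.1, β.2.1]
  · exact ContinuousAlternatingMap.ext (h x hx)

open Classical in
/-- The smooth form with given values outside the origin of the cone. -/
def ofCone (η : Cone k → Cone k [⋀^Fin n]→L[ℝ] ℂ) (h1 : ContDiffOn ℝ ∞ η {0}ᶜ)
    (h2 : ∀ c : ℂ, c ≠ 0 → ∀ x, x ≠ 0 → ∀ v : Fin n → Cone k, η (c • x) (fun i => c • v i) = η x v)
    (h3 : ∀ x, x ≠ 0 → ∀ v : Fin n → Cone k, (∃ i, ∃ c : ℂ, v i = c • x) → η x v = 0) :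
    SmoothForm k n :=
  ⟨fun x => if x = 0 then 0 else η x, by
    refine ⟨if_pos rfl, ?_, ?_, ?_⟩
    · exact h1.congr fun x hx => if_neg hx
    · intro c hc x hx v
      simp only [if_neg hx, if_neg (smul_ne_zero hc hx), h2 c hc x hx v]
    · intro x hx v hv
      simp only [if_neg hx, h3 x hx v hv]⟩

theorem ofCone_apply {η : Cone k → Cone k [⋀^Fin n]→L[ℝ] ℂ} {h1 h2 h3} {x : Cone k} (hx : x ≠ 0) :
    (ofCone η h1 h2 h3).1 x = η x := if_neg hx

/-- The product of a smooth function and a smooth form. -/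
def mulFun (χ : Cone k → ℝ) (hχ : IsSmoothFunction χ) (α : SmoothForm k n) : SmoothForm k n :=
  ofCone (fun x => χ x • α.1 x) (hχ.contDiffOn.smul (contDiffOn α))
    (fun c hc x hx v => by simp [hχ.smul c hc x, apply_smul α hc hx v])
    (fun x hx v ⟨i, c, h⟩ => by simp [apply_eq_zero α hx i c h])

theorem mulFun_apply (χ : Cone k → ℝ) (hχ : IsSmoothFunction χ) (α : SmoothForm k n) (x : Cone k) :
    (mulFun χ hχ α).1 x = χ x • α.1 x := by
  by_cases hx : x = 0
  · rw [hx, (mulFun χ hχ α).2.1, α.2.1]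
    ext v
    simp
  · exact ofCone_apply hx

/-- The infinitesimal form of the invariance under homotheties. -/
theorem fderiv_apply_smul_add (β : SmoothForm k n) {x : Cone k} (hx : x ≠ 0) (c : ℂ)
    (v : Fin n → Cone k) :
    fderiv ℝ β.1 x (c • x) v + ∑ i, β.1 x (Function.update v i (c • v i)) = 0 := by
  have hg : ∀ y : Cone k, HasDerivAt (fun s : ℝ => y + s • (c • y)) (c • y) 0 := fun y => by
    simpa using ((hasDerivAt_id (0 : ℝ)).smul_const (c • y)).const_add y
  have h0 : ∀ y : Cone k, y + (0 : ℝ) • (c • y) = y := fun y => by simp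
  have h1 : HasFDerivAt (fun s : ℝ => β.1 (x + s • (c • x)))
      ((fderiv ℝ β.1 x).comp (ContinuousLinearMap.toSpanSingleton ℝ (c • x))) 0 := by
    refine HasFDerivAt.comp (g := β.1) (0 : ℝ) ?_ (hg x).hasFDerivAt
    rw [h0]
    exact (differentiableAt β hx).hasFDerivAt
  have h2 := (h1.continuousAlternatingMap_apply (g := fun i s => v i + s • (c • v i))
    fun i => (hg (v i)).hasFDerivAt).hasDerivAt
  -- The point and all arguments are multiplied by `1 + s c`, which is non-zero for small `s`, so
  -- invariance makes the function locally constant.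
  have h3 : (fun s : ℝ => β.1 (x + s • (c • x)) fun i => v i + s • (c • v i)) =ᶠ[𝓝 0]
      fun _ => β.1 x v := by
    have hs : ∀ᶠ s : ℝ in 𝓝 0, (1 + (s : ℂ) * c) ≠ 0 := by
      have : ContinuousAt (fun s : ℝ => 1 + (s : ℂ) * c) 0 := by fun_prop
      exact this.eventually_ne (by simp)
    filter_upwards [hs] with s hs
    have e : ∀ y : Cone k, y + s • (c • y) = (1 + (s : ℂ) * c) • y := fun y => by
      rw [add_smul, one_smul, mul_smul, Complex.coe_smul]
    simp only [e]
    exact apply_smul β hs hx v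
  have h4 := h2.unique ((hasDerivAt_const (0 : ℝ) (β.1 x v)).congr_of_eventuallyEq h3)
  simp only [h0] at h4
  simpa using h4

theorem extDeriv_apply_smul (β : SmoothForm k n) {c : ℂ} (hc : c ≠ 0) {x : Cone k} (hx : x ≠ 0)
    (v : Fin (n + 1) → Cone k) :
    extDeriv β.1 (c • x) (fun i => c • v i) = extDeriv β.1 x v := by
  let L : Cone k →L[ℝ] Cone k := c • ContinuousLinearMap.id ℝ (Cone k)
  have hL : ∀ y, L y = c • y := fun y => rfl
  have hLx : fderiv ℝ L x = L := L.fderiv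
  have h := extDeriv_pullback (f := L) (x := x) (r := 2)
    (differentiableAt β (smul_ne_zero hc hx)) L.contDiff.contDiffAt (by simp)
  have h1 : (fun y => (β.1 (L y)).compContinuousLinearMap (fderiv ℝ L y)) =ᶠ[𝓝 x] β.1 := by
    filter_upwards [isOpen_compl_singleton.mem_nhds hx] with y hy
    rw [L.fderiv]
    exact ContinuousAlternatingMap.ext fun u => apply_smul β hc hy u
  rw [h1.extDeriv_eq, hLx] at h
  rw [h]
  rfl

/-- Cartan's formula for the vertical field `y ↦ c • y`: both its contraction with `β` and the Lie
derivative of `β` along it vanish, hence so does its contraction with the exterior derivative. -/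
theorem extDeriv_apply_eq_zero (β : SmoothForm k n) {x : Cone k} (hx : x ≠ 0)
    {v : Fin (n + 1) → Cone k} (i : Fin (n + 1)) (c : ℂ) (hv : v i = c • x) :
    extDeriv β.1 x v = 0 := by
  suffices H : ∀ u : Fin n → Cone k, extDeriv β.1 x (Matrix.vecCons (c • x) u) = 0 by
    have := (extDeriv β.1 x).map_insertNth i (c • x) (i.removeNth v)
    rw [H, smul_zero, ← hv, Fin.insertNth_self_removeNth] at this
    exact this
  intro u
  cases n with
  | zero =>
    rw [extDeriv_apply (differentiableAt β hx)]
    have h := fderiv_apply_smul_add β hx c u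
    rw [Fin.sum_univ_zero, add_zero] at h
    rw [Fin.sum_univ_one, fderiv_continuousAlternatingMap_apply_const_apply
      (differentiableAt β hx), Subsingleton.elim (Fin.removeNth _ _) u]
    simpa using h
  | succ m =>
    have h := extDeriv_curryLeft_add (differentiableAt β hx) (c • ContinuousLinearMap.id ℝ (Cone k)) u
    have h1 : (fun y => (β.1 y).curryLeft ((c • ContinuousLinearMap.id ℝ (Cone k)) y)) =ᶠ[𝓝 x]
        fun _ => 0 := by
      filter_upwards [isOpen_compl_singleton.mem_nhds hx] with y hy
      exact ContinuousAlternatingMap.ext fun w => apply_eq_zero β hy 0 c rfl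
    rw [h1.extDeriv_eq] at h
    have h2 : extDeriv (fun _ : Cone k => (0 : Cone k [⋀^Fin m]→L[ℝ] ℂ)) x = 0 := by
      ext w
      rw [extDeriv_apply (differentiableAt_const _)]
      simp
    rw [h2] at h
    have h3 := fderiv_apply_smul_add β hx c u
    have h4 : ∀ y : Cone k, (c • ContinuousLinearMap.id ℝ (Cone k)) y = c • y := fun y => rfl
    simp only [h4] at h
    rw [h3] at h
    simpa using h

theorem contDiffOn_extDeriv (β : SmoothForm k n) : ContDiffOn ℝ ∞ (extDeriv β.1) {0}ᶜ := by
  refine contDiffOn_alternating_of_apply fun v => ?_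
  have h1 : ContDiffOn ℝ ∞ (fun x => ∑ i : Fin (n + 1), (-1 : ℝ) ^ i.val •
      fderiv ℝ β.1 x (v i) (i.removeNth v)) {0}ᶜ := by
    refine ContDiffOn.sum fun i _ => ContDiffOn.const_smul _ ?_
    have h2 : ContDiffOn ℝ ∞ (fderiv ℝ β.1) {0}ᶜ :=
      (contDiffOn β).fderiv_of_isOpen isOpen_compl_singleton (by simp)
    have h3 : ContDiffOn ℝ ∞ (fun x => fderiv ℝ β.1 x (v i)) {0}ᶜ := h2.clm_apply contDiffOn_const
    exact contDiffOn_alternating_apply h3 fun j => contDiffOn_const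
  refine h1.congr fun x hx => ?_
  rw [extDeriv_apply (differentiableAt β hx)]
  refine Finset.sum_congr rfl fun i _ => ?_
  rw [fderiv_continuousAlternatingMap_apply_const_apply (differentiableAt β hx)]
  simp

/-- The exterior derivative of a smooth form. -/
def d (β : SmoothForm k n) : SmoothForm k (n + 1) :=
  ofCone (extDeriv β.1) (contDiffOn_extDeriv β) (fun _ hc _ hx v => extDeriv_apply_smul β hc hx v)
    (fun _ hx _ ⟨i, c, h⟩ => extDeriv_apply_eq_zero β hx i c h)

theorem isExteriorDerivative_d (β : SmoothForm k n) : IsExteriorDerivative (d β) β :=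
  fun _ hx => ofCone_apply hx

/-- The interior product of a smooth form and a linear vector field which commutes with
homotheties. -/
def interior (A : Cone k →L[ℂ] Cone k) (α : SmoothForm k (n + 1)) : SmoothForm k n :=
  ofCone (fun x => (α.1 x).curryLeft (A x))
    (by
      refine contDiffOn_alternating_of_apply fun v => ?_
      refine contDiffOn_alternating_apply (contDiffOn α) (g := fun i x => (Matrix.vecCons (A x) v : _) i)
        fun i => ?_
      refine Fin.cases ?_ (fun j => ?_) i
      · exact (A.restrictScalars ℝ).contDiff.contDiffOn
      · exact contDiffOn_const)
    (by
      intro c hc x hx v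
      have := apply_smul α hc hx (Matrix.vecCons (A x) v)
      rw [ContinuousAlternatingMap.curryLeft_apply_apply,
        ContinuousAlternatingMap.curryLeft_apply_apply, ← this, map_smul]
      congr 1
      funext i
      refine Fin.cases ?_ (fun j => ?_) i <;> simp)
    (by
      rintro x hx v ⟨i, c, h⟩
      exact apply_eq_zero α hx i.succ c (by simpa using h))

theorem interior_apply (A : Cone k →L[ℂ] Cone k) (α : SmoothForm k (n + 1)) {x : Cone k}
    (hx : x ≠ 0) : (interior A α).1 x = (α.1 x).curryLeft (A x) := ofCone_apply hx

/-- At a zero of the field, Cartan's formula keeps only the algebraic action of `A` on the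
arguments: the contraction of the exterior derivative and the derivative along the field both drop
out. -/
theorem d_interior_apply (A : Cone k →L[ℂ] Cone k) (α : SmoothForm k (n + 1)) {x : Cone k}
    (hx : x ≠ 0) (hA : A x = 0) (v : Fin (n + 1) → Cone k) :
    (d (interior A α)).1 x v = ∑ i, α.1 x (Function.update v i (A (v i))) := by
  rw [(isExteriorDerivative_d _) x hx]
  have h1 : (interior A α).1 =ᶠ[𝓝 x] fun y => (α.1 y).curryLeft (A.restrictScalars ℝ y) := by
    filter_upwards [isOpen_compl_singleton.mem_nhds hx] with y hy
    exact interior_apply A α hy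
  rw [h1.extDeriv_eq]
  have h := extDeriv_curryLeft_add (differentiableAt α hx) (A.restrictScalars ℝ) v
  have h2 : (A.restrictScalars ℝ) x = 0 := hA
  rw [h2, (extDeriv α.1 x).map_coord_zero 0 (by rfl)] at h
  simpa using h

end SmoothForm

/-! ### Values of forms on complex subspaces -/

namespace SmoothForm

variable {k l : ℕ}

theorem complexTuple_even (v : Fin l → Cone k) (i : Fin l) :
    complexTuple v ⟨2 * i, by omega⟩ = v i := by
  simp [complexTuple]

theorem complexTuple_odd (v : Fin l → Cone k) (i : Fin l) :
    complexTuple v ⟨2 * i + 1, by omega⟩ = Complex.I • v i := by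
  have h1 : (2 * (i : ℕ) + 1) % 2 = 1 := by omega
  have h2 : (2 * (i : ℕ) + 1) / 2 = i := by omega
  simp [complexTuple, h1, h2]

theorem complexTuple_update (v : Fin l → Cone k) (i : Fin l) (a : Cone k) :
    complexTuple (Function.update v i a) = Function.update
      (Function.update (complexTuple v) ⟨2 * i, by omega⟩ a) ⟨2 * i + 1, by omega⟩
        (Complex.I • a) := by
  funext ⟨j, hj⟩
  rcases Nat.even_or_odd' j with ⟨m, rfl | rfl⟩
  · have hml : m < l := by omega
    have e : ∀ w : Fin l → Cone k, complexTuple w ⟨2 * m, hj⟩ = w ⟨m, hml⟩ := fun w =>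
      complexTuple_even w ⟨m, hml⟩
    rw [e]
    by_cases h : (⟨m, hml⟩ : Fin l) = i
    · subst h
      simp
    · rw [Function.update_of_ne h, Function.update_of_ne, Function.update_of_ne, e]
      · simpa [Fin.ext_iff] using h
      · simp [Fin.ext_iff]; omega
  · have hml : m < l := by omega
    have e : ∀ w : Fin l → Cone k, complexTuple w ⟨2 * m + 1, hj⟩ = Complex.I • w ⟨m, hml⟩ :=
      fun w => complexTuple_odd w ⟨m, hml⟩
    rw [e]
    by_cases h : (⟨m, hml⟩ : Fin l) = i
    · subst h
      simp
    · rw [Function.update_of_ne h, Function.update_of_ne, Function.update_of_ne, e]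
      · simp [Fin.ext_iff]; omega
      · simpa [Fin.ext_iff] using h

theorem complexTuple_smul (c : ℂ) (v : Fin l → Cone k) :
    (fun j => c • complexTuple v j) = complexTuple fun i => c • v i := by
  funext j
  simp only [complexTuple]
  rw [smul_comm]

section Alternating

variable (η : Cone k [⋀^Fin (2 * l)]→L[ℝ] ℂ)

/-- A complex multiple of `v j` is a real combination of `v j` and `i v j`, which both already occur
as arguments when `j ≠ i`; a multiple of `x` is killed by assumption. -/
theorem map_update_update_eq_zero_of_mem_span {x : Cone k}
    (hx : ∀ (u : Fin (2 * l) → Cone k) (m) (c : ℂ), u m = c • x → η u = 0)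
    (v : Fin l → Cone k) (i : Fin l) {z : Cone k}
    (hz : z ∈ Submodule.span ℂ (insert x (v '' {i}ᶜ))) :
    ∀ (c : ℂ) (a : Cone k),
      η (Function.update (Function.update (complexTuple v) ⟨2 * i, by omega⟩ (c • z))
        ⟨2 * i + 1, by omega⟩ a) = 0 ∧
      η (Function.update (Function.update (complexTuple v) ⟨2 * i, by omega⟩ a)
        ⟨2 * i + 1, by omega⟩ (c • z)) = 0 := by
  have hne : (⟨2 * i, by omega⟩ : Fin (2 * l)) ≠ ⟨2 * i + 1, by omega⟩ := by simp [Fin.ext_iff]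
  have comm : ∀ a b : Cone k, Function.update (Function.update (complexTuple v) ⟨2 * i, by omega⟩ a)
      ⟨2 * i + 1, by omega⟩ b = Function.update (Function.update (complexTuple v)
        ⟨2 * i + 1, by omega⟩ b) ⟨2 * i, by omega⟩ a := fun a b => Function.update_comm hne _ _ _
  induction hz using Submodule.span_induction with
  | mem z hz =>
    intro c a
    rcases hz with rfl | ⟨j, hj, rfl⟩
    · constructor
      · rw [comm]
        exact hx _ ⟨2 * i, by omega⟩ c (by simp)
      · exact hx _ ⟨2 * i + 1, by omega⟩ c (by simp)
    · have hji : (j : ℕ) ≠ i := fun h => hj (Fin.ext h)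
      have hc : c • v j = c.re • v j + c.im • (Complex.I • v j) := by
        conv_lhs => rw [← Complex.re_add_im c, add_smul, mul_smul]
        simp only [Complex.coe_smul]
      rw [hc]
      constructor
      · rw [comm, η.map_update_add, η.map_update_smul, η.map_update_smul,
          η.map_eq_zero_of_eq (i := ⟨2 * i, by omega⟩) (j := ⟨2 * j, by omega⟩),
          η.map_eq_zero_of_eq (i := ⟨2 * i, by omega⟩) (j := ⟨2 * j + 1, by omega⟩)]
        · simp
        · rw [Function.update_self, Function.update_of_ne, Function.update_of_ne, complexTuple_odd] <;>
            simp [Fin.ext_iff] <;> omega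
        · simp [Fin.ext_iff]; omega
        · rw [Function.update_self, Function.update_of_ne, Function.update_of_ne,
            complexTuple_even] <;> simp [Fin.ext_iff] <;> omega
        · simp [Fin.ext_iff]; omega
      · rw [η.map_update_add, η.map_update_smul, η.map_update_smul,
          η.map_eq_zero_of_eq (i := ⟨2 * i + 1, by omega⟩) (j := ⟨2 * j, by omega⟩),
          η.map_eq_zero_of_eq (i := ⟨2 * i + 1, by omega⟩) (j := ⟨2 * j + 1, by omega⟩)]
        · simp
        · rw [Function.update_self, Function.update_of_ne, Function.update_of_ne, complexTuple_odd] <;>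
            simp [Fin.ext_iff] <;> omega
        · simp [Fin.ext_iff]; omega
        · rw [Function.update_self, Function.update_of_ne, Function.update_of_ne,
            complexTuple_even] <;> simp [Fin.ext_iff] <;> omega
        · simp [Fin.ext_iff]; omega
  | zero =>
    intro c a
    rw [smul_zero]
    constructor
    · rw [comm, η.map_update_zero]
    · rw [η.map_update_zero]
  | add y z _ _ hy hz =>
    intro c a
    rw [smul_add]
    constructor
    · rw [comm, η.map_update_add, ← comm, ← comm, (hy c a).1, (hz c a).1, add_zero]
    · rw [η.map_update_add, (hy c a).2, (hz c a).2, add_zero]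
  | smul b y _ hy =>
    intro c a
    rw [smul_smul]
    exact hy _ a

theorem map_complexTuple_update_add {x : Cone k}
    (hx : ∀ (u : Fin (2 * l) → Cone k) (m) (c : ℂ), u m = c • x → η u = 0)
    (v : Fin l → Cone k) (i : Fin l) (a : Cone k) {z : Cone k}
    (hz : z ∈ Submodule.span ℂ (insert x (v '' {i}ᶜ))) :
    η (complexTuple (Function.update v i (a + z))) = η (complexTuple (Function.update v i a)) := by
  have hne : (⟨2 * i, by omega⟩ : Fin (2 * l)) ≠ ⟨2 * i + 1, by omega⟩ := by simp [Fin.ext_iff]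
  have h := map_update_update_eq_zero_of_mem_span η hx v i hz
  have h1 : ∀ b, η (Function.update (Function.update (complexTuple v) ⟨2 * i, by omega⟩ z)
      ⟨2 * i + 1, by omega⟩ b) = 0 := fun b => by simpa using (h 1 b).1
  rw [complexTuple_update, complexTuple_update, smul_add, η.map_update_add, (h _ _).2, add_zero,
    Function.update_comm hne, η.map_update_add, ← Function.update_comm hne,
    ← Function.update_comm hne, h1, add_zero]

/-- Multiplication by `c` on the real plane spanned by `v i` and `i v i` has determinant `|c|²`, and
`η` is alternating in these two slots. -/
theorem map_complexTuple_update_smul (v : Fin l → Cone k) (i : Fin l) (c : ℂ) :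
    η (complexTuple (Function.update v i (c • v i))) = Complex.normSq c * η (complexTuple v) := by
  have hne : (⟨2 * i, by omega⟩ : Fin (2 * l)) ≠ ⟨2 * i + 1, by omega⟩ := by simp [Fin.ext_iff]
  have comm : ∀ a b : Cone k, Function.update (Function.update (complexTuple v) ⟨2 * i, by omega⟩ a)
      ⟨2 * i + 1, by omega⟩ b = Function.update (Function.update (complexTuple v)
        ⟨2 * i + 1, by omega⟩ b) ⟨2 * i, by omega⟩ a := fun a b => Function.update_comm hne _ _ _
  set β : Cone k → Cone k → ℂ := fun a b => η (Function.update (Function.update (complexTuple v)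
    ⟨2 * i, by omega⟩ a) ⟨2 * i + 1, by omega⟩ b) with hβ
  have add_r : ∀ a b b', β a (b + b') = β a b + β a b' := fun a b b' => η.map_update_add _ _ _ _
  have smul_r : ∀ a (r : ℝ) b, β a (r • b) = r • β a b := fun a r b => η.map_update_smul _ _ _ _
  have add_l : ∀ a a' b, β (a + a') b = β a b + β a' b := fun a a' b => by
    simp only [hβ, comm]; exact η.map_update_add _ _ _ _
  have smul_l : ∀ (r : ℝ) a b, β (r • a) b = r • β a b := fun r a b => by
    simp only [hβ, comm]; exact η.map_update_smul _ _ _ _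
  have self : ∀ a, β a a = 0 := fun a => by
    refine η.map_eq_zero_of_eq _ (i := ⟨2 * i, by omega⟩) (j := ⟨2 * i + 1, by omega⟩) ?_ hne
    simp
  have swap : ∀ a b, β a b = -β b a := fun a b => by
    have := self (a + b)
    rw [add_l, add_r, add_r, self, self] at this
    linear_combination this
  have hv : ∀ a, η (complexTuple (Function.update v i a)) = β a (Complex.I • a) := fun a => by
    rw [complexTuple_update]
  have hc : c • v i = c.re • v i + c.im • (Complex.I • v i) := by
    conv_lhs => rw [← Complex.re_add_im c, add_smul, mul_smul]
    simp only [Complex.coe_smul]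
  have hic : Complex.I • c • v i = c.re • (Complex.I • v i) + (-c.im) • v i := by
    rw [hc, smul_add, smul_comm, smul_comm Complex.I c.im, smul_smul Complex.I Complex.I,
      Complex.I_mul_I]
    simp
  have h0 := hv (v i)
  rw [Function.update_eq_self] at h0
  rw [hv, h0, hic, hc]
  simp only [add_l, add_r, smul_l, smul_r, self, swap (Complex.I • v i) (v i)]
  simp only [Complex.real_smul, Complex.normSq_apply]
  push_cast
  ring

theorem map_complexTuple_smul (v : Fin l → Cone k) (c : Fin l → ℂ) :
    η (complexTuple fun i => c i • v i) = (∏ i, Complex.normSq (c i) : ℝ) * η (complexTuple v) := by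
  have h : ∀ s : Finset (Fin l), η (complexTuple fun i => if i ∈ s then c i • v i else v i) =
      (∏ i ∈ s, Complex.normSq (c i) : ℝ) * η (complexTuple v) := by
    intro s
    induction s using Finset.induction_on with
    | empty => simp
    | insert a s ha ih =>
      have := map_complexTuple_update_smul η (fun i => if i ∈ s then c i • v i else v i) a (c a)
      rw [ih] at this
      rw [Finset.prod_insert ha]
      rw [Complex.ofReal_mul, mul_assoc, ← this]
      congr 2
      funext i
      by_cases hi : i = a
      · subst hi; simp [ha]
      · simp [hi]
  simpa using h Finset.univ

/-- A unitriangular change of vectors does not alter the value. The vectors are replaced from the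
last index downwards, so that each correction only involves vectors `v j` which are still in place.
-/
theorem map_complexTuple_of_sub_mem_span {x : Cone k}
    (hx : ∀ (u : Fin (2 * l) → Cone k) (m) (c : ℂ), u m = c • x → η u = 0)
    (v w : Fin l → Cone k)
    (h : ∀ i, w i - v i ∈ Submodule.span ℂ (insert x (v '' Set.Iio i))) :
    η (complexTuple w) = η (complexTuple v) := by
  have key : ∀ m, m ≤ l → η (complexTuple fun i : Fin l => if m ≤ i then w i else v i) =
      η (complexTuple v) := by
    intro m hm
    induction hm using Nat.decreasingInduction with
    | self =>
      congr 2
      funext i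
      simp
    | of_succ m hm ih =>
      rw [← ih]
      set u : Fin l → Cone k := fun i : Fin l => if m + 1 ≤ i then w i else v i
      have h1 : (fun i : Fin l => if m ≤ i then w i else v i) =
          Function.update u ⟨m, hm⟩ (v ⟨m, hm⟩ + (w ⟨m, hm⟩ - v ⟨m, hm⟩)) := by
        funext i
        by_cases hi : i = ⟨m, hm⟩
        · subst hi; simp
        · have : (i : ℕ) ≠ m := fun h => hi (Fin.ext h)
          rw [Function.update_of_ne hi]
          simp only [u]
          congr 1
          simp only [eq_iff_iff]
          omega
      have h2 : Function.update u ⟨m, hm⟩ (v ⟨m, hm⟩) = u := by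
        rw [Function.update_eq_self_iff]
        simp [u]
      rw [h1, map_complexTuple_update_add η hx, h2]
      refine Submodule.span_mono (Set.insert_subset_insert ?_) (h ⟨m, hm⟩)
      rintro _ ⟨j, hj, rfl⟩
      have hj' : (j : ℕ) < m := hj
      refine ⟨j, ?_, ?_⟩
      · intro hjm
        rw [Set.mem_singleton_iff.1 hjm] at hj'
        exact lt_irrefl _ hj'
      · simp only [u]
        rw [if_neg (by omega)]
  simpa using key 0 (Nat.zero_le _)

end Alternating

/-- A tuple of vectors which is orthonormal for the standard hermitian product. -/
def IsFrame {m : ℕ} (F : Fin m → Cone k) : Prop :=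
  Orthonormal ℂ fun i => WithLp.toLp 2 (F i)

theorem IsFrame.ne_zero {m : ℕ} {F : Fin m → Cone k} (hF : IsFrame F) (i : Fin m) : F i ≠ 0 := by
  intro h
  have := Orthonormal.ne_zero hF i
  simp [h] at this

theorem IsFrame.linearIndependent {m : ℕ} {F : Fin m → Cone k} (hF : IsFrame F) :
    LinearIndependent ℂ F :=
  LinearIndependent.of_comp (WithLp.linearEquiv 2 ℂ (Cone k)).symm.toLinearMap
    (Orthonormal.linearIndependent hF)

theorem isCompact_setOf_isFrame (m : ℕ) : IsCompact {F : Fin m → Cone k | IsFrame F} := by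
  refine Metric.isCompact_of_isClosed_isBounded ?_ ?_
  · have : {F : Fin m → Cone k | IsFrame F} = {F | ∀ i j, inner ℂ (WithLp.toLp 2 (F i))
        (WithLp.toLp 2 (F j)) = if i = j then (1 : ℂ) else 0} := by
      ext F
      exact orthonormal_iff_ite
    rw [this]
    simp only [Set.ofPred_forall]
    refine isClosed_iInter fun i => isClosed_iInter fun j => isClosed_eq ?_ continuous_const
    have hi : ∀ i, Continuous fun F : Fin m → Cone k => WithLp.toLp 2 (F i) := fun i =>
      (PiLp.continuous_toLp 2 _).comp (continuous_apply i)
    exact (hi i).inner (hi j)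
  · refine (Metric.isBounded_closedBall (x := (0 : Fin m → Cone k)) (r := 1)).subset fun F hF => ?_
    rw [mem_closedBall_zero_iff, pi_norm_le_iff_of_nonneg zero_le_one]
    intro i
    rw [pi_norm_le_iff_of_nonneg zero_le_one]
    intro j
    have h1 := (hF : Orthonormal ℂ _).1 i
    rw [← h1]
    exact PiLp.norm_apply_le (WithLp.toLp 2 (F i)) j

/-- The values of forms on complex subspaces are determined by those on orthonormal frames. -/
theorem exists_isFrame {x : Cone k} (hx : x ≠ 0) (v : Fin l → Cone k) :
    (∀ α : SmoothForm k (2 * l), α.1 x (complexTuple v) = 0) ∨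
    ∃ F : Fin (l + 1) → Cone k, IsFrame F ∧ (∃ r : ℂ, r ≠ 0 ∧ F 0 = r • x) ∧ ∃ c : ℝ, 0 < c ∧
      ∀ α : SmoothForm k (2 * l),
        α.1 x (complexTuple v) = c * α.1 (F 0) (complexTuple fun i => F i.succ) := by
  -- Gram–Schmidt is applied to `x` followed by `v`, so that its first vector stays on the fibre. If
  -- some vector degenerates, all forms vanish on the tuple. Otherwise normalizing the vectors and
  -- moving the base point along the fibre produces the factor `∏ (‖g i.succ‖ / ‖g 0‖)²`, which does
  -- not depend on the form.
  let f : Fin (l + 1) → EuclideanSpace ℂ (Fin (k + 1)) :=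
    fun i => WithLp.toLp 2 ((Fin.cons x v : Fin (l + 1) → Cone k) i)
  let g := InnerProductSpace.gramSchmidt ℂ f
  have hg0 : g 0 = WithLp.toLp 2 x := by
    have := InnerProductSpace.gramSchmidt_bot (𝕜 := ℂ) (f := f)
    exact this
  have hgw : ∀ i : Fin l, (g i.succ).ofLp - v i ∈
      Submodule.span ℂ (insert x (v '' Set.Iio i)) := by
    intro i
    have h1 : g i.succ - f i.succ ∈ Submodule.span ℂ (f '' Set.Iio i.succ) := by
      rw [← InnerProductSpace.span_gramSchmidt_Iio]
      have := InnerProductSpace.gramSchmidt_def ℂ f i.succ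
      rw [show g i.succ = _ from this, sub_sub_cancel_left]
      refine Submodule.neg_mem _ (Submodule.sum_mem _ fun j hj => ?_)
      refine Submodule.span_mono ?_ (Submodule.starProjection_apply_mem _ _)
      rw [Set.singleton_subset_iff]
      exact ⟨j, by simpa using hj, rfl⟩
    have h2 := Submodule.mem_map_of_mem (f := (WithLp.linearEquiv 2 ℂ (Cone k)).toLinearMap) h1
    rw [Submodule.map_span] at h2
    have h3 : (WithLp.linearEquiv 2 ℂ (Cone k)).toLinearMap (g i.succ - f i.succ) =
        (g i.succ).ofLp - v i := rfl
    rw [h3] at h2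
    refine Submodule.span_mono ?_ h2
    rintro _ ⟨_, ⟨j, hj, rfl⟩, rfl⟩
    revert hj
    refine Fin.cases (fun _ => Or.inl rfl) (fun j hj => Or.inr ⟨j, ?_, rfl⟩) j
    simpa using hj
  have hα : ∀ α : SmoothForm k (2 * l), α.1 x (complexTuple v) =
      α.1 x (complexTuple fun i => (g i.succ).ofLp) := fun α =>
    (map_complexTuple_of_sub_mem_span (α.1 x) (x := x)
      (fun u m c h => apply_eq_zero α hx m c h) v _ hgw).symm
  by_cases h0 : ∃ i, g i = 0
  · left
    intro α
    obtain ⟨i, hi⟩ := h0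
    revert hi
    refine Fin.cases (fun hi => ?_) (fun i hi => ?_) i
    · rw [hg0] at hi
      exact absurd (by simpa using hi) hx
    · rw [hα]
      refine (α.1 x).map_coord_zero ⟨2 * i, by omega⟩ ?_
      rw [complexTuple_even]
      simp [hi]
  · right
    push Not at h0
    have hn : ∀ i, ‖g i‖ ≠ 0 := fun i => norm_ne_zero_iff.2 (h0 i)
    have hnC : ∀ i, ((‖g i‖ : ℝ) : ℂ) ≠ 0 := fun i => by exact_mod_cast hn i
    refine ⟨fun i => ((‖g i‖ : ℝ) : ℂ)⁻¹ • (g i).ofLp, ?_, ⟨((‖g 0‖ : ℝ) : ℂ)⁻¹, inv_ne_zero (hnC 0),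
      by simp only [hg0]⟩, ∏ i : Fin l, Complex.normSq (‖g i.succ‖ / ‖g 0‖), ?_, ?_⟩
    · refine ⟨fun i => ?_, fun i j hij => ?_⟩
      · simp only [WithLp.toLp_smul, WithLp.toLp_ofLp, norm_smul]
        simp [hn i]
      · simp only [WithLp.toLp_smul, WithLp.toLp_ofLp]
        rw [inner_smul_left, inner_smul_right]
        have : inner ℂ (g i) (g j) = 0 := InnerProductSpace.gramSchmidt_orthogonal ℂ f hij
        rw [this]
        simp
    · refine Finset.prod_pos fun i _ => Complex.normSq_pos.2 ?_
      exact div_ne_zero (hnC _) (hnC _)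
    · intro α
      have hF0 : ((‖g 0‖ : ℝ) : ℂ)⁻¹ • (g 0).ofLp ≠ 0 := by
        rw [hg0]
        exact smul_ne_zero (by simpa [hg0] using hx) hx
      rw [hα, ← map_complexTuple_smul]
      have h1 := apply_smul α (inv_ne_zero (hnC 0)) hx
        (complexTuple fun i : Fin l => (g i.succ).ofLp)
      rw [complexTuple_smul] at h1
      rw [← h1]
      simp only [hg0]
      congr 2
      funext i
      rw [smul_smul]
      congr 1
      have := hnC i.succ
      field_simp

end SmoothForm

/-! ### Bidegree components -/

/-- The functions `c ↦ ∑ a_{pq} c^p (conj c)^q`, `p + q = n`. -/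
def bihomogeneous (n : ℕ) : Submodule ℂ (ℂ → ℂ) :=
  Submodule.span ℂ {f | ∃ p q : ℕ, p + q = n ∧ f = fun c => c ^ p * conj c ^ q}

theorem mul_mem_bihomogeneous {n : ℕ} {f : ℂ → ℂ} (hf : f ∈ bihomogeneous n) :
    (fun c => c * f c) ∈ bihomogeneous (n + 1) ∧
      (fun c => conj c * f c) ∈ bihomogeneous (n + 1) := by
  induction hf using Submodule.span_induction with
  | mem f hf =>
    obtain ⟨p, q, h, rfl⟩ := hf
    constructor
    · refine Submodule.subset_span ⟨p + 1, q, by omega, ?_⟩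
      funext c
      ring
    · refine Submodule.subset_span ⟨p, q + 1, by omega, ?_⟩
      funext c
      ring
  | zero =>
    simp only [Pi.zero_apply, mul_zero]
    exact ⟨Submodule.zero_mem _, Submodule.zero_mem _⟩
  | add f g _ _ hf hg =>
    simp only [Pi.add_apply, mul_add]
    exact ⟨Submodule.add_mem _ hf.1 hg.1, Submodule.add_mem _ hf.2 hg.2⟩
  | smul a f _ hf =>
    simp only [Pi.smul_apply, smul_eq_mul, mul_left_comm _ a]
    exact ⟨Submodule.smul_mem _ a hf.1, Submodule.smul_mem _ a hf.2⟩

theorem re_mul_mem_bihomogeneous {n : ℕ} {f : ℂ → ℂ} (hf : f ∈ bihomogeneous n) :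
    (fun c : ℂ => (c.re : ℂ) * f c) ∈ bihomogeneous (n + 1) ∧
      (fun c : ℂ => (c.im : ℂ) * f c) ∈ bihomogeneous (n + 1) := by
  obtain ⟨h1, h2⟩ := mul_mem_bihomogeneous hf
  constructor
  · convert Submodule.smul_mem _ (1 / 2 : ℂ) (Submodule.add_mem _ h1 h2) using 1
    funext c
    simp only [Pi.smul_apply, Pi.add_apply, smul_eq_mul, Complex.re_eq_add_conj]
    ring
  · convert Submodule.smul_mem _ (1 / (2 * Complex.I) : ℂ) (Submodule.sub_mem _ h1 h2) using 1
    funext c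
    simp only [Pi.smul_apply, Pi.sub_apply, smul_eq_mul, Complex.im_eq_sub_conj]
    ring

theorem re_pow_mul_im_pow_mem_bihomogeneous (a b : ℕ) :
    (fun c : ℂ => (c.re : ℂ) ^ a * (c.im : ℂ) ^ b) ∈ bihomogeneous (a + b) := by
  induction a with
  | zero =>
    induction b with
    | zero => exact Submodule.subset_span ⟨0, 0, rfl, by simp⟩
    | succ b ih =>
      have := (re_mul_mem_bihomogeneous ih).2
      rw [← add_assoc]
      convert this using 1
      funext c
      ring
  | succ a ih =>
    have := (re_mul_mem_bihomogeneous ih).1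
    rw [add_right_comm]
    convert this using 1
    funext c
    ring

/-- Expanding `c • v i` into its real and imaginary parts by multilinearity gives a homogeneous
polynomial of degree `n` in `Re c` and `Im c`, hence one in `c` and its conjugate. -/
theorem map_smul_mem_bihomogeneous {E : Type*} [NormedAddCommGroup E] [NormedSpace ℂ E] {n : ℕ}
    (η : E [⋀^Fin n]→L[ℝ] ℂ) (v : Fin n → E) :
    (fun c : ℂ => η fun i => c • v i) ∈ bihomogeneous n := by
  have h : (fun c : ℂ => η fun i => c • v i) = ∑ s : Finset (Fin n),
      η (s.piecewise v fun i => Complex.I • v i) •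
        fun c : ℂ => (c.re : ℂ) ^ s.card * (c.im : ℂ) ^ (n - s.card) := by
    funext c
    have hc : (fun i => c • v i) = (fun i => c.re • v i) + fun i => c.im • (Complex.I • v i) := by
      funext i
      conv_lhs => rw [← Complex.re_add_im c, add_smul, mul_smul]
      simp only [Complex.coe_smul, Pi.add_apply]
    rw [hc, η.map_add_univ, Finset.sum_apply]
    refine Finset.sum_congr rfl fun s _ => ?_
    have h1 : s.piecewise (fun i => c.re • v i) (fun i => c.im • (Complex.I • v i)) = fun i =>
        (s.piecewise (fun _ => c.re) (fun _ => c.im) : Fin n → ℝ) i •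
          (s.piecewise v fun i => Complex.I • v i) i := by
      funext i
      by_cases hi : i ∈ s <;> simp [hi]
    rw [h1, η.map_smul_univ, Finset.prod_piecewise]
    simp only [Finset.prod_const, Finset.univ_inter, Pi.smul_apply, smul_eq_mul, Complex.real_smul,
      ← Finset.compl_eq_univ_sdiff, Finset.card_compl, Fintype.card_fin]
    push_cast
    ring
  rw [h]
  refine Submodule.sum_mem _ fun s _ => Submodule.smul_mem _ _ ?_
  have hs : s.card ≤ n := by simpa using s.card_le_univ
  have := re_pow_mul_im_pow_mem_bihomogeneous s.card (n - s.card)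
  rwa [Nat.add_sub_cancel' hs] at this

/-- The root of unity used for averaging. -/
def zetaRoot (n : ℕ) : ℂ := Complex.exp (2 * Real.pi * Complex.I / ((2 * n + 1 : ℕ) : ℂ))

theorem isPrimitiveRoot_zetaRoot (n : ℕ) : IsPrimitiveRoot (zetaRoot n) (2 * n + 1) :=
  Complex.isPrimitiveRoot_exp _ (by omega)

theorem zetaRoot_mul_conj (n : ℕ) : zetaRoot n * conj (zetaRoot n) = 1 := by
  rw [Complex.mul_conj, Complex.normSq_eq_norm_sq,
    (isPrimitiveRoot_zetaRoot n).norm'_eq_one (by omega)]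
  simp

/-- The projection to the component `c^p (conj c)^q` by averaging over roots of unity. -/
def average (n p q : ℕ) (f : ℂ → ℂ) : ℂ :=
  ((2 * n + 1 : ℕ) : ℂ)⁻¹ * ∑ j ∈ Finset.range (2 * n + 1),
    conj (zetaRoot n ^ j) ^ p * (zetaRoot n ^ j) ^ q * f (zetaRoot n ^ j)

/-- Orthogonality of characters. The exponents `q + p'` and `p + q'` lie between `0` and `2n`, so
roots of unity of order `2n + 1` distinguish them, and they agree exactly when `p = p'`. -/
theorem average_monomial {n p q p' q' : ℕ} (h : p + q = n) (h' : p' + q' = n) (c : ℂ) :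
    average n p q (fun z => (z * c) ^ p' * conj (z * c) ^ q') =
      if p = p' then c ^ p * conj c ^ q else 0 := by
  set ζ := zetaRoot n
  have hz : ζ * conj ζ = 1 := zetaRoot_mul_conj n
  have hN : ((2 * n + 1 : ℕ) : ℂ) ≠ 0 := by exact_mod_cast (by omega : 2 * n + 1 ≠ 0)
  have h1 : ∀ j, conj (ζ ^ j) ^ p * (ζ ^ j) ^ q * ((ζ ^ j * c) ^ p' * conj (ζ ^ j * c) ^ q') =
      (c ^ p' * conj c ^ q') * (ζ ^ (q + p') * conj ζ ^ (p + q')) ^ j := by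
    intro j
    simp only [map_mul, map_pow, mul_pow]
    ring
  simp only [average]
  rw [Finset.sum_congr rfl fun j _ => h1 j, ← Finset.mul_sum]
  split_ifs with hp
  · subst hp
    obtain rfl : q = q' := by omega
    have : ζ ^ (q + p) * conj ζ ^ (p + q) = 1 := by
      rw [add_comm q p, ← mul_pow, hz, one_pow]
    rw [this]
    simp only [one_pow, Finset.sum_const, Finset.card_range, nsmul_eq_mul, mul_one]
    field_simp
  · have hw : ζ ^ (q + p') * conj ζ ^ (p + q') ≠ 1 := by
      intro hw
      have h2 : ζ ^ (q + p') = ζ ^ (p + q') := by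
        calc ζ ^ (q + p') = ζ ^ (q + p') * (ζ * conj ζ) ^ (p + q') := by rw [hz, one_pow, mul_one]
          _ = (ζ ^ (q + p') * conj ζ ^ (p + q')) * ζ ^ (p + q') := by rw [mul_pow]; ring
          _ = ζ ^ (p + q') := by rw [hw, one_mul]
      have := (isPrimitiveRoot_zetaRoot n).pow_inj (by omega) (by omega) h2
      omega
    have hw1 : (ζ ^ (q + p') * conj ζ ^ (p + q')) ^ (2 * n + 1) = 1 := by
      have h3 : ζ ^ (2 * n + 1) = 1 := (isPrimitiveRoot_zetaRoot n).pow_eq_one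
      have h4 : conj ζ ^ (2 * n + 1) = 1 := by rw [← map_pow, h3, map_one]
      rw [mul_pow, ← pow_mul, ← pow_mul, mul_comm (q + p'), mul_comm (p + q'), pow_mul, pow_mul,
        h3, h4]
      simp
    have hg := geom_sum_mul (ζ ^ (q + p') * conj ζ ^ (p + q')) (2 * n + 1)
    rw [hw1, sub_self] at hg
    rw [(mul_eq_zero.1 hg).resolve_right (sub_ne_zero.2 hw)]
    simp

theorem average_add (n p q : ℕ) (f g : ℂ → ℂ) :
    average n p q (fun z => f z + g z) = average n p q f + average n p q g := by
  simp only [average, mul_add, Finset.sum_add_distrib]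

theorem average_smul (n p q : ℕ) (a : ℂ) (f : ℂ → ℂ) :
    average n p q (fun z => a * f z) = a * average n p q f := by
  simp only [average, Finset.mul_sum]
  exact Finset.sum_congr rfl fun j _ => by ring

theorem average_zero (n p q : ℕ) : average n p q (fun _ => 0) = 0 := by simp [average]

theorem average_mul_right {n p q : ℕ} (h : p + q = n) {f : ℂ → ℂ} (hf : f ∈ bihomogeneous n)
    (c : ℂ) : average n p q (fun z => f (z * c)) = c ^ p * conj c ^ q * average n p q f := by
  induction hf using Submodule.span_induction with
  | mem f hf =>
    obtain ⟨p', q', h', rfl⟩ := hf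
    have h1 := average_monomial h h' 1
    simp only [mul_one, map_one, one_pow] at h1
    rw [average_monomial h h' c, h1]
    split_ifs <;> simp
  | zero => simp [show (0 : ℂ → ℂ) = fun _ => 0 from rfl, average_zero]
  | add f g _ _ hf hg =>
    simp only [Pi.add_apply]
    rw [average_add n p q (fun z => f (z * c)), hf, hg]
    have := average_add n p q f g
    rw [show (f + g) = fun z => f z + g z from rfl, this]
    ring
  | smul a f _ hf =>
    simp only [Pi.smul_apply, smul_eq_mul]
    rw [average_smul n p q a (fun z => f (z * c)), hf,
      show (a • f) = fun z => a * f z from rfl, average_smul]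
    ring

theorem sum_average {n : ℕ} {f : ℂ → ℂ} (hf : f ∈ bihomogeneous n) :
    ∑ pq ∈ Finset.HasAntidiagonal.antidiagonal n, average n pq.1 pq.2 f = f 1 := by
  induction hf using Submodule.span_induction with
  | mem f hf =>
    obtain ⟨p', q', h', rfl⟩ := hf
    rw [Finset.sum_eq_single (p', q')]
    · have h1 := average_monomial h' h' 1
      simpa using h1
    · intro pq hpq hne
      have hpq' : pq.1 + pq.2 = n := by simpa using hpq
      have h1 := average_monomial hpq' h' 1
      simp only [mul_one, map_one, one_pow] at h1
      rw [h1, if_neg]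
      intro h
      refine hne (Prod.ext h ?_)
      simp only
      omega
    · intro h
      exact absurd (by simpa using h') h
  | zero => simp [show (0 : ℂ → ℂ) = fun _ => 0 from rfl, average_zero]
  | add f g _ _ hf hg =>
    rw [show (f + g) = fun z => f z + g z from rfl]
    simp only [average_add, Finset.sum_add_distrib, hf, hg]
  | smul a f _ hf =>
    rw [show (a • f) = fun z => a * f z from rfl]
    simp only [average_smul, ← Finset.mul_sum, hf]

namespace SmoothForm

variable {k n l : ℕ}

/-- The pull-back of all arguments by the multiplication by `c`. -/
def rotate (c : ℂ) (α : SmoothForm k n) : SmoothForm k n :=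
  ofCone (fun x => (α.1 x).compContinuousLinearMap (c • ContinuousLinearMap.id ℝ (Cone k)))
    (contDiffOn_alternating_of_apply fun v =>
      contDiffOn_alternating_apply (η := α.1) (g := fun i _ => c • v i) (contDiffOn α)
        fun _ => contDiffOn_const)
    (by
      intro b hb x hx v
      have := apply_smul α hb hx fun i => c • v i
      simpa [Function.comp_def, smul_comm b c] using this)
    (by
      rintro x hx v ⟨i, b, h⟩
      exact apply_eq_zero α hx i (c * b) (by simp [h, mul_smul]))

theorem rotate_apply (c : ℂ) (α : SmoothForm k n) {x : Cone k} (hx : x ≠ 0) (v : Fin n → Cone k) :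
    (rotate c α).1 x v = α.1 x fun i => c • v i := by
  rw [rotate, ofCone_apply hx]
  rfl

/-- The component of bidegree `(p, q)`. -/
def component (p q : ℕ) (α : SmoothForm k n) : SmoothForm k n :=
  ((2 * n + 1 : ℕ) : ℂ)⁻¹ • ∑ j ∈ Finset.range (2 * n + 1),
    (conj (zetaRoot n ^ j) ^ p * (zetaRoot n ^ j) ^ q) • rotate (zetaRoot n ^ j) α

theorem sum_apply {ι : Type*} (s : Finset ι) (α : ι → SmoothForm k n) (x : Cone k)
    (v : Fin n → Cone k) : (∑ i ∈ s, α i).1 x v = ∑ i ∈ s, (α i).1 x v := by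
  classical
  induction s using Finset.induction_on with
  | empty => simp
  | insert a s ha ih => rw [Finset.sum_insert ha, Finset.sum_insert ha, ← ih]; rfl

theorem component_apply (p q : ℕ) (α : SmoothForm k n) {x : Cone k} (hx : x ≠ 0)
    (v : Fin n → Cone k) :
    (component p q α).1 x v = average n p q fun z => α.1 x fun i => z • v i := by
  have : (component p q α).1 x v = ((2 * n + 1 : ℕ) : ℂ)⁻¹ * (∑ j ∈ Finset.range (2 * n + 1),
    (conj (zetaRoot n ^ j) ^ p * (zetaRoot n ^ j) ^ q) • rotate (zetaRoot n ^ j) α).1 x v := rfl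
  rw [this, sum_apply, average]
  congr 1
  refine Finset.sum_congr rfl fun j _ => ?_
  rw [← rotate_apply _ _ hx]
  rfl

theorem isBidegree_component {p q : ℕ} (h : p + q = n) (α : SmoothForm k n) :
    IsBidegree (component p q α) p q := by
  refine ⟨h, fun x hx c v => ?_⟩
  rw [component_apply p q α hx, component_apply p q α hx]
  simp only [smul_smul]
  exact average_mul_right h (map_smul_mem_bihomogeneous (α.1 x) v) c

theorem sum_component (α : SmoothForm k n) :
    ∑ pq ∈ Finset.HasAntidiagonal.antidiagonal n, component pq.1 pq.2 α = α := by
  refine ext_apply fun x hx v => ?_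
  rw [sum_apply]
  simp only [component_apply _ _ α hx]
  rw [sum_average (map_smul_mem_bihomogeneous (α.1 x) v)]
  simp

/-- Rotating a complex tuple by a number of modulus one does not change the value, so every term of
the average is the same. Only the component of bidegree `(l, l)` is seen by complex subspaces. -/
theorem component_apply_complexTuple (α : SmoothForm k (2 * l)) {x : Cone k} (hx : x ≠ 0)
    (v : Fin l → Cone k) :
    (component l l α).1 x (complexTuple v) = α.1 x (complexTuple v) := by
  rw [component_apply l l α hx, average]
  have h : ∀ j ∈ Finset.range (2 * (2 * l) + 1), conj (zetaRoot (2 * l) ^ j) ^ l *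
      (zetaRoot (2 * l) ^ j) ^ l * (α.1 x fun i => zetaRoot (2 * l) ^ j • complexTuple v i) =
        α.1 x (complexTuple v) := by
    intro j _
    have hz := zetaRoot_mul_conj (2 * l)
    rw [complexTuple_smul, map_complexTuple_smul, ← mul_pow, map_pow, ← mul_pow, mul_comm (conj _),
      hz]
    have : Complex.normSq (zetaRoot (2 * l) ^ j) = 1 := by
      have h1 : ((Complex.normSq (zetaRoot (2 * l)) : ℝ) : ℂ) = 1 := by rw [← Complex.mul_conj, hz]
      rw [map_pow, Complex.ofReal_eq_one.1 h1, one_pow]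
    simp [this]
  rw [Finset.sum_congr rfl h, Finset.sum_const, Finset.card_range, nsmul_eq_mul]
  have hN : ((2 * (2 * l) + 1 : ℕ) : ℂ) ≠ 0 := by exact_mod_cast (by omega : 2 * (2 * l) + 1 ≠ 0)
  field_simp

/-- The composition of a form with a real-linear map on values. -/
def postcomp (L : ℂ →L[ℝ] ℂ) (α : SmoothForm k n) : SmoothForm k n :=
  ofCone (fun x => L.compContinuousAlternatingMap (α.1 x))
    (contDiffOn_alternating_of_apply fun v => L.contDiff.comp_contDiffOn
      (contDiffOn_alternating_apply (contDiffOn α) fun _ => contDiffOn_const))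
    (by
      intro c hc x hx v
      have := congrArg L (apply_smul α hc hx v)
      exact this)
    (fun x hx v ⟨i, c, h⟩ => by
      simp [apply_eq_zero α hx i c h])

theorem postcomp_apply (L : ℂ →L[ℝ] ℂ) (α : SmoothForm k n) {x : Cone k} (hx : x ≠ 0)
    (v : Fin n → Cone k) : (postcomp L α).1 x v = L (α.1 x v) := by
  exact congrArg (fun a => a v) (ofCone_apply hx)

/-- The factor `c^l (conj c)^l` is real, so it commutes with real-linear maps of the values; this
permits real and imaginary parts to be taken within bidegree `(l, l)`. -/
theorem IsBidegree.postcomp {α : SmoothForm k n} (h : IsBidegree α l l) (L : ℂ →L[ℝ] ℂ) :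
    IsBidegree (postcomp L α) l l := by
  refine ⟨h.1, fun x hx c v => ?_⟩
  rw [postcomp_apply L α hx, postcomp_apply L α hx, h.2 x hx]
  have : c ^ l * conj c ^ l = ((Complex.normSq c ^ l : ℝ) : ℂ) := by
    rw [← mul_pow, Complex.mul_conj]
    simp
  rw [this, ← Complex.real_smul, map_smul, Complex.real_smul]

end SmoothForm

/-! ### Supports of forms and currents -/

namespace SmoothForm

variable {k n l : ℕ}

theorem apply_rep_eq_zero_iff (α : SmoothForm k n) {x : Cone k} (hx : x ≠ 0) :
    α.1 (Projectivization.mk ℂ x hx).rep = 0 ↔ α.1 x = 0 := by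
  obtain ⟨c, hc, h⟩ := PSpace.exists_rep_mk x hx
  rw [h]
  constructor
  · intro h0
    ext v
    rw [← apply_smul α hc hx, h0]
    rfl
  · intro h0
    ext v
    have := apply_smul α hc hx fun i => c⁻¹ • v i
    rw [h0] at this
    simpa [smul_smul, hc] using this

theorem apply_eq_zero_of_notMem_support (α : SmoothForm k n) {x : Cone k} (hx : x ≠ 0)
    (h : Projectivization.mk ℂ x hx ∉ support α) : α.1 x = 0 := by
  by_contra h0
  exact h (subset_closure (mt (apply_rep_eq_zero_iff α hx).1 h0))

theorem support_subset {α : SmoothForm k n} {K : Set (PSpace k)} (hK : IsClosed K)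
    (h : ∀ x (hx : x ≠ 0), Projectivization.mk ℂ x hx ∉ K → α.1 x = 0) : support α ⊆ K := by
  refine closure_minimal (fun p hp => ?_) hK
  by_contra hpK
  obtain ⟨x, hx, rfl⟩ := PSpace.exists_mk_eq p
  exact hp ((apply_rep_eq_zero_iff α hx).2 (h x hx hpK))

theorem isClosed_support (α : SmoothForm k n) : IsClosed (support α) := isClosed_closure

end SmoothForm

namespace Current

open SmoothForm

variable {k n l : ℕ}

/-- `T` vanishes on the forms supported in `V`. -/
def VanishesOn (T : Current k n) (V : Set (PSpace k)) : Prop :=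
  ∀ α : SmoothForm k n, SmoothForm.support α ⊆ V → T.toLinearMap α = 0

/-- Normality is used twice, since supports are closures: `χ` must be one on a neighbourhood of `K`,
and zero outside a closed subset of `W`. -/
theorem exists_cutoff {K W : Set (PSpace k)} (hK : _root_.IsClosed K) (hW : IsOpen W) (hKW : K ⊆ W) :
    ∃ (χ : Cone k → ℝ) (O C : Set (PSpace k)), IsSmoothFunction χ ∧ IsOpen O ∧ _root_.IsClosed C ∧
      K ⊆ O ∧ C ⊆ W ∧ O ⊆ C ∧ (∀ x, χ x ∈ Set.Icc 0 1) ∧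
      (∀ x (hx : x ≠ 0), Projectivization.mk ℂ x hx ∈ O → χ x = 1) ∧
      ∀ x (hx : x ≠ 0), Projectivization.mk ℂ x hx ∉ C → χ x = 0 := by
  obtain ⟨O, hO, hKO, hOW⟩ := normal_exists_closure_subset hK hW hKW
  obtain ⟨O', hO', hOO', hO'W⟩ := normal_exists_closure_subset isClosed_closure hW hOW
  obtain ⟨χ, hχ, h01, h1, h0⟩ := exists_isSmoothFunction (isClosed_closure (s := O))
    hO'.isClosed_compl (Set.disjoint_compl_right_iff_subset.2 hOO')
  refine ⟨χ, O, closure O', hχ, hO, isClosed_closure, hKO, hO'W, ?_, h01,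
    fun x hx h => h1 x hx (subset_closure h), fun x hx h => h0 x hx fun h' => h (subset_closure h')⟩
  exact subset_closure.trans (hOO'.trans subset_closure)

/-- A two-piece partition of unity: the cut-off equals one near the part of the support outside `W`,
so one piece is supported in `V` and the other in `W`. -/
theorem VanishesOn.union {T : Current k n} {V W : Set (PSpace k)} (hT : T.VanishesOn V)
    (hT' : T.VanishesOn W) (hV : IsOpen V) (hW : IsOpen W) : T.VanishesOn (V ∪ W) := by
  intro α hα
  obtain ⟨χ, O, C, hχ, hO, hC, hKO, hCV, -, -, h1, h0⟩ :=
    exists_cutoff ((isClosed_support α).sdiff hW) hV (by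
      rintro p ⟨hp, hpW⟩
      exact (hα hp).resolve_right hpW)
  have hα1 : T.toLinearMap (mulFun χ hχ α) = 0 := by
    refine hT _ ((support_subset hC fun x hx h => ?_).trans hCV)
    rw [mulFun_apply, h0 x hx h]
    ext v
    simp
  have hα2 : T.toLinearMap (α - mulFun χ hχ α) = 0 := by
    refine hT' _ ((support_subset ((isClosed_support α).sdiff hO) fun x hx h => ?_).trans ?_)
    · have : (α - mulFun χ hχ α).1 x = α.1 x - χ x • α.1 x := by
        rw [← mulFun_apply χ hχ]
        rfl
      rw [this]
      by_cases hs : Projectivization.mk ℂ x hx ∈ SmoothForm.support α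
      · rw [h1 x hx (by_contra fun h' => h ⟨hs, h'⟩)]
        ext v
        simp
      · rw [apply_eq_zero_of_notMem_support α hx hs]
        ext v
        simp
    · rintro p ⟨hp, hpO⟩
      by_contra hpW
      exact hpO (hKO ⟨hp, hpW⟩)
  have hα3 := T.toLinearMap.map_sub α (mulFun χ hχ α)
  rw [hα1, sub_zero, hα2] at hα3
  exact hα3.symm

/-- The support of a test form is compact, so it is covered by finitely many of the open sets
defining the complement, and these can be united pairwise. -/
theorem vanishesOn_compl_support (T : Current k n) : T.VanishesOn T.supportᶜ := by
  intro α hα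
  have hs : SmoothForm.support α ⊆ ⋃₀ {V | IsOpen V ∧ T.VanishesOn V} := by
    intro p hp
    have := hα hp
    rwa [Current.support, compl_compl] at this
  obtain ⟨V, ⟨hV, hV'⟩, hαV⟩ : ∃ V, (IsOpen V ∧ T.VanishesOn V) ∧ SmoothForm.support α ⊆ V := by
    refine (isClosed_support α).isCompact.induction_on
      (p := fun K => ∃ V, (IsOpen V ∧ T.VanishesOn V) ∧ K ⊆ V) ?_ ?_ ?_ ?_
    · refine ⟨∅, ⟨isOpen_empty, fun β hβ => ?_⟩, Set.Subset.rfl⟩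
      have : β = 0 := ext_apply fun x hx v => by
        rw [apply_eq_zero_of_notMem_support β hx fun h => hβ h]
        rfl
      rw [this, map_zero]
    · rintro K L hKL ⟨V, hV, hLV⟩
      exact ⟨V, hV, hKL.trans hLV⟩
    · rintro K L ⟨V, hV, hKV⟩ ⟨W, hW, hLW⟩
      exact ⟨V ∪ W, ⟨hV.1.union hW.1, hV.2.union hW.2 hV.1 hW.1⟩, Set.union_subset_union hKV hLW⟩
    · intro p hp
      obtain ⟨V, hV, hpV⟩ := hs hp
      exact ⟨V, mem_nhdsWithin_of_mem_nhds (hV.1.mem_nhds hpV), V, hV, Set.Subset.rfl⟩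
  exact hV' α hαV

theorem toLinearMap_eq_of_eqOn {T : Current k n} {O : Set (PSpace k)} (hO : IsOpen O)
    (hT : T.support ⊆ O) {α β : SmoothForm k n}
    (h : ∀ x (hx : x ≠ 0), Projectivization.mk ℂ x hx ∈ O → α.1 x = β.1 x) :
    T.toLinearMap α = T.toLinearMap β := by
  rw [← sub_eq_zero, ← map_sub]
  refine T.vanishesOn_compl_support _ ((support_subset hO.isClosed_compl fun x hx hxO => ?_).trans
    (Set.compl_subset_compl.2 hT))
  have : (α - β).1 x = α.1 x - β.1 x := rfl
  rw [this, h x hx (by simpa using hxO), sub_self]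

end Current

/-! ### Strictly positive forms and compactness of frames -/

namespace SmoothForm

variable {k n l : ℕ}

theorem continuousOn_apply_frame (α : SmoothForm k (2 * l)) :
    ContinuousOn (fun F : Fin (l + 1) → Cone k => α.1 (F 0) (complexTuple fun i => F i.succ))
      {F | F 0 ≠ 0} := by
  have h1 : ContDiffOn ℝ ∞ (fun F : Fin (l + 1) → Cone k => α.1 (F 0)) {F | F 0 ≠ 0} :=
    (contDiffOn α).comp (contDiff_apply ℝ (Cone k) (0 : Fin (l + 1))).contDiffOn fun F hF => hF
  refine (contDiffOn_alternating_apply h1 (g := fun j F => complexTuple (fun i => F i.succ) j)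
    fun j => ContDiff.contDiffOn ?_).continuousOn
  have h2 : ContDiff ℝ ∞ fun F : Fin (l + 1) → Cone k => F (⟨j.1 / 2, by omega⟩ : Fin l).succ :=
    contDiff_apply ℝ (Cone k) _
  exact h2.const_smul (Complex.I ^ (j.1 % 2))

/-- Strict positivity of a form at the points of `W`. -/
def IsStrictlyPositiveOn (Θ : SmoothForm k (2 * l)) (W : Set (PSpace k)) : Prop :=
  ∀ F : Fin (l + 1) → Cone k, IsFrame F → (∀ h0, Projectivization.mk ℂ (F 0) h0 ∈ W) →
    0 < (Θ.1 (F 0) (complexTuple fun i => F i.succ)).re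

theorem IsStrictlyPositiveOn.re_nonneg {Θ : SmoothForm k (2 * l)} {W : Set (PSpace k)}
    (h : IsStrictlyPositiveOn Θ W) {x : Cone k} (hx : x ≠ 0) (hxW : Projectivization.mk ℂ x hx ∈ W)
    (v : Fin l → Cone k) : 0 ≤ (Θ.1 x (complexTuple v)).re := by
  rcases exists_isFrame hx v with h0 | ⟨F, hF, ⟨r, hr, hFx⟩, c, hc, hα⟩
  · rw [h0, Complex.zero_re]
  · rw [hα, Complex.re_ofReal_mul]
    refine mul_nonneg hc.le (h F hF fun h0 => ?_).le
    have : Projectivization.mk ℂ (F 0) h0 = Projectivization.mk ℂ x hx :=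
      (Projectivization.mk_eq_mk_iff' ℂ _ _ _ _).2 ⟨r, hFx.symm⟩
    rwa [this]

/-- The quotient of the two values is continuous on the compact set of orthonormal frames over `W`.
Any other tuple changes both values by the same positive factor, or annihilates both. -/
theorem IsStrictlyPositiveOn.exists_bound {Θ : SmoothForm k (2 * l)} {W : Set (PSpace k)}
    (h : IsStrictlyPositiveOn Θ W) (hW : IsClosed W) (α : SmoothForm k (2 * l)) :
    ∃ M : ℝ, 0 ≤ M ∧ ∀ x (hx : x ≠ 0), Projectivization.mk ℂ x hx ∈ W → ∀ v : Fin l → Cone k,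
      ‖α.1 x (complexTuple v)‖ ≤ M * (Θ.1 x (complexTuple v)).re := by
  let X := {F : Fin (l + 1) → Cone k // IsFrame F}
  have : CompactSpace X := isCompact_iff_compactSpace.1 (isCompact_setOf_isFrame (l + 1))
  let g : X → PSpace k := fun F => Projectivization.mk' ℂ ⟨F.1 0, F.2.ne_zero 0⟩
  have hg : Continuous g := PSpace.continuous_mk'.comp
    (Continuous.subtype_mk ((continuous_apply 0).comp continuous_subtype_val) _)
  have hcont : ∀ β : SmoothForm k (2 * l), Continuous fun F : X =>
      β.1 (F.1 0) (complexTuple fun i => F.1 i.succ) := fun β =>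
    (continuousOn_apply_frame β).comp_continuous continuous_subtype_val fun F => F.2.ne_zero 0
  have hZ : IsCompact (g ⁻¹' W) := (hW.preimage hg).isCompact
  have hpos : ∀ F ∈ g ⁻¹' W, 0 < (Θ.1 (F.1 0) (complexTuple fun i => F.1 i.succ)).re :=
    fun F hF => h F.1 F.2 fun _ => hF
  obtain ⟨M, hM⟩ := hZ.exists_bound_of_continuousOn
    (f := fun F => ‖α.1 (F.1 0) (complexTuple fun i => F.1 i.succ)‖ /
      (Θ.1 (F.1 0) (complexTuple fun i => F.1 i.succ)).re)
    ((hcont α).norm.continuousOn.div (Complex.continuous_re.comp (hcont Θ)).continuousOn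
      fun F hF => (hpos F hF).ne')
  refine ⟨max M 0, le_max_right _ _, fun x hx hxW v => ?_⟩
  rcases exists_isFrame hx v with h0 | ⟨F, hF, ⟨r, hr, hFx⟩, c, hc, hα⟩
  · rw [h0, h0]
    simp
  · have hFW : (⟨F, hF⟩ : X) ∈ g ⁻¹' W := by
      have : g ⟨F, hF⟩ = Projectivization.mk ℂ x hx :=
        (Projectivization.mk_eq_mk_iff' ℂ _ _ _ _).2 ⟨r, hFx.symm⟩
      rwa [Set.mem_preimage, this]
    have h1 := (hM _ hFW).trans (le_max_left M 0)
    have h2 := hpos _ hFW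
    simp only [norm_div, Real.norm_eq_abs, abs_norm] at h1
    rw [abs_of_pos h2, div_le_iff₀ h2] at h1
    rw [hα, hα, Complex.re_ofReal_mul, norm_mul, Complex.norm_real, Real.norm_eq_abs,
      abs_of_pos hc]
    calc c * _ ≤ c * _ := mul_le_mul_of_nonneg_left h1 hc.le
      _ = _ := by ring

/-- The frames on which the value is not positive form a compact set; its projection is closed and
misses `W`. -/
theorem IsStrictlyPositiveOn.exists_isOpen {Θ : SmoothForm k (2 * l)} {W : Set (PSpace k)}
    (h : IsStrictlyPositiveOn Θ W) : ∃ O, IsOpen O ∧ W ⊆ O ∧ IsStrictlyPositiveOn Θ O := by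
  let X := {F : Fin (l + 1) → Cone k // IsFrame F}
  have : CompactSpace X := isCompact_iff_compactSpace.1 (isCompact_setOf_isFrame (l + 1))
  let g : X → PSpace k := fun F => Projectivization.mk' ℂ ⟨F.1 0, F.2.ne_zero 0⟩
  have hg : Continuous g := PSpace.continuous_mk'.comp
    (Continuous.subtype_mk ((continuous_apply 0).comp continuous_subtype_val) _)
  have hcont : Continuous fun F : X => Θ.1 (F.1 0) (complexTuple fun i => F.1 i.succ) :=
    (continuousOn_apply_frame Θ).comp_continuous continuous_subtype_val fun F => F.2.ne_zero 0
  have hB : IsClosed {F : X | (Θ.1 (F.1 0) (complexTuple fun i => F.1 i.succ)).re ≤ 0} :=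
    isClosed_le (Complex.continuous_re.comp hcont) continuous_const
  refine ⟨(g '' {F : X | (Θ.1 (F.1 0) (complexTuple fun i => F.1 i.succ)).re ≤ 0})ᶜ,
    (hB.isCompact.image hg).isClosed.isOpen_compl, ?_, ?_⟩
  · rintro p hp ⟨F, hF, rfl⟩
    exact absurd (h F.1 F.2 fun _ => hp) (not_lt.2 hF)
  · intro F hF hFO
    by_contra hneg
    exact hFO (hF.ne_zero 0) ⟨⟨F, hF⟩, not_lt.1 hneg, rfl⟩

end SmoothForm

/-! ### Positive currents which vanish on a strictly positive form -/

namespace Current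

open SmoothForm

variable {k l : ℕ}

/-- A positive current vanishes if its support lies in an open set where some form on which it
vanishes is strictly positive. -/
theorem eq_zero_of_isStrictlyPositiveOn {T : Current k (2 * l)} (hb : T.IsBidimension)
    (hp : T.IsPositive) {W : Set (PSpace k)} (hW : IsOpen W) {K : Set (PSpace k)} (hK : _root_.IsClosed K)
    (hKW : K ⊆ W) (hT : T.support ⊆ K) (Θ : SmoothForm k (2 * l)) (hΘ : IsStrictlyPositiveOn Θ W)
    (hΘr : ∀ x, x ≠ 0 → ∀ v, (Θ.1 x v).im = 0) (h0 : T.toLinearMap Θ = 0) :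
    T.toLinearMap = 0 := by
  obtain ⟨χ, O, C, hχ, hO, hC, hKO, hCW, hOC, h01, hχ1, hχ0⟩ := exists_cutoff hK hW hKW
  obtain ⟨ψ, O', C', hψ, hO', hC', hCO', hC'W, hO'C', hψ01, hψ1, hψ0⟩ := exists_cutoff hC hW hCW
  have hcomp : ∀ α : SmoothForm k (2 * l), T.toLinearMap (component l l α) = T.toLinearMap α := by
    intro α
    conv_rhs => rw [← sum_component α, map_sum]
    rw [Finset.sum_eq_single (l, l)]
    · intro pq hpq hne
      have hpq' : pq.1 + pq.2 = 2 * l := by simpa using hpq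
      exact hb pq.1 pq.2 hne _ (isBidegree_component hpq' α)
    · intro h
      exact absurd (by simp; omega) h
  -- Positivity is a global condition of bidegree `(l, l)`. The form is therefore cut off and
  -- projected to this bidegree, which changes neither the pairing with `T` nor, up to the factor
  -- `ψ`, the values on complex tuples.
  set Ω := component l l (mulFun ψ hψ Θ) with hΩ
  have hΩT : T.toLinearMap Ω = 0 := by
    rw [hcomp, ← h0]
    refine toLinearMap_eq_of_eqOn hO' (hT.trans (hKO.trans (hOC.trans hCO'))) fun x hx h => ?_
    rw [mulFun_apply, hψ1 x hx h, one_smul]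
  have hΩval : ∀ x, x ≠ 0 → ∀ v : Fin l → Cone k,
      Ω.1 x (complexTuple v) = ψ x * Θ.1 x (complexTuple v) := by
    intro x hx v
    rw [hΩ, component_apply_complexTuple _ hx, mulFun_apply]
    simp
  have hΩb : IsBidegree Ω l l := isBidegree_component (by omega) _
  have hψΘ : ∀ x, x ≠ 0 → ∀ v : Fin l → Cone k, 0 ≤ ψ x * (Θ.1 x (complexTuple v)).re := by
    intro x hx v
    by_cases hxC : Projectivization.mk ℂ x hx ∈ C'
    · exact mul_nonneg (hψ01 x).1 (hΘ.re_nonneg hx (hC'W hxC) v)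
    · rw [hψ0 x hx hxC, zero_mul]
  -- A real form `a` supported where `ψ = 1` is dominated by a multiple `M Ω`, so `M Ω + a` and `M Ω
  -- − a` are both positive. As `T` kills `Ω`, the pairing with `a` is both nonnegative and
  -- nonpositive.
  have main : ∀ (α : SmoothForm k (2 * l)) (L : ℂ →L[ℝ] ℂ), (∀ z, (L z).im = 0) →
      (∀ z, ‖L z‖ ≤ ‖z‖) →
      T.toLinearMap (postcomp L (component l l (mulFun χ hχ α))) = 0 := by
    intro α L hL hL1
    obtain ⟨M, hM0, hM⟩ := IsStrictlyPositiveOn.exists_bound (Θ := Θ) (W := C)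
      (fun F hF h => hΘ F hF fun h0 => hCW (h h0)) hC α
    set a := postcomp L (component l l (mulFun χ hχ α))
    have ha : ∀ x (_ : x ≠ 0) (v : Fin l → Cone k),
        a.1 x (complexTuple v) = L (χ x * α.1 x (complexTuple v)) := by
      intro x hx v
      rw [postcomp_apply _ _ hx, component_apply_complexTuple _ hx, mulFun_apply]
      simp
    have hab : IsBidegree a l l := (isBidegree_component (by omega) _).postcomp L
    have bound : ∀ x, x ≠ 0 → ∀ v : Fin l → Cone k,
        |(a.1 x (complexTuple v)).re| ≤ M * (ψ x * (Θ.1 x (complexTuple v)).re) := by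
      intro x hx v
      rw [ha x hx]
      refine (Complex.abs_re_le_norm _).trans ((hL1 _).trans ?_)
      by_cases hxC : Projectivization.mk ℂ x hx ∈ C
      · rw [hψ1 x hx (hCO' hxC), norm_mul, Complex.norm_real, Real.norm_eq_abs,
          abs_of_nonneg (h01 x).1]
        calc χ x * ‖α.1 x (complexTuple v)‖ ≤ 1 * ‖α.1 x (complexTuple v)‖ :=
              mul_le_mul_of_nonneg_right (h01 x).2 (norm_nonneg _)
          _ ≤ M * (1 * _) := by rw [one_mul, one_mul]; exact hM x hx hxC v
      · rw [hχ0 x hx hxC]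
        simpa using mul_nonneg hM0 (hψΘ x hx v)
    have pos : ∀ s : ℝ, s = 1 ∨ s = -1 → SmoothForm.IsPositive ((M : ℂ) • Ω + (s : ℂ) • a) := by
      intro s hs
      refine ⟨⟨by omega, fun x hx c v => ?_⟩, fun x hx v => ?_⟩
      · have e : ∀ w, ((M : ℂ) • Ω + (s : ℂ) • a).1 x w = M * Ω.1 x w + s * a.1 x w := fun w => rfl
        rw [e, e, hΩb.2 x hx, hab.2 x hx]
        ring
      · have e : ∀ w, ((M : ℂ) • Ω + (s : ℂ) • a).1 x w = M * Ω.1 x w + s * a.1 x w := fun w => rfl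
        rw [e, hΩval x hx]
        have him : (a.1 x (complexTuple v)).im = 0 := by
          rw [ha x hx]
          exact hL _
        have := abs_le.1 (bound x hx v)
        constructor
        · rw [Complex.add_re, Complex.re_ofReal_mul, Complex.re_ofReal_mul, Complex.re_ofReal_mul]
          rcases hs with rfl | rfl <;> linarith
        · rw [Complex.add_im, Complex.im_ofReal_mul, Complex.im_ofReal_mul, Complex.im_ofReal_mul,
            him, hΘr x hx]
          simp
    have h1 := hp _ (pos 1 (Or.inl rfl))
    have h2 := hp _ (pos (-1) (Or.inr rfl))
    simp only [map_add, map_smul, hΩT, smul_zero, zero_add, Complex.ofReal_one, one_smul,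
      Complex.ofReal_neg, neg_smul, Complex.neg_re] at h1 h2
    exact Complex.ext (le_antisymm (neg_nonneg.1 h2.1) h1.1) h1.2
  refine LinearMap.ext fun α => ?_
  rw [LinearMap.zero_apply]
  have h1 : T.toLinearMap α = T.toLinearMap (component l l (mulFun χ hχ α)) := by
    rw [hcomp]
    refine toLinearMap_eq_of_eqOn hO (hT.trans hKO) fun x hx h => ?_
    rw [mulFun_apply, hχ1 x hx h, one_smul]
  set b := component l l (mulFun χ hχ α)
  have h2 : b = postcomp (Complex.ofRealCLM.comp Complex.reCLM) b +
      Complex.I • postcomp (Complex.ofRealCLM.comp Complex.imCLM) b := by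
    refine ext_apply fun x hx v => ?_
    have e : ∀ (β γ : SmoothForm k (2 * l)), (β + Complex.I • γ).1 x v =
      β.1 x v + Complex.I * γ.1 x v := fun β γ => rfl
    rw [e, postcomp_apply _ _ hx, postcomp_apply _ _ hx]
    exact ((congrArg _ (mul_comm _ _)).trans (Complex.re_add_im _)).symm
  rw [h1, h2, map_add, map_smul, main α _ (by simp) fun z => by simpa using Complex.abs_re_le_norm z,
    main α _ (by simp) fun z => by simpa using Complex.abs_im_le_norm z]
  simp

end Current

/-! ### The real volume form of the cone -/

section VolumeForm

variable (k : ℕ)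

/-- The real basis `(e₀, i e₀, …, e_k, i e_k)` of the cone. -/
def realBasis : Module.Basis (Fin (2 * (k + 1))) ℝ (Cone k) :=
  (Complex.basisOneI.smulTower (Pi.basisFun ℂ (Fin (k + 1)))).reindex
    (((Equiv.prodComm _ _).trans finProdFinEquiv).trans (finCongr (mul_comm _ _)))

theorem realBasis_eq_complexTuple :
    ⇑(realBasis k) = SmoothForm.complexTuple fun i => Pi.single i 1 := by
  funext j
  rw [realBasis, Module.Basis.reindex_apply, Module.Basis.smulTower_apply,
    SmoothForm.complexTuple, Pi.basisFun_apply]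
  congr 1
  have h : j.1 % 2 < 2 := Nat.mod_lt _ two_pos
  have h2 : ∀ a : Fin 2, Complex.basisOneI a = Complex.I ^ a.1 := by
    intro a
    fin_cases a <;> simp
  rw [h2]
  rfl

theorem continuous_realBasis_det : Continuous fun u => ((realBasis k).det u : ℂ) := by
  refine Complex.continuous_ofReal.comp ?_
  have h : ∀ u, (realBasis k).det u = ((realBasis k).toMatrix u).det := fun u =>
    Module.Basis.det_apply _ _
  rw [show ⇑(realBasis k).det = fun u => ((realBasis k).toMatrix u).det from funext h]
  refine Continuous.matrix_det (continuous_matrix fun i j => ?_)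
  exact (((realBasis k).coord i).continuous_of_finiteDimensional).comp (continuous_apply j)

/-- The real determinant on the cone. -/
def volumeForm : Cone k [⋀^Fin (2 * (k + 1))]→L[ℝ] ℂ :=
  { (Complex.ofRealCLM : ℝ →ₗ[ℝ] ℂ).compAlternatingMap (realBasis k).det with
    cont := continuous_realBasis_det k }

variable {k}

theorem volumeForm_apply (u : Fin (2 * (k + 1)) → Cone k) :
    volumeForm k u = ((realBasis k).det u : ℂ) := rfl

theorem volumeForm_im (u : Fin (2 * (k + 1)) → Cone k) : (volumeForm k u).im = 0 :=
  Complex.ofReal_im _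

/-- The real determinant of a complex-linear map is the squared modulus of its complex determinant.
-/
theorem volumeForm_map (g : Cone k →ₗ[ℂ] Cone k) (u : Fin (2 * (k + 1)) → Cone k) :
    volumeForm k (fun i => g (u i)) = Complex.normSq (LinearMap.det g) * volumeForm k u := by
  have h := (realBasis k).det_comp (g.restrictScalars ℝ) u
  rw [LinearMap.det_restrictScalars, Algebra.norm_complex_eq] at h
  rw [volumeForm_apply, volumeForm_apply, ← Complex.ofReal_mul]
  exact congrArg _ h

theorem volumeForm_complexTuple (w : Fin (k + 1) → Cone k) :
    volumeForm k (SmoothForm.complexTuple w) =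
      Complex.normSq (LinearMap.det ((Pi.basisFun ℂ (Fin (k + 1))).constr ℂ w)) := by
  set g := (Pi.basisFun ℂ (Fin (k + 1))).constr ℂ w
  have hg : ∀ i, g (Pi.single i 1) = w i := fun i => by
    have := (Pi.basisFun ℂ (Fin (k + 1))).constr_basis ℂ w i
    rwa [Pi.basisFun_apply] at this
  have h := volumeForm_map g (realBasis k)
  rw [volumeForm_apply (⇑(realBasis k)), Module.Basis.det_self, Complex.ofReal_one, mul_one] at h
  rw [← h, realBasis_eq_complexTuple]
  congr 1
  funext j
  simp only [SmoothForm.complexTuple, map_smul, hg]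

theorem volumeForm_complexTuple_nonneg (w : Fin (k + 1) → Cone k) :
    0 ≤ (volumeForm k (SmoothForm.complexTuple w)).re := by
  rw [volumeForm_complexTuple, Complex.ofReal_re]
  exact Complex.normSq_nonneg _

theorem volumeForm_complexTuple_pos {w : Fin (k + 1) → Cone k} (hw : LinearIndependent ℂ w) :
    0 < (volumeForm k (SmoothForm.complexTuple w)).re := by
  rw [volumeForm_complexTuple, Complex.ofReal_re, Complex.normSq_pos]
  let b := basisOfLinearIndependentOfCardEqFinrank hw (by simp)
  have hb : (Pi.basisFun ℂ (Fin (k + 1))).constr ℂ w =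
      ((Pi.basisFun ℂ (Fin (k + 1))).equiv b (Equiv.refl _)).toLinearMap := by
    refine (Pi.basisFun ℂ (Fin (k + 1))).ext fun i => ?_
    rw [Module.Basis.constr_basis, LinearEquiv.coe_coe, Module.Basis.equiv_apply]
    simp [b]
  rw [hb]
  exact (LinearEquiv.isUnit_det' _).ne_zero

/-- Derivative at `s = 0` of the transformation rule of the volume form under `1 + s g`. -/
theorem sum_volumeForm_update (g : Cone k →ₗ[ℂ] Cone k) (c : ℝ)
    (hg : HasDerivAt (fun s : ℝ => Complex.normSq (LinearMap.det (LinearMap.id + (s : ℂ) • g))) c 0)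
    (u : Fin (2 * (k + 1)) → Cone k) :
    ∑ i, volumeForm k (Function.update u i (g (u i))) = c * volumeForm k u := by
  have h1 : HasDerivAt (fun s : ℝ => volumeForm k (fun i => u i + s • g (u i)))
      (∑ i, volumeForm k (Function.update u i (g (u i)))) 0 := by
    have h2 : HasDerivAt (fun s : ℝ => fun i => u i + s • g (u i)) (fun i => g (u i)) 0 :=
      hasDerivAt_pi.2 fun i => by
        simpa using ((hasDerivAt_id (0 : ℝ)).smul_const (g (u i))).const_add (u i)
    have h3 := (volumeForm k).toContinuousMultilinearMap.hasFDerivAt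
      (x := fun i => u i + (0 : ℝ) • g (u i))
    have h4 := h3.comp_hasDerivAt (0 : ℝ) h2
    rw [ContinuousMultilinearMap.linearDeriv_apply] at h4
    simp only [zero_smul, add_zero] at h4
    exact h4
  have h5 : (fun s : ℝ => volumeForm k (fun i => u i + s • g (u i))) = fun s : ℝ =>
      (Complex.normSq (LinearMap.det (LinearMap.id + (s : ℂ) • g)) : ℂ) * volumeForm k u := by
    funext s
    rw [← volumeForm_map]
    rfl
  rw [h5] at h1
  exact h1.unique (hg.ofReal_comp.mul_const _)

end VolumeForm

/-! ### Exact forms which are positive along a linear subspace -/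

namespace SmoothForm

variable {k l m n : ℕ}

theorem complexTuple_cons (x : Cone k) (v : Fin l → Cone k) :
    (Matrix.vecCons x (Matrix.vecCons (Complex.I • x) (complexTuple v)) : Fin (2 * l + 1 + 1) → _) =
      complexTuple (l := l + 1) (Fin.cons x v) := by
  funext j
  refine Fin.cases ?_ (fun j => ?_) j
  · simp [complexTuple]
  refine Fin.cases ?_ (fun j => ?_) j
  · have h1 : ((Fin.succ 0 : Fin (2 * l + 1 + 1)) : ℕ) = 1 := rfl
    have h2 : ∀ h, (⟨1 / 2, h⟩ : Fin (l + 1)) = 0 := fun h => rfl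
    simp only [Matrix.cons_val_succ, Matrix.cons_val_zero, complexTuple, h1, h2, Fin.cons_zero]
    simp
  · have h1 : ((j.succ.succ : Fin (2 * l + 1 + 1)) : ℕ) = j.1 + 2 := rfl
    have h2 : ∀ h, (⟨(j.1 + 2) / 2, h⟩ : Fin (l + 1)) = (⟨j.1 / 2, by omega⟩ : Fin l).succ := by
      intro h
      ext
      simp
    simp only [Matrix.cons_val_succ, complexTuple, h1, h2, Nat.add_mod_right, Fin.cons_succ]

/-- The form on projective space obtained by contracting a constant form on the cone with the
tangent plane of the fibre. -/
def ofConstant (E : Cone k [⋀^Fin (2 * l + 1 + 1)]→L[ℝ] ℂ)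
    (hE : ∀ c : ℂ, c ≠ 0 → ∀ u, E (fun i => c • u i) = (Complex.normSq c ^ (l + 1) : ℝ) * E u) :
    SmoothForm k (2 * l) :=
  ofCone (fun x => (PSpace.normSq x ^ (l + 1))⁻¹ • (E.curryLeft x).curryLeft (Complex.I • x))
    (by
      refine ContDiffOn.smul ((PSpace.contDiff_normSq.contDiffOn.pow _).inv
        fun x hx => (pow_pos (PSpace.normSq_pos hx) _).ne') ?_
      refine contDiffOn_alternating_of_apply fun v => ?_
      refine contDiffOn_alternating_apply (contDiffOn_const (c := E))
        (g := fun i x => (Matrix.vecCons x (Matrix.vecCons (Complex.I • x) v) : _) i) fun i => ?_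
      refine Fin.cases ?_ (fun j => ?_) i
      · exact contDiffOn_id
      refine Fin.cases ?_ (fun j => ?_) j
      · exact contDiffOn_id.const_smul Complex.I
      · exact contDiffOn_const)
    (by
      intro c hc x hx v
      have := hE c hc (Matrix.vecCons x (Matrix.vecCons (Complex.I • x) v))
      have e : (fun i => c • (Matrix.vecCons x (Matrix.vecCons (Complex.I • x) v) :
          Fin (2 * l + 1 + 1) → Cone k) i) =
          Matrix.vecCons (c • x) (Matrix.vecCons (Complex.I • c • x) fun i => c • v i) := by
        funext i
        refine Fin.cases ?_ (fun j => ?_) i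
        · simp
        refine Fin.cases ?_ (fun j => ?_) j
        · simp [smul_comm c Complex.I]
        · simp
      rw [e] at this
      simp only [ContinuousAlternatingMap.smul_apply,
        ContinuousAlternatingMap.curryLeft_apply_apply, this, PSpace.normSq_smul]
      have h1 : Complex.normSq c ≠ 0 := by simpa using hc
      rw [mul_pow, mul_inv, ← Complex.real_smul, smul_smul]
      congr 1
      field_simp)
    (by
      rintro x hx v ⟨i, c, h⟩
      simp only [ContinuousAlternatingMap.smul_apply, ContinuousAlternatingMap.curryLeft_apply_apply]
      have h1 : v = Function.update v i (c.re • x + c.im • Complex.I • x) := by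
        rw [eq_comm, Function.update_eq_self_iff, h]
        conv_rhs => rw [← Complex.re_add_im c, add_smul, mul_smul, Complex.coe_smul, Complex.coe_smul]
      set u : Fin (2 * l + 1 + 1) → Cone k := Matrix.vecCons x (Matrix.vecCons (Complex.I • x) v)
        with hu
      have h2 : u = Function.update u i.succ.succ (c.re • x + c.im • Complex.I • x) := by
        rw [eq_comm, Function.update_eq_self_iff, hu, Matrix.cons_val_succ, Matrix.cons_val_succ,
          h, ← Complex.coe_smul, ← Complex.coe_smul, smul_smul, ← add_smul, Complex.re_add_im]
      have h3 : E (Function.update u i.succ.succ x) = 0 := by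
        refine E.map_eq_zero_of_eq _ (i := 0) (j := i.succ.succ) ?_ (Fin.succ_ne_zero _).symm
        rw [Function.update_self, Function.update_of_ne (Fin.succ_ne_zero _).symm]
        rfl
      have h4 : E (Function.update u i.succ.succ (Complex.I • x)) = 0 := by
        have hne : (Fin.succ 0 : Fin (2 * l + 1 + 1)) ≠ i.succ.succ :=
          fun h => Fin.succ_ne_zero _ (Fin.succ_injective _ h).symm
        refine E.map_eq_zero_of_eq _ (i := Fin.succ 0) (j := i.succ.succ) ?_ hne
        rw [Function.update_self, Function.update_of_ne hne]
        rfl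
      rw [h2, E.map_update_add, E.map_update_smul, E.map_update_smul, h3, h4]
      simp)

theorem ofConstant_apply (E : Cone k [⋀^Fin (2 * l + 1 + 1)]→L[ℝ] ℂ) (hE) {x : Cone k} (hx : x ≠ 0)
    (v : Fin (2 * l) → Cone k) :
    (ofConstant E hE).1 x v = ((PSpace.normSq x ^ (l + 1))⁻¹ : ℝ) *
      E (Matrix.vecCons x (Matrix.vecCons (Complex.I • x) v)) := by
  refine (DFunLike.congr_fun (ofCone_apply hx) v).trans ?_
  rw [ContinuousAlternatingMap.smul_apply, Complex.real_smul]
  rfl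

theorem d_apply_im {β : SmoothForm k n} (h : ∀ x, x ≠ 0 → ∀ v, (β.1 x v).im = 0) {x : Cone k}
    (hx : x ≠ 0) (v : Fin (n + 1) → Cone k) : ((d β).1 x v).im = 0 := by
  rw [isExteriorDerivative_d β x hx, extDeriv_apply (differentiableAt β hx), Complex.im_sum]
  refine Finset.sum_eq_zero fun i _ => ?_
  set w := i.removeNth v
  have h1 : HasFDerivAt (fun y => Complex.imCLM (β.1 y w)) (Complex.imCLM.comp
      (fderiv ℝ (fun y => β.1 y w) x)) x := by
    refine Complex.imCLM.hasFDerivAt.comp x (DifferentiableAt.hasFDerivAt ?_)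
    exact (differentiableAt β hx).continuousAlternatingMap_apply fun _ => differentiableAt_const _
  have h2 : (fun y => Complex.imCLM (β.1 y w)) =ᶠ[𝓝 x] fun _ => 0 := by
    filter_upwards [isOpen_compl_singleton.mem_nhds hx] with y hy
    exact h y hy w
  have h3 := h1.unique ((hasFDerivAt_const (0 : ℝ) x).congr_of_eventuallyEq h2)
  have h4 := DFunLike.congr_fun h3 (v i)
  simp only [ContinuousLinearMap.comp_apply, Complex.imCLM_apply, zero_apply] at h4
  rw [Complex.smul_im, h4, smul_zero]

/-- Where `A x = 0`, the two slots filled by `x` and `i x` contribute nothing to the derivation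
action of `A`, so the remaining slots already give all of `E'`. -/
theorem d_interior_ofConstant_apply (A : Cone k →L[ℂ] Cone k)
    {E E' : Cone k [⋀^Fin (2 * (m + 1) + 1 + 1)]→L[ℝ] ℂ} (hE)
    (hEE' : ∀ u, ∑ i, E (Function.update u i (A (u i))) = E' u)
    {x : Cone k} (hx : x ≠ 0) (hA : A x = 0) (v : Fin (2 * m + 1 + 1) → Cone k) :
    (d (interior A (n := 2 * m + 1) (ofConstant E hE))).1 x v =
      ((PSpace.normSq x ^ (m + 1 + 1))⁻¹ : ℝ) *
        E' (Matrix.vecCons x (Matrix.vecCons (Complex.I • x) v)) := by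
  rw [d_interior_apply A _ hx hA]
  set u : Fin (2 * (m + 1) + 1 + 1) → Cone k :=
    Matrix.vecCons x (Matrix.vecCons (Complex.I • x) v) with hu
  have h0 : E (Function.update u 0 (A (u 0))) = 0 :=
    E.map_coord_zero 0 (by rw [Function.update_self]; exact hA)
  have h1 : E (Function.update u (Fin.succ 0) (A (u (Fin.succ 0)))) = 0 := by
    refine E.map_coord_zero (Fin.succ 0) ?_
    rw [Function.update_self]
    change A (Complex.I • x) = 0
    rw [map_smul, hA, smul_zero]
  have h2 : E' u = ∑ i : Fin (2 * m + 1 + 1),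
      E (Function.update u (Fin.succ (Fin.succ i)) (A (u (Fin.succ (Fin.succ i))))) := by
    rw [← hEE', Fin.sum_univ_succ, Fin.sum_univ_succ, h0, h1, zero_add, zero_add]
    rfl
  rw [h2, Finset.mul_sum]
  refine Finset.sum_congr rfl fun i _ => ?_
  refine (ofConstant_apply E hE hx _).trans ?_
  congr 2
  have e : ∀ (a : Cone k) (n : ℕ) (w : Fin n → Cone k) (j : Fin n) (b : Cone k),
      (Matrix.vecCons a (Function.update w j b) : Fin (n + 1) → Cone k) =
        Function.update (Matrix.vecCons a w) j.succ b := fun a n w j b => Fin.cons_update _ _ _ _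
  rw [e, e]
  rfl

/-- There is no positive closed current of bidimension `(m + 1, m + 1)` near the linear subspace
`A = 0`, as some exact form is positive there. -/
theorem exists_isOpen_not_supportsPositiveClosedCurrent (A : Cone k →L[ℂ] Cone k)
    {E E' : Cone k [⋀^Fin (2 * (m + 1) + 1 + 1)]→L[ℝ] ℂ}
    (hE : ∀ c : ℂ, c ≠ 0 → ∀ u,
      E (fun i => c • u i) = (Complex.normSq c ^ (m + 1 + 1) : ℝ) * E u)
    (hEE' : ∀ u, ∑ i, E (Function.update u i (A (u i))) = E' u) (hEi : ∀ u, (E u).im = 0)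
    (hE' : ∀ w : Fin (m + 1 + 1) → Cone k, LinearIndependent ℂ w →
      0 < (E' (complexTuple (l := m + 1 + 1) w)).re) :
    ∃ O : Set (PSpace k), IsOpen O ∧ (∀ x hx, A x = 0 → Projectivization.mk ℂ x hx ∈ O) ∧
      ∀ K S, IsClosed K → K ⊆ O → S ⊆ K → ¬ SupportsPositiveClosedCurrent S (m + 1) := by
  set β := interior A (n := 2 * m + 1) (ofConstant E hE)
  have hpos : IsStrictlyPositiveOn (l := m + 1) (d β) {p | A p.rep = 0} := by
    intro F hF hW
    have h0 := hF.ne_zero 0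
    have hA : A (F 0) = 0 := by
      obtain ⟨c, hc, h⟩ := PSpace.exists_rep_mk (F 0) h0
      have h1 : A (Projectivization.mk ℂ (F 0) h0).rep = 0 := hW h0
      rw [h, map_smul] at h1
      exact (smul_eq_zero.1 h1).resolve_left hc
    have h2 := d_interior_ofConstant_apply A hE hEE' h0 hA (complexTuple fun i : Fin (m + 1) => F i.succ)
    have h3 := complexTuple_cons (F 0) fun i => F i.succ
    have h4 : (Fin.cons (F 0) fun i => F i.succ : Fin (m + 1 + 1) → Cone k) = F :=
      Fin.cons_self_tail F
    rw [h4] at h3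
    refine lt_of_lt_of_eq ?_ (congrArg Complex.re h2).symm
    rw [Complex.re_ofReal_mul]
    refine mul_pos (inv_pos.2 (pow_pos (PSpace.normSq_pos h0) _)) ?_
    exact lt_of_lt_of_eq (hE' F hF.linearIndependent) (congrArg (fun u => (E' u).re) h3).symm
  obtain ⟨O, hO, hWO, hOpos⟩ := hpos.exists_isOpen
  refine ⟨O, hO, fun x hx hAx => hWO ?_, ?_⟩
  · obtain ⟨c, hc, h⟩ := PSpace.exists_rep_mk x hx
    change A (Projectivization.mk ℂ x hx).rep = 0
    rw [h, map_smul, hAx, smul_zero]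
  · rintro K S hK hKO hSK ⟨T, hT0, hTb, hTp, hTc, hTS⟩
    refine hT0 (Current.eq_zero_of_isStrictlyPositiveOn hTb hTp hO hK hKO (hTS.trans hSK) (d β) hOpos
      ?_ (hTc β (d β) (isExteriorDerivative_d β)))
    intro x hx v
    refine d_apply_im (fun x hx v => ?_) hx v
    rw [interior_apply A _ hx, ContinuousAlternatingMap.curryLeft_apply_apply]
    refine (congrArg Complex.im (ofConstant_apply E hE hx _)).trans ?_
    rw [Complex.im_ofReal_mul, hEi, mul_zero]

end SmoothForm

/-- There is no orthonormal frame of `l + 1` vectors in a space of dimension `k + 1 ≤ l`, so even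
the zero form is strictly positive. -/
theorem not_supportsPositiveClosedCurrent_of_lt {k l : ℕ} (h : k < l) (S : Set (PSpace k)) :
    ¬ SupportsPositiveClosedCurrent S l := by
  rintro ⟨T, hT0, hTb, hTp, -, -⟩
  refine hT0 (Current.eq_zero_of_isStrictlyPositiveOn hTb hTp isOpen_univ isClosed_univ
    (Set.subset_univ _) (Set.subset_univ _) 0 (fun F hF _ => ?_) (fun _ _ _ => rfl) (map_zero _))
  have := hF.linearIndependent.fintype_card_le_finrank
  simp at this
  omega

open SmoothForm

/-! ### Currents near a line in `ℙ^3` -/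

theorem volumeForm_smul {k : ℕ} (c : ℂ) (u : Fin (2 * (k + 1)) → Cone k) :
    volumeForm k (fun i => c • u i) = (Complex.normSq c ^ (k + 1) : ℝ) * volumeForm k u := by
  have h := volumeForm_map (c • LinearMap.id) u
  rw [LinearMap.det_smul, LinearMap.det_id, mul_one, map_pow] at h
  simpa using h

/-- The contraction depends only on the bivector of `e` and `i e`, which is multiplied by the real
determinant of multiplication by `c`. -/
theorem curryLeft_curryLeft_smul {E : Type*} [NormedAddCommGroup E] [NormedSpace ℂ E] {n : ℕ}
    (V : E [⋀^Fin (n + 1 + 1)]→L[ℝ] ℂ) (c : ℂ) (e : E) :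
    (V.curryLeft (c • e)).curryLeft (c • Complex.I • e) =
      Complex.normSq c • (V.curryLeft e).curryLeft (Complex.I • e) := by
  have h1 : c • e = c.re • e + c.im • Complex.I • e := by
    conv_lhs => rw [← Complex.re_add_im c, add_smul, mul_smul, Complex.coe_smul, Complex.coe_smul]
  have h2 : c • Complex.I • e = c.re • Complex.I • e - c.im • e := by
    conv_lhs => rw [← Complex.re_add_im c, add_smul, mul_smul, Complex.coe_smul, Complex.coe_smul,
      smul_smul Complex.I, Complex.I_mul_I, neg_one_smul, smul_neg, ← sub_eq_add_neg]
  have halt : ∀ a, (V.curryLeft a).curryLeft a = 0 := fun a => by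
    ext v
    rw [ContinuousAlternatingMap.curryLeft_apply_apply,
      ContinuousAlternatingMap.curryLeft_apply_apply]
    exact V.map_eq_zero_of_eq _ (i := 0) (j := Fin.succ 0) rfl (Fin.succ_ne_zero _).symm
  have hadd1 : ∀ a b, V.curryLeft (a + b) = V.curryLeft a + V.curryLeft b := fun a b =>
    V.curryLeft.map_add a b
  have hsmul1 : ∀ (r : ℝ) a, V.curryLeft (r • a) = r • V.curryLeft a := fun r a =>
    V.curryLeft.map_smul r a
  set W := V.curryLeft
  have hanti : ∀ a b, (W a).curryLeft b = -(W b).curryLeft a := by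
    intro a b
    have h := halt (a + b)
    rw [hadd1, ContinuousAlternatingMap.curryLeft_add, add_apply, map_add, map_add,
      halt, halt, zero_add, add_zero] at h
    exact eq_neg_of_add_eq_zero_left h
  rw [h1, h2, hadd1, hsmul1, hsmul1]
  simp only [ContinuousAlternatingMap.curryLeft_add, ContinuousAlternatingMap.curryLeft_smul,
    add_apply, smul_apply, map_sub, map_smul, halt]
  rw [hanti (Complex.I • e) e, Complex.normSq_apply]
  module

/-- The projection to the last two coordinates. -/
def lastTwo : Cone 3 →L[ℂ] Cone 3 :=
  LinearMap.toContinuousLinearMap (Matrix.toLin' (Matrix.diagonal ![0, 0, 1, 1]))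

theorem lastTwo_apply (x : Cone 3) : lastTwo x = ![0, 0, x 2, x 3] := by
  change Matrix.toLin' (Matrix.diagonal ![0, 0, 1, 1]) x = _
  funext i
  rw [Matrix.toLin'_apply, Matrix.mulVec_diagonal]
  fin_cases i <;> simp

/-- The factor is the real trace of the projection, of complex rank two. -/
theorem sum_volumeForm_update_lastTwo (u : Fin (2 * (3 + 1)) → Cone 3) :
    ∑ i, volumeForm 3 (Function.update u i (lastTwo (u i))) = 4 * volumeForm 3 u := by
  refine (sum_volumeForm_update (Matrix.toLin' (Matrix.diagonal ![0, 0, 1, 1])) 4 ?_ u).trans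
    (by norm_num)
  have h : ∀ s : ℝ, Complex.normSq (LinearMap.det (LinearMap.id + (s : ℂ) •
      Matrix.toLin' (Matrix.diagonal (![0, 0, 1, 1] : Fin 4 → ℂ)))) = (1 + s) ^ 4 := by
    intro s
    rw [← Matrix.toLin'_one, ← map_smul, ← map_add, LinearMap.det_toLin',
      ← Matrix.diagonal_one, ← Matrix.diagonal_smul, Matrix.diagonal_add, Matrix.det_diagonal,
      Fin.prod_univ_four]
    have : (1 + (s : ℂ)) = ((1 + s : ℝ) : ℂ) := by push_cast; rfl
    simp only [Pi.smul_apply, smul_eq_mul, Matrix.cons_val, mul_zero, mul_one, add_zero, one_mul, this,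
      map_mul, Complex.normSq_ofReal]
    ring
  simp only [h]
  refine (((hasDerivAt_id (0 : ℝ)).const_add 1).fun_pow 4).congr_deriv ?_
  simp

theorem exists_isOpen_not_supportsPositiveClosedCurrent_three :
    ∃ O : Set (PSpace 3), IsOpen O ∧ (∀ x hx, lastTwo x = 0 → Projectivization.mk ℂ x hx ∈ O) ∧
      ∀ K S, IsClosed K → K ⊆ O → S ⊆ K → ¬ SupportsPositiveClosedCurrent S 3 := by
  refine exists_isOpen_not_supportsPositiveClosedCurrent (m := 2) lastTwo (E := volumeForm 3)
    (E' := (4 : ℝ) • volumeForm 3) (fun c _ u => volumeForm_smul c u) (fun u => ?_) volumeForm_im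
    fun w hw => ?_
  · refine (sum_volumeForm_update_lastTwo u).trans ?_
    rw [ContinuousAlternatingMap.smul_apply, Complex.real_smul]
    norm_num
  · rw [ContinuousAlternatingMap.smul_apply, Complex.real_smul, Complex.re_ofReal_mul]
    exact mul_pos (by norm_num) (volumeForm_complexTuple_pos hw)

/-- The constant form is the sum of the contractions of the volume form with the complex coordinate
lines. Removing the line of `e j` subtracts its share `2 p j` from the trace `4`, and what remains,
`4` or `2`, is still positive. -/
theorem exists_isOpen_not_supportsPositiveClosedCurrent_two :
    ∃ O : Set (PSpace 3), IsOpen O ∧ (∀ x hx, lastTwo x = 0 → Projectivization.mk ℂ x hx ∈ O) ∧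
      ∀ K S, IsClosed K → K ⊆ O → S ⊆ K → ¬ SupportsPositiveClosedCurrent S 2 := by
  let V : Cone 3 [⋀^Fin (2 * 2 + 1 + 1 + 1 + 1)]→L[ℝ] ℂ := volumeForm 3
  let e : Fin 4 → Cone 3 := fun j => Pi.single j 1
  let p : Fin 4 → ℝ := ![0, 0, 1, 1]
  have hp : ∀ j, lastTwo (e j) = p j • e j := by
    intro j
    rw [lastTwo_apply]
    funext i
    fin_cases j <;> fin_cases i <;> simp [e, p]
  have hp1 : ∀ j, 0 < 4 - 2 * p j := by
    intro j
    fin_cases j <;> norm_num [p]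
  let D : Fin 4 → Cone 3 [⋀^Fin (2 * 2 + 1 + 1)]→L[ℝ] ℂ :=
    fun j => (V.curryLeft (e j)).curryLeft (Complex.I • e j)
  have hD : ∀ j u, D j u = V (Matrix.vecCons (e j) (Matrix.vecCons (Complex.I • e j) u)) :=
    fun _ _ => rfl
  have hcT : ∀ j (w : Fin 3 → Cone 3),
      D j (complexTuple w) = volumeForm 3 (complexTuple (Fin.cons (e j) w)) := fun j w =>
    (hD j _).trans (congrArg V (complexTuple_cons (e j) w))
  refine exists_isOpen_not_supportsPositiveClosedCurrent (m := 1) lastTwo (E := ∑ j, D j)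
    (E' := ∑ j, (4 - 2 * p j) • D j) (fun c hc u => ?_) (fun u => ?_) (fun u => ?_) fun w hw => ?_
  · rw [ContinuousAlternatingMap.sum_apply, ContinuousAlternatingMap.sum_apply, Finset.mul_sum]
    refine Finset.sum_congr rfl fun j _ => ?_
    -- The contracted vectors are divided by `c` beforehand, so that scaling all arguments of the
    -- volume form leaves them fixed; this lowers the exponent from four to three.
    have h1 := volumeForm_smul c (k := 3)
      (Matrix.vecCons (c⁻¹ • e j) (Matrix.vecCons (c⁻¹ • Complex.I • e j) u))
    have h2 : (fun i => c • (Matrix.vecCons (c⁻¹ • e j)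
        (Matrix.vecCons (c⁻¹ • Complex.I • e j) u) : Fin (2 * 2 + 1 + 1 + 1 + 1) → Cone 3) i) =
        Matrix.vecCons (e j) (Matrix.vecCons (Complex.I • e j) fun i => c • u i) := by
      funext i
      refine Fin.cases ?_ (fun i => ?_) i
      · simp [smul_smul, hc]
      refine Fin.cases ?_ (fun i => ?_) i
      · simp [smul_smul, mul_inv_cancel_left₀ hc]
      · simp
    have h3 := DFunLike.congr_fun (curryLeft_curryLeft_smul V c⁻¹ (e j)) u
    rw [hD]
    refine (congrArg V h2).symm.trans (h1.trans ?_)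
    refine (congrArg (((Complex.normSq c ^ (3 + 1) : ℝ) : ℂ) * ·) h3).trans ?_
    rw [ContinuousAlternatingMap.smul_apply, Complex.real_smul, ← mul_assoc, ← Complex.ofReal_mul]
    congr 2
    have : Complex.normSq c ≠ 0 := by simpa using hc
    rw [map_inv₀]
    field_simp
    ring
  · simp only [ContinuousAlternatingMap.sum_apply]
    rw [Finset.sum_comm]
    refine Finset.sum_congr rfl fun j _ => ?_
    have h1 := sum_volumeForm_update_lastTwo
      (Matrix.vecCons (e j) (Matrix.vecCons (Complex.I • e j) u))
    set u' : Fin (2 * 2 + 1 + 1 + 1 + 1) → Cone 3 :=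
      Matrix.vecCons (e j) (Matrix.vecCons (Complex.I • e j) u) with hu'
    have h2 : ∑ i : Fin (2 * 2 + 1 + 1 + 1 + 1), V (Function.update u' i (lastTwo (u' i))) =
      4 * V u' := h1
    rw [Fin.sum_univ_succ, Fin.sum_univ_succ] at h2
    have h3 : V (Function.update u' 0 (lastTwo (u' 0))) = p j * V u' := by
      have : lastTwo (u' 0) = p j • u' 0 := hp j
      rw [this, V.map_update_smul, Function.update_eq_self, Complex.real_smul]
    have h4 : V (Function.update u' (Fin.succ 0) (lastTwo (u' (Fin.succ 0)))) = p j * V u' := by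
      have : lastTwo (u' (Fin.succ 0)) = p j • u' (Fin.succ 0) := by
        change lastTwo (Complex.I • e j) = p j • Complex.I • e j
        rw [map_smul, hp, smul_comm]
      rw [this, V.map_update_smul, Function.update_eq_self, Complex.real_smul]
    rw [h3, h4] at h2
    have h5 : ∀ i : Fin (2 * 2 + 1 + 1), D j (Function.update u i (lastTwo (u i))) =
        V (Function.update u' i.succ.succ (lastTwo (u' i.succ.succ))) := by
      intro i
      rw [hD]
      have e : ∀ (a : Cone 3) (n : ℕ) (w : Fin n → Cone 3) (j : Fin n) (b : Cone 3),
          (Matrix.vecCons a (Function.update w j b) : Fin (n + 1) → Cone 3) =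
            Function.update (Matrix.vecCons a w) j.succ b := fun a n w j b => Fin.cons_update _ _ _ _
      rw [e, e]
      rfl
    rw [ContinuousAlternatingMap.smul_apply, Complex.real_smul, hD, ← hu']
    refine (Finset.sum_congr rfl fun i _ => h5 i).trans ?_
    push_cast
    linear_combination h2
  · rw [ContinuousAlternatingMap.sum_apply, Complex.im_sum]
    exact Finset.sum_eq_zero fun j _ => volumeForm_im _
  -- Three vectors do not span `ℂ⁴`, so some coordinate vector completes them to a basis; its term
  -- is positive and the others are nonnegative.
  · have h1 : ∃ j, e j ∉ Submodule.span ℂ (Set.range w) := by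
      by_contra! h
      have h2 : (⊤ : Submodule ℂ (Cone 3)) ≤ Submodule.span ℂ (Set.range w) := by
        rw [← (Pi.basisFun ℂ (Fin (3 + 1))).span_eq, Submodule.span_le]
        rintro _ ⟨j, rfl⟩
        rw [Pi.basisFun_apply]
        exact h j
      have h3 := finrank_range_le_card (R := ℂ) w
      rw [Set.finrank, top_le_iff.1 h2] at h3
      simp at h3
    obtain ⟨j, hj⟩ := h1
    rw [ContinuousAlternatingMap.sum_apply, Complex.re_sum]
    have h2 : ∀ j, (((4 - 2 * p j) • D j) (complexTuple w)).re =
        (4 - 2 * p j) * (volumeForm 3 (complexTuple (Fin.cons (e j) w))).re := by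
      intro j
      rw [ContinuousAlternatingMap.smul_apply, Complex.real_smul, Complex.re_ofReal_mul, hcT]
    refine Finset.sum_pos' (fun j _ => ?_) ⟨j, Finset.mem_univ _, ?_⟩
    · exact (h2 j).symm ▸ mul_nonneg (hp1 j).le (volumeForm_complexTuple_nonneg _)
    · exact (h2 j).symm ▸ mul_pos (hp1 j) (volumeForm_complexTuple_pos
        (linearIndependent_finCons.2 ⟨hw, hj⟩))

/-- Near the line `t = u = 0` there are no positive closed currents of bidimension larger than
`(1, 1)`. -/
theorem exists_isOpen_forall_not_supportsPositiveClosedCurrent :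
    ∃ O : Set (PSpace 3), IsOpen O ∧
      (∀ x hx, x 2 = 0 → x 3 = 0 → Projectivization.mk ℂ x hx ∈ O) ∧
      ∀ K S, IsClosed K → K ⊆ O → S ⊆ K → ∀ l, 1 < l → ¬ SupportsPositiveClosedCurrent S l := by
  obtain ⟨O, hO, hL, h⟩ := exists_isOpen_not_supportsPositiveClosedCurrent_two
  obtain ⟨O', hO', hL', h'⟩ := exists_isOpen_not_supportsPositiveClosedCurrent_three
  have h0 : ∀ x : Cone 3, x 2 = 0 → x 3 = 0 → lastTwo x = 0 := by
    intro x h2 h3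
    rw [lastTwo_apply, h2, h3]
    funext i
    fin_cases i <;> rfl
  refine ⟨O ∩ O', hO.inter hO', fun x hx h2 h3 => ⟨hL x hx (h0 x h2 h3), hL' x hx (h0 x h2 h3)⟩, ?_⟩
  intro K S hK hKO hSK l hl
  rcases lt_or_ge 3 l with h3 | h3
  · exact not_supportsPositiveClosedCurrent_of_lt h3 S
  · interval_cases l
    · exact h K S hK (hKO.trans Set.inter_subset_left) hSK
    · exact h' K S hK (hKO.trans Set.inter_subset_right) hSK

/-! ### Integration of forms over the projective line -/

section Integration

open SmoothForm MeasureTheory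

variable {k n : ℕ}

/-- The density of a `2`-form along the affine line `ζ ↦ a + ζ e`. -/
def affineDensity (a e : Cone k) (α : SmoothForm k (2 * 1)) (ζ : ℂ) : ℂ :=
  α.1 (a + ζ • e) (complexTuple fun _ : Fin 1 => e)

theorem contDiff_comp_affine {a e : Cone k} (hae : ∀ ζ : ℂ, a + ζ • e ≠ 0) (α : SmoothForm k n)
    (v : Fin n → Cone k) : ContDiff ℝ ∞ fun ζ : ℂ => α.1 (a + ζ • e) v := by
  have h1 : ContDiff ℝ ∞ fun ζ : ℂ => a + ζ • e := by fun_prop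
  have h2 : ContDiffOn ℝ ∞ (fun x => α.1 x v) {0}ᶜ :=
    contDiffOn_alternating_apply (contDiffOn α) fun i => contDiffOn_const
  rw [← contDiffOn_univ]
  exact h2.comp h1.contDiffOn fun ζ _ => hae ζ

theorem continuous_affineDensity {a e : Cone k} (hae : ∀ ζ : ℂ, a + ζ • e ≠ 0)
    (α : SmoothForm k (2 * 1)) : Continuous (affineDensity a e α) :=
  (contDiff_comp_affine hae α _).continuous

/-- Stokes' theorem for forms with compact support on an affine line. -/
theorem integral_affineDensity_d {a e : Cone k} (hae : ∀ ζ : ℂ, a + ζ • e ≠ 0)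
    {β : SmoothForm k 1} {γ : SmoothForm k (2 * 1)} (hγ : IsExteriorDerivative (n := 1) γ β) {r : ℝ}
    (hr : ∀ ζ : ℂ, r < ‖ζ‖ → β.1 (a + ζ • e) = 0) : ∫ ζ, affineDensity a e γ ζ = 0 := by
  have hp : ∀ (v : Fin 1 → Cone k) (c : ℂ),
      Integrable (fun ζ : ℂ => fderiv ℝ (fun ζ : ℂ => β.1 (a + ζ • e) v) ζ c) ∧
      ∫ ζ : ℂ, fderiv ℝ (fun ζ : ℂ => β.1 (a + ζ • e) v) ζ c = 0 := by
    intro v c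
    set p := fun ζ : ℂ => β.1 (a + ζ • e) v with hpdef
    have hp1 : ContDiff ℝ ∞ p := contDiff_comp_affine hae β v
    have hpc : HasCompactSupport p := by
      refine HasCompactSupport.intro (isCompact_closedBall 0 r) fun ζ hζ => ?_
      rw [Metric.mem_closedBall, dist_zero_right, not_le] at hζ
      simp only [hpdef, hr ζ hζ]
      rfl
    have hi : Integrable (fun ζ : ℂ => fderiv ℝ p ζ c) := by
      refine Continuous.integrable_of_hasCompactSupport ?_ (hpc.fderiv_apply ℝ c)
      exact (hp1.continuous_fderiv (by simp)).clm_apply continuous_const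
    refine ⟨hi, ?_⟩
    -- Integration by parts against the constant function one.
    have := integral_mul_fderiv_eq_neg_fderiv_mul_of_integrable (𝕜 := ℂ) (μ := volume)
      (f := fun _ : ℂ => (1 : ℂ)) (g := p) (v := c)
      (by simp) (by simpa using hi)
      (by simpa using hp1.continuous.integrable_of_hasCompactSupport hpc) (by fun_prop)
      (fun _ _ => hp1.differentiable (by simp) _)
    simpa using this
  -- In the real coordinates of `ζ` this is the usual curl of the restriction of `β` to the affine
  -- line.
  have hd : ∀ ζ : ℂ, affineDensity a e γ ζ =
      fderiv ℝ (fun ζ : ℂ => β.1 (a + ζ • e) fun _ => Complex.I • e) ζ 1 -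
      fderiv ℝ (fun ζ : ℂ => β.1 (a + ζ • e) fun _ => e) ζ Complex.I := by
    intro ζ
    have hf : ∀ (v : Fin 1 → Cone k) (c : ℂ),
        fderiv ℝ (fun ζ : ℂ => β.1 (a + ζ • e) v) ζ c =
          fderiv ℝ (fun x => β.1 x v) (a + ζ • e) (c • e) := by
      intro v c
      have h1 : HasFDerivAt (fun ζ : ℂ => a + ζ • e)
          ((ContinuousLinearMap.toSpanSingleton ℂ e).restrictScalars ℝ) ζ :=
        ((ContinuousLinearMap.toSpanSingleton ℂ e).restrictScalars ℝ).hasFDerivAt.const_add a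
      have h2 : DifferentiableAt ℝ (fun x => β.1 x v) (a + ζ • e) :=
        (differentiableAt β (hae ζ)).continuousAlternatingMap_apply fun _ =>
          differentiableAt_const _
      have h3 := h2.hasFDerivAt.comp ζ h1
      have h4 := DFunLike.congr_fun h3.fderiv c
      exact h4
    rw [affineDensity, hγ _ (hae ζ), hf, hf]
    have h5 := extDeriv_apply (differentiableAt β (hae ζ)) (complexTuple fun _ : Fin 1 => e)
    refine h5.trans ?_
    rw [Fin.sum_univ_two]
    have e0 : (complexTuple fun _ : Fin 1 => e) (0 : Fin 2) = (1 : ℂ) • e := by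
      change Complex.I ^ 0 • e = _
      rw [pow_zero]
    have e1 : (complexTuple fun _ : Fin 1 => e) (1 : Fin 2) = Complex.I • e := by
      change Complex.I ^ 1 • e = _
      rw [pow_one]
    have r0 : Fin.removeNth (0 : Fin 2) (complexTuple fun _ : Fin 1 => e) = fun _ => Complex.I • e := by
      funext j
      rw [Subsingleton.elim j 0]
      exact e1
    have r1 : Fin.removeNth (1 : Fin 2) (complexTuple fun _ : Fin 1 => e) = fun _ => e := by
      funext j
      rw [Subsingleton.elim j 0]
      exact e0.trans (one_smul _ _)
    rw [e0, e1, r0, r1]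
    simp [sub_eq_add_neg]
  simp only [hd]
  rw [integral_sub (hp _ _).1 (hp _ _).1, (hp _ _).2, (hp _ _).2, sub_zero]

/-- The point `a + ζ e` is `ζ x` with `x = e + ζ⁻¹ a`. Invariance replaces the direction `e` by `ζ⁻¹
e`, which is congruent modulo `x` to `−ζ⁻² a`; the factor is the squared modulus of `ζ⁻²`. -/
theorem affineDensity_inv {a e : Cone k}
    (hea : ∀ ζ : ℂ, e + ζ • a ≠ 0) (α : SmoothForm k (2 * 1)) {ζ : ℂ} (hζ : ζ ≠ 0) :
    affineDensity a e α ζ = ((Complex.normSq ζ ^ 2)⁻¹ : ℝ) * affineDensity e a α ζ⁻¹ := by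
  set x := e + ζ⁻¹ • a with hx
  have h1 : a + ζ • e = ζ • x := by rw [hx, smul_add, smul_smul, mul_inv_cancel₀ hζ, one_smul, add_comm]
  have h2 : complexTuple (fun _ : Fin 1 => e) =
      fun i => ζ • complexTuple (fun _ : Fin 1 => ζ⁻¹ • e) i := by
    funext i
    simp only [complexTuple]
    rw [smul_comm ζ, smul_smul ζ, mul_inv_cancel₀ hζ, one_smul]
  have h3 := map_complexTuple_of_sub_mem_span (l := 1) (α.1 x) (x := x)
    (fun u m c h => apply_eq_zero α (hea _) m c h) (fun _ => ζ⁻¹ • e) (fun _ => (-(ζ⁻¹ ^ 2)) • a)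
    (fun i => by
      have : (-(ζ⁻¹ ^ 2)) • a - ζ⁻¹ • e = (-ζ⁻¹) • x := by
        rw [hx]
        module
      rw [this]
      exact Submodule.smul_mem _ _ (Submodule.subset_span (Set.mem_insert _ _)))
  have h4 := map_complexTuple_smul (l := 1) (α.1 x) (fun _ => a) (fun _ => -(ζ⁻¹ ^ 2))
  rw [affineDensity, h1, h2, apply_smul α hζ (hea _), ← h3, h4, affineDensity]
  simp [hx]

/-- The density is bounded on the unit disc of each chart, and the change of chart turns the second
bound into decay of order `‖ζ‖⁻⁴`. The constant `4` absorbs `(1 + ‖ζ‖²)²` in both cases. -/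
theorem exists_bound_affineDensity {a e : Cone k} (hae : ∀ ζ : ℂ, a + ζ • e ≠ 0)
    (hea : ∀ ζ : ℂ, e + ζ • a ≠ 0) (α : SmoothForm k (2 * 1)) :
    ∃ C : ℝ, ∀ ζ, ‖affineDensity a e α ζ‖ ≤ C * ((1 : ℝ) + ‖ζ‖ ^ 2) ^ (-(4 : ℝ) / 2) := by
  obtain ⟨C, hC⟩ := (isCompact_closedBall (0 : ℂ) 1).exists_bound_of_continuousOn
    (continuous_affineDensity hae α).continuousOn
  obtain ⟨C', hC'⟩ := (isCompact_closedBall (0 : ℂ) 1).exists_bound_of_continuousOn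
    (continuous_affineDensity hea α).continuousOn
  have hC0 : 0 ≤ max C C' := ((norm_nonneg _).trans (hC 0 (by simp))).trans (le_max_left _ _)
  refine ⟨4 * max C C', fun ζ => ?_⟩
  have hpow : ((1 : ℝ) + ‖ζ‖ ^ 2) ^ (-(4 : ℝ) / 2) = ((1 + ‖ζ‖ ^ 2) ^ 2)⁻¹ := by
    rw [show (-(4 : ℝ) / 2) = -((2 : ℕ) : ℝ) by norm_num, Real.rpow_neg (by positivity),
      Real.rpow_natCast]
  rw [hpow, ← div_eq_mul_inv, le_div_iff₀ (by positivity)]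
  rcases le_or_gt ‖ζ‖ 1 with h | h
  · have h1 := (hC ζ (by simpa using h)).trans (le_max_left C C')
    have h2 : (1 + ‖ζ‖ ^ 2) ^ 2 ≤ 4 := by
      have := pow_le_one₀ (n := 2) (norm_nonneg ζ) h
      nlinarith [sq_nonneg ‖ζ‖]
    nlinarith [norm_nonneg (affineDensity a e α ζ)]
  · have hζ : ζ ≠ 0 := norm_pos_iff.1 (by linarith)
    have h1 := (hC' ζ⁻¹ (by simpa using inv_le_one_of_one_le₀ h.le)).trans (le_max_right C C')
    rw [affineDensity_inv hea α hζ, norm_mul, Complex.norm_real, Complex.normSq_eq_norm_sq,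
      norm_inv, Real.norm_of_nonneg (by positivity), inv_mul_eq_div, div_mul_eq_mul_div,
      div_le_iff₀ (by positivity)]
    have h2 : (1 + ‖ζ‖ ^ 2) ^ 2 ≤ 4 * (‖ζ‖ ^ 2) ^ 2 := by
      have := one_le_pow₀ (n := 2) h.le
      nlinarith
    calc _ ≤ max C C' * (4 * (‖ζ‖ ^ 2) ^ 2) := mul_le_mul h1 h2 (by positivity) hC0
      _ = _ := by ring

theorem integrable_affineDensity {a e : Cone k} (hae : ∀ ζ : ℂ, a + ζ • e ≠ 0)
    (hea : ∀ ζ : ℂ, e + ζ • a ≠ 0) (α : SmoothForm k (2 * 1)) :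
    Integrable (affineDensity a e α) := by
  obtain ⟨C, hC⟩ := exists_bound_affineDensity hae hea α
  refine Integrable.mono' ((integrable_rpow_neg_one_add_norm_sq (E := ℂ) (r := 4) ?_).const_mul C)
    (continuous_affineDensity hae α).aestronglyMeasurable (Filter.Eventually.of_forall hC)
  rw [Complex.finrank_real_complex]
  norm_num

/-- The Jacobian of inversion is exactly the factor by which the densities in the two charts differ.
-/
theorem integral_affineDensity_comm {a e : Cone k}
    (hea : ∀ ζ : ℂ, e + ζ • a ≠ 0) (α : SmoothForm k (2 * 1)) :
    ∫ ζ, affineDensity a e α ζ = ∫ ζ, affineDensity e a α ζ := by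
  have hinv : (fun z : ℂ => z⁻¹) '' {0}ᶜ = {0}ᶜ := by
    ext z
    refine ⟨?_, fun hz => ⟨z⁻¹, inv_ne_zero hz, inv_inv z⟩⟩
    rintro ⟨w, hw, rfl⟩
    exact inv_ne_zero hw
  have h := integral_image_eq_integral_abs_det_fderiv_smul (μ := (volume : Measure ℂ))
    (s := {0}ᶜ) (f := fun z : ℂ => z⁻¹)
    (f' := fun z => (ContinuousLinearMap.toSpanSingleton ℂ (-(z ^ 2)⁻¹)).restrictScalars ℝ)
    (measurableSet_singleton 0).compl
    (fun z hz => ((hasDerivAt_inv hz).hasFDerivAt.restrictScalars ℝ).hasFDerivWithinAt)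
    (inv_injective.injOn) (affineDensity e a α)
  rw [hinv] at h
  have hae0 : ({0}ᶜ : Set ℂ) =ᵐ[volume] Set.univ := by
    rw [ae_eq_univ, compl_compl]
    exact measure_singleton 0
  rw [← setIntegral_univ, ← setIntegral_univ (f := affineDensity e a α), ← setIntegral_congr_set hae0,
    ← setIntegral_congr_set hae0, h]
  refine setIntegral_congr_fun (measurableSet_singleton 0).compl fun z hz => ?_
  have hdet : ((ContinuousLinearMap.toSpanSingleton ℂ (-(z ^ 2)⁻¹)).restrictScalars ℝ).det =
      (Complex.normSq z ^ 2)⁻¹ := by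
    have h1 := LinearMap.det_restrictScalars (R := ℝ) (S := ℂ)
      (f := (ContinuousLinearMap.toSpanSingleton ℂ (-(z ^ 2)⁻¹) : ℂ →ₗ[ℂ] ℂ))
    rw [Algebra.norm_complex_eq] at h1
    refine Eq.trans (by rfl) (h1.trans ?_)
    have h2 : LinearMap.det (ContinuousLinearMap.toSpanSingleton ℂ (-(z ^ 2)⁻¹) : ℂ →ₗ[ℂ] ℂ) =
        -(z ^ 2)⁻¹ := by
      rw [LinearMap.det_ring]
      simp
    rw [h2]
    simp
  simp only [hdet]
  rw [affineDensity_inv hea α hz, abs_of_nonneg (by positivity), Complex.real_smul]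

end Integration

open SmoothForm

/-! ### Pull-back of forms -/

/-- Holomorphic maps between cones which are homogeneous of degree `D` and induce maps between
projective spaces. -/
structure IsConeMap {m k : ℕ} (G : Cone m → Cone k) (D : ℕ) : Prop where
  contDiff : ContDiff ℂ ∞ G
  smul : ∀ (c : ℂ) x, G (c • x) = c ^ D • G x
  ne_zero : ∀ x, x ≠ 0 → G x ≠ 0

namespace IsConeMap

variable {m k n D : ℕ} {G : Cone m → Cone k}

theorem hasFDerivAt (hG : IsConeMap G D) (x : Cone m) : HasFDerivAt G (fderiv ℂ G x) x :=
  (hG.contDiff.differentiable (by simp) x).hasFDerivAt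

theorem fderiv_real (hG : IsConeMap G D) (x : Cone m) :
    fderiv ℝ G x = (fderiv ℂ G x).restrictScalars ℝ :=
  ((hG.hasFDerivAt x).restrictScalars ℝ).fderiv

/-- Euler's identity; it makes pull-backs vanish on vertical vectors. -/
theorem fderiv_apply_self (hG : IsConeMap G D) (x : Cone m) : fderiv ℂ G x x = (D : ℂ) • G x := by
  have h1 : HasDerivAt (fun s : ℂ => s • x) ((1 : ℂ) • x) 1 := (hasDerivAt_id (1 : ℂ)).smul_const x
  have h2 : HasDerivAt (fun s : ℂ => G (s • x)) (fderiv ℂ G x x) 1 := by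
    have h3 : HasFDerivAt G (fderiv ℂ G x) ((1 : ℂ) • x) := by
      rw [one_smul]
      exact hG.hasFDerivAt x
    have h4 := h3.comp_hasDerivAt (1 : ℂ) h1
    rw [one_smul] at h4
    exact h4
  simp only [hG.smul] at h2
  have h4 := (hasDerivAt_pow D (1 : ℂ)).smul_const (G x)
  rw [h2.unique h4, one_pow, mul_one]

theorem fderiv_smul_apply_smul (hG : IsConeMap G D) {c : ℂ} (x v : Cone m) :
    fderiv ℂ G (c • x) (c • v) = c ^ D • fderiv ℂ G x v := by
  have h1 : HasFDerivAt (fun y : Cone m => c • y) (c • ContinuousLinearMap.id ℂ (Cone m)) x :=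
    (hasFDerivAt_id x).const_smul c
  have h2 := (hG.hasFDerivAt (c • x)).comp x h1
  have h3 : G ∘ (fun y : Cone m => c • y) = fun y => c ^ D • G y := funext (hG.smul c)
  rw [h3] at h2
  have h4 := DFunLike.congr_fun (h2.unique ((hG.hasFDerivAt x).const_smul (c ^ D))) v
  simpa using h4

/-- The pull-back of a form. -/
def pullback (hG : IsConeMap G D) (α : SmoothForm k n) : SmoothForm m n :=
  ofCone (fun x => (α.1 (G x)).compContinuousLinearMap ((fderiv ℂ G x).restrictScalars ℝ))
    (by
      refine contDiffOn_alternating_of_apply fun v => ?_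
      have h1 : ContDiffOn ℝ ∞ (fun x => α.1 (G x)) {0}ᶜ :=
        (contDiffOn α).comp (hG.contDiff.restrict_scalars ℝ).contDiffOn fun x hx => hG.ne_zero x hx
      refine contDiffOn_alternating_apply h1 (g := fun i x => fderiv ℂ G x (v i)) fun i => ?_
      have h2 : ContDiff ℂ ∞ fun x => fderiv ℂ G x (v i) :=
        (hG.contDiff.fderiv_right (m := ∞) (by simp)).clm_apply contDiff_const
      exact (h2.restrict_scalars ℝ).contDiffOn)
    (by
      intro c hc x hx v
      have h := apply_smul α (pow_ne_zero D hc) (hG.ne_zero x hx) fun i => fderiv ℂ G x (v i)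
      simp only [← hG.fderiv_smul_apply_smul, ← hG.smul] at h
      exact h)
    (by
      rintro x hx v ⟨i, c, h⟩
      refine apply_eq_zero α (hG.ne_zero x hx) i (c * D) ?_
      change fderiv ℂ G x (v i) = _
      rw [h, map_smul, hG.fderiv_apply_self, smul_smul])

theorem pullback_apply (hG : IsConeMap G D) (α : SmoothForm k n) {x : Cone m} (hx : x ≠ 0)
    (v : Fin n → Cone m) :
    (hG.pullback α).1 x v = α.1 (G x) fun i => fderiv ℂ G x (v i) :=
  DFunLike.congr_fun (ofCone_apply hx) v

theorem pullback_apply_complexTuple {l : ℕ} (hG : IsConeMap G D) (α : SmoothForm k (2 * l))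
    {x : Cone m} (hx : x ≠ 0) (v : Fin l → Cone m) :
    (hG.pullback α).1 x (complexTuple v) = α.1 (G x) (complexTuple fun i => fderiv ℂ G x (v i)) := by
  rw [pullback_apply hG α hx]
  congr 1
  funext j
  simp only [complexTuple, map_smul]

theorem pullback_add (hG : IsConeMap G D) (α β : SmoothForm k n) :
    hG.pullback (α + β) = hG.pullback α + hG.pullback β := by
  refine ext_apply fun x hx v => ?_
  refine (pullback_apply hG _ hx v).trans ?_
  exact (congrArg₂ (· + ·) (pullback_apply hG α hx v) (pullback_apply hG β hx v)).symm

theorem pullback_smul (hG : IsConeMap G D) (c : ℂ) (α : SmoothForm k n) :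
    hG.pullback (c • α) = c • hG.pullback α := by
  refine ext_apply fun x hx v => ?_
  refine (pullback_apply hG _ hx v).trans ?_
  exact (congrArg (c * ·) (pullback_apply hG α hx v)).symm

theorem isExteriorDerivative_pullback (hG : IsConeMap G D) {β : SmoothForm k n}
    {γ : SmoothForm k (n + 1)} (h : IsExteriorDerivative γ β) :
    IsExteriorDerivative (hG.pullback γ) (hG.pullback β) := by
  intro x hx
  have h1 := extDeriv_pullback (r := 2) (f := G) (x := x) (differentiableAt β (hG.ne_zero x hx))
    ((hG.contDiff.restrict_scalars ℝ).contDiffAt.of_le (WithTop.coe_le_coe.2 (le_top : (2 : ℕ∞) ≤ ⊤))) (by simp)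
  have h2 : (hG.pullback β).1 =ᶠ[𝓝 x]
      fun y => (β.1 (G y)).compContinuousLinearMap (fderiv ℝ G y) := by
    filter_upwards [isOpen_compl_singleton.mem_nhds hx] with y hy
    rw [hG.fderiv_real]
    exact ofCone_apply hy
  rw [h2.extDeriv_eq, h1, ← h _ (hG.ne_zero x hx), hG.fderiv_real]
  exact ofCone_apply hx

end IsConeMap

/-! ### A strictly positive form of bidegree `(1, 1)` -/

section FubiniStudy

variable {k : ℕ}

/-- The minor of `x` and `v` with rows `i` and `j`. -/
def minorMap (x : Cone k) (i j : Fin (k + 1)) : Cone k →L[ℂ] Cone 0 :=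
  ContinuousLinearMap.pi fun _ =>
    x i • ContinuousLinearMap.proj j - x j • ContinuousLinearMap.proj i

theorem minorMap_apply (x : Cone k) (i j : Fin (k + 1)) (v : Cone k) :
    minorMap x i j v = fun _ => x i * v j - x j * v i := rfl

/-- The Fubini–Study form, up to a constant. -/
def fubiniStudy (k : ℕ) : SmoothForm k (2 * 1) :=
  ofCone (fun x => (PSpace.normSq x ^ 2)⁻¹ • ∑ i, ∑ j,
      (volumeForm 0).compContinuousLinearMap ((minorMap x i j).restrictScalars ℝ))
    (by
      refine ContDiffOn.smul ((PSpace.contDiff_normSq.contDiffOn.pow _).inv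
        fun x hx => (pow_pos (PSpace.normSq_pos hx) _).ne') ?_
      refine ContDiffOn.sum fun i _ => ContDiffOn.sum fun j _ => ?_
      refine contDiffOn_alternating_of_apply fun v => ?_
      refine contDiffOn_alternating_apply (contDiffOn_const (c := volumeForm 0))
        (g := fun a x => minorMap x i j (v a)) fun a => ContDiff.contDiffOn ?_
      simp only [minorMap_apply]
      fun_prop)
    (by
      intro c hc x hx v
      simp only [ContinuousAlternatingMap.smul_apply, ContinuousAlternatingMap.sum_apply,
        PSpace.normSq_smul]
      have h1 : ∀ i j, (volumeForm 0).compContinuousLinearMap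
          ((minorMap (c • x) i j).restrictScalars ℝ) (fun a => c • v a) =
          (Complex.normSq c ^ 2 : ℝ) *
            (volumeForm 0).compContinuousLinearMap ((minorMap x i j).restrictScalars ℝ) v := by
        intro i j
        have h2 := volumeForm_smul (k := 0) (c ^ 2) fun a => minorMap x i j (v a)
        have h3 : ∀ a, c ^ 2 • minorMap x i j (v a) = minorMap (c • x) i j (c • v a) := by
          intro a
          funext b
          simp only [minorMap_apply, Pi.smul_apply, smul_eq_mul]
          ring
        simp only [h3] at h2
        have h5 : Complex.normSq (c ^ 2) ^ (0 + 1) = Complex.normSq c ^ 2 := by simp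
        rw [h5] at h2
        exact h2
      simp only [h1, ← Finset.mul_sum]
      have h4 : Complex.normSq c ≠ 0 := by simpa using hc
      rw [mul_pow, mul_inv, ← Complex.real_smul, smul_smul]
      congr 1
      field_simp)
    (by
      rintro x hx v ⟨a, c, h⟩
      simp only [ContinuousAlternatingMap.smul_apply, ContinuousAlternatingMap.sum_apply]
      rw [Finset.sum_eq_zero fun i _ => Finset.sum_eq_zero fun j _ => ?_, smul_zero]
      refine (volumeForm 0).map_coord_zero a ?_
      change minorMap x i j (v a) = 0
      rw [h]
      funext b
      simp only [minorMap_apply, Pi.smul_apply, smul_eq_mul, Pi.zero_apply]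
      ring)

theorem fubiniStudy_apply {x : Cone k} (hx : x ≠ 0) (v : Fin 1 → Cone k) :
    (fubiniStudy k).1 x (complexTuple v) = ((PSpace.normSq x ^ 2)⁻¹ : ℝ) *
      ∑ i, ∑ j, volumeForm 0 (complexTuple fun a => minorMap x i j (v a)) := by
  refine (DFunLike.congr_fun (ofCone_apply hx) _).trans ?_
  simp only [ContinuousAlternatingMap.smul_apply, ContinuousAlternatingMap.sum_apply,
    Complex.real_smul]
  refine congrArg _ (Finset.sum_congr rfl fun i _ => Finset.sum_congr rfl fun j _ => ?_)
  refine congrArg (volumeForm 0) (funext fun a => ?_)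
  simp [complexTuple]

theorem fubiniStudy_im {x : Cone k} (hx : x ≠ 0) (v : Fin 1 → Cone k) :
    ((fubiniStudy k).1 x (complexTuple v)).im = 0 := by
  rw [fubiniStudy_apply hx, Complex.im_ofReal_mul, Complex.im_sum, Finset.sum_eq_zero, mul_zero]
  intro i _
  rw [Complex.im_sum]
  exact Finset.sum_eq_zero fun j _ => volumeForm_im _

theorem fubiniStudy_re_nonneg {x : Cone k} (hx : x ≠ 0) (v : Fin 1 → Cone k) :
    0 ≤ ((fubiniStudy k).1 x (complexTuple v)).re := by
  rw [fubiniStudy_apply hx, Complex.re_ofReal_mul, Complex.re_sum]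
  refine mul_nonneg (by positivity) (Finset.sum_nonneg fun i _ => ?_)
  rw [Complex.re_sum]
  exact Finset.sum_nonneg fun j _ => volumeForm_complexTuple_nonneg (k := 0) _

/-- The value is the sum of the squared moduli of the two-by-two minors of `x` and `v 0`, up to a
positive factor, and these all vanish only for proportional vectors. -/
theorem exists_eq_smul_of_fubiniStudy_le {x : Cone k} (hx : x ≠ 0) (v : Fin 1 → Cone k)
    (h : ((fubiniStudy k).1 x (complexTuple v)).re ≤ 0) : ∃ c : ℂ, v 0 = c • x := by
  by_contra hne
  have h1 : ∃ i j, minorMap x i j (v 0) ≠ 0 := by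
    by_contra! h0
    obtain ⟨i, hi⟩ := Function.ne_iff.1 hx
    refine hne ⟨v 0 i / x i, funext fun j => ?_⟩
    have := congrFun (h0 i j) 0
    simp only [minorMap_apply, Pi.zero_apply] at this hi
    rw [Pi.smul_apply, smul_eq_mul, div_mul_eq_mul_div, eq_div_iff hi]
    linear_combination this
  obtain ⟨i, j, hij⟩ := h1
  refine absurd h (not_le.2 ?_)
  rw [fubiniStudy_apply hx, Complex.re_ofReal_mul, Complex.re_sum]
  refine mul_pos (inv_pos.2 (pow_pos (PSpace.normSq_pos hx) _)) ?_
  simp only [Complex.re_sum]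
  refine Finset.sum_pos' (fun i _ => Finset.sum_nonneg fun j _ =>
    volumeForm_complexTuple_nonneg (k := 0) _) ⟨i, Finset.mem_univ _, ?_⟩
  refine Finset.sum_pos' (fun j _ => volumeForm_complexTuple_nonneg (k := 0) _)
    ⟨j, Finset.mem_univ _, volumeForm_complexTuple_pos (k := 0) ?_⟩
  exact LinearIndependent.of_subsingleton (ι := Fin 1) 0 hij

theorem isStrictlyPositiveOn_fubiniStudy :
    IsStrictlyPositiveOn (fubiniStudy k) (Set.univ : Set (PSpace k)) := by
  intro F hF _
  by_contra hneg
  obtain ⟨c, hc⟩ := exists_eq_smul_of_fubiniStudy_le (hF.ne_zero 0) _ (not_lt.1 hneg)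
  have h1 := hF.2 (i := 1) (j := 0) (by simp)
  have h2 : (Fin.succ 0 : Fin 2) = 1 := rfl
  rw [h2] at hc
  simp only [hc, WithLp.toLp_smul, inner_smul_left, inner_self_eq_norm_sq_to_K, hF.1] at h1
  have h3 : c = 0 := by simpa using h1
  rw [h3, zero_smul] at hc
  exact hF.ne_zero 1 hc

/-- By compactness of frames, with one constant for all forms. This controls integrals over curves
by their Fubini–Study mass and the sup norm of the form. -/
theorem exists_le_fubiniStudy (k : ℕ) : ∃ C : ℝ, ∀ (α : SmoothForm k (2 * 1)) (M : ℝ),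
    (∀ x : Cone k, ‖x‖ = 1 → ‖α.1 x‖ ≤ M) → ∀ x, x ≠ 0 → ∀ v : Fin 1 → Cone k,
      ‖α.1 x (complexTuple v)‖ ≤ C * M * ((fubiniStudy k).1 x (complexTuple v)).re := by
  let X := {F : Fin (1 + 1) → Cone k // IsFrame F}
  have : CompactSpace X := isCompact_iff_compactSpace.1 (isCompact_setOf_isFrame (1 + 1))
  have hcont : Continuous fun F : X =>
      (‖F.1 1‖ / ‖F.1 0‖) ^ 2 / ((fubiniStudy k).1 (F.1 0) (complexTuple fun i => F.1 i.succ)).re := by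
    refine Continuous.div (Continuous.pow (Continuous.div ?_ ?_ fun F => ?_) 2)
      (Complex.continuous_re.comp ((continuousOn_apply_frame _).comp_continuous
        continuous_subtype_val fun F => F.2.ne_zero 0)) fun F => ?_
    · exact ((continuous_apply 1).comp continuous_subtype_val).norm
    · exact ((continuous_apply 0).comp continuous_subtype_val).norm
    · exact norm_ne_zero_iff.2 (F.2.ne_zero 0)
    · exact (isStrictlyPositiveOn_fubiniStudy F.1 F.2 fun _ => trivial).ne'
  obtain ⟨C, hC⟩ := isCompact_univ.exists_bound_of_continuousOn hcont.continuousOn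
  refine ⟨C, fun α M hM x hx v => ?_⟩
  rcases exists_isFrame hx v with h0 | ⟨F, hF, -, c, hc, hα⟩
  · rw [h0, h0]
    simp
  · rw [hα, hα, Complex.re_ofReal_mul, norm_mul, Complex.norm_real, Real.norm_of_nonneg hc.le]
    have hF0 := hF.ne_zero 0
    have hpos := isStrictlyPositiveOn_fubiniStudy F hF fun _ => trivial
    have hr : 0 < ‖F 0‖ := norm_pos_iff.2 hF0
    set r : ℂ := ((‖F 0‖⁻¹ : ℝ) : ℂ) with hrdef
    have hr0 : r ≠ 0 := by
      rw [hrdef]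
      exact_mod_cast (inv_pos.2 hr).ne'
    have hrn : ‖r‖ = ‖F 0‖⁻¹ := by
      rw [hrdef, Complex.norm_real, Real.norm_of_nonneg (inv_pos.2 hr).le]
    have h1 : ‖α.1 (F 0) (complexTuple fun i => F i.succ)‖ ≤ M * (‖F 1‖ / ‖F 0‖) ^ 2 := by
      rw [← apply_smul α hr0 hF0]
      have h2 := hM (r • F 0) (by rw [norm_smul, hrn, inv_mul_cancel₀ hr.ne'])
      refine ((α.1 (r • F 0)).le_of_opNorm_le h2 _).trans (le_of_eq ?_)
      congr 1
      have h3 : ∀ i : Fin (2 * 1), ‖r • complexTuple (fun i : Fin 1 => F i.succ) i‖ =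
          ‖F 1‖ / ‖F 0‖ := by
        intro i
        rw [norm_smul, hrn, complexTuple, norm_smul, norm_pow, Complex.norm_I, one_pow, one_mul,
          inv_mul_eq_div]
        congr 3
        ext
        simp
        omega
      rw [Finset.prod_congr rfl fun i _ => h3 i]
      simp [div_pow]
    have hM0 : 0 ≤ M := (norm_nonneg _).trans (hM (r • F 0)
      (by rw [norm_smul, hrn, inv_mul_cancel₀ hr.ne']))
    have h4 := (le_abs_self _).trans (hC ⟨F, hF⟩ trivial)
    rw [div_le_iff₀ hpos] at h4
    calc c * _ ≤ c * (M * (C * _)) :=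
          mul_le_mul_of_nonneg_left (h1.trans (mul_le_mul_of_nonneg_left h4 hM0)) hc.le
      _ = _ := by ring

end FubiniStudy

open SmoothForm MeasureTheory

/-! ### Integration over holomorphic curves -/

/-- A homogeneous holomorphic function of positive degree in two variables has a nontrivial zero. -/
theorem exists_ne_zero_apply_eq_zero {g : Cone 1 → ℂ} (hg : Differentiable ℂ g) {D : ℕ} (hD : D ≠ 0)
    (hs : ∀ (c : ℂ) x, g (c • x) = c ^ D * g x) : ∃ x, x ≠ 0 ∧ g x = 0 := by
  by_contra! h
  have hne : ∀ ζ : ℂ, (![ζ, 1] : Cone 1) ≠ 0 := fun ζ h0 => by simpa using congrFun h0 1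
  have hne' : ∀ ζ : ℂ, (![1, ζ] : Cone 1) ≠ 0 := fun ζ h0 => by simpa using congrFun h0 0
  -- Without zeros this would be an entire function. Since `g(ζ, 1) = ζ^D g(1, ζ⁻¹)`, it would tend
  -- to zero at infinity, hence vanish identically by Liouville's theorem, although it is an
  -- inverse.
  have hd : Differentiable ℂ fun ζ : ℂ => (g ![ζ, 1])⁻¹ := by
    have h1 : Differentiable ℂ fun ζ : ℂ => (![ζ, 1] : Cone 1) := by
      refine differentiable_pi.2 fun i => ?_
      fin_cases i
      · exact differentiable_id
      · exact differentiable_const _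
    exact (hg.comp h1).inv fun ζ => h _ (hne ζ)
  have hlim : Filter.Tendsto (fun ζ : ℂ => (g ![ζ, 1])⁻¹) (Filter.cocompact ℂ) (𝓝 0) := by
    have h1 : Filter.Tendsto (fun ζ : ℂ => ζ⁻¹) (Filter.cocompact ℂ) (𝓝 0) :=
      Metric.cobounded_eq_cocompact (α := ℂ) ▸ Filter.tendsto_inv₀_cobounded
    have h2 : Continuous fun s : ℂ => s ^ D * (g ![1, s])⁻¹ := by
      refine (continuous_pow D).mul (Continuous.inv₀ (hg.continuous.comp ?_) fun s => h _ (hne' s))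
      refine continuous_pi fun i => ?_
      fin_cases i
      · exact continuous_const
      · exact continuous_id
    have h3 := (h2.tendsto 0).comp h1
    rw [zero_pow hD, zero_mul] at h3
    refine h3.congr' ?_
    have h4 : ∀ᶠ ζ in Filter.cocompact ℂ, ζ ≠ 0 :=
      (isCompact_singleton (x := (0 : ℂ))).compl_mem_cocompact
    filter_upwards [h4] with ζ hζ
    have h5 := hs ζ ![1, ζ⁻¹]
    have h6 : ζ • (![1, ζ⁻¹] : Cone 1) = ![ζ, 1] := by
      simp [hζ]
    rw [h6] at h5
    simp only [Function.comp_apply]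
    rw [h5, mul_inv, inv_pow]
  exact inv_ne_zero (h _ (hne 0)) (hd.apply_eq_of_tendsto_cocompact 0 hlim)

theorem PSpace.fderiv_projector_smul {k : ℕ} {x : Cone k} (hx : x ≠ 0) (c : ℂ) :
    fderiv ℝ PSpace.projector x (c • x) = 0 := by
  have hg : HasDerivAt (fun s : ℝ => x + s • (c • x)) (c • x) 0 := by
    simpa using ((hasDerivAt_id (0 : ℝ)).smul_const (c • x)).const_add x
  have h0 : x + (0 : ℝ) • (c • x) = x := by simp
  have h1 : HasFDerivAt (PSpace.projector (k := k)) (fderiv ℝ PSpace.projector x)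
      (x + (0 : ℝ) • (c • x)) := by
    rw [h0]
    exact ((PSpace.contDiffOn_projector.contDiffAt (isOpen_compl_singleton.mem_nhds hx)).differentiableAt
      (by simp)).hasFDerivAt
  have h2 := h1.comp_hasDerivAt (0 : ℝ) hg
  have h3 : PSpace.projector ∘ (fun s : ℝ => x + s • (c • x)) =ᶠ[𝓝 0]
      fun _ => PSpace.projector x := by
    have hs : ∀ᶠ s : ℝ in 𝓝 0, (1 + (s : ℂ) * c) ≠ 0 := by
      have : ContinuousAt (fun s : ℝ => 1 + (s : ℂ) * c) 0 := by fun_prop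
      exact this.eventually_ne (by simp)
    filter_upwards [hs] with s hs
    have e : x + s • (c • x) = (1 + (s : ℂ) * c) • x := by
      rw [add_smul, one_smul, mul_smul, Complex.coe_smul]
    rw [Function.comp_apply, e, PSpace.projector_smul hs]
  exact h2.unique ((hasDerivAt_const (0 : ℝ) _).congr_of_eventuallyEq h3)

/-- The two coordinate vectors of `ℂ²`. -/
abbrev e₀ : Cone 1 := ![1, 0]
/-- The two coordinate vectors of `ℂ²`. -/
abbrev e₁ : Cone 1 := ![0, 1]

theorem e₁_add_smul (ζ : ℂ) : e₁ + ζ • e₀ = ![ζ, 1] := by simp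

theorem e₀_add_smul (ζ : ℂ) : e₀ + ζ • e₁ = ![1, ζ] := by simp

theorem e₁_add_smul_ne_zero (ζ : ℂ) : e₁ + ζ • e₀ ≠ 0 := fun h0 => by
  simpa [e₁_add_smul] using congrFun h0 1

theorem e₀_add_smul_ne_zero (ζ : ℂ) : e₀ + ζ • e₁ ≠ 0 := fun h0 => by
  simpa [e₀_add_smul] using congrFun h0 0

/-- Multiplication by `χ` and by `1 − χ` splits a form on the projective line into two parts, each
with compact support in one of the affine charts. -/
theorem exists_cutoff_line : ∃ χ : Cone 1 → ℝ, IsSmoothFunction χ ∧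
    (∀ ζ : ℂ, 2 < ‖ζ‖ → χ (e₁ + ζ • e₀) = 0) ∧ ∀ ζ : ℂ, 1 < ‖ζ‖ → χ (e₀ + ζ • e₁) = 1 := by
  have hK : ∀ x (hx : x ≠ 0),
      Projectivization.mk ℂ x hx ∈ {p : PSpace 1 | ‖p.rep 0‖ ≤ ‖p.rep 1‖} ↔
        x ∈ {x : Cone 1 | ‖x 0‖ ≤ ‖x 1‖} := by
    intro x hx
    obtain ⟨c, hc, h⟩ := PSpace.exists_rep_mk x hx
    simp only [Set.mem_ofPred_eq, h, Pi.smul_apply, norm_smul]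
    exact mul_le_mul_iff_right₀ (norm_pos_iff.2 hc)
  have hL : ∀ x (hx : x ≠ 0),
      Projectivization.mk ℂ x hx ∈ {p : PSpace 1 | 2 * ‖p.rep 1‖ ≤ ‖p.rep 0‖} ↔
        x ∈ {x : Cone 1 | 2 * ‖x 1‖ ≤ ‖x 0‖} := by
    intro x hx
    obtain ⟨c, hc, h⟩ := PSpace.exists_rep_mk x hx
    simp only [Set.mem_ofPred_eq, h, Pi.smul_apply, norm_smul, mul_left_comm (2 : ℝ)]
    exact mul_le_mul_iff_right₀ (norm_pos_iff.2 hc)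
  have hd : Disjoint {p : PSpace 1 | ‖p.rep 0‖ ≤ ‖p.rep 1‖} {p | 2 * ‖p.rep 1‖ ≤ ‖p.rep 0‖} := by
    refine Set.disjoint_left.2 fun p hp hp' => p.rep_nonzero ?_
    simp only [Set.mem_ofPred_eq] at hp hp'
    have h1 : ‖p.rep 1‖ = 0 := by linarith [norm_nonneg (p.rep 1)]
    have h0 : ‖p.rep 0‖ = 0 := by linarith [norm_nonneg (p.rep 0)]
    funext i
    fin_cases i
    · exact norm_eq_zero.1 h0
    · exact norm_eq_zero.1 h1
  obtain ⟨χ, hχ, -, h1, h0⟩ := exists_isSmoothFunction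
    (PSpace.isClosed_of_cone (isClosed_le (by fun_prop) (by fun_prop)) hK)
    (PSpace.isClosed_of_cone (isClosed_le (by fun_prop) (by fun_prop)) hL) hd
  refine ⟨χ, hχ, fun ζ hζ => h0 _ (e₁_add_smul_ne_zero ζ) ((hL _ _).2 ?_), fun ζ hζ =>
    h1 _ (e₀_add_smul_ne_zero ζ) ((hK _ _).2 ?_)⟩
  · rw [e₁_add_smul]
    simpa using hζ.le
  · rw [e₀_add_smul]
    simpa using hζ.le

/-- Stokes' theorem on the projective line. -/
theorem integral_affineDensity_eq_zero {β : SmoothForm 1 1} {γ : SmoothForm 1 (2 * 1)}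
    (h : IsExteriorDerivative (n := 1) γ β) : ∫ ζ, affineDensity e₁ e₀ γ ζ = 0 := by
  obtain ⟨χ, hχ, h0, h1⟩ := exists_cutoff_line
  -- Stokes' theorem is applied to `β₁` in one chart and to `β - β₁` in the other.
  set β₁ := mulFun χ hχ β
  have hγ : ∀ x, x ≠ 0 → γ.1 x = (d β₁).1 x + (d (β - β₁)).1 x := by
    intro x hx
    have e : β.1 = β₁.1 + (β - β₁).1 := by
      funext y
      exact (add_sub_cancel (β₁.1 y) (β.1 y)).symm
    rw [h x hx, isExteriorDerivative_d _ x hx, isExteriorDerivative_d _ x hx,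
      ← extDeriv_add (differentiableAt β₁ hx) (differentiableAt (β - β₁) hx), ← e]
  have hdens : affineDensity e₁ e₀ γ = fun ζ => affineDensity e₁ e₀ (d (n := 1) β₁) ζ +
      affineDensity e₁ e₀ (d (n := 1) (β - β₁)) ζ := by
    funext ζ
    rw [affineDensity, hγ _ (e₁_add_smul_ne_zero ζ)]
    rfl
  rw [hdens, integral_add (integrable_affineDensity e₁_add_smul_ne_zero e₀_add_smul_ne_zero _)
    (integrable_affineDensity e₁_add_smul_ne_zero e₀_add_smul_ne_zero _),
    integral_affineDensity_comm e₀_add_smul_ne_zero (d (n := 1) (β - β₁)),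
    integral_affineDensity_d e₁_add_smul_ne_zero (isExteriorDerivative_d β₁) (r := 2) fun ζ hζ => ?_,
    integral_affineDensity_d e₀_add_smul_ne_zero (isExteriorDerivative_d (β - β₁)) (r := 1)
      fun ζ hζ => ?_, add_zero]
  · change β.1 _ - β₁.1 _ = 0
    rw [mulFun_apply, h1 ζ hζ, one_smul, sub_self]
  · rw [mulFun_apply, h0 ζ hζ]
    ext w
    simp

namespace IsConeMap

variable {k D : ℕ} {G : Cone 1 → Cone k}

/-- Integration of `2`-forms over the curve parametrized by `G`. -/
def curveIntegral (hG : IsConeMap G D) : SmoothForm k (2 * 1) →ₗ[ℂ] ℂ where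
  toFun α := ∫ ζ, affineDensity e₁ e₀ (hG.pullback α) ζ
  map_add' α β := by
    rw [hG.pullback_add, ← integral_add
      (integrable_affineDensity e₁_add_smul_ne_zero e₀_add_smul_ne_zero _)
      (integrable_affineDensity e₁_add_smul_ne_zero e₀_add_smul_ne_zero _)]
    rfl
  map_smul' c α := by
    rw [hG.pullback_smul, RingHom.id_apply, smul_eq_mul, ← integral_const_mul]
    rfl

theorem curveIntegral_apply (hG : IsConeMap G D) (α : SmoothForm k (2 * 1)) :
    hG.curveIntegral α = ∫ ζ, affineDensity e₁ e₀ (hG.pullback α) ζ := rfl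

theorem integrable (hG : IsConeMap G D) (α : SmoothForm k (2 * 1)) :
    Integrable (affineDensity e₁ e₀ (hG.pullback α)) :=
  integrable_affineDensity e₁_add_smul_ne_zero e₀_add_smul_ne_zero _

theorem density_eq (hG : IsConeMap G D) (α : SmoothForm k (2 * 1)) (ζ : ℂ) :
    affineDensity e₁ e₀ (hG.pullback α) ζ = α.1 (G (e₁ + ζ • e₀))
      (complexTuple fun _ : Fin 1 => fderiv ℂ G (e₁ + ζ • e₀) e₀) :=
  hG.pullback_apply_complexTuple (l := 1) α (e₁_add_smul_ne_zero ζ) _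

theorem curveIntegral_eq_zero_of_isExteriorDerivative (hG : IsConeMap G D) {β : SmoothForm k 1}
    {γ : SmoothForm k (2 * 1)} (h : IsExteriorDerivative (n := 1) γ β) : hG.curveIntegral γ = 0 :=
  integral_affineDensity_eq_zero (hG.isExteriorDerivative_pullback h)

theorem curveIntegral_re (hG : IsConeMap G D) (α : SmoothForm k (2 * 1)) :
    (hG.curveIntegral α).re = ∫ ζ, (affineDensity e₁ e₀ (hG.pullback α) ζ).re :=
  (Complex.reCLM.integral_comp_comm (hG.integrable α)).symm

theorem curveIntegral_im (hG : IsConeMap G D) (α : SmoothForm k (2 * 1)) :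
    (hG.curveIntegral α).im = ∫ ζ, (affineDensity e₁ e₀ (hG.pullback α) ζ).im :=
  (Complex.imCLM.integral_comp_comm (hG.integrable α)).symm

theorem curveIntegral_nonneg (hG : IsConeMap G D) {α : SmoothForm k (2 * 1)}
    (h : SmoothForm.IsPositive α) : 0 ≤ (hG.curveIntegral α).re ∧ (hG.curveIntegral α).im = 0 := by
  rw [curveIntegral_re, curveIntegral_im]
  constructor
  · refine integral_nonneg fun ζ => ?_
    simp only [density_eq, Pi.zero_apply]
    exact (h.2 _ (hG.ne_zero _ (e₁_add_smul_ne_zero ζ)) _).1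
  · rw [← integral_zero ℂ ℝ]
    congr 1
    funext ζ
    rw [density_eq]
    exact (h.2 _ (hG.ne_zero _ (e₁_add_smul_ne_zero ζ)) _).2

theorem curveIntegral_eq_zero (hG : IsConeMap G D) {α : SmoothForm k (2 * 1)}
    (h : ∀ x, x ≠ 0 → ∀ v : Fin 1 → Cone k, α.1 (G x) (complexTuple v) = 0) :
    hG.curveIntegral α = 0 := by
  rw [curveIntegral_apply, ← integral_zero ℂ ℂ]
  congr 1
  funext ζ
  rw [density_eq]
  exact h _ (e₁_add_smul_ne_zero ζ) _

theorem curveIntegral_fubiniStudy_im (hG : IsConeMap G D) :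
    (hG.curveIntegral (fubiniStudy k)).im = 0 := by
  rw [curveIntegral_im, ← integral_zero ℂ ℝ]
  congr 1
  funext ζ
  rw [density_eq]
  exact fubiniStudy_im (hG.ne_zero _ (e₁_add_smul_ne_zero ζ)) _

theorem norm_curveIntegral_le (hG : IsConeMap G D) {α : SmoothForm k (2 * 1)} {C : ℝ}
    (h : ∀ x, x ≠ 0 → ∀ v : Fin 1 → Cone k,
      ‖α.1 x (complexTuple v)‖ ≤ C * ((fubiniStudy k).1 x (complexTuple v)).re) :
    ‖hG.curveIntegral α‖ ≤ C * (hG.curveIntegral (fubiniStudy k)).re := by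
  rw [curveIntegral_apply, curveIntegral_re, ← integral_const_mul]
  refine norm_integral_le_of_norm_le ((hG.integrable _).re.const_mul C)
    (Filter.Eventually.of_forall fun ζ => ?_)
  rw [density_eq, density_eq]
  exact h _ (hG.ne_zero _ (e₁_add_smul_ne_zero ζ)) _

/-- With zero mass the derivative of `G` along the affine line would be vertical everywhere, so the
projector of `G` would be constant. But each coordinate of `G` has a non-trivial zero, having
positive degree in two variables; a coordinate which is non-zero at `e₀` would then vanish on the
whole affine line, and by continuity at `e₀` too. -/
theorem curveIntegral_fubiniStudy_pos (hG : IsConeMap G D) (hD : D ≠ 0) :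
    0 < (hG.curveIntegral (fubiniStudy k)).re := by
  have hnn : ∀ ζ, 0 ≤ (affineDensity e₁ e₀ (hG.pullback (fubiniStudy k)) ζ).re := by
    intro ζ
    rw [density_eq]
    exact fubiniStudy_re_nonneg (hG.ne_zero _ (e₁_add_smul_ne_zero ζ)) _
  rw [curveIntegral_re]
  refine lt_of_le_of_ne (integral_nonneg hnn) fun h0 => ?_
  have h1 := (integral_eq_zero_iff_of_nonneg hnn (hG.integrable _).re).1 h0.symm
  have hcont : Continuous fun ζ => (affineDensity e₁ e₀ (hG.pullback (fubiniStudy k)) ζ).re :=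
    Complex.continuous_re.comp (continuous_affineDensity e₁_add_smul_ne_zero _)
  have h2 := (hcont.ae_eq_iff_eq volume continuous_const).1 h1
  have h3 : ∀ ζ : ℂ, ∃ c : ℂ,
      fderiv ℂ G (e₁ + ζ • e₀) e₀ = c • G (e₁ + ζ • e₀) := by
    intro ζ
    refine exists_eq_smul_of_fubiniStudy_le (hG.ne_zero _ (e₁_add_smul_ne_zero ζ))
      (fun _ => fderiv ℂ G (e₁ + ζ • e₀) e₀) ?_
    rw [← density_eq]
    exact (congrFun h2 ζ).le
  set p : ℂ → Fin (k + 1) → Fin (k + 1) → ℂ := fun ζ => PSpace.projector (G (e₁ + ζ • e₀)) with hp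
  have hp' : ∀ ζ, HasFDerivAt p (0 : ℂ →L[ℝ] _) ζ := by
    intro ζ
    have hne := hG.ne_zero _ (e₁_add_smul_ne_zero ζ)
    have d1 : HasFDerivAt (fun ζ : ℂ => e₁ + ζ • e₀)
        ((ContinuousLinearMap.toSpanSingleton ℂ e₀).restrictScalars ℝ) ζ :=
      ((ContinuousLinearMap.toSpanSingleton ℂ e₀).restrictScalars ℝ).hasFDerivAt.const_add e₁
    have d2 := ((hG.hasFDerivAt (e₁ + ζ • e₀)).restrictScalars ℝ).comp ζ d1
    have d3 := ((PSpace.contDiffOn_projector.contDiffAt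
      (isOpen_compl_singleton.mem_nhds hne)).differentiableAt (by simp)).hasFDerivAt.comp ζ d2
    refine d3.congr_fderiv ?_
    ext1 c
    obtain ⟨a, ha⟩ := h3 ζ
    change fderiv ℝ PSpace.projector _ (fderiv ℂ G (e₁ + ζ • e₀) (c • e₀)) = 0
    rw [map_smul, ha, smul_smul]
    exact PSpace.fderiv_projector_smul hne _
  have hconst : ∀ ζ ζ', p ζ = p ζ' := fun ζ ζ' =>
    is_const_of_fderiv_eq_zero (𝕜 := ℝ) (fun ζ => (hp' ζ).differentiableAt)
      (fun ζ => (hp' ζ).fderiv) ζ ζ'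
  have he₀ : e₀ ≠ 0 := by simp
  obtain ⟨i, hi⟩ := Function.ne_iff.1 (hG.ne_zero e₀ he₀)
  have hdiff : Differentiable ℂ fun x => G x i :=
    differentiable_pi.1 (hG.contDiff.differentiable (by simp)) i
  obtain ⟨y, hy, hy0⟩ := exists_ne_zero_apply_eq_zero hdiff hD fun c x => by
    rw [hG.smul, Pi.smul_apply, smul_eq_mul]
  have hy1 : y 1 ≠ 0 := by
    intro hy1
    have e : y = y 0 • e₀ := by
      funext j
      fin_cases j
      · simp
      · simpa using hy1
    rw [e, hG.smul, Pi.smul_apply, smul_eq_mul] at hy0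
    have := (mul_eq_zero.1 hy0).resolve_right hi
    rw [e, pow_eq_zero_iff hD |>.1 this, zero_smul] at hy
    exact hy rfl
  have hz : G (e₁ + (y 0 / y 1) • e₀) i = 0 := by
    have e : y = y 1 • (e₁ + (y 0 / y 1) • e₀) := by
      funext j
      fin_cases j
      · simp [mul_div_cancel₀ _ hy1]
      · simp
    rw [e, hG.smul, Pi.smul_apply, smul_eq_mul] at hy0
    exact (mul_eq_zero.1 hy0).resolve_left (pow_ne_zero _ hy1)
  have hall : ∀ ζ : ℂ, G (e₁ + ζ • e₀) i = 0 := by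
    intro ζ
    have h4 := congrFun (congrFun (hconst ζ (y 0 / y 1)) i) i
    simp only [hp, PSpace.projector, hz, zero_mul, smul_zero] at h4
    have h5 := (smul_eq_zero.1 h4).resolve_left
      (inv_ne_zero (PSpace.normSq_pos (hG.ne_zero _ (e₁_add_smul_ne_zero ζ))).ne')
    rw [Complex.mul_conj] at h5
    simpa using h5
  have hcl : Set.EqOn (fun s : ℂ => G (e₀ + s • e₁) i) (fun _ => 0) {0}ᶜ := by
    intro s hs
    have e : e₀ + s • e₁ = s • (e₁ + s⁻¹ • e₀) := by
      rw [smul_add, smul_smul, mul_inv_cancel₀ hs, one_smul, add_comm]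
    simp only
    rw [e, hG.smul, Pi.smul_apply, hall, smul_zero]
  have hcont2 : Continuous fun s : ℂ => G (e₀ + s • e₁) i :=
    hdiff.continuous.comp (by fun_prop)
  have h6 := congrFun (hcont2.ext_on (dense_compl_singleton (0 : ℂ)) continuous_const hcl) 0
  rw [zero_smul, add_zero] at h6
  exact hi h6

end IsConeMap

open SmoothForm MeasureTheory Filter

/-! ### Existence of currents -/

theorem SmoothForm.exists_bound {k n : ℕ} (α : SmoothForm k n) :
    ∃ M : ℝ, ∀ x : Cone k, ‖x‖ = 1 → ‖α.1 x‖ ≤ M := by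
  obtain ⟨M, hM⟩ := (isCompact_sphere (0 : Cone k) 1).exists_bound_of_continuousOn
    ((contDiffOn α).continuousOn.mono fun x hx h0 => by
      rw [Set.mem_singleton_iff.1 h0] at hx
      simp at hx)
  exact ⟨M, fun x hx => hM x (by simpa using hx)⟩

/-- Weak limits of currents of order `0` with bounded mass. -/
theorem exists_current_tendsto {k n : ℕ} (t : ℕ → SmoothForm k n →ₗ[ℂ] ℂ) {C : ℝ}
    (h : ∀ j (α : SmoothForm k n) (M : ℝ), (∀ x : Cone k, ‖x‖ = 1 → ‖α.1 x‖ ≤ M) →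
      ‖t j α‖ ≤ C * M) :
    ∃ (T : Current k n) (U : Ultrafilter ℕ), (U : Filter ℕ) ≤ atTop ∧
      ∀ α, Tendsto (fun j => t j α) U (𝓝 (T.toLinearMap α)) := by
  -- One fixed non-principal ultrafilter gives limits for all test forms simultaneously, without
  -- extracting subsequences.
  have hlim : ∀ α, ∃ z, Tendsto (fun j => t j α) (hyperfilter ℕ) (𝓝 z) := by
    intro α
    obtain ⟨M, hM⟩ := SmoothForm.exists_bound α
    obtain ⟨z, -, hz⟩ := (isCompact_closedBall (0 : ℂ) (C * M)).ultrafilter_le_nhds'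
      ((hyperfilter ℕ).map fun j => t j α)
      (Filter.mem_map.2 (univ_mem' fun j => by simpa using h j α M hM))
    exact ⟨z, hz⟩
  choose T hT using hlim
  refine ⟨⟨⟨⟨T, fun α β => ?_⟩, fun c α => ?_⟩, 0, C, fun α M hM => ?_⟩, hyperfilter ℕ,
    Nat.hyperfilter_le_atTop, hT⟩
  · refine tendsto_nhds_unique (hT (α + β)) ?_
    simp only [map_add]
    exact (hT α).add (hT β)
  · refine tendsto_nhds_unique (hT (c • α)) ?_
    simp only [map_smul]
    exact (hT α).const_smul c
  · refine le_of_tendsto (hT α).norm (Eventually.of_forall fun j => h j α M fun x hx => ?_)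
    simpa using hM 0 le_rfl x hx

/-- Multiplication by `i` fixes the value on a complex line, while bidegree `(2, 0)` or `(0, 2)`
makes it change sign. -/
theorem SmoothForm.IsBidegree.apply_complexTuple_eq_zero {k p q : ℕ} {α : SmoothForm k (2 * 1)}
    (h : IsBidegree α p q) (hpq : (p, q) ≠ (1, 1)) {x : Cone k} (hx : x ≠ 0) (v : Fin 1 → Cone k) :
    α.1 x (complexTuple v) = 0 := by
  have h1 := h.2 x hx Complex.I (complexTuple v)
  have h2 := map_complexTuple_smul (l := 1) (α.1 x) v fun _ => Complex.I
  rw [complexTuple_smul, h2] at h1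
  have h3 := h.1
  have h4 : p = 0 ∧ q = 2 ∨ p = 2 ∧ q = 0 := by
    have : ¬ (p = 1 ∧ q = 1) := by simpa using hpq
    omega
  rcases h4 with ⟨rfl, rfl⟩ | ⟨rfl, rfl⟩ <;>
  · simp at h1
    linear_combination h1 / 2

theorem Endo.isConeMap_coneMap {k d : ℕ} (f : Endo k d) : IsConeMap f.coneMap d where
  contDiff := by
    refine contDiff_pi.2 fun i => ?_
    exact (AnalyticOnNhd.eval_mvPolynomial (𝕜 := ℂ) (f.poly i)).contDiff
  smul := f.coneMap_smul
  ne_zero _ hx := f.coneMap_ne_zero hx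

theorem IsConeMap.comp {l m k D D' : ℕ} {G : Cone m → Cone k} {H : Cone l → Cone m}
    (hG : IsConeMap G D) (hH : IsConeMap H D') : IsConeMap (G ∘ H) (D' * D) where
  contDiff := hG.contDiff.comp hH.contDiff
  smul c x := by rw [Function.comp_apply, hH.smul, hG.smul, pow_mul]; rfl
  ne_zero x hx := hG.ne_zero _ (hH.ne_zero x hx)

/-- This presents the attracting set as a decreasing intersection of compact sets. -/
theorem IsTrappingRegion.iInter_eq {k d : ℕ} {f : Endo k d} {U : Set (PSpace k)}
    (hU : closure (f '' U) ⊆ U) :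
    ⋂ n, f^[n] '' closure (f '' U) = ⋂ n, f^[n] '' U := by
  refine Set.Subset.antisymm (Set.iInter_mono fun n => Set.image_mono hU) ?_
  refine Set.subset_iInter fun n => (Set.iInter_subset _ (n + 1)).trans ?_
  rw [Function.iterate_succ, Set.image_comp]
  exact Set.image_mono subset_closure

theorem image_iterate_antitone {X : Type*} {f : X → X} {K : Set X} (h : f '' K ⊆ K) :
    Antitone fun n => f^[n] '' K := by
  refine antitone_nat_of_succ_le fun n => ?_
  rw [Function.iterate_succ, Set.image_comp]
  exact Set.image_mono h

/-- A trapping region which contains a holomorphic curve has an attracting set which supports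
a positive closed current of bidimension `(1, 1)`. -/
theorem supportsPositiveClosedCurrent_one {k d : ℕ} (f : Endo k d) (hd : d ≠ 0)
    {U : Set (PSpace k)} (hU : closure (f '' U) ⊆ U) {G : Cone 1 → Cone k} {D : ℕ} (hD : D ≠ 0)
    (hG : IsConeMap G D) (hGU : ∀ y hy, Projectivization.mk ℂ (G y) (hG.ne_zero y hy) ∈ U) :
    SupportsPositiveClosedCurrent (⋂ n, f^[n] '' U) 1 := by
  have hcurve : ∀ n, ∃ (Γ : Cone 1 → Cone k) (D : ℕ) (_ : D ≠ 0) (hΓ : IsConeMap Γ D),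
      ∀ y hy, Projectivization.mk ℂ (Γ y) (hΓ.ne_zero y hy) ∈ f^[n] '' U := by
    intro n
    induction n with
    | zero => exact ⟨G, D, hD, hG, fun y hy => by simpa using hGU y hy⟩
    | succ n ih =>
      obtain ⟨Γ, D, hD, hΓ, h⟩ := ih
      refine ⟨f.coneMap ∘ Γ, D * d, mul_ne_zero hD hd, f.isConeMap_coneMap.comp hΓ, fun y hy => ?_⟩
      rw [Function.iterate_succ', Set.image_comp]
      exact ⟨_, h y hy, f.apply_mk _ _⟩
  choose Γ D hD hΓ hΓU using hcurve
  -- Normalization by this mass bounds the functionals uniformly and gives the limit the value one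
  -- on the Fubini–Study form, so the limit is not zero.
  let m : ℕ → ℝ := fun n => ((hΓ n).curveIntegral (fubiniStudy k)).re
  have hm : ∀ n, 0 < m n := fun n => (hΓ n).curveIntegral_fubiniStudy_pos (hD n)
  let t : ℕ → SmoothForm k (2 * 1) →ₗ[ℂ] ℂ := fun n => ((m n)⁻¹ : ℂ) • (hΓ n).curveIntegral
  have ht : ∀ n α, t n α = ((m n)⁻¹ : ℝ) * (hΓ n).curveIntegral α := fun n α => by
    rw [Complex.ofReal_inv]
    rfl
  obtain ⟨C, hC⟩ := exists_le_fubiniStudy k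
  obtain ⟨T, F, hF, hT⟩ := exists_current_tendsto t (C := C) fun n α M hM => by
    rw [ht, norm_mul, Complex.norm_real, Real.norm_of_nonneg (inv_pos.2 (hm n)).le,
      inv_mul_le_iff₀ (hm n), mul_comm (m n)]
    exact (hΓ n).norm_curveIntegral_le (hC α M hM)
  have hzero : ∀ α, (∀ᶠ n in (F : Filter ℕ), (hΓ n).curveIntegral α = 0) → T.toLinearMap α = 0 := by
    intro α hα
    refine tendsto_nhds_unique_of_eventuallyEq (hT α) tendsto_const_nhds ?_
    filter_upwards [hα] with n hn
    rw [ht, hn, mul_zero]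
  have hfs : T.toLinearMap (fubiniStudy k) = 1 := by
    refine tendsto_nhds_unique (hT _) (tendsto_const_nhds.congr fun n => ?_)
    have h1 : (hΓ n).curveIntegral (fubiniStudy k) = (m n : ℂ) :=
      Complex.ext rfl (hΓ n).curveIntegral_fubiniStudy_im
    rw [ht, h1, ← Complex.ofReal_mul, inv_mul_cancel₀ (hm n).ne', Complex.ofReal_one]
  refine ⟨T, fun h0 => ?_, fun p q hpq α hα => ?_, fun α hα => ?_, fun β γ h => ?_, ?_⟩
  · rw [h0] at hfs
    exact zero_ne_one hfs
  · exact hzero α (Eventually.of_forall fun n => (hΓ n).curveIntegral_eq_zero fun x hx v =>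
      hα.apply_complexTuple_eq_zero hpq ((hΓ n).ne_zero x hx) v)
  · have h1 : ∀ n, 0 ≤ (t n α).re ∧ (t n α).im = 0 := fun n => by
      have h2 := (hΓ n).curveIntegral_nonneg hα
      rw [ht, Complex.re_ofReal_mul, Complex.im_ofReal_mul, h2.2, mul_zero]
      exact ⟨mul_nonneg (inv_pos.2 (hm n)).le h2.1, rfl⟩
    refine ⟨ge_of_tendsto ((Complex.continuous_re.tendsto _).comp (hT α))
      (Eventually.of_forall fun n => (h1 n).1), ?_⟩
    refine tendsto_nhds_unique ((Complex.continuous_im.tendsto _).comp (hT α))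
      (tendsto_const_nhds.congr fun n => ?_)
    exact (h1 n).2.symm
  · exact hzero γ (Eventually.of_forall fun n =>
      (hΓ n).curveIntegral_eq_zero_of_isExteriorDerivative h)
  -- For `n > N` the `n`-th curve lies in the closed set `f^[N] '' K`, so a form supported off this
  -- set has zero integral for all large `n`.
  · set K := closure (f '' U) with hKdef
    have hK : IsCompact K := isClosed_closure.isCompact
    have hfK : f '' K ⊆ K := (Set.image_mono hU).trans subset_closure
    have hcl : ∀ n, IsClosed (f^[n] '' K) := fun n =>
      (hK.image (f.continuous_toFun.iterate n)).isClosed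
    rw [← IsTrappingRegion.iInter_eq hU]
    refine Set.subset_iInter fun N => ?_
    rw [Current.support, Set.compl_subset_comm]
    refine Set.subset_sUnion_of_mem ⟨(hcl N).isOpen_compl, fun α hα => hzero α ?_⟩
    filter_upwards [hF (eventually_ge_atTop (N + 1))] with n hn
    refine (hΓ n).curveIntegral_eq_zero fun x hx v => ?_
    rw [apply_eq_zero_of_notMem_support α ((hΓ n).ne_zero x hx)]
    · rfl
    · intro hs
      refine hα hs (image_iterate_antitone (f := f) hfK (Nat.le_sub_one_of_lt hn) ?_)
      have h1 := hΓU n x hx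
      obtain ⟨j, rfl⟩ : ∃ j, n = j + 1 := ⟨n - 1, by omega⟩
      rw [Function.iterate_succ, Set.image_comp] at h1
      exact Set.image_mono subset_closure h1

/-! ### Binary forms -/

section BinaryForms

variable {d : ℕ}

/-- The binary form with given coefficients. -/
def binaryForm (a : Fin (d + 1) → ℂ) (y : Cone 1) : ℂ :=
  ∑ i : Fin (d + 1), a i * (y 0 ^ i.1 * y 1 ^ (d - i.1))

theorem eval_eq_binaryForm {p : MvPolynomial (Fin 2) ℂ} (hp : p.IsHomogeneous d) (y : Cone 1) :
    MvPolynomial.eval y p = binaryForm (fun i : Fin (d + 1) =>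
      MvPolynomial.coeff (Finsupp.single 0 i.1 + Finsupp.single 1 (d - i.1)) p) y := by
  have hinj : Function.Injective fun i : Fin (d + 1) =>
      (Finsupp.single 0 i.1 + Finsupp.single 1 (d - i.1) : Fin 2 →₀ ℕ) := by
    intro i j h
    have := DFunLike.congr_fun h 0
    simpa [Fin.ext_iff] using this
  rw [MvPolynomial.eval_eq', binaryForm]
  have hsub : p.support ⊆ Finset.univ.image fun i : Fin (d + 1) =>
      (Finsupp.single 0 i.1 + Finsupp.single 1 (d - i.1) : Fin 2 →₀ ℕ) := by
    intro m hm
    have hdeg : m.degree = d := by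
      by_contra h
      exact MvPolynomial.mem_support_iff.1 hm (hp.coeff_eq_zero h)
    rw [Finsupp.degree_eq_sum, Fin.sum_univ_two] at hdeg
    refine Finset.mem_image.2 ⟨⟨m 0, by omega⟩, Finset.mem_univ _, ?_⟩
    ext i
    fin_cases i
    · simp
    · simp
      omega
  rw [Finset.sum_subset hsub fun m _ hm => by rw [MvPolynomial.notMem_support_iff.1 hm, zero_mul],
    Finset.sum_image fun i _ j _ h => hinj h]
  refine Finset.sum_congr rfl fun i _ => ?_
  rw [Fin.prod_univ_two]
  simp

theorem binaryForm_smul (a : Fin (d + 1) → ℂ) (c : ℂ) (y : Cone 1) :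
    binaryForm a (c • y) = c ^ d * binaryForm a y := by
  rw [binaryForm, binaryForm, Finset.mul_sum]
  refine Finset.sum_congr rfl fun i _ => ?_
  have h : c ^ d = c ^ i.1 * c ^ (d - i.1) := by
    rw [← pow_add]
    congr 1
    omega
  rw [h, Pi.smul_apply, Pi.smul_apply, smul_eq_mul, smul_eq_mul, mul_pow, mul_pow]
  ring

/-- `∑ A^l B^(n-1-l)`. -/
def geomPair (n : ℕ) (A B : ℂ) : ℂ := ∑ l ∈ Finset.range n, A ^ l * B ^ (n - 1 - l)

theorem sub_mul_geomPair (n : ℕ) (A B : ℂ) : (A - B) * geomPair n A B = A ^ n - B ^ n :=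
  (Commute.all A B).mul_geom_sum₂ n

theorem geomPair_smul (n : ℕ) (c A B : ℂ) :
    geomPair n (c * A) (c * B) = c ^ (n - 1) * geomPair n A B := by
  rw [geomPair, geomPair, Finset.mul_sum]
  refine Finset.sum_congr rfl fun l hl => ?_
  obtain ⟨j, hj⟩ : ∃ j, n - 1 = l + j := ⟨n - 1 - l, by have := Finset.mem_range.1 hl; omega⟩
  have : n - 1 - l = j := by omega
  rw [this, hj]
  ring

/-- The quotient of an antisymmetrized product of monomials by the determinant. -/
def monomialBezout (d i k : ℕ) (y y' : Cone 1) : ℂ :=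
  if k < i then (y 0 * y' 0) ^ k * (y 1 * y' 1) ^ (d - i) * geomPair (i - k) (y 0 * y' 1) (y 1 * y' 0)
  else -((y 0 * y' 0) ^ i * (y 1 * y' 1) ^ (d - k) * geomPair (k - i) (y 0 * y' 1) (y 1 * y' 0))

theorem det_mul_monomialBezout {i k : ℕ} (hi : i ≤ d) (hk : k ≤ d) (y y' : Cone 1) :
    (y 0 * y' 1 - y 1 * y' 0) * monomialBezout d i k y y' =
      y 0 ^ i * y 1 ^ (d - i) * (y' 0 ^ k * y' 1 ^ (d - k)) -
        y 0 ^ k * y 1 ^ (d - k) * (y' 0 ^ i * y' 1 ^ (d - i)) := by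
  rw [monomialBezout]
  split_ifs with h
  · obtain ⟨n, rfl⟩ : ∃ n, i = k + n := ⟨i - k, by omega⟩
    obtain ⟨e, rfl⟩ : ∃ e, d = k + n + e := ⟨d - (k + n), by omega⟩
    have h1 : k + n - k = n := by omega
    have h2 : k + n + e - (k + n) = e := by omega
    have h3 : k + n + e - k = n + e := by omega
    rw [h1, h2, h3]
    have := sub_mul_geomPair n (y 0 * y' 1) (y 1 * y' 0)
    linear_combination (y 0 * y' 0) ^ k * (y 1 * y' 1) ^ e * this
  · obtain ⟨n, rfl⟩ : ∃ n, k = i + n := ⟨k - i, by omega⟩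
    obtain ⟨e, rfl⟩ : ∃ e, d = i + n + e := ⟨d - (i + n), by omega⟩
    have h1 : i + n - i = n := by omega
    have h2 : i + n + e - (i + n) = e := by omega
    have h3 : i + n + e - i = n + e := by omega
    rw [h1, h2, h3]
    have := sub_mul_geomPair n (y 0 * y' 1) (y 1 * y' 0)
    linear_combination -(y 0 * y' 0) ^ i * (y 1 * y' 1) ^ e * this

theorem monomialBezout_swap (d i k : ℕ) (y y' : Cone 1) :
    monomialBezout d i k y' y = monomialBezout d i k y y' := by
  have h : ∀ n A B, geomPair n A B = geomPair n B A := by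
    intro n A B
    rw [geomPair, geomPair, ← Finset.sum_range_reflect]
    refine Finset.sum_congr rfl fun l hl => ?_
    have := Finset.mem_range.1 hl
    rw [show n - 1 - (n - 1 - l) = l by omega, mul_comm]
  rw [monomialBezout, monomialBezout, mul_comm (y' 0) (y 0), mul_comm (y' 1) (y 1),
    mul_comm (y' 0) (y 1), mul_comm (y' 1) (y 0), h _ (y 1 * y' 0) (y 0 * y' 1),
    h _ (y 1 * y' 0) (y 0 * y' 1)]

theorem monomialBezout_smul_left {i k : ℕ} (hi : i ≤ d) (hk : k ≤ d) (c : ℂ) (y y' : Cone 1) :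
    monomialBezout d i k (c • y) y' = c ^ (d - 1) * monomialBezout d i k y y' := by
  rw [monomialBezout, monomialBezout]
  simp only [Pi.smul_apply, smul_eq_mul, mul_assoc c, geomPair_smul]
  split_ifs with h
  · obtain ⟨n, rfl⟩ : ∃ n, i = k + n + 1 := ⟨i - k - 1, by omega⟩
    obtain ⟨e, rfl⟩ : ∃ e, d = k + n + 1 + e := ⟨d - (k + n + 1), by omega⟩
    rw [show k + n + 1 - k - 1 = n by omega, show k + n + 1 + e - (k + n + 1) = e by omega,
      show k + n + 1 + e - 1 = k + n + e by omega]
    ring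
  · rcases eq_or_ne i k with rfl | hne
    · simp [geomPair]
    obtain ⟨n, rfl⟩ : ∃ n, k = i + n + 1 := ⟨k - i - 1, by omega⟩
    obtain ⟨e, rfl⟩ : ∃ e, d = i + n + 1 + e := ⟨d - (i + n + 1), by omega⟩
    rw [show i + n + 1 - i - 1 = n by omega, show i + n + 1 + e - (i + n + 1) = e by omega,
      show i + n + 1 + e - 1 = i + n + e by omega]
    ring

/-- The quotient of `P(y) Q(y') - Q(y) P(y')` by `z w' - w z'`, for binary forms `P` and `Q`. -/
def bezout (a b : Fin (d + 1) → ℂ) (y y' : Cone 1) : ℂ :=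
  ∑ i : Fin (d + 1), ∑ k : Fin (d + 1), a i * b k * monomialBezout d i.1 k.1 y y'

/-- Bilinearity reduces this to pairs of monomials. Dividing out the diagonal leaves a form of
degree `d - 1` in each point, whose zeros outside the diagonal are the pairs with proportional
values. -/
theorem det_mul_bezout (a b : Fin (d + 1) → ℂ) (y y' : Cone 1) :
    (y 0 * y' 1 - y 1 * y' 0) * bezout a b y y' =
      binaryForm a y * binaryForm b y' - binaryForm b y * binaryForm a y' := by
  rw [mul_comm (binaryForm b y)]
  unfold bezout binaryForm
  rw [Finset.sum_mul_sum, Finset.sum_mul_sum, ← Finset.sum_sub_distrib, Finset.mul_sum]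
  refine Finset.sum_congr rfl fun i _ => ?_
  rw [← Finset.sum_sub_distrib, Finset.mul_sum]
  refine Finset.sum_congr rfl fun k _ => ?_
  linear_combination (a i * b k) * det_mul_monomialBezout (d := d) (i := i.1) (k := k.1)
    (by omega) (by omega) y y'

theorem bezout_smul_left (a b : Fin (d + 1) → ℂ) (c : ℂ) (y y' : Cone 1) :
    bezout a b (c • y) y' = c ^ (d - 1) * bezout a b y y' := by
  simp only [bezout, Finset.mul_sum]
  refine Finset.sum_congr rfl fun i _ => Finset.sum_congr rfl fun k _ => ?_
  rw [monomialBezout_smul_left (by omega) (by omega)]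
  ring

theorem bezout_swap (a b : Fin (d + 1) → ℂ) (y y' : Cone 1) :
    bezout a b y' y = bezout a b y y' := by
  simp only [bezout, monomialBezout_swap]

theorem bezout_smul_right (a b : Fin (d + 1) → ℂ) (c : ℂ) (y y' : Cone 1) :
    bezout a b y (c • y') = c ^ (d - 1) * bezout a b y y' := by
  rw [bezout_swap, bezout_smul_left, bezout_swap]

theorem differentiable_bezout (a b : Fin (d + 1) → ℂ) (y : Cone 1) :
    Differentiable ℂ fun y' => bezout a b y y' := by
  unfold bezout
  refine Differentiable.fun_sum fun i _ => Differentiable.fun_sum fun k _ =>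
    Differentiable.const_mul ?_ _
  unfold monomialBezout geomPair
  split_ifs <;> fun_prop

theorem continuous_bezout (a b : Fin (d + 1) → ℂ) :
    Continuous fun q : Cone 1 × Cone 1 => bezout a b q.1 q.2 := by
  unfold bezout
  refine continuous_finsetSum _ fun i _ => continuous_finsetSum _ fun k _ => ?_
  unfold monomialBezout geomPair
  split_ifs <;> fun_prop

theorem exists_eq_smul_of_det_eq_zero {y y' : Cone 1} (hy : y ≠ 0)
    (h : y 0 * y' 1 - y 1 * y' 0 = 0) : ∃ c : ℂ, y' = c • y := by
  by_cases h0 : y 0 = 0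
  · have h1 : y 1 ≠ 0 := by
      intro h1
      refine hy (funext fun i => ?_)
      fin_cases i
      · exact h0
      · exact h1
    refine ⟨y' 1 / y 1, funext fun i => ?_⟩
    have h2 : y' 0 = 0 := by
      rw [h0, zero_mul, zero_sub, neg_eq_zero] at h
      exact (mul_eq_zero.1 h).resolve_left h1
    fin_cases i
    · simp [h0, h2]
    · simp [h1]
  · refine ⟨y' 0 / y 0, funext fun i => ?_⟩
    fin_cases i
    · simp [h0]
    · simp only [Fin.mk_one, Pi.smul_apply, smul_eq_mul]
      rw [div_mul_eq_mul_div, eq_div_iff h0]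
      linear_combination h

end BinaryForms

/-! ### The one-dimensional maps -/

namespace Triple

variable {d : ℕ} (τ : Triple d)

/-- The lift `(P, Q)` of the map of the projective line. -/
def base (Y : Cone 1) : Cone 1 := ![MvPolynomial.eval Y τ.P, MvPolynomial.eval Y τ.Q]

/-- The third form. -/
def third (Y : Cone 1) : ℂ := MvPolynomial.eval Y τ.R

theorem isConeMap_base : IsConeMap τ.base d where
  contDiff := by
    refine contDiff_pi.2 fun i => ?_
    fin_cases i
    · exact (AnalyticOnNhd.eval_mvPolynomial (𝕜 := ℂ) τ.P).contDiff
    · exact (AnalyticOnNhd.eval_mvPolynomial (𝕜 := ℂ) τ.Q).contDiff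
  smul c Y := by
    funext i
    fin_cases i
    · exact eval_smul_of_isHomogeneous τ.homP c Y
    · exact eval_smul_of_isHomogeneous τ.homQ c Y
  ne_zero Y hY h := hY (τ.eq_zero_of_eval Y (congrFun h 0) (congrFun h 1))

theorem continuous_base : Continuous τ.base := τ.isConeMap_base.contDiff.continuous

theorem continuous_third : Continuous τ.third :=
  (AnalyticOnNhd.eval_mvPolynomial (𝕜 := ℂ) τ.R).contDiff (n := 0) |>.continuous

theorem base_smul (c : ℂ) (Y : Cone 1) : τ.base (c • Y) = c ^ d • τ.base Y := τ.isConeMap_base.smul c Y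

theorem base_ne_zero {Y : Cone 1} (hY : Y ≠ 0) : τ.base Y ≠ 0 := τ.isConeMap_base.ne_zero Y hY

theorem third_smul (c : ℂ) (Y : Cone 1) : τ.third (c • Y) = c ^ d * τ.third Y :=
  eval_smul_of_isHomogeneous τ.homR c Y

theorem base_zero_eq (Y : Cone 1) :
    τ.base Y 0 = binaryForm (fun i => τ.coeffs (0, i)) Y := eval_eq_binaryForm τ.homP Y

theorem base_one_eq (Y : Cone 1) :
    τ.base Y 1 = binaryForm (fun i => τ.coeffs (1, i)) Y := eval_eq_binaryForm τ.homQ Y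

theorem third_eq (Y : Cone 1) :
    τ.third Y = binaryForm (fun i => τ.coeffs (2, i)) Y := eval_eq_binaryForm τ.homR Y

/-- The correspondence of the pairs of distinct points with the same image. -/
def conjugacy (Y Y' : Cone 1) : ℂ :=
  bezout (fun i => τ.coeffs (0, i)) (fun i => τ.coeffs (1, i)) Y Y'

theorem det_mul_conjugacy (Y Y' : Cone 1) : (Y 0 * Y' 1 - Y 1 * Y' 0) * τ.conjugacy Y Y' =
    τ.base Y 0 * τ.base Y' 1 - τ.base Y 1 * τ.base Y' 0 := by
  rw [conjugacy, det_mul_bezout, base_zero_eq, base_zero_eq, base_one_eq, base_one_eq]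

theorem exists_pow_eq {n : ℕ} (hn : n ≠ 0) (c : ℂ) : ∃ x : ℂ, x ^ n = c :=
  IsAlgClosed.exists_pow_nat_eq c (Nat.pos_of_ne_zero hn)

/-- A zero of the determinant of `Y` and `τ.base Z` maps to the line of `Y`; a `d`-th root adjusts
the lift. -/
theorem exists_base_eq (hd : d ≠ 0) (Y : Cone 1) (hY : Y ≠ 0) : ∃ Z, Z ≠ 0 ∧ τ.base Z = Y := by
  have hdiff : Differentiable ℂ τ.base := τ.isConeMap_base.contDiff.differentiable (by simp)
  obtain ⟨Z, hZ, h⟩ := exists_ne_zero_apply_eq_zero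
    (g := fun Z => Y 0 * τ.base Z 1 - Y 1 * τ.base Z 0)
    (((differentiable_pi.1 hdiff 1).const_mul _).sub ((differentiable_pi.1 hdiff 0).const_mul _)) hd
    (fun c x => by
      rw [base_smul]
      simp only [Pi.smul_apply, smul_eq_mul]
      ring)
  obtain ⟨c, hc⟩ := exists_eq_smul_of_det_eq_zero hY h
  have hc0 : c ≠ 0 := by
    rintro rfl
    rw [zero_smul] at hc
    exact τ.base_ne_zero hZ hc
  obtain ⟨s, hs⟩ := exists_pow_eq hd c⁻¹
  have hs0 : s ≠ 0 := by
    rintro rfl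
    rw [zero_pow hd] at hs
    exact inv_ne_zero hc0 hs.symm
  exact ⟨s • Z, smul_ne_zero hs0 hZ, by rw [base_smul, hs, hc, smul_smul, inv_mul_cancel₀ hc0, one_smul]⟩

/-- Fixed points on the projective line are zeros of a form of degree `d + 1`; rescaling by a root
of order `d - 1` makes the lift itself fixed. -/
theorem exists_base_eq_self (hd : 2 ≤ d) : ∃ Y, Y ≠ 0 ∧ τ.base Y = Y := by
  have hdiff : Differentiable ℂ τ.base := τ.isConeMap_base.contDiff.differentiable (by simp)
  obtain ⟨Z, hZ, h⟩ := exists_ne_zero_apply_eq_zero (D := d + 1)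
    (g := fun Z => Z 0 * τ.base Z 1 - Z 1 * τ.base Z 0)
    (((differentiable_apply 0).mul (differentiable_pi.1 hdiff 1)).sub
      ((differentiable_apply 1).mul (differentiable_pi.1 hdiff 0))) (by omega)
    (fun c x => by
      rw [base_smul]
      simp only [Pi.smul_apply, smul_eq_mul]
      ring)
  obtain ⟨c, hc⟩ := exists_eq_smul_of_det_eq_zero hZ h
  have hc0 : c ≠ 0 := by
    rintro rfl
    rw [zero_smul] at hc
    exact τ.base_ne_zero hZ hc
  obtain ⟨s, hs⟩ := exists_pow_eq (n := d - 1) (by omega) c⁻¹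
  have hs0 : s ≠ 0 := by
    rintro rfl
    rw [zero_pow (by omega)] at hs
    exact inv_ne_zero hc0 hs.symm
  refine ⟨s • Z, smul_ne_zero hs0 hZ, ?_⟩
  have h1 : s ^ d = s ^ (d - 1) * s := by rw [← pow_succ]; congr 1; omega
  rw [base_smul, h1, hs, hc, smul_smul]
  congr 1
  field_simp

/-- The correspondence has positive degree `d - 1` in the second point, so a conjugate point exists.
It may coincide projectively with `Y`. -/
theorem exists_conjugacy_eq_zero (hd : 2 ≤ d) (Y : Cone 1) (hY : Y ≠ 0) :
    ∃ Z, Z ≠ 0 ∧ τ.conjugacy Y Z = 0 ∧ τ.base Z = τ.base Y := by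
  obtain ⟨Z, hZ, h⟩ := exists_ne_zero_apply_eq_zero (differentiable_bezout (fun i => τ.coeffs (0, i))
    (fun i => τ.coeffs (1, i)) Y) (D := d - 1) (by omega) (fun c x => bezout_smul_right _ _ c Y x)
  have h1 := τ.det_mul_conjugacy Y Z
  rw [conjugacy, h, mul_zero] at h1
  obtain ⟨c, hc⟩ := exists_eq_smul_of_det_eq_zero (τ.base_ne_zero hY) h1.symm
  have hc0 : c ≠ 0 := by
    rintro rfl
    rw [zero_smul] at hc
    exact τ.base_ne_zero hZ hc
  obtain ⟨s, hs⟩ := exists_pow_eq (n := d) (by omega) c⁻¹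
  have hs0 : s ≠ 0 := by
    rintro rfl
    rw [zero_pow (by omega)] at hs
    exact inv_ne_zero hc0 hs.symm
  refine ⟨s • Z, smul_ne_zero hs0 hZ, ?_, ?_⟩
  · rw [conjugacy, bezout_smul_right, h, mul_zero]
  · rw [base_smul, hs, hc, smul_smul, inv_mul_cancel₀ hc0, one_smul]

end Triple

/-! ### Rescaled homogeneous coordinates -/

section Rescaled

variable {d : ℕ} {ε₁ ε₂ : ℂ}

/-- The point of the cone with rescaled coordinates `p`. -/
def unscale (ε₁ ε₂ : ℂ) (p : Cone 1 × ℂ × ℂ) : Cone 3 := ![p.1 0, p.1 1, ε₁ * p.2.1, ε₂ * p.2.2]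

theorem unscale_smul (s : ℂ) (p : Cone 1 × ℂ × ℂ) :
    unscale ε₁ ε₂ (s • p) = s • unscale ε₁ ε₂ p := by
  funext i
  fin_cases i
  · rfl
  · rfl
  · simp [unscale, mul_left_comm]
  · simp [unscale, mul_left_comm]

theorem unscale_injective (h₁ : ε₁ ≠ 0) (h₂ : ε₂ ≠ 0) : Function.Injective (unscale ε₁ ε₂) := by
  intro p q h
  have h0 := congrFun h 0
  have h1 := congrFun h 1
  have h2 := congrFun h 2
  have h3 := congrFun h 3
  simp only [unscale, Matrix.cons_val] at h0 h1 h2 h3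
  refine Prod.ext (funext fun i => ?_) (Prod.ext (mul_left_cancel₀ h₁ h2) (mul_left_cancel₀ h₂ h3))
  fin_cases i
  · exact h0
  · exact h1

theorem exists_unscale_eq (h₁ : ε₁ ≠ 0) (h₂ : ε₂ ≠ 0) (x : Cone 3) :
    unscale ε₁ ε₂ (![x 0, x 1], ε₁⁻¹ * x 2, ε₂⁻¹ * x 3) = x := by
  funext i
  fin_cases i
  · rfl
  · rfl
  · simp [unscale, h₁]
  · simp [unscale, h₂]

/-- `p` is a tuple of rescaled homogeneous coordinates of `x`. -/
def IsCoord (ε₁ ε₂ : ℂ) (x : PSpace 3) (p : Cone 1 × ℂ × ℂ) : Prop :=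
  ∃ h : unscale ε₁ ε₂ p ≠ 0, x = Projectivization.mk ℂ (unscale ε₁ ε₂ p) h

theorem IsCoord.smul {x : PSpace 3} {p : Cone 1 × ℂ × ℂ} (h : IsCoord ε₁ ε₂ x p) {s : ℂ}
    (hs : s ≠ 0) : IsCoord ε₁ ε₂ x (s • p) := by
  obtain ⟨h0, rfl⟩ := h
  have h1 : unscale ε₁ ε₂ (s • p) ≠ 0 := by
    rw [unscale_smul]
    exact smul_ne_zero hs h0
  refine ⟨h1, ?_⟩
  rw [Projectivization.mk_eq_mk_iff']
  refine ⟨s⁻¹, ?_⟩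
  rw [unscale_smul, smul_smul, inv_mul_cancel₀ hs, one_smul]

theorem IsCoord.eq_smul (h₁ : ε₁ ≠ 0) (h₂ : ε₂ ≠ 0) {x : PSpace 3} {p q : Cone 1 × ℂ × ℂ}
    (hp : IsCoord ε₁ ε₂ x p) (hq : IsCoord ε₁ ε₂ x q) : ∃ s : ℂ, s ≠ 0 ∧ q = s • p := by
  obtain ⟨h0, rfl⟩ := hp
  obtain ⟨h1, h⟩ := hq
  obtain ⟨s, hs⟩ := (Projectivization.mk_eq_mk_iff' ℂ _ _ _ _).1 h.symm
  refine ⟨s, ?_, unscale_injective h₁ h₂ ?_⟩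
  · rintro rfl
    rw [zero_smul] at hs
    exact h1 hs.symm
  · rw [unscale_smul, hs]

theorem IsCoord.unique {x y : PSpace 3} {p : Cone 1 × ℂ × ℂ}
    (hx : IsCoord ε₁ ε₂ x p) (hy : IsCoord ε₁ ε₂ y p) : x = y := by
  obtain ⟨_, rfl⟩ := hx
  obtain ⟨_, rfl⟩ := hy
  rfl

theorem exists_isCoord (h₁ : ε₁ ≠ 0) (h₂ : ε₂ ≠ 0) (x : PSpace 3) : ∃ p, IsCoord ε₁ ε₂ x p := by
  obtain ⟨x, hx, rfl⟩ := PSpace.exists_mk_eq x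
  refine ⟨(![x 0, x 1], ε₁⁻¹ * x 2, ε₂⁻¹ * x 3), ?_⟩
  rw [IsCoord, exists_unscale_eq h₁ h₂]
  exact ⟨hx, rfl⟩

theorem isCoord_mk {p : Cone 1 × ℂ × ℂ} (hp : p.1 ≠ 0) :
    ∃ x, IsCoord ε₁ ε₂ x p := by
  refine ⟨_, fun h => hp (funext fun i => ?_), rfl⟩
  fin_cases i
  · exact congrFun h 0
  · exact congrFun h 1

/-- The neighbourhoods of the line `t = u = 0`. -/
def openTube (ε₁ ε₂ : ℂ) (r : ℝ) : Set (PSpace 3) :=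
  {x | ∃ p, ‖p.2.1‖ < r * ‖p.1‖ ∧ ‖p.2.2‖ < r * ‖p.1‖ ∧ IsCoord ε₁ ε₂ x p}

/-- The closed neighbourhoods of the line `t = u = 0`. -/
def closedTube (ε₁ ε₂ : ℂ) (r : ℝ) : Set (PSpace 3) :=
  {x | ∃ p, ‖p.2.1‖ ≤ r * ‖p.1‖ ∧ ‖p.2.2‖ ≤ r * ‖p.1‖ ∧ IsCoord ε₁ ε₂ x p}

theorem mk_mem_openTube_iff (h₁ : ε₁ ≠ 0) (h₂ : ε₂ ≠ 0) (r : ℝ) (x : Cone 3) (hx : x ≠ 0) :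
    Projectivization.mk ℂ x hx ∈ openTube ε₁ ε₂ r ↔
      x ∈ {x : Cone 3 | ‖ε₁⁻¹ * x 2‖ < r * ‖(![x 0, x 1] : Cone 1)‖ ∧
        ‖ε₂⁻¹ * x 3‖ < r * ‖(![x 0, x 1] : Cone 1)‖} := by
  have h0 : IsCoord ε₁ ε₂ (Projectivization.mk ℂ x hx)
      (![x 0, x 1], ε₁⁻¹ * x 2, ε₂⁻¹ * x 3) := by
    rw [IsCoord, exists_unscale_eq h₁ h₂]
    exact ⟨hx, rfl⟩
  constructor
  · rintro ⟨p, hp1, hp2, hp⟩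
    obtain ⟨s, hs, h⟩ := hp.eq_smul h₁ h₂ h0
    have e1 : (![x 0, x 1] : Cone 1) = s • p.1 := congrArg Prod.fst h
    have e2 : ε₁⁻¹ * x 2 = s * p.2.1 := congrArg (fun q => q.2.1) h
    have e3 : ε₂⁻¹ * x 3 = s * p.2.2 := congrArg (fun q => q.2.2) h
    have hs' := norm_pos_iff.2 hs
    simp only [Set.mem_ofPred_eq]
    rw [e1, e2, e3, norm_smul, norm_mul, norm_mul]
    constructor <;> nlinarith
  · rintro ⟨hp1, hp2⟩
    exact ⟨_, hp1, hp2, h0⟩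

theorem mk_mem_closedTube_iff (h₁ : ε₁ ≠ 0) (h₂ : ε₂ ≠ 0) (r : ℝ) (x : Cone 3) (hx : x ≠ 0) :
    Projectivization.mk ℂ x hx ∈ closedTube ε₁ ε₂ r ↔
      x ∈ {x : Cone 3 | ‖ε₁⁻¹ * x 2‖ ≤ r * ‖(![x 0, x 1] : Cone 1)‖ ∧
        ‖ε₂⁻¹ * x 3‖ ≤ r * ‖(![x 0, x 1] : Cone 1)‖} := by
  have h0 : IsCoord ε₁ ε₂ (Projectivization.mk ℂ x hx)
      (![x 0, x 1], ε₁⁻¹ * x 2, ε₂⁻¹ * x 3) := by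
    rw [IsCoord, exists_unscale_eq h₁ h₂]
    exact ⟨hx, rfl⟩
  constructor
  · rintro ⟨p, hp1, hp2, hp⟩
    obtain ⟨s, hs, h⟩ := hp.eq_smul h₁ h₂ h0
    have e1 : (![x 0, x 1] : Cone 1) = s • p.1 := congrArg Prod.fst h
    have e2 : ε₁⁻¹ * x 2 = s * p.2.1 := congrArg (fun q => q.2.1) h
    have e3 : ε₂⁻¹ * x 3 = s * p.2.2 := congrArg (fun q => q.2.2) h
    have hs' := norm_pos_iff.2 hs
    simp only [Set.mem_ofPred_eq]
    rw [e1, e2, e3, norm_smul, norm_mul, norm_mul]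
    constructor <;> nlinarith
  · rintro ⟨hp1, hp2⟩
    exact ⟨_, hp1, hp2, h0⟩

theorem isOpen_openTube (h₁ : ε₁ ≠ 0) (h₂ : ε₂ ≠ 0) (r : ℝ) : IsOpen (openTube ε₁ ε₂ r) := by
  refine PSpace.isOpen_of_cone ?_ (mk_mem_openTube_iff h₁ h₂ r)
  refine IsOpen.and (isOpen_lt ?_ ?_) (isOpen_lt ?_ ?_)
  · fun_prop
  · refine continuous_const.mul (Continuous.norm (continuous_pi fun i => ?_))
    fin_cases i <;> simp <;> fun_prop
  · fun_prop
  · refine continuous_const.mul (Continuous.norm (continuous_pi fun i => ?_))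
    fin_cases i <;> simp <;> fun_prop

theorem isClosed_closedTube (h₁ : ε₁ ≠ 0) (h₂ : ε₂ ≠ 0) (r : ℝ) :
    IsClosed (closedTube ε₁ ε₂ r) := by
  refine PSpace.isClosed_of_cone ?_ (mk_mem_closedTube_iff h₁ h₂ r)
  refine IsClosed.inter (s₁ := {x : Cone 3 | ‖ε₁⁻¹ * x 2‖ ≤ r * ‖(![x 0, x 1] : Cone 1)‖})
    (s₂ := {x : Cone 3 | ‖ε₂⁻¹ * x 3‖ ≤ r * ‖(![x 0, x 1] : Cone 1)‖})
    (isClosed_le ?_ ?_) (isClosed_le ?_ ?_)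
  · fun_prop
  · refine continuous_const.mul (Continuous.norm (continuous_pi fun i => ?_))
    fin_cases i <;> simp <;> fun_prop
  · fun_prop
  · refine continuous_const.mul (Continuous.norm (continuous_pi fun i => ?_))
    fin_cases i <;> simp <;> fun_prop

theorem IsCoord.fst_ne_zero {x : PSpace 3} {p : Cone 1 × ℂ × ℂ} (h : IsCoord ε₁ ε₂ x p) {r : ℝ}
    (h1 : ‖p.2.1‖ ≤ r * ‖p.1‖) (h2 : ‖p.2.2‖ ≤ r * ‖p.1‖) : p.1 ≠ 0 := by
  intro h0
  rw [h0, norm_zero, mul_zero] at h1 h2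
  obtain ⟨h, -⟩ := h
  refine h (funext fun i => ?_)
  fin_cases i
  · simp [unscale, h0]
  · simp [unscale, h0]
  · simp [unscale, norm_le_zero_iff.1 h1]
  · simp [unscale, norm_le_zero_iff.1 h2]

/-- Closed tubes of small radius are contained in any given neighbourhood of the line. -/
theorem exists_closedTube_subset {O : Set (PSpace 3)} (hO : IsOpen O)
    (h : ∀ x hx, x 2 = 0 → x 3 = 0 → Projectivization.mk ℂ x hx ∈ O) :
    ∃ κ : ℝ, 0 < κ ∧ ∀ (ε₁ ε₂ : ℂ) (r : ℝ), ε₁ ≠ 0 → ε₂ ≠ 0 → ‖ε₁‖ * r ≤ κ → ‖ε₂‖ * r ≤ κ →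
      closedTube ε₁ ε₂ r ⊆ O := by
  let g : Cone 3 → ℝ := fun x => max ‖x 2‖ ‖x 3‖
  have hg : Continuous g := by fun_prop
  let S : Set (Cone 3) := {x | ∀ hx : x ≠ 0, Projectivization.mk ℂ x hx ∉ O} ∩ Metric.sphere 0 1
  have hS : IsCompact S := by
    refine (isCompact_sphere _ _).of_isClosed_subset ?_ Set.inter_subset_right
    have ho : IsOpen {x : Cone 3 | ∃ hx : x ≠ 0, Projectivization.mk ℂ x hx ∈ O} := by
      have h1 : IsOpen (Projectivization.mk' ℂ (V := Cone 3) ⁻¹' O) :=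
        hO.preimage PSpace.continuous_mk'
      have h2 := (isOpen_compl_singleton (x := (0 : Cone 3))).isOpenMap_subtype_val _ h1
      convert h2 using 1
      ext x
      constructor
      · rintro ⟨hx, h⟩
        exact ⟨⟨x, hx⟩, h, rfl⟩
      · rintro ⟨⟨y, hy⟩, h, rfl⟩
        exact ⟨hy, h⟩
    have : S = {x : Cone 3 | ∃ hx : x ≠ 0, Projectivization.mk ℂ x hx ∈ O}ᶜ ∩ Metric.sphere 0 1 := by
      ext x
      simp [S]
    rw [this]
    exact ho.isClosed_compl.inter Metric.isClosed_sphere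
  -- The function vanishes only on the line, so it has a positive lower bound on the compact part of
  -- the sphere lying outside `O`.
  obtain ⟨κ, hκ, hmin⟩ := hS.exists_forall_le' hg.continuousOn (a := 0) fun x hx => by
    by_contra hle
    have hx0 : x ≠ 0 := by
      rintro rfl
      simpa using hx.2
    have h0 : g x ≤ 0 := not_lt.1 hle
    refine hx.1 hx0 (h x hx0 ?_ ?_)
    · exact norm_le_zero_iff.1 ((le_max_left _ _).trans h0)
    · exact norm_le_zero_iff.1 ((le_max_right _ _).trans h0)
  refine ⟨κ / 2, by positivity, ?_⟩
  rintro ε₁ ε₂ r h₁ h₂ hr1 hr2 x ⟨p, hp1, hp2, hp⟩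
  by_contra hxO
  obtain ⟨h0, rfl⟩ := hp
  set y := unscale ε₁ ε₂ p with hy
  have hyn : (‖y‖ : ℂ)⁻¹ ≠ 0 := by simpa using h0
  have hyS : (‖y‖ : ℂ)⁻¹ • y ∈ S := by
    refine ⟨fun hx => ?_, ?_⟩
    · rw [PSpace.mk_smul y h0]
      exact hxO
    · simp [norm_smul, h0]
  have hle := hmin _ hyS
  have hy0 : 0 < ‖y‖ := norm_pos_iff.2 h0
  have hp1y : ‖p.1‖ ≤ ‖y‖ := by
    refine (pi_norm_le_iff_of_nonneg hy0.le).2 fun i => ?_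
    fin_cases i
    · exact norm_le_pi_norm y 0
    · exact norm_le_pi_norm y 1
  have hgy : g ((‖y‖ : ℂ)⁻¹ • y) ≤ κ / 2 := by
    refine max_le ?_ ?_
    · have : ‖y 2‖ ≤ κ / 2 * ‖y‖ := by
        have e : y 2 = ε₁ * p.2.1 := rfl
        rw [e, norm_mul]
        calc ‖ε₁‖ * ‖p.2.1‖ ≤ ‖ε₁‖ * (r * ‖p.1‖) := by gcongr
          _ = (‖ε₁‖ * r) * ‖p.1‖ := by ring
          _ ≤ κ / 2 * ‖y‖ := by gcongr
      rw [Pi.smul_apply, norm_smul, norm_inv, Complex.norm_real, norm_norm, inv_mul_le_iff₀ hy0]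
      linarith
    · have : ‖y 3‖ ≤ κ / 2 * ‖y‖ := by
        have e : y 3 = ε₂ * p.2.2 := rfl
        rw [e, norm_mul]
        calc ‖ε₂‖ * ‖p.2.2‖ ≤ ‖ε₂‖ * (r * ‖p.1‖) := by gcongr
          _ = (‖ε₂‖ * r) * ‖p.1‖ := by ring
          _ ≤ κ / 2 * ‖y‖ := by gcongr
      rw [Pi.smul_apply, norm_smul, norm_inv, Complex.norm_real, norm_norm, inv_mul_le_iff₀ hy0]
      linarith
  linarith

end Rescaled

/-! ### The dynamics in rescaled coordinates -/

namespace Triple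

variable {d : ℕ} (τ : Triple d)

/-- The lift of the endomorphism in rescaled coordinates. -/
def step (ε₁ ε₂ : ℂ) (p : Cone 1 × ℂ × ℂ) : Cone 1 × ℂ × ℂ :=
  (τ.base p.1, τ.third p.1 + ε₁ ^ (d - 1) * p.2.1 ^ d,
    τ.base p.1 1 + ε₂ ^ (d - 1) * (p.2.2 ^ d - p.1 1 ^ d))

variable {ε₁ ε₂ : ℂ}

theorem step_smul (s : ℂ) (p : Cone 1 × ℂ × ℂ) :
    τ.step ε₁ ε₂ (s • p) = s ^ d • τ.step ε₁ ε₂ p := by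
  refine Prod.ext (τ.base_smul s p.1) (Prod.ext ?_ ?_)
  · have := τ.third_smul s p.1
    simp only [step, Prod.smul_fst, Prod.smul_snd, smul_eq_mul, mul_pow, this]
    ring
  · have := congrFun (τ.base_smul s p.1) 1
    simp only [step, Prod.smul_fst, Prod.smul_snd, smul_eq_mul, mul_pow, this, Pi.smul_apply]
    ring

/-- Dividing the last two components by `ε₁` and `ε₂` leaves the factors `ε₁ ^ (d - 1)` and `ε₂ ^ (d
- 1)` on the terms depending on the old transverse coordinates, which are small because `d ≥ 2`. -/
theorem coneMap_unscale (hd : 2 ≤ d) (p : Cone 1 × ℂ × ℂ) :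
    (τ.toEndo hd ε₁ ε₂).coneMap (unscale ε₁ ε₂ p) = unscale ε₁ ε₂ (τ.step ε₁ ε₂ p) := by
  have hY : (![unscale ε₁ ε₂ p 0, unscale ε₁ ε₂ p 1] : Cone 1) = p.1 := by
    funext i
    fin_cases i <;> rfl
  have hd' : ∀ ε : ℂ, ε ^ d = ε * ε ^ (d - 1) := fun ε => by
    rw [← pow_succ']
    congr 1
    omega
  have hY' : (![p.1 0, p.1 1] : Cone 1) = p.1 := hY
  funext i
  fin_cases i
  · simp [Endo.coneMap, toEndo, eval_inZW, unscale, step, base, hY']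
  · simp [Endo.coneMap, toEndo, eval_inZW, unscale, step, base, hY']
  · simp [Endo.coneMap, toEndo, eval_inZW, unscale, step, third, hY', mul_pow, hd']
    ring
  · simp [Endo.coneMap, toEndo, eval_inZW, unscale, step, base, hY', mul_pow, hd']
    ring

theorem isCoord_step (hd : 2 ≤ d) {x : PSpace 3} {p : Cone 1 × ℂ × ℂ}
    (h : IsCoord ε₁ ε₂ x p) :
    IsCoord ε₁ ε₂ (τ.toEndo hd ε₁ ε₂ x) (τ.step ε₁ ε₂ p) := by
  obtain ⟨h0, rfl⟩ := h
  have h1 := (τ.toEndo hd ε₁ ε₂).coneMap_ne_zero h0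
  have h2 := τ.coneMap_unscale hd (ε₁ := ε₁) (ε₂ := ε₂) p
  refine ⟨h2 ▸ h1, ?_⟩
  rw [Endo.apply_mk]
  congr 1

theorem isCoord_iterate (hd : 2 ≤ d) {x : PSpace 3} {p : Cone 1 × ℂ × ℂ}
    (h : IsCoord ε₁ ε₂ x p) (n : ℕ) :
    IsCoord ε₁ ε₂ ((τ.toEndo hd ε₁ ε₂)^[n] x) ((τ.step ε₁ ε₂)^[n] p) := by
  induction n with
  | zero => exact h
  | succ n ih =>
    rw [Function.iterate_succ_apply', Function.iterate_succ_apply']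
    exact τ.isCoord_step hd ih

theorem step_iterate_fst (n : ℕ) (p : Cone 1 × ℂ × ℂ) :
    ((τ.step ε₁ ε₂)^[n] p).1 = τ.base^[n] p.1 := by
  induction n with
  | zero => rfl
  | succ n ih =>
    rw [Function.iterate_succ_apply', Function.iterate_succ_apply', ← ih]
    rfl

theorem base_iterate_smul (n : ℕ) (s : ℂ) (Y : Cone 1) :
    τ.base^[n] (s • Y) = s ^ d ^ n • τ.base^[n] Y := by
  induction n with
  | zero => simp
  | succ n ih =>
    rw [Function.iterate_succ_apply', Function.iterate_succ_apply', ih, base_smul, ← pow_mul,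
      pow_succ]

theorem step_iterate_smul (n : ℕ) (s : ℂ) (p : Cone 1 × ℂ × ℂ) :
    (τ.step ε₁ ε₂)^[n] (s • p) = s ^ d ^ n • (τ.step ε₁ ε₂)^[n] p := by
  induction n with
  | zero => simp
  | succ n ih =>
    rw [Function.iterate_succ_apply', Function.iterate_succ_apply', ih, step_smul, ← pow_mul,
      pow_succ]

theorem base_iterate_ne_zero (n : ℕ) {Y : Cone 1} (hY : Y ≠ 0) : τ.base^[n] Y ≠ 0 := by
  induction n with
  | zero => exact hY
  | succ n ih =>
    rw [Function.iterate_succ_apply']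
    exact τ.base_ne_zero ih

/-- Two-sided bounds for the lifts. -/
theorem exists_bounds : ∃ c C : ℝ, 0 < c ∧ 0 < C ∧ ∀ Y : Cone 1,
    c * ‖Y‖ ^ d ≤ ‖τ.base Y‖ ∧ ‖τ.base Y‖ ≤ C * ‖Y‖ ^ d ∧ ‖τ.third Y‖ ≤ C * ‖Y‖ ^ d := by
  have hK : IsCompact (Metric.sphere (0 : Cone 1) 1) := isCompact_sphere _ _
  obtain ⟨c, hc, hc'⟩ := hK.exists_forall_le' (f := fun Y => ‖τ.base Y‖) (a := 0)
    τ.continuous_base.norm.continuousOn fun Y hY => norm_pos_iff.2 (τ.base_ne_zero (by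
      rintro rfl
      simp at hY))
  obtain ⟨C₁, hC₁⟩ := hK.exists_bound_of_continuousOn τ.continuous_base.continuousOn
  obtain ⟨C₂, hC₂⟩ := hK.exists_bound_of_continuousOn τ.continuous_third.continuousOn
  refine ⟨c, max 1 (max C₁ C₂), hc, by positivity, fun Y => ?_⟩
  rcases eq_or_ne Y 0 with rfl | hY
  -- For `d = 0` one has `‖0‖ ^ d = 1`, so the bounds at the origin are not trivial; the maps are
  -- then constant and the bounds on the sphere apply.
  · rcases Nat.eq_zero_or_pos d with hd | hd
    · subst hd
      have h1 : ∀ Y : Cone 1, τ.base Y = τ.base 0 := fun Y => by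
        have := τ.base_smul 0 Y
        simpa using this.symm
      have h2 : ∀ Y : Cone 1, τ.third Y = τ.third 0 := fun Y => by
        have := τ.third_smul 0 Y
        simpa using this.symm
      obtain ⟨Y, hY⟩ : (Metric.sphere (0 : Cone 1) 1).Nonempty :=
        NormedSpace.sphere_nonempty.2 zero_le_one
      have e1 := hc' Y hY
      have e2 := hC₁ Y hY
      have e3 := hC₂ Y hY
      simp only [h1 Y, h2 Y] at e1 e2 e3
      simp only [pow_zero, mul_one]
      exact ⟨e1, e2.trans (le_max_of_le_right (le_max_left _ _)),
        e3.trans (le_max_of_le_right (le_max_right _ _))⟩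
    · have h1 : τ.base (0 : Cone 1) = 0 := by
        have := τ.base_smul 0 0
        rwa [zero_pow hd.ne', zero_smul, zero_smul] at this
      have h2 : τ.third (0 : Cone 1) = 0 := by
        have := τ.third_smul 0 0
        rwa [zero_pow hd.ne', zero_smul, zero_mul] at this
      simp [h1, h2, hd.ne']
  · have hY0 : (‖Y‖ : ℂ) ≠ 0 := by simpa using hY
    have hYn : 0 < ‖Y‖ := norm_pos_iff.2 hY
    set Z := (‖Y‖ : ℂ)⁻¹ • Y with hZ
    have hZs : Z ∈ Metric.sphere (0 : Cone 1) 1 := by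
      simp [hZ, norm_smul, hY]
    have hYZ : Y = (‖Y‖ : ℂ) • Z := by
      rw [hZ, smul_smul, mul_inv_cancel₀ hY0, one_smul]
    have e1 := hc' Z hZs
    have e2 := hC₁ Z hZs
    have e3 := hC₂ Z hZs
    have f1 : ‖τ.base Y‖ = ‖Y‖ ^ d * ‖τ.base Z‖ := by
      conv_lhs => rw [hYZ, base_smul, norm_smul, norm_pow, Complex.norm_real, norm_norm]
    have f2 : ‖τ.third Y‖ = ‖Y‖ ^ d * ‖τ.third Z‖ := by
      conv_lhs => rw [hYZ, third_smul, norm_mul, norm_pow, Complex.norm_real, norm_norm]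
    rw [f1, f2, mul_comm c, mul_comm (max _ _)]
    refine ⟨by gcongr, ?_, ?_⟩
    · gcongr
      exact e2.trans (le_max_of_le_right (le_max_left _ _))
    · gcongr
      exact e3.trans (le_max_of_le_right (le_max_right _ _))

end Triple

/-! ### Trapping, contraction towards the hyperplane, and the bad set -/

namespace Triple

variable {d : ℕ}

/-- `Y` is `η`-close to the set over which two points of the attracting set may have the same
image. -/
def NearBad (τ : Triple d) (η : ℝ) (Y : Cone 1) : Prop :=
  ‖Y 1‖ ≤ η * ‖Y‖ ∨ ‖τ.third Y‖ ≤ η * ‖Y‖ ^ d ∨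
    ∃ (Z : Cone 1) (ζ : ℂ), ζ ^ d = 1 ∧ τ.base Z = τ.base Y ∧ τ.conjugacy Y Z = 0 ∧
      ‖τ.third Z - ζ * τ.third Y‖ ≤ η * ‖Y‖ ^ d

/-- The smallness conditions on the parameters. -/
structure Adapted (τ : Triple d) (c C ρ η m : ℝ) (ε₁ ε₂ : ℂ) : Prop where
  two_le : 2 ≤ d
  c_pos : 0 < c
  C_pos : 0 < C
  bounds : ∀ Y : Cone 1,
    c * ‖Y‖ ^ d ≤ ‖τ.base Y‖ ∧ ‖τ.base Y‖ ≤ C * ‖Y‖ ^ d ∧ ‖τ.third Y‖ ≤ C * ‖Y‖ ^ d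
  one_le_rho : 1 ≤ ρ
  le_rho : 2 * (C + 1) ≤ c * ρ
  eta_pos : 0 < η
  m_pos : 0 < m
  m_le_one : m ≤ 1
  le_norm_sub : ∀ ζ ξ : ℂ, ζ ^ d = 1 → ξ ^ d = 1 → ζ ≠ ξ → m ≤ ‖ζ - ξ‖
  ne_zero₁ : ε₁ ≠ 0
  ne_zero₂ : ε₂ ≠ 0
  small₁ : ‖ε₁ ^ (d - 1)‖ * ρ ^ d ≤ 1
  small₂ : ‖ε₂ ^ (d - 1)‖ * (ρ ^ d + 1) ≤ 1
  contracting₁ : ‖ε₁ ^ (d - 1)‖ * (d * ρ ^ (d - 1)) ≤ c / 2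
  contracting₂ : ‖ε₂ ^ (d - 1)‖ * (d * ρ ^ (d - 1)) ≤ c / 2
  near₁ : ‖ε₁ ^ (d - 1)‖ * ρ ^ d * (1 + C / c) ≤ η * m
  near₂ : 2 * (‖ε₂ ^ (d - 1)‖ * (ρ ^ d + 1)) / c ≤ η * m

theorem norm_pow_sub_pow_le (n : ℕ) {A B : ℂ} {r : ℝ} (hA : ‖A‖ ≤ r) (hB : ‖B‖ ≤ r) :
    ‖A ^ n - B ^ n‖ ≤ n * r ^ (n - 1) * ‖A - B‖ := by
  have hr : 0 ≤ r := (norm_nonneg _).trans hA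
  rw [← sub_mul_geomPair, norm_mul, mul_comm]
  gcongr
  refine (norm_sum_le _ _).trans ((Finset.sum_le_card_nsmul _ _ (r ^ (n - 1)) fun l hl => ?_).trans
    (by simp))
  have hl' := Finset.mem_range.1 hl
  rw [norm_mul, norm_pow, norm_pow]
  calc ‖A‖ ^ l * ‖B‖ ^ (n - 1 - l) ≤ r ^ l * r ^ (n - 1 - l) := by gcongr
    _ = r ^ (n - 1) := by rw [← pow_add]; congr 1; omega

theorem eq_root_mul {n : ℕ} {a b : ℂ} (h : a ^ n = b ^ n) (hb : b ≠ 0) :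
    ∃ ζ : ℂ, ζ ^ n = 1 ∧ a = ζ * b :=
  ⟨a / b, by rw [div_pow, h, div_self (pow_ne_zero _ hb)], by field_simp⟩

namespace Adapted

variable {τ : Triple d} {c C ρ η m : ℝ} {ε₁ ε₂ : ℂ}

theorem rho_pos (h : τ.Adapted c C ρ η m ε₁ ε₂) : 0 < ρ := one_pos.trans_le h.one_le_rho

/-- The closed trap is mapped into a smaller one. -/
theorem step_mem (h : τ.Adapted c C ρ η m ε₁ ε₂) {p : Cone 1 × ℂ × ℂ}
    (hS : ‖p.2.1‖ ≤ ρ * ‖p.1‖) (hV : ‖p.2.2‖ ≤ ρ * ‖p.1‖) :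
    ‖(τ.step ε₁ ε₂ p).2.1‖ ≤ ρ / 2 * ‖(τ.step ε₁ ε₂ p).1‖ ∧
      ‖(τ.step ε₁ ε₂ p).2.2‖ ≤ ρ / 2 * ‖(τ.step ε₁ ε₂ p).1‖ := by
  obtain ⟨h1, h2, h3⟩ := h.bounds p.1
  have hρ := h.rho_pos
  have hc := h.c_pos
  have hN : (0 : ℝ) ≤ ‖p.1‖ ^ d := by positivity
  -- The choice of `ρ` turns a bound by `C`, plus one for the perturbation, into half the radius.
  have key : (C + 1) * ‖p.1‖ ^ d ≤ ρ / 2 * ‖τ.base p.1‖ := by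
    have e : C + 1 ≤ ρ / 2 * c := by linarith [h.le_rho]
    calc (C + 1) * ‖p.1‖ ^ d ≤ ρ / 2 * c * ‖p.1‖ ^ d := by gcongr
      _ = ρ / 2 * (c * ‖p.1‖ ^ d) := by ring
      _ ≤ ρ / 2 * ‖τ.base p.1‖ := by gcongr
  constructor
  · refine le_trans ?_ key
    calc ‖τ.third p.1 + ε₁ ^ (d - 1) * p.2.1 ^ d‖
        ≤ ‖τ.third p.1‖ + ‖ε₁ ^ (d - 1)‖ * ‖p.2.1‖ ^ d := by
          refine (norm_add_le _ _).trans ?_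
          rw [norm_mul, norm_pow p.2.1]
      _ ≤ C * ‖p.1‖ ^ d + ‖ε₁ ^ (d - 1)‖ * (ρ * ‖p.1‖) ^ d := by gcongr
      _ = C * ‖p.1‖ ^ d + (‖ε₁ ^ (d - 1)‖ * ρ ^ d) * ‖p.1‖ ^ d := by ring
      _ ≤ C * ‖p.1‖ ^ d + 1 * ‖p.1‖ ^ d := by gcongr; exact h.small₁
      _ = (C + 1) * ‖p.1‖ ^ d := by ring
  · refine le_trans ?_ key
    calc ‖τ.base p.1 1 + ε₂ ^ (d - 1) * (p.2.2 ^ d - p.1 1 ^ d)‖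
        ≤ ‖τ.base p.1 1‖ + ‖ε₂ ^ (d - 1)‖ * (‖p.2.2‖ ^ d + ‖p.1 1‖ ^ d) := by
          refine (norm_add_le _ _).trans ?_
          rw [norm_mul, ← norm_pow p.2.2, ← norm_pow (p.1 1)]
          gcongr
          exact norm_sub_le _ _
      _ ≤ C * ‖p.1‖ ^ d + ‖ε₂ ^ (d - 1)‖ * ((ρ * ‖p.1‖) ^ d + ‖p.1‖ ^ d) := by
          gcongr
          · exact (norm_le_pi_norm _ _).trans h2
          · exact norm_le_pi_norm _ _
      _ = C * ‖p.1‖ ^ d + (‖ε₂ ^ (d - 1)‖ * (ρ ^ d + 1)) * ‖p.1‖ ^ d := by ring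
      _ ≤ C * ‖p.1‖ ^ d + 1 * ‖p.1‖ ^ d := by gcongr; exact h.small₂
      _ = (C + 1) * ‖p.1‖ ^ d := by ring

/-- The trap in the cone. -/
def Mem (ρ : ℝ) (p : Cone 1 × ℂ × ℂ) : Prop := ‖p.2.1‖ ≤ ρ * ‖p.1‖ ∧ ‖p.2.2‖ ≤ ρ * ‖p.1‖

theorem mem_step (h : τ.Adapted c C ρ η m ε₁ ε₂) {p : Cone 1 × ℂ × ℂ} (hp : Mem ρ p) :
    Mem ρ (τ.step ε₁ ε₂ p) := by
  obtain ⟨h1, h2⟩ := h.step_mem hp.1 hp.2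
  have hρ := h.rho_pos
  have h0 := mul_nonneg hρ.le (norm_nonneg (τ.step ε₁ ε₂ p).1)
  constructor <;> linarith

theorem mem_iterate (h : τ.Adapted c C ρ η m ε₁ ε₂) {p : Cone 1 × ℂ × ℂ} (hp : Mem ρ p) (n : ℕ) :
    Mem ρ ((τ.step ε₁ ε₂)^[n] p) := by
  induction n with
  | zero => exact hp
  | succ n ih =>
    rw [Function.iterate_succ_apply']
    exact h.mem_step ih

theorem mem_smul {s : ℂ} {p : Cone 1 × ℂ × ℂ} (hp : Mem ρ p) : Mem ρ (s • p) := by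
  obtain ⟨h1, h2⟩ := hp
  constructor
  · simp only [Prod.smul_snd, Prod.smul_fst, norm_smul]
    nlinarith [norm_nonneg s]
  · simp only [Prod.smul_snd, Prod.smul_fst, norm_smul]
    nlinarith [norm_nonneg s]

/-- Every point of the trap has coordinates in the trap. -/
theorem mem_of_isCoord (h : τ.Adapted c C ρ η m ε₁ ε₂) {x : PSpace 3}
    (hx : x ∈ openTube ε₁ ε₂ ρ) {p : Cone 1 × ℂ × ℂ} (hp : IsCoord ε₁ ε₂ x p) :
    Mem ρ p ∧ p.1 ≠ 0 := by
  obtain ⟨q, h1, h2, hq⟩ := hx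
  obtain ⟨s, hs, rfl⟩ := hq.eq_smul h.ne_zero₁ h.ne_zero₂ hp
  have hm : Mem ρ (s • q) := mem_smul ⟨h1.le, h2.le⟩
  exact ⟨hm, hp.fst_ne_zero hm.1 hm.2⟩

theorem image_subset (h : τ.Adapted c C ρ η m ε₁ ε₂) :
    τ.toEndo h.two_le ε₁ ε₂ '' openTube ε₁ ε₂ ρ ⊆ closedTube ε₁ ε₂ (ρ / 2) := by
  rintro _ ⟨x, ⟨p, h1, h2, hp⟩, rfl⟩
  obtain ⟨g1, g2⟩ := h.step_mem h1.le h2.le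
  exact ⟨_, g1, g2, τ.isCoord_step h.two_le hp⟩

theorem closedTube_subset_openTube (h : τ.Adapted c C ρ η m ε₁ ε₂) :
    closedTube ε₁ ε₂ (ρ / 2) ⊆ openTube ε₁ ε₂ ρ := by
  rintro x ⟨p, h1, h2, hp⟩
  have hY := norm_pos_iff.2 (hp.fst_ne_zero h1 h2)
  have := mul_pos h.rho_pos hY
  exact ⟨p, by linarith, by linarith, hp⟩

theorem closure_image_subset_closedTube (h : τ.Adapted c C ρ η m ε₁ ε₂) :
    closure (τ.toEndo h.two_le ε₁ ε₂ '' openTube ε₁ ε₂ ρ) ⊆ closedTube ε₁ ε₂ (ρ / 2) :=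
  closure_minimal h.image_subset (isClosed_closedTube h.ne_zero₁ h.ne_zero₂ _)

theorem closure_image_subset (h : τ.Adapted c C ρ η m ε₁ ε₂) :
    closure (τ.toEndo h.two_le ε₁ ε₂ '' openTube ε₁ ε₂ ρ) ⊆ openTube ε₁ ε₂ ρ :=
  h.closure_image_subset_closedTube.trans h.closedTube_subset_openTube

/-- The contraction in the last coordinate. -/
theorem norm_step_sub_le (h : τ.Adapted c C ρ η m ε₁ ε₂) {p : Cone 1 × ℂ × ℂ} (hp : Mem ρ p) :
    ‖(τ.step ε₁ ε₂ p).2.2 - (τ.step ε₁ ε₂ p).1 1‖ * ‖p.1‖ ≤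
      1 / 2 * ‖p.2.2 - p.1 1‖ * ‖(τ.step ε₁ ε₂ p).1‖ := by
  have hd := h.two_le
  have hc := h.c_pos
  have hρ := h.one_le_rho
  have e1 : (τ.step ε₁ ε₂ p).2.2 - (τ.step ε₁ ε₂ p).1 1 =
      ε₂ ^ (d - 1) * (p.2.2 ^ d - p.1 1 ^ d) := by simp [step]
  have e2 : (τ.step ε₁ ε₂ p).1 = τ.base p.1 := rfl
  have e3 := norm_pow_sub_pow_le d hp.2 ((norm_le_pi_norm p.1 1).trans
    (le_mul_of_one_le_left (norm_nonneg _) hρ))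
  have e4 : ‖p.1‖ ^ d = ‖p.1‖ ^ (d - 1) * ‖p.1‖ := by
    rw [← pow_succ]
    congr 1
    omega
  rw [e1, e2, norm_mul]
  calc ‖ε₂ ^ (d - 1)‖ * ‖p.2.2 ^ d - p.1 1 ^ d‖ * ‖p.1‖
      ≤ ‖ε₂ ^ (d - 1)‖ * (d * (ρ * ‖p.1‖) ^ (d - 1) * ‖p.2.2 - p.1 1‖) * ‖p.1‖ := by gcongr
    _ = (‖ε₂ ^ (d - 1)‖ * (d * ρ ^ (d - 1))) * (‖p.2.2 - p.1 1‖ * ‖p.1‖ ^ d) := by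
        rw [e4]
        ring
    _ ≤ c / 2 * (‖p.2.2 - p.1 1‖ * ‖p.1‖ ^ d) := by
        gcongr
        exact h.contracting₂
    _ = 1 / 2 * ‖p.2.2 - p.1 1‖ * (c * ‖p.1‖ ^ d) := by ring
    _ ≤ 1 / 2 * ‖p.2.2 - p.1 1‖ * ‖τ.base p.1‖ := by
        gcongr
        exact (h.bounds p.1).1

/-- The scale-invariant quantity `‖V - w‖ / ‖Y‖` is halved at each step; the inequality is
cross-multiplied so as to avoid divisions. -/
theorem norm_iterate_sub_le (h : τ.Adapted c C ρ η m ε₁ ε₂) {p : Cone 1 × ℂ × ℂ} (hp : Mem ρ p)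
    (n : ℕ) : ‖((τ.step ε₁ ε₂)^[n] p).2.2 - ((τ.step ε₁ ε₂)^[n] p).1 1‖ * ‖p.1‖ ≤
      (1 / 2) ^ n * ‖p.2.2 - p.1 1‖ * ‖((τ.step ε₁ ε₂)^[n] p).1‖ := by
  induction n with
  | zero => simp
  | succ n ih =>
    have h1 := h.norm_step_sub_le (h.mem_iterate hp n)
    rw [Function.iterate_succ_apply']
    set q := (τ.step ε₁ ε₂)^[n] p with hq
    rcases eq_or_ne q.1 0 with h0 | h0
    · have : p.1 = 0 := by
        by_contra hne
        refine τ.base_iterate_ne_zero n hne ?_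
        rw [← step_iterate_fst (ε₁ := ε₁) (ε₂ := ε₂)]
        exact h0
      rw [this, norm_zero, mul_zero]
      positivity
    have hq0 := norm_pos_iff.2 h0
    refine le_of_mul_le_mul_right ?_ hq0
    calc ‖(τ.step ε₁ ε₂ q).2.2 - (τ.step ε₁ ε₂ q).1 1‖ * ‖p.1‖ * ‖q.1‖
        = (‖(τ.step ε₁ ε₂ q).2.2 - (τ.step ε₁ ε₂ q).1 1‖ * ‖q.1‖) * ‖p.1‖ := by ring
      _ ≤ (1 / 2 * ‖q.2.2 - q.1 1‖ * ‖(τ.step ε₁ ε₂ q).1‖) * ‖p.1‖ := by gcongr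
      _ = 1 / 2 * ‖(τ.step ε₁ ε₂ q).1‖ * (‖q.2.2 - q.1 1‖ * ‖p.1‖) := by ring
      _ ≤ 1 / 2 * ‖(τ.step ε₁ ε₂ q).1‖ * ((1 / 2) ^ n * ‖p.2.2 - p.1 1‖ * ‖q.1‖) := by gcongr
      _ = (1 / 2) ^ (n + 1) * ‖p.2.2 - p.1 1‖ * ‖(τ.step ε₁ ε₂ q).1‖ * ‖q.1‖ := by ring

/-- The attracting set is contained in a hyperplane. -/
theorem snd_snd_eq (h : τ.Adapted c C ρ η m ε₁ ε₂) {x : PSpace 3}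
    (hx : x ∈ ⋂ n, (τ.toEndo h.two_le ε₁ ε₂)^[n] '' openTube ε₁ ε₂ ρ) {p : Cone 1 × ℂ × ℂ}
    (hp : IsCoord ε₁ ε₂ x p) : p.2.2 = p.1 1 := by
  have hρ := h.rho_pos
  -- A point of the attracting set has an `n`-th preimage in the tube, where the defect is at most
  -- `(ρ + 1) ‖Y‖`.
  have key : ∀ n : ℕ, ‖p.2.2 - p.1 1‖ ≤ (1 / 2) ^ n * ((ρ + 1) * ‖p.1‖) := by
    intro n
    obtain ⟨y, hy, hyx⟩ := Set.mem_iInter.1 hx n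
    obtain ⟨q, hq⟩ := exists_isCoord h.ne_zero₁ h.ne_zero₂ y
    obtain ⟨hm, hq0⟩ := h.mem_of_isCoord hy hq
    have hit := τ.isCoord_iterate h.two_le hq n
    rw [hyx] at hit
    obtain ⟨s, hs, hsp⟩ := hit.eq_smul h.ne_zero₁ h.ne_zero₂ hp
    have h1 := h.norm_iterate_sub_le hm n
    set r := (τ.step ε₁ ε₂)^[n] q
    have hq0' := norm_pos_iff.2 hq0
    have h2 : ‖q.2.2 - q.1 1‖ ≤ (ρ + 1) * ‖q.1‖ := by
      refine (norm_sub_le _ _).trans ?_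
      have := norm_le_pi_norm q.1 1
      linarith [hm.2]
    have h3 : ‖r.2.2 - r.1 1‖ ≤ (1 / 2) ^ n * ((ρ + 1) * ‖r.1‖) := by
      refine le_of_mul_le_mul_right (h1.trans ?_) hq0'
      calc (1 / 2) ^ n * ‖q.2.2 - q.1 1‖ * ‖r.1‖
          ≤ (1 / 2) ^ n * ((ρ + 1) * ‖q.1‖) * ‖r.1‖ := by gcongr
        _ = (1 / 2) ^ n * ((ρ + 1) * ‖r.1‖) * ‖q.1‖ := by ring
    have h4 : p.2.2 - p.1 1 = s * (r.2.2 - r.1 1) := by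
      rw [hsp]
      simp
      ring
    have h5 : ‖p.1‖ = ‖s‖ * ‖r.1‖ := by
      rw [hsp, Prod.smul_fst, norm_smul]
    rw [h4, h5, norm_mul]
    calc ‖s‖ * ‖r.2.2 - r.1 1‖ ≤ ‖s‖ * ((1 / 2) ^ n * ((ρ + 1) * ‖r.1‖)) := by gcongr
      _ = (1 / 2) ^ n * ((ρ + 1) * (‖s‖ * ‖r.1‖)) := by ring
  have hlim : Filter.Tendsto (fun n : ℕ => (1 / 2 : ℝ) ^ n * ((ρ + 1) * ‖p.1‖)) Filter.atTop
      (𝓝 (0 * ((ρ + 1) * ‖p.1‖))) :=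
    (tendsto_pow_atTop_nhds_zero_of_lt_one (by norm_num) (by norm_num)).mul_const _
  have := ge_of_tendsto' hlim key
  rw [zero_mul] at this
  exact sub_eq_zero.1 (norm_le_zero_iff.1 this)

/-! #### Points with the same image -/

theorem pow_norm_le (h : τ.Adapted c C ρ η m ε₁ ε₂) {Y Z : Cone 1}
    (hYZ : ‖τ.base Z‖ = ‖τ.base Y‖) : ‖Z‖ ^ d ≤ C / c * ‖Y‖ ^ d := by
  have hc := h.c_pos
  rw [div_mul_eq_mul_div, le_div_iff₀ hc]
  have h1 := (h.bounds Z).1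
  have h2 := (h.bounds Y).2.1
  linarith

theorem norm_snd_fst_pow_le {p : Cone 1 × ℂ × ℂ} (hp : Mem ρ p) :
    ‖p.2.1 ^ d‖ ≤ ρ ^ d * ‖p.1‖ ^ d := by
  rw [norm_pow, ← mul_pow]
  exact pow_le_pow_left₀ (norm_nonneg _) hp.1 d

/-- Equal norms of the images under the base map make the two base points comparable, so the
perturbation terms at both points are controlled by the size of one of them. -/
theorem norm_delta_le (h : τ.Adapted c C ρ η m ε₁ ε₂) {p q : Cone 1 × ℂ × ℂ} (hp : Mem ρ p)
    (hq : Mem ρ q) (hpq : ‖τ.base q.1‖ = ‖τ.base p.1‖) {a b : ℂ} (ha : ‖a‖ = 1) (hb : ‖b‖ = 1) :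
    ‖a * (ε₁ ^ (d - 1) * p.2.1 ^ d) - b * (ε₁ ^ (d - 1) * q.2.1 ^ d)‖ ≤ η * m * ‖p.1‖ ^ d := by
  have h1 := norm_snd_fst_pow_le (d := d) hp
  have h2 := norm_snd_fst_pow_le (d := d) hq
  have h3 := h.pow_norm_le hpq
  have hρ := h.rho_pos
  calc ‖a * (ε₁ ^ (d - 1) * p.2.1 ^ d) - b * (ε₁ ^ (d - 1) * q.2.1 ^ d)‖
      ≤ ‖ε₁ ^ (d - 1)‖ * ‖p.2.1 ^ d‖ + ‖ε₁ ^ (d - 1)‖ * ‖q.2.1 ^ d‖ := by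
        refine (norm_sub_le _ _).trans (le_of_eq ?_)
        rw [norm_mul a, norm_mul b, ha, hb, norm_mul, norm_mul, one_mul, one_mul]
    _ ≤ ‖ε₁ ^ (d - 1)‖ * (ρ ^ d * ‖p.1‖ ^ d) +
        ‖ε₁ ^ (d - 1)‖ * (ρ ^ d * (C / c * ‖p.1‖ ^ d)) := by
        gcongr
        exact h2.trans (by gcongr)
    _ = (‖ε₁ ^ (d - 1)‖ * ρ ^ d * (1 + C / c)) * ‖p.1‖ ^ d := by ring
    _ ≤ η * m * ‖p.1‖ ^ d := by
        exact mul_le_mul_of_nonneg_right h.near₁ (by positivity)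

theorem norm_eq_one {ζ : ℂ} {n : ℕ} (hn : n ≠ 0) (h : ζ ^ n = 1) : ‖ζ‖ = 1 := by
  have : ‖ζ‖ ^ n = 1 := by rw [← norm_pow, h, norm_one]
  exact (pow_eq_one_iff_of_nonneg (norm_nonneg _) hn).1 this

/-- Two points with the same image are conjugate or projectively equal, by the factorization
`det_mul_conjugacy`. -/
theorem conjugacy_eq_zero {Y Z : Cone 1} (h : τ.base Z = τ.base Y) (hY : Y ≠ 0) :
    τ.conjugacy Y Z = 0 ∨ ∃ s : ℂ, Z = s • Y := by
  have h1 := τ.det_mul_conjugacy Y Z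
  rw [h, mul_comm (τ.base Y 1), sub_self] at h1
  rcases mul_eq_zero.1 h1 with h2 | h2
  · exact Or.inr (exists_eq_smul_of_det_eq_zero hY h2)
  · exact Or.inl h2

theorem pow_eq_one_of_base_eq {Y : Cone 1} (hY : Y ≠ 0) {s : ℂ}
    (h : τ.base (s • Y) = τ.base Y) : s ^ d = 1 := by
  rw [base_smul] at h
  have h2 : (s ^ d - 1) • τ.base Y = 0 := by rw [sub_smul, h, one_smul, sub_self]
  exact sub_eq_zero.1 ((smul_eq_zero.1 h2).resolve_right (τ.base_ne_zero hY))

/-- Two points of the trap which have the same third image, but different second images, lie over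
the bad set. -/
theorem nearBad_of_iterate_eq (h : τ.Adapted c C ρ η m ε₁ ε₂) {p q : Cone 1 × ℂ × ℂ}
    (hp : Mem ρ p) (hq : Mem ρ q) (hp0 : p.1 ≠ 0)
    (hpq : (τ.step ε₁ ε₂)^[2] q = (τ.step ε₁ ε₂)^[2] p)
    (hne : ∀ s : ℂ, τ.step ε₁ ε₂ q ≠ s • τ.step ε₁ ε₂ p) :
    τ.NearBad η (τ.base p.1) ∨ τ.NearBad η p.1 := by
  have hd0 : d ≠ 0 := by have := h.two_le; omega
  have hc := h.c_pos
  have hη := h.eta_pos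
  have hm0 := h.m_pos
  have hm1 := h.m_le_one
  have hρ := h.rho_pos
  set p' := τ.step ε₁ ε₂ p with hp'
  set q' := τ.step ε₁ ε₂ q with hq'
  have hmp : Mem ρ p' := h.mem_step hp
  have hmq : Mem ρ q' := h.mem_step hq
  have hp'0 : p'.1 ≠ 0 := τ.base_ne_zero hp0
  have hstep : τ.step ε₁ ε₂ q' = τ.step ε₁ ε₂ p' := hpq
  have E1 : τ.base q'.1 = τ.base p'.1 := congrArg Prod.fst hstep
  have E2 : τ.third q'.1 + ε₁ ^ (d - 1) * q'.2.1 ^ d = τ.third p'.1 + ε₁ ^ (d - 1) * p'.2.1 ^ d :=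
    congrArg (fun r => r.2.1) hstep
  have E3 : τ.base q'.1 1 + ε₂ ^ (d - 1) * (q'.2.2 ^ d - q'.1 1 ^ d) =
      τ.base p'.1 1 + ε₂ ^ (d - 1) * (p'.2.2 ^ d - p'.1 1 ^ d) :=
    congrArg (fun r => r.2.2) hstep
  have hδ₁ : ε₁ ^ (d - 1) ≠ 0 := pow_ne_zero _ h.ne_zero₁
  have hδ₂ : ε₂ ^ (d - 1) ≠ 0 := pow_ne_zero _ h.ne_zero₂
  -- Conjugate base points: equality of the second coordinates of the images forces the values of
  -- the third form to be close, which is badness with root of unity one.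
  rcases conjugacy_eq_zero E1 hp'0 with hD | ⟨ζ, hζ⟩
  · left
    refine Or.inr (Or.inr ⟨q'.1, 1, one_pow _, E1, hD, ?_⟩)
    have h1 := h.norm_delta_le hmp hmq (congrArg norm E1) norm_one norm_one
    have h2 : τ.third q'.1 - 1 * τ.third p'.1 =
        1 * (ε₁ ^ (d - 1) * p'.2.1 ^ d) - 1 * (ε₁ ^ (d - 1) * q'.2.1 ^ d) := by
      linear_combination E2
    rw [← h2] at h1
    refine h1.trans ?_
    have : η * m ≤ η := mul_le_of_le_one_right hη.le hm1
    exact mul_le_mul_of_nonneg_right this (by positivity)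
  have hζd : ζ ^ d = 1 := pow_eq_one_of_base_eq hp'0 (by rw [← hζ, E1])
  have hζ1 := norm_eq_one hd0 hζd
  have hζ0 : ζ ≠ 0 := by
    rintro rfl
    simp [hd0] at hζd
  have hR : τ.third q'.1 = τ.third p'.1 := by rw [hζ, third_smul, hζd, one_mul]
  have hw : q'.1 1 = ζ * p'.1 1 := by rw [hζ]; rfl
  have hS : q'.2.1 ^ d = p'.2.1 ^ d := by
    rw [hR] at E2
    exact mul_left_cancel₀ hδ₁ (add_left_cancel E2)
  have hV : q'.2.2 ^ d = p'.2.2 ^ d := by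
    rw [congrFun E1 1, hw, mul_pow, hζd, one_mul] at E3
    have := mul_left_cancel₀ hδ₂ (add_left_cancel E3)
    exact sub_left_injective this
  -- From here on the base points agree up to a root of unity `ζ`, and the transverse coordinates
  -- agree up to roots of unity. The points being different, one of these roots is not `ζ`. In this
  -- branch the last coordinates match, so the difference lies in `S`.
  by_cases hV' : q'.2.2 = ζ * p'.2.2
  · right
    have hS' : q'.2.1 ≠ ζ * p'.2.1 := by
      intro hS'
      exact hne ζ (Prod.ext hζ (Prod.ext hS' hV'))
    have hS0 : p'.2.1 ≠ 0 := by
      intro h0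
      rw [h0, zero_pow hd0] at hS
      rw [h0, mul_zero] at hS'
      exact hS' (by simpa [hd0] using hS)
    obtain ⟨ξ, hξd, hξ⟩ := eq_root_mul hS hS0
    have hξζ : ξ ≠ ζ := by
      rintro rfl
      exact hS' hξ
    -- The coordinate `S` of the first image is close to the third form at the previous base point.
    -- Rescaling `q.1` gives `Z` with the same base image as `p.1`, so badness is read one step
    -- earlier, at `p.1` itself.
    obtain ⟨μ, hμ⟩ := exists_pow_eq hd0 ζ⁻¹
    have hμ0 : μ ≠ 0 := by
      rintro rfl
      rw [zero_pow hd0] at hμ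
      exact inv_ne_zero hζ0 hμ.symm
    set Z := μ • q.1 with hZ
    have hFZ : τ.base Z = τ.base p.1 := by
      have : τ.base q.1 = ζ • τ.base p.1 := hζ
      rw [hZ, base_smul, this, hμ, smul_smul, inv_mul_cancel₀ hζ0, one_smul]
    have hRZ : τ.third Z = ζ⁻¹ * τ.third q.1 := by rw [hZ, third_smul, hμ]
    have hbn : ‖τ.base q.1‖ = ‖τ.base p.1‖ := by
      have : τ.base q.1 = ζ • τ.base p.1 := hζ
      rw [this, norm_smul, hζ1, one_mul]
    have hξ1 := norm_eq_one hd0 hξd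
    have hθ1 : ‖ζ⁻¹ * ξ‖ = 1 := by rw [norm_mul, norm_inv, hζ1, hξ1, inv_one, one_mul]
    have hζi : ‖ζ⁻¹‖ = 1 := by rw [norm_inv, hζ1, inv_one]
    have h1 := h.norm_delta_le hp hq hbn hθ1 hζi
    have e1 : q'.2.1 = τ.third q.1 + ε₁ ^ (d - 1) * q.2.1 ^ d := rfl
    have e2 : p'.2.1 = τ.third p.1 + ε₁ ^ (d - 1) * p.2.1 ^ d := rfl
    have h2 : τ.third Z - ζ⁻¹ * ξ * τ.third p.1 =
        ζ⁻¹ * ξ * (ε₁ ^ (d - 1) * p.2.1 ^ d) - ζ⁻¹ * (ε₁ ^ (d - 1) * q.2.1 ^ d) := by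
      rw [hRZ]
      rw [e1, e2] at hξ
      linear_combination ζ⁻¹ * hξ
    rw [← h2] at h1
    have hθd : (ζ⁻¹ * ξ) ^ d = 1 := by rw [mul_pow, inv_pow, hζd, hξd, inv_one, one_mul]
    rcases conjugacy_eq_zero hFZ hp0 with hD | ⟨s, hs⟩
    · refine Or.inr (Or.inr ⟨Z, ζ⁻¹ * ξ, hθd, hFZ, hD, h1.trans ?_⟩)
      have : η * m ≤ η := mul_le_of_le_one_right hη.le hm1
      exact mul_le_mul_of_nonneg_right this (by positivity)
    · refine Or.inr (Or.inl ?_)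
      have hsd : s ^ d = 1 := pow_eq_one_of_base_eq hp0 (by rw [← hs, hFZ])
      have h3 : τ.third Z = τ.third p.1 := by rw [hs, third_smul, hsd, one_mul]
      have h4 : m ≤ ‖1 - ζ⁻¹ * ξ‖ := by
        refine h.le_norm_sub _ _ (one_pow _) hθd fun h0 => hξζ ?_
        rw [eq_comm, inv_mul_eq_iff_eq_mul₀ hζ0, mul_one] at h0
        exact h0
      have h5 : τ.third Z - ζ⁻¹ * ξ * τ.third p.1 = (1 - ζ⁻¹ * ξ) * τ.third p.1 := by
        rw [h3]
        ring
      rw [h5, norm_mul] at h1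
      refine le_of_mul_le_mul_left ?_ hm0
      calc m * ‖τ.third p.1‖ ≤ ‖1 - ζ⁻¹ * ξ‖ * ‖τ.third p.1‖ := by gcongr
        _ ≤ η * m * ‖p.1‖ ^ d := h1
        _ = m * (η * ‖p.1‖ ^ d) := by ring
  -- Here `V` and `V'` differ by a root of unity other than `ζ`. Both are close to the respective
  -- `w`, and `w' = ζ w`, so `w` is small.
  · left
    left
    have hV0 : p'.2.2 ≠ 0 := by
      intro h0
      rw [h0, zero_pow hd0] at hV
      rw [h0, mul_zero] at hV'
      exact hV' (by simpa [hd0] using hV)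
    obtain ⟨ξ, hξd, hξ⟩ := eq_root_mul hV hV0
    have hξζ : ξ ≠ ζ := by
      rintro rfl
      exact hV' hξ
    have hξ1 := norm_eq_one hd0 hξd
    have hmξ := h.le_norm_sub _ _ hξd hζd hξζ
    have aux : ∀ r : Cone 1 × ℂ × ℂ, Mem ρ r → ‖(τ.step ε₁ ε₂ r).2.2 - (τ.step ε₁ ε₂ r).1 1‖ ≤
        ‖ε₂ ^ (d - 1)‖ * (ρ ^ d + 1) / c * ‖(τ.step ε₁ ε₂ r).1‖ := by
      intro r hr
      have e1 : (τ.step ε₁ ε₂ r).2.2 - (τ.step ε₁ ε₂ r).1 1 =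
        ε₂ ^ (d - 1) * (r.2.2 ^ d - r.1 1 ^ d) := by simp [step]
      have e2 : (τ.step ε₁ ε₂ r).1 = τ.base r.1 := rfl
      rw [e1, e2, norm_mul]
      calc ‖ε₂ ^ (d - 1)‖ * ‖r.2.2 ^ d - r.1 1 ^ d‖
          ≤ ‖ε₂ ^ (d - 1)‖ * ((ρ * ‖r.1‖) ^ d + ‖r.1‖ ^ d) := by
            gcongr
            refine (norm_sub_le _ _).trans ?_
            rw [norm_pow, norm_pow]
            gcongr
            · exact hr.2
            · exact norm_le_pi_norm _ _
        _ = ‖ε₂ ^ (d - 1)‖ * (ρ ^ d + 1) / c * (c * ‖r.1‖ ^ d) := by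
            field_simp
            ring
        _ ≤ ‖ε₂ ^ (d - 1)‖ * (ρ ^ d + 1) / c * ‖τ.base r.1‖ := by
            gcongr
            exact (h.bounds r.1).1
    have a1 := aux p hp
    have a2 := aux q hq
    rw [← hp'] at a1
    rw [← hq', hξ, hw, hζ, norm_smul, hζ1, one_mul] at a2
    have a3 : (ξ - ζ) * p'.1 1 = (ξ * p'.2.2 - ζ * p'.1 1) - ξ * (p'.2.2 - p'.1 1) := by ring
    have a4 : ‖ξ - ζ‖ * ‖p'.1 1‖ ≤ 2 * (‖ε₂ ^ (d - 1)‖ * (ρ ^ d + 1)) / c * ‖p'.1‖ := by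
      rw [← norm_mul, a3]
      refine (norm_sub_le _ _).trans ?_
      rw [norm_mul ξ, hξ1, one_mul]
      refine (add_le_add a2 a1).trans (le_of_eq ?_)
      ring
    change ‖p'.1 1‖ ≤ η * ‖p'.1‖
    refine le_of_mul_le_mul_left ?_ hm0
    calc m * ‖p'.1 1‖ ≤ ‖ξ - ζ‖ * ‖p'.1 1‖ := by gcongr
      _ ≤ 2 * (‖ε₂ ^ (d - 1)‖ * (ρ ^ d + 1)) / c * ‖p'.1‖ := a4
      _ ≤ η * m * ‖p'.1‖ := by
        gcongr
        exact h.near₂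
      _ = m * (η * ‖p'.1‖) := by ring

end Adapted

end Triple

/-! ### Genericity and its quantitative form -/

namespace Triple

variable {d : ℕ} (τ : Triple d)

/-- For a pair of conjugate points, the vanishing of this function means that two points of the
attracting set over the pair may have the same image. -/
def badness (Y Z : Cone 1) : ℂ := Y 1 * τ.third Y * (τ.third Z ^ d - τ.third Y ^ d)

theorem badness_smul (s : ℂ) (Y Z : Cone 1) :
    τ.badness (s • Y) (s • Z) = s ^ (d ^ 2 + d + 1) * τ.badness Y Z := by
  rw [badness, badness, third_smul, third_smul, Pi.smul_apply, smul_eq_mul, mul_pow, mul_pow,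
    ← pow_mul, sq]
  ring

theorem conjugacy_smul_smul (s : ℂ) {Y Z : Cone 1} (h : τ.conjugacy Y Z = 0) :
    τ.conjugacy (s • Y) (s • Z) = 0 := by
  rw [conjugacy, bezout_smul_left, bezout_smul_right]
  rw [conjugacy] at h
  rw [h, mul_zero, mul_zero]

theorem continuous_badness : Continuous fun q : Cone 1 × Cone 1 => τ.badness q.1 q.2 := by
  have h := τ.continuous_third
  unfold badness
  fun_prop

theorem continuous_conjugacy {X : Type*} [TopologicalSpace X] {f g : X → Cone 1}
    (hf : Continuous f) (hg : Continuous g) : Continuous fun x => τ.conjugacy (f x) (g x) :=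
  (continuous_bezout (fun i => τ.coeffs (0, i)) (fun i => τ.coeffs (1, i))).comp₂ hf hg

theorem continuous_base_iterate (n : ℕ) : Continuous τ.base^[n] := τ.continuous_base.iterate n

/-- No point and one of its first images lie both in the bad set. -/
def IsGeneric : Prop :=
  ∀ (j : ℕ) (Y Z Z' : Cone 1), 1 ≤ j → j ≤ 9 → Y ≠ 0 →
    τ.base Z = τ.base Y → τ.conjugacy Y Z = 0 →
    τ.base Z' = τ.base (τ.base^[j] Y) → τ.conjugacy (τ.base^[j] Y) Z' = 0 →
    τ.badness Y Z = 0 → τ.badness (τ.base^[j] Y) Z' ≠ 0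

variable {τ}

/-- Each of the three alternatives makes one factor of `badness` small, while the other factors are
bounded. The constant does not depend on `η`, so `η` can be chosen afterwards. -/
theorem NearBad.exists_badness_le (hd : 2 ≤ d) {c C : ℝ} (hc : 0 < c) (hC : 0 < C)
    (hb : ∀ Y : Cone 1,
      c * ‖Y‖ ^ d ≤ ‖τ.base Y‖ ∧ ‖τ.base Y‖ ≤ C * ‖Y‖ ^ d ∧ ‖τ.third Y‖ ≤ C * ‖Y‖ ^ d) :
    ∃ K : ℝ, 0 < K ∧ ∀ (η : ℝ) (Y : Cone 1), 0 < η → Y ≠ 0 → τ.NearBad η Y →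
      ∃ Z, τ.base Z = τ.base Y ∧ τ.conjugacy Y Z = 0 ∧
        ‖τ.badness Y Z‖ ≤ K * η * ‖Y‖ ^ (d ^ 2 + d + 1) := by
  set B : ℝ := C + C * (C / c) with hB
  have hB0 : 0 < B := by positivity
  have hCB : C ≤ B := by
    rw [hB]
    have : 0 ≤ C * (C / c) := by positivity
    linarith
  have hRY : ∀ Y, ‖τ.third Y‖ ≤ B * ‖Y‖ ^ d := fun Y =>
    (hb Y).2.2.trans (by gcongr)
  have hRZ : ∀ Y Z, τ.base Z = τ.base Y → ‖τ.third Z‖ ≤ B * ‖Y‖ ^ d := by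
    intro Y Z h
    have h1 := (hb Z).1
    have h2 := (hb Y).2.1
    have h3 : ‖Z‖ ^ d ≤ C / c * ‖Y‖ ^ d := by
      rw [div_mul_eq_mul_div, le_div_iff₀ hc]
      rw [h] at h1
      linarith
    calc ‖τ.third Z‖ ≤ C * ‖Z‖ ^ d := (hb Z).2.2
      _ ≤ C * (C / c * ‖Y‖ ^ d) := by gcongr
      _ = (C * (C / c)) * ‖Y‖ ^ d := by ring
      _ ≤ B * ‖Y‖ ^ d := by
        gcongr
        rw [hB]
        linarith
  have hdiff : ∀ Y Z, τ.base Z = τ.base Y →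
      ‖τ.third Z ^ d - τ.third Y ^ d‖ ≤ 2 * B ^ d * ‖Y‖ ^ (d ^ 2) := by
    intro Y Z h
    refine (norm_sub_le _ _).trans ?_
    rw [norm_pow, norm_pow]
    calc ‖τ.third Z‖ ^ d + ‖τ.third Y‖ ^ d ≤ (B * ‖Y‖ ^ d) ^ d + (B * ‖Y‖ ^ d) ^ d := by
          gcongr
          · exact hRZ Y Z h
          · exact hRY Y
      _ = 2 * B ^ d * ‖Y‖ ^ (d ^ 2) := by
        rw [mul_pow, ← pow_mul, sq]
        ring
  refine ⟨2 * B ^ d * (1 + C) + C * (d * B ^ (d - 1)), by positivity, ?_⟩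
  intro η Y hη hY h
  have hN := norm_pos_iff.2 hY
  have hw : ‖Y 1‖ ≤ ‖Y‖ := norm_le_pi_norm Y 1
  have hR := (hb Y).2.2
  have hK : ∀ x : ℝ, x ≤ 2 * B ^ d * C ∨ x ≤ 2 * B ^ d ∨ x ≤ C * (d * B ^ (d - 1)) →
      x ≤ 2 * B ^ d * (1 + C) + C * (d * B ^ (d - 1)) := by
    intro x hx
    have h1 : 0 < 2 * B ^ d := by positivity
    have h2 : 0 < 2 * B ^ d * C := by positivity
    have h3 : 0 ≤ C * (d * B ^ (d - 1)) := by positivity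
    rcases hx with h | h | h <;> linarith
  -- When `w` or the third form at `Y` is small, any conjugate point will do.
  obtain ⟨Z₀, -, hZ₀, hZ₀'⟩ := τ.exists_conjugacy_eq_zero hd Y hY
  have hprod : ∀ Z, ‖τ.badness Y Z‖ =
      ‖Y 1‖ * ‖τ.third Y‖ * ‖τ.third Z ^ d - τ.third Y ^ d‖ := fun Z => by
    rw [badness, norm_mul, norm_mul]
  rcases h with h | h | ⟨Z, ζ, hζ, hZ, hYZ, h⟩
  · refine ⟨Z₀, hZ₀', hZ₀, ?_⟩
    rw [hprod]
    calc ‖Y 1‖ * ‖τ.third Y‖ * ‖τ.third Z₀ ^ d - τ.third Y ^ d‖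
        ≤ (η * ‖Y‖) * (C * ‖Y‖ ^ d) * (2 * B ^ d * ‖Y‖ ^ (d ^ 2)) := by
          gcongr
          exact hdiff Y Z₀ hZ₀'
      _ = 2 * B ^ d * C * η * ‖Y‖ ^ (d ^ 2 + d + 1) := by ring
      _ ≤ _ := by
        gcongr
        exact hK _ (Or.inl le_rfl)
  · refine ⟨Z₀, hZ₀', hZ₀, ?_⟩
    rw [hprod]
    calc ‖Y 1‖ * ‖τ.third Y‖ * ‖τ.third Z₀ ^ d - τ.third Y ^ d‖
        ≤ ‖Y‖ * (η * ‖Y‖ ^ d) * (2 * B ^ d * ‖Y‖ ^ (d ^ 2)) := by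
          gcongr
          exact hdiff Y Z₀ hZ₀'
      _ = 2 * B ^ d * η * ‖Y‖ ^ (d ^ 2 + d + 1) := by ring
      _ ≤ _ := by
        gcongr
        exact hK _ (Or.inr (Or.inl le_rfl))
  · refine ⟨Z, hZ, hYZ, ?_⟩
    have hζ1 : ‖ζ‖ = 1 := Adapted.norm_eq_one (by omega) hζ
    have h1 : ‖ζ * τ.third Y‖ ≤ B * ‖Y‖ ^ d := by
      rw [norm_mul, hζ1, one_mul]
      exact hRY Y
    -- As `ζ ^ d = 1`, multiplying the second value by `ζ` does not alter the difference of `d`-th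
    -- powers.
    have h2 := norm_pow_sub_pow_le d (hRZ Y Z hZ) h1
    rw [mul_pow ζ, hζ, one_mul] at h2
    have h3 : (‖Y‖ ^ d) ^ (d - 1) * ‖Y‖ ^ d = ‖Y‖ ^ (d ^ 2) := by
      rw [← pow_succ, ← pow_mul, sq]
      congr 2
      omega
    rw [hprod]
    calc ‖Y 1‖ * ‖τ.third Y‖ * ‖τ.third Z ^ d - τ.third Y ^ d‖
        ≤ ‖Y‖ * (C * ‖Y‖ ^ d) * (d * (B * ‖Y‖ ^ d) ^ (d - 1) * (η * ‖Y‖ ^ d)) := by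
          gcongr
          exact h2.trans (by gcongr)
      _ = C * (d * B ^ (d - 1)) * η * (‖Y‖ * ‖Y‖ ^ d * ((‖Y‖ ^ d) ^ (d - 1) * ‖Y‖ ^ d)) := by
        rw [mul_pow]
        generalize (‖Y‖ ^ d) ^ (d - 1) = x
        ring
      _ = C * (d * B ^ (d - 1)) * η * ‖Y‖ ^ (d ^ 2 + d + 1) := by
        rw [h3]
        ring
      _ ≤ _ := by
        gcongr
        exact hK _ (Or.inr (Or.inr le_rfl))

theorem norm_le_of_base (hd : 2 ≤ d) {c : ℝ} (hc : 0 < c)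
    (hb : ∀ Y : Cone 1, c * ‖Y‖ ^ d ≤ ‖τ.base Y‖) (Z : Cone 1) :
    ‖Z‖ ≤ max 1 (‖τ.base Z‖ / c) := by
  rcases le_total ‖Z‖ 1 with h | h
  · exact le_max_of_le_left h
  · refine le_max_of_le_right ?_
    rw [le_div_iff₀ hc, mul_comm]
    refine le_trans ?_ (hb Z)
    gcongr
    exact le_self_pow₀ h (by omega)

/-- The normalized conjugate pairs over a point and over its `j`-th image. -/
def conjugatePairs (τ : Triple d) (j : ℕ) : Set (Cone 1 × Cone 1 × Cone 1) :=
  {q | ‖q.1‖ = 1} ∩ ({q | τ.base q.2.1 = τ.base q.1} ∩ ({q | τ.conjugacy q.1 q.2.1 = 0} ∩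
    ({q | τ.base q.2.2 = τ.base (τ.base^[j] q.1)} ∩
      {q | τ.conjugacy (τ.base^[j] q.1) q.2.2 = 0})))

/-- The base map is proper by its lower bound, so prescribing the images of `Z` and `Z'` bounds
these points. -/
theorem isCompact_conjugatePairs (τ : Triple d) (hd : 2 ≤ d) (j : ℕ) :
    IsCompact (τ.conjugatePairs j) := by
  obtain ⟨c, C, hc, hC, hb⟩ := τ.exists_bounds
  have hlow := norm_le_of_base hd hc fun Y => (hb Y).1
  have hsph : IsCompact (Metric.sphere (0 : Cone 1) 1) := isCompact_sphere _ _
  obtain ⟨M, hM⟩ := hsph.exists_bound_of_continuousOn τ.continuous_base.continuousOn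
  obtain ⟨M', hM'⟩ := hsph.exists_bound_of_continuousOn
    (τ.continuous_base_iterate (j + 1)).continuousOn
  have c1 := τ.continuous_base
  have c2 := τ.continuous_base_iterate j
  have p2 : Continuous fun q : Cone 1 × Cone 1 × Cone 1 => q.2.1 :=
    continuous_fst.comp continuous_snd
  have p3 : Continuous fun q : Cone 1 × Cone 1 × Cone 1 => q.2.2 :=
    continuous_snd.comp continuous_snd
  have k1 : IsClosed {q : Cone 1 × Cone 1 × Cone 1 | ‖q.1‖ = 1} :=
    isClosed_eq continuous_fst.norm continuous_const
  have k2 : IsClosed {q : Cone 1 × Cone 1 × Cone 1 | τ.base q.2.1 = τ.base q.1} :=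
    isClosed_eq (c1.comp p2) (c1.comp continuous_fst)
  have k3 : IsClosed {q : Cone 1 × Cone 1 × Cone 1 | τ.conjugacy q.1 q.2.1 = 0} :=
    isClosed_eq (τ.continuous_conjugacy continuous_fst p2) continuous_const
  have k4 : IsClosed {q : Cone 1 × Cone 1 × Cone 1 | τ.base q.2.2 = τ.base (τ.base^[j] q.1)} :=
    isClosed_eq (c1.comp p3) (c1.comp (c2.comp continuous_fst))
  have k5 : IsClosed {q : Cone 1 × Cone 1 × Cone 1 | τ.conjugacy (τ.base^[j] q.1) q.2.2 = 0} :=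
    isClosed_eq (τ.continuous_conjugacy (c2.comp continuous_fst) p3) continuous_const
  refine IsCompact.of_isClosed_subset (hsph.prod ((isCompact_closedBall (0 : Cone 1)
    (max 1 (M / c))).prod (isCompact_closedBall (0 : Cone 1) (max 1 (M' / c)))))
    (k1.inter (k2.inter (k3.inter (k4.inter k5)))) ?_
  rintro ⟨Y, Z, Z'⟩ ⟨e1, e2, -, e4, -⟩
  have hYs : Y ∈ Metric.sphere (0 : Cone 1) 1 := mem_sphere_zero_iff_norm.2 e1
  refine ⟨hYs, mem_closedBall_zero_iff.2 ((hlow Z).trans (max_le_max le_rfl ?_)),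
    mem_closedBall_zero_iff.2 ((hlow Z').trans (max_le_max le_rfl ?_))⟩
  · have : ‖τ.base Z‖ ≤ M := (congrArg norm e2).trans_le (hM Y hYs)
    exact div_le_div_of_nonneg_right this hc.le
  · have h4 : τ.base Z' = τ.base^[j + 1] Y := by
      rw [Function.iterate_succ_apply']
      exact e4
    have : ‖τ.base Z'‖ ≤ M' := (congrArg norm h4).trans_le (hM' Y hYs)
    exact div_le_div_of_nonneg_right this hc.le

/-- Genericity says that this continuous sum is positive at each point of a compact set. -/
theorem IsGeneric.exists_lt_badness (hτ : τ.IsGeneric) (hd : 2 ≤ d) {j : ℕ} (h1 : 1 ≤ j)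
    (h9 : j ≤ 9) : ∃ κ : ℝ, 0 < κ ∧ ∀ q ∈ τ.conjugatePairs j,
      κ ≤ ‖τ.badness q.1 q.2.1‖ +
        ‖τ.badness (τ.base^[j] q.1) q.2.2‖ / ‖τ.base^[j] q.1‖ ^ (d ^ 2 + d + 1) := by
  have c2 := τ.continuous_base_iterate j
  have p2 : Continuous fun q : Cone 1 × Cone 1 × Cone 1 => q.2.1 :=
    continuous_fst.comp continuous_snd
  have p3 : Continuous fun q : Cone 1 × Cone 1 × Cone 1 => q.2.2 :=
    continuous_snd.comp continuous_snd
  have hne : ∀ q ∈ τ.conjugatePairs j, q.1 ≠ 0 := by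
    rintro q ⟨e1, -⟩ h0
    have e1' : ‖q.1‖ = 1 := e1
    rw [h0, norm_zero] at e1'
    exact zero_ne_one e1'
  refine (τ.isCompact_conjugatePairs hd j).exists_forall_le' (a := (0 : ℝ)) (ContinuousOn.add
    (τ.continuous_badness.comp (continuous_fst.prodMk p2)).norm.continuousOn (ContinuousOn.div
    (τ.continuous_badness.comp ((c2.comp continuous_fst).prodMk p3)).norm.continuousOn
    ((c2.comp continuous_fst).norm.pow _).continuousOn fun q hq => pow_ne_zero _
      (norm_ne_zero_iff.2 (τ.base_iterate_ne_zero j (hne q hq))))) fun q hq => ?_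
  have hY := hne q hq
  obtain ⟨-, e2, e3, e4, e5⟩ := hq
  have h4 := norm_pos_iff.2 (τ.base_iterate_ne_zero j hY)
  rcases eq_or_ne (τ.badness q.1 q.2.1) 0 with h | h
  · exact add_pos_of_nonneg_of_pos (norm_nonneg _)
      (div_pos (norm_pos_iff.2 (hτ j q.1 q.2.1 q.2.2 h1 h9 hY e2 e3 e4 e5 h)) (pow_pos h4 _))
  · exact add_pos_of_pos_of_nonneg (norm_pos_iff.2 h) (div_nonneg (norm_nonneg _)
      (pow_nonneg h4.le _))

/-- Homogeneity removes the normalization. Scaling `Y` and `Z` by `s` must be accompanied by scaling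
`Z'` by `s ^ d ^ j`, the factor acquired by the `j`-th image. -/
theorem le_of_forall_conjugatePairs {j : ℕ} {κ : ℝ} (hmin : ∀ q ∈ τ.conjugatePairs j,
      κ ≤ ‖τ.badness q.1 q.2.1‖ +
        ‖τ.badness (τ.base^[j] q.1) q.2.2‖ / ‖τ.base^[j] q.1‖ ^ (d ^ 2 + d + 1))
    {Y Z Z' : Cone 1} (hY : Y ≠ 0) (e2 : τ.base Z = τ.base Y) (e3 : τ.conjugacy Y Z = 0)
    (e4 : τ.base Z' = τ.base (τ.base^[j] Y)) (e5 : τ.conjugacy (τ.base^[j] Y) Z' = 0) :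
    κ ≤ ‖τ.badness Y Z‖ / ‖Y‖ ^ (d ^ 2 + d + 1) +
        ‖τ.badness (τ.base^[j] Y) Z'‖ / ‖τ.base^[j] Y‖ ^ (d ^ 2 + d + 1) := by
  have hYn := norm_pos_iff.2 hY
  obtain ⟨s, hs1⟩ : ∃ s : ℂ, ‖s‖ = ‖Y‖⁻¹ :=
    ⟨(‖Y‖ : ℂ)⁻¹, by rw [norm_inv, Complex.norm_real, norm_norm]⟩
  have hs0 : s ≠ 0 := by
    rw [← norm_pos_iff, hs1]
    positivity
  have hmem : (s • Y, s • Z, s ^ d ^ j • Z') ∈ τ.conjugatePairs j := by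
    refine ⟨?_, ?_, τ.conjugacy_smul_smul s e3, ?_, ?_⟩
    · change ‖s • Y‖ = 1
      rw [norm_smul, hs1, inv_mul_cancel₀ hYn.ne']
    · change τ.base (s • Z) = τ.base (s • Y)
      rw [base_smul, base_smul, e2]
    · change τ.base (s ^ d ^ j • Z') = τ.base (τ.base^[j] (s • Y))
      rw [base_iterate_smul, base_smul, base_smul, e4]
    · change τ.conjugacy (τ.base^[j] (s • Y)) (s ^ d ^ j • Z') = 0
      rw [base_iterate_smul]
      exact τ.conjugacy_smul_smul _ e5
  have h := hmin _ hmem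
  generalize hr : s ^ d ^ j = r at h
  have hr0 : r ≠ 0 := hr ▸ pow_ne_zero _ hs0
  change κ ≤ ‖τ.badness (s • Y) (s • Z)‖ + ‖τ.badness (τ.base^[j] (s • Y)) (r • Z')‖ /
    ‖τ.base^[j] (s • Y)‖ ^ (d ^ 2 + d + 1) at h
  rw [base_iterate_smul, hr, badness_smul, badness_smul] at h
  generalize d ^ 2 + d + 1 = e at h ⊢
  rw [norm_mul, norm_mul, norm_smul, mul_pow, norm_pow, norm_pow,
    mul_div_mul_left _ _ (pow_ne_zero _ (norm_ne_zero_iff.2 hr0)), hs1, inv_pow,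
    inv_mul_eq_div] at h
  exact h

/-- With `κ` the least of the nine lower bounds, `η = κ / (4K)` makes each of the two normalized
values at most `κ / 4`, so both points cannot be near the bad set. -/
theorem IsGeneric.exists_nearBad (hτ : τ.IsGeneric) (hd : 2 ≤ d) :
    ∃ η : ℝ, 0 < η ∧ ∀ (j : ℕ) (Y : Cone 1), 1 ≤ j → j ≤ 9 → Y ≠ 0 → τ.NearBad η Y →
      ¬ τ.NearBad η (τ.base^[j] Y) := by
  obtain ⟨c, C, hc, hC, hb⟩ := τ.exists_bounds
  obtain ⟨K, hK, hKb⟩ := NearBad.exists_badness_le hd hc hC hb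
  have hj : ∀ j : ℕ, ∃ κ : ℝ, 0 < κ ∧ (1 ≤ j → j ≤ 9 → ∀ Y Z Z' : Cone 1, Y ≠ 0 →
      τ.base Z = τ.base Y → τ.conjugacy Y Z = 0 →
      τ.base Z' = τ.base (τ.base^[j] Y) → τ.conjugacy (τ.base^[j] Y) Z' = 0 →
      κ ≤ ‖τ.badness Y Z‖ / ‖Y‖ ^ (d ^ 2 + d + 1) +
        ‖τ.badness (τ.base^[j] Y) Z'‖ / ‖τ.base^[j] Y‖ ^ (d ^ 2 + d + 1)) := by
    intro j
    by_cases h : 1 ≤ j ∧ j ≤ 9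
    · obtain ⟨κ, hκ, h'⟩ := hτ.exists_lt_badness hd h.1 h.2
      exact ⟨κ, hκ, fun _ _ Y Z Z' => le_of_forall_conjugatePairs h'⟩
    · exact ⟨1, one_pos, fun h1 h2 => absurd ⟨h1, h2⟩ h⟩
  choose κ hκ hκ' using hj
  obtain ⟨j₀, -, hmin⟩ := (Finset.Icc 1 9).exists_min_image κ ⟨1, by simp⟩
  refine ⟨κ j₀ / (4 * K), div_pos (hκ j₀) (by positivity), fun j Y h1 h9 hY hbad hbad' => ?_⟩
  have hη : 0 < κ j₀ / (4 * K) := div_pos (hκ j₀) (by positivity)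
  have hY' := τ.base_iterate_ne_zero j hY
  obtain ⟨Z, e2, e3, hZ⟩ := hKb _ Y hη hY hbad
  obtain ⟨Z', e4, e5, hZ'⟩ := hKb _ _ hη hY' hbad'
  have h := hκ' j h1 h9 Y Z Z' hY e2 e3 e4 e5
  have hle := hmin j (Finset.mem_Icc.2 ⟨h1, h9⟩)
  have hYn := norm_pos_iff.2 hY
  have hYn' := norm_pos_iff.2 hY'
  have f1 : ‖τ.badness Y Z‖ / ‖Y‖ ^ (d ^ 2 + d + 1) ≤ K * (κ j₀ / (4 * K)) := by
    rwa [div_le_iff₀ (by positivity)]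
  have f2 : ‖τ.badness (τ.base^[j] Y) Z'‖ / ‖τ.base^[j] Y‖ ^ (d ^ 2 + d + 1) ≤
      K * (κ j₀ / (4 * K)) := by
    rwa [div_le_iff₀ (by positivity)]
  have f3 : K * (κ j₀ / (4 * K)) = κ j₀ / 4 := by
    field_simp
  have := hκ j₀
  linarith

theorem exists_le_norm_sub_of_pow_eq_one {n : ℕ} (hn : n ≠ 0) : ∃ m : ℝ, 0 < m ∧ m ≤ 1 ∧
    ∀ ζ ξ : ℂ, ζ ^ n = 1 → ξ ^ n = 1 → ζ ≠ ξ → m ≤ ‖ζ - ξ‖ := by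
  have hfin : {ζ : ℂ | ζ ^ n = 1}.Finite := by
    refine ((Polynomial.nthRoots n (1 : ℂ)).toFinset.finite_toSet).subset fun ζ hζ => ?_
    simpa [Polynomial.mem_nthRoots (Nat.pos_of_ne_zero hn)] using hζ
  have hfin2 : {q : ℂ × ℂ | q.1 ^ n = 1 ∧ q.2 ^ n = 1 ∧ q.1 ≠ q.2}.Finite :=
    (hfin.prod hfin).subset fun q hq => ⟨hq.1, hq.2.1⟩
  obtain ⟨κ, hκ, hmin⟩ := hfin2.isCompact.exists_forall_le' (f := fun q : ℂ × ℂ => ‖q.1 - q.2‖)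
    (a := 0) (by fun_prop) fun q hq => norm_pos_iff.2 (sub_ne_zero.2 hq.2.2)
  exact ⟨min κ 1, lt_min hκ one_pos, min_le_right _ _, fun ζ ξ h1 h2 h3 =>
    (min_le_left _ _).trans (hmin (ζ, ξ) ⟨h1, h2, h3⟩)⟩

theorem eventually_norm_pow_mul_le {n : ℕ} (hn : n ≠ 0) (a : ℝ) {b : ℝ} (hb : 0 < b) :
    ∀ᶠ ε : ℂ in 𝓝 0, ‖ε ^ n‖ * a ≤ b := by
  have h : Filter.Tendsto (fun ε : ℂ => ‖ε ^ n‖ * a) (𝓝 0) (𝓝 (‖(0 : ℂ) ^ n‖ * a)) :=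
    Continuous.tendsto (by fun_prop) 0
  rw [zero_pow hn, norm_zero, zero_mul] at h
  exact h.eventually_le_const hb

/-- The bounds, `ρ` and the separation `m` of roots of unity are fixed first; each remaining
condition asks that a positive power of a parameter be small. -/
theorem exists_adapted (τ : Triple d) (hd : 2 ≤ d) {η κ : ℝ} (hη : 0 < η) (hκ : 0 < κ) :
    ∃ c C ρ m e₁ e₂ : ℝ, 0 < e₁ ∧ 0 < e₂ ∧ ∀ ε₁ ε₂ : ℂ, 0 < ‖ε₁‖ → ‖ε₁‖ < e₁ → 0 < ‖ε₂‖ →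
      ‖ε₂‖ < e₂ → τ.Adapted c C ρ η m ε₁ ε₂ ∧ ‖ε₁‖ * ρ ≤ κ ∧ ‖ε₂‖ * ρ ≤ κ := by
  obtain ⟨c, C, hc, hC, hb⟩ := τ.exists_bounds
  obtain ⟨m, hm0, hm1, hm⟩ := exists_le_norm_sub_of_pow_eq_one (n := d) (by omega)
  set ρ : ℝ := max 1 (2 * (C + 1) / c) with hρ
  have hρ1 : 1 ≤ ρ := le_max_left _ _
  have hρ2 : 2 * (C + 1) ≤ c * ρ := by
    have : 2 * (C + 1) / c ≤ ρ := le_max_right _ _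
    rw [div_le_iff₀ hc] at this
    linarith
  have hd1 : d - 1 ≠ 0 := by omega
  have hηm : 0 < η * m := by positivity
  have E := fun (a : ℝ) {b : ℝ} (hb : 0 < b) => eventually_norm_pow_mul_le hd1 a hb
  have F := eventually_norm_pow_mul_le one_ne_zero ρ hκ
  obtain ⟨e₁, he₁, h₁⟩ := Metric.eventually_nhds_iff_ball.1 ((E (ρ ^ d) one_pos).and
    ((E (d * ρ ^ (d - 1)) (half_pos hc)).and ((E (ρ ^ d * (1 + C / c)) hηm).and F)))
  obtain ⟨e₂, he₂, h₂⟩ := Metric.eventually_nhds_iff_ball.1 ((E (ρ ^ d + 1) one_pos).and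
    ((E (d * ρ ^ (d - 1)) (half_pos hc)).and ((E (2 * (ρ ^ d + 1) / c) hηm).and F)))
  refine ⟨c, C, ρ, m, e₁, e₂, he₁, he₂, fun ε₁ ε₂ h01 h1 h02 h2 => ?_⟩
  obtain ⟨a1, a2, a3, a4⟩ := h₁ ε₁ (by simpa using h1)
  obtain ⟨b1, b2, b3, b4⟩ := h₂ ε₂ (by simpa using h2)
  rw [pow_one] at a4 b4
  refine ⟨⟨hd, hc, hC, hb, hρ1, hρ2, hη, hm0, hm1, hm, norm_pos_iff.1 h01, norm_pos_iff.1 h02,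
    a1, b1, a2, b2, ?_, ?_⟩, a4, b4⟩
  · rw [mul_assoc]
    exact a3
  · refine (le_of_eq ?_).trans b3
    ring

end Triple

/-! ### Counting preimages -/

section Counting

theorem encard_le_mul {X Y : Type*} {S : Set X} {T : Set Y} {a b : ℕ} (r : X → Y → Prop)
    (hT : T.encard ≤ a) (hr : ∀ x ∈ S, ∃ y ∈ T, r x y)
    (hb : ∀ y ∈ T, {x ∈ S | r x y}.encard ≤ b) : S.encard ≤ (a * b : ℕ) := by
  classical
  obtain ⟨hfin, hcard⟩ := Set.encard_le_coe_iff_finite_ncard_le.1 hT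
  have hb' : ∀ y ∈ hfin.toFinset, {x ∈ S | r x y}.Finite := fun y hy =>
    (Set.encard_le_coe_iff_finite_ncard_le.1 (hb y (hfin.mem_toFinset.1 hy))).1
  have hsub : S ⊆ hfin.toFinset.biUnion fun y =>
      if h : {x ∈ S | r x y}.Finite then h.toFinset else ∅ := by
    intro x hx
    obtain ⟨y, hy, hxy⟩ := hr x hx
    have hy' := hfin.mem_toFinset.2 hy
    refine Finset.mem_coe.2 (Finset.mem_biUnion.2 ⟨y, hy', ?_⟩)
    rw [dif_pos (hb' y hy')]
    exact (Set.Finite.mem_toFinset _).2 ⟨hx, hxy⟩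
  refine (Set.encard_le_encard hsub).trans ?_
  rw [Set.encard_coe_eq_coe_finsetCard]
  refine Nat.cast_le.2 ((Finset.card_biUnion_le_card_mul _ _ b fun y hy => ?_).trans ?_)
  · rw [dif_pos (hb' y hy), ← Set.ncard_eq_toFinset_card _ (hb' y hy)]
    exact (Set.encard_le_coe_iff_finite_ncard_le.1 (hb y (hfin.mem_toFinset.1 hy))).2
  · rw [← Set.ncard_eq_toFinset_card _ hfin]
    gcongr

variable {X : Type*} {f : X → X}

theorem iterate_two_apply (f : X → X) (x : X) : f^[2] x = f (f x) := rfl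

theorem iterate_three_apply (f : X → X) (x : X) : f^[3] x = f (f (f x)) := rfl

theorem encard_preimage_iterate_add_le {V V' : Set X} {m n a b : ℕ} {x : X}
    (hV : Set.MapsTo f^[m] V V') (ha : (f^[n] ⁻¹' {x} ∩ V').encard ≤ a)
    (hb : ∀ z, (f^[m] ⁻¹' {z} ∩ V).encard ≤ b) :
    (f^[m + n] ⁻¹' {x} ∩ V).encard ≤ (a * b : ℕ) := by
  refine encard_le_mul (fun y z => f^[m] y = z) ha ?_ fun z _ =>
    (Set.encard_le_encard ?_).trans (hb z)
  · rintro y ⟨hy, hyV⟩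
    refine ⟨f^[m] y, ⟨?_, hV hyV⟩, rfl⟩
    rw [Set.mem_preimage, Set.mem_singleton_iff] at hy ⊢
    rw [← hy, add_comm, Function.iterate_add_apply]
  · rintro y ⟨⟨-, hyV⟩, hz⟩
    exact ⟨hz, hyV⟩

open Classical in
/-- If the points have at most `M` preimages and an orbit of length `n` ending at `x` meets at most
`b` points with several preimages, then there are at most `M ^ b` such orbits. -/
theorem encard_preimage_iterate_le_pow {W : Set X} (hW : Set.MapsTo f W W) {M : ℕ} (hM1 : 1 ≤ M)
    (hM : ∀ x, (f ⁻¹' {x} ∩ W).encard ≤ M) (n b : ℕ) (x : X)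
    (hb : ∀ y ∈ W, f^[n] y = x → ((Finset.range n).filter fun i =>
      ∃ y' ∈ W, y' ≠ f^[i] y ∧ f y' = f^[i + 1] y).card ≤ b) :
    (f^[n] ⁻¹' {x} ∩ W).encard ≤ (M ^ b : ℕ) := by
  induction n generalizing b x with
  | zero =>
    refine (Set.encard_le_encard (t := {x}) fun y hy => hy.1).trans ?_
    rw [Set.encard_singleton]
    exact_mod_cast Nat.one_le_pow _ _ hM1
  | succ n ih =>
    have hWn : ∀ n, Set.MapsTo f^[n] W W := fun n => hW.iterate n
    rcases Set.eq_empty_or_nonempty (f^[n + 1] ⁻¹' {x} ∩ W) with he | ⟨y₀, hy₀, hy₀W⟩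
    · rw [he, Set.encard_empty]
      exact zero_le
    have hr : ∀ y ∈ f^[n + 1] ⁻¹' {x} ∩ W, f^[n] y ∈ f ⁻¹' {x} ∩ W := by
      rintro y ⟨hy, hyW⟩
      refine ⟨?_, hWn n hyW⟩
      change f (f^[n] y) = x
      rw [← Function.iterate_succ_apply' f]
      exact hy
    have hsub : ∀ z, {y ∈ f^[n + 1] ⁻¹' {x} ∩ W | f^[n] y = z} ⊆ f^[n] ⁻¹' {z} ∩ W := by
      rintro z y ⟨⟨-, hyW⟩, hz⟩
      exact ⟨hz, hyW⟩
    -- Without branching over `x` the count is inherited from the unique preimage. With branching it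
    -- is multiplied by at most `M`, and every orbit ending at `x` uses up one unit of `b`.
    by_cases hbr : (f ⁻¹' {x} ∩ W).Subsingleton
    · have h1 : (f ⁻¹' {x} ∩ W).encard ≤ (1 : ℕ) := Set.encard_le_one_iff_subsingleton.2 hbr
      have := encard_le_mul (b := M ^ b) (fun y z => f^[n] y = z) h1
        (fun y hy => ⟨_, hr y hy, rfl⟩) fun z hz => (Set.encard_le_encard (hsub z)).trans
          (ih b z fun y hyW hy => ?_)
      · rwa [one_mul] at this
      · refine le_trans (Finset.card_le_card ?_) (hb y hyW ?_)
        · exact Finset.filter_subset_filter _ (Finset.range_subset_range.2 n.le_succ)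
        · rw [Function.iterate_succ_apply', hy]
          exact hz.1
    · have hbr' : ∀ y ∈ W, f^[n + 1] y = x → ∃ y' ∈ W, y' ≠ f^[n] y ∧ f y' = f^[n + 1] y := by
        intro y hyW hy
        by_contra hno
        push Not at hno
        have key : ∀ y' ∈ f ⁻¹' {x} ∩ W, y' = f^[n] y := by
          rintro y' ⟨h1, h2⟩
          by_contra hne
          exact hno y' h2 hne (h1.trans hy.symm)
        exact hbr fun a ha b hb => (key a ha).trans (key b hb).symm
      have hcard : ∀ y ∈ W, f^[n + 1] y = x → ((Finset.range n).filter fun i =>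
          ∃ y' ∈ W, y' ≠ f^[i] y ∧ f y' = f^[i + 1] y).card + 1 ≤ b := by
        intro y hyW hy
        refine le_trans ?_ (hb y hyW hy)
        rw [Finset.range_add_one, Finset.filter_insert, if_pos (hbr' y hyW hy),
          Finset.card_insert_of_notMem fun hmem =>
            lt_irrefl n (Finset.mem_range.1 (Finset.mem_filter.1 hmem).1)]
      obtain ⟨b, rfl⟩ : ∃ b', b = b' + 1 :=
        ⟨b - 1, by have := hcard y₀ hy₀W hy₀; omega⟩
      rw [pow_succ']
      refine encard_le_mul (b := M ^ b) (fun y z => f^[n] y = z) (hM x)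
        (fun y hy => ⟨_, hr y hy, rfl⟩) fun z hz => (Set.encard_le_encard (hsub z)).trans
          (ih b z fun y hyW hy => ?_)
      have := hcard y hyW (by rw [Function.iterate_succ_apply', hy]; exact hz.1)
      omega

theorem encard_preimage_iterate_le {W : Set X} (hW : Set.MapsTo f W W) {M : ℕ} (hM1 : 1 ≤ M)
    (hM : ∀ x, (f ⁻¹' {x} ∩ W).encard ≤ M) (n : ℕ) (x : X) :
    (f^[n] ⁻¹' {x} ∩ W).encard ≤ (M ^ n : ℕ) := by
  classical
  exact encard_preimage_iterate_le_pow hW hM1 hM n n x fun y _ _ =>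
    (Finset.card_filter_le _ _).trans (Finset.card_range n).le

theorem encard_preimage_iterate_mul_le {W : Set X} (hW : Set.MapsTo f W W) {n a : ℕ}
    (ha : ∀ x, (f^[n] ⁻¹' {x} ∩ W).encard ≤ a) (k : ℕ) (x : X) :
    (f^[n * k] ⁻¹' {x} ∩ W).encard ≤ (a ^ k : ℕ) := by
  induction k generalizing x with
  | zero =>
    refine (Set.encard_le_encard (t := {x}) fun y hy => hy.1).trans ?_
    rw [Set.encard_singleton, pow_zero, Nat.cast_one]
  | succ k ih =>
    rw [Nat.mul_succ, pow_succ']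
    exact encard_preimage_iterate_add_le (hW.iterate _) (ha x) fun z => ih z

/-- The exponent `17/18` lies between `8/9` and `1`; the additive `40` is absorbed once `n / 18 ≥
40`, that is, `n ≥ 720`. -/
theorem limsup_rpow_lt {d : ℕ} (hd : 2 ≤ d) (u : ℕ → ℕ∞)
    (hu : ∀ n, u n ≤ (d ^ (40 + 8 * (n / 9)) : ℕ)) :
    Filter.limsup (fun n : ℕ => (u n : ℝ≥0∞) ^ (1 / (n : ℝ))) Filter.atTop < (d : ℝ≥0∞) := by
  have h1 : (1 : ℝ≥0∞) < d := by exact_mod_cast (by omega : 1 < d)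
  have hlt : (d : ℝ≥0∞) ^ (17 / 18 : ℝ) < d := by
    conv_rhs => rw [← ENNReal.rpow_one (d : ℝ≥0∞)]
    exact ENNReal.rpow_lt_rpow_of_exponent_lt h1 (ENNReal.natCast_ne_top d) (by norm_num)
  refine lt_of_le_of_lt (Filter.limsup_le_of_le (by isBoundedDefault) ?_) hlt
  filter_upwards [Filter.eventually_ge_atTop 720] with n hn
  have hn' : (720 : ℝ) ≤ n := by exact_mod_cast hn
  have h2 : (u n : ℝ≥0∞) ≤ (d : ℝ≥0∞) ^ ((40 + 8 * (n / 9) : ℕ) : ℝ) := by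
    rw [ENNReal.rpow_natCast]
    have := ENat.toENNReal_le.2 (hu n)
    refine this.trans (le_of_eq ?_)
    push_cast
    rfl
  have h3 : ((n / 9 : ℕ) : ℝ) ≤ n / 9 := Nat.cast_div_le
  calc (u n : ℝ≥0∞) ^ (1 / (n : ℝ))
      ≤ ((d : ℝ≥0∞) ^ ((40 + 8 * (n / 9) : ℕ) : ℝ)) ^ (1 / (n : ℝ)) := by gcongr
    _ = (d : ℝ≥0∞) ^ (((40 + 8 * (n / 9) : ℕ) : ℝ) * (1 / (n : ℝ))) := by rw [ENNReal.rpow_mul]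
    _ ≤ (d : ℝ≥0∞) ^ (17 / 18 : ℝ) := by
      refine ENNReal.rpow_le_rpow_of_exponent_le h1.le ?_
      rw [mul_one_div, div_le_iff₀ (by linarith)]
      push_cast
      linarith

theorem encard_pow_eq_le {n : ℕ} (hn : n ≠ 0) (c : ℂ) : {s : ℂ | s ^ n = c}.encard ≤ n := by
  classical
  have h : {s : ℂ | s ^ n = c} ⊆ (Polynomial.nthRoots n c).toFinset := fun s hs => by
    simpa [Polynomial.mem_nthRoots (Nat.pos_of_ne_zero hn)] using hs
  refine (Set.encard_le_encard h).trans ?_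
  rw [Set.encard_coe_eq_coe_finsetCard]
  exact Nat.cast_le.2 ((Multiset.toFinset_card_le _).trans (Polynomial.card_nthRoots n c))

theorem encard_binaryForm_eq_zero_le {d : ℕ} {g : Fin (d + 1) → ℂ} (hg : ∃ y, binaryForm g y ≠ 0) :
    {a : ℂ | binaryForm g ![a, 1] = 0}.encard ≤ d := by
  classical
  let p : Polynomial ℂ := ∑ i : Fin (d + 1), Polynomial.C (g i) * Polynomial.X ^ i.1
  have hcoeff : ∀ i : Fin (d + 1), p.coeff i.1 = g i := by
    intro i
    simp only [p, Polynomial.finsetSum_coeff, Polynomial.coeff_C_mul_X_pow]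
    rw [Finset.sum_eq_single i]
    · simp
    · intro j _ hj
      rw [if_neg]
      intro h
      exact hj (Fin.ext h.symm)
    · simp
  have hp : p ≠ 0 := by
    intro h0
    obtain ⟨y, hy⟩ := hg
    refine hy ?_
    rw [binaryForm]
    refine Finset.sum_eq_zero fun i _ => ?_
    rw [← hcoeff i, h0, Polynomial.coeff_zero, zero_mul]
  have hdeg : p.natDegree ≤ d := by
    refine Polynomial.natDegree_sum_le_of_forall_le _ _ fun i _ => ?_
    exact (Polynomial.natDegree_C_mul_X_pow_le _ _).trans (by omega)
  have hsub : {a : ℂ | binaryForm g ![a, 1] = 0} ⊆ p.roots.toFinset := by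
    intro a ha
    rw [Finset.mem_coe, Multiset.mem_toFinset, Polynomial.mem_roots hp, Polynomial.IsRoot.def]
    rw [Set.mem_ofPred_eq, binaryForm] at ha
    rw [← ha]
    simp [p, Polynomial.eval_finsetSum]
  refine (Set.encard_le_encard hsub).trans ?_
  rw [Set.encard_coe_eq_coe_finsetCard]
  exact Nat.cast_le.2 ((Multiset.toFinset_card_le _).trans ((Polynomial.card_roots' p).trans hdeg))

end Counting

/-! ### Topological degree on the trapping region -/

namespace Triple.Adapted

variable {d : ℕ} {τ : Triple d} {c C ρ η m : ℝ} {ε₁ ε₂ : ℂ}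

/-- There are at most `d + 1 ≤ d ^ 2` candidates for the normalized base point, the extra one being
`[1 : 0]`, and then at most `d` values for each transverse coordinate. The bound is crude, but only
its being a fixed power of `d` matters. -/
theorem encard_fiber_le (h : τ.Adapted c C ρ η m ε₁ ε₂) (x : PSpace 3) :
    (τ.toEndo h.two_le ε₁ ε₂ ⁻¹' {x} ∩ openTube ε₁ ε₂ ρ).encard ≤ (d ^ 4 : ℕ) := by
  have hd := h.two_le
  have hd0 : d ≠ 0 := by omega
  have hδ₁ : ε₁ ^ (d - 1) ≠ 0 := pow_ne_zero _ h.ne_zero₁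
  have hδ₂ : ε₂ ^ (d - 1) ≠ 0 := pow_ne_zero _ h.ne_zero₂
  obtain ⟨a, ha⟩ := exists_isCoord h.ne_zero₁ h.ne_zero₂ x
  have hcoord : ∀ y ∈ τ.toEndo h.two_le ε₁ ε₂ ⁻¹' {x} ∩ openTube ε₁ ε₂ ρ, ∀ p,
      IsCoord ε₁ ε₂ y p → p.1 ≠ 0 ∧ ∃ s : ℂ, s ≠ 0 ∧ τ.step ε₁ ε₂ p = s • a := by
    rintro y ⟨hy, hyU⟩ p hp
    refine ⟨(h.mem_of_isCoord hyU hp).2, ?_⟩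
    have h1 := τ.isCoord_step hd hp
    rw [Set.mem_preimage, Set.mem_singleton_iff] at hy
    rw [hy] at h1
    exact ha.eq_smul h.ne_zero₁ h.ne_zero₂ h1
  rcases Set.eq_empty_or_nonempty (τ.toEndo h.two_le ε₁ ε₂ ⁻¹' {x} ∩ openTube ε₁ ε₂ ρ) with
    he | ⟨y₀, hy₀⟩
  · rw [he, Set.encard_empty]
    exact zero_le
  have ha0 : a.1 ≠ 0 := by
    intro h0
    obtain ⟨p, hp⟩ := exists_isCoord h.ne_zero₁ h.ne_zero₂ y₀
    obtain ⟨h1, s, -, h2⟩ := hcoord y₀ hy₀ p hp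
    refine τ.base_ne_zero h1 ((congrArg Prod.fst h2).trans ?_)
    rw [Prod.smul_fst, h0, smul_zero]
  let g : Fin (d + 1) → ℂ := fun i => a.1 0 * τ.coeffs (1, i) - a.1 1 * τ.coeffs (0, i)
  have hg : ∀ Y, binaryForm g Y = a.1 0 * τ.base Y 1 - a.1 1 * τ.base Y 0 := by
    intro Y
    rw [base_one_eq, base_zero_eq, binaryForm, binaryForm, binaryForm, Finset.mul_sum,
      Finset.mul_sum, ← Finset.sum_sub_distrib]
    refine Finset.sum_congr rfl fun i _ => ?_
    ring
  have hg0 : ∃ Y, binaryForm g Y ≠ 0 := by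
    by_contra hno
    push Not at hno
    obtain ⟨Z₁, hZ₁, e1⟩ := τ.exists_base_eq hd0 ![1, 0] (fun h => by simpa using congrFun h 0)
    obtain ⟨Z₂, hZ₂, e2⟩ := τ.exists_base_eq hd0 ![0, 1] (fun h => by simpa using congrFun h 1)
    have f1 := (hg Z₁).symm.trans (hno Z₁)
    have f2 := (hg Z₂).symm.trans (hno Z₂)
    rw [e1] at f1
    rw [e2] at f2
    refine ha0 (funext fun i => ?_)
    fin_cases i
    · simpa using f2
    · simpa using f1
  let T : Set (Cone 1) := insert ![1, 0] ((fun α : ℂ => ![α, 1]) '' {α | binaryForm g ![α, 1] = 0})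
  have hT : T.encard ≤ (d ^ 2 : ℕ) := by
    refine (Set.encard_insert_le _ _).trans ?_
    refine (add_le_add_left ((Set.encard_image_le _ _).trans
      (encard_binaryForm_eq_zero_le hg0)) 1).trans ?_
    have : d + 1 ≤ d ^ 2 := by nlinarith
    exact_mod_cast this
  have hdd : d ^ 4 = d ^ 2 * (d * d) := by ring
  rw [hdd]
  refine encard_le_mul (fun y Z => ∃ S, IsCoord ε₁ ε₂ y (Z, S)) hT ?_ ?_
  · intro y hy
    obtain ⟨p, hp⟩ := exists_isCoord h.ne_zero₁ h.ne_zero₂ y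
    obtain ⟨hp0, s, hs, hps⟩ := hcoord y hy p hp
    have hF : τ.base p.1 = s • a.1 := congrArg Prod.fst hps
    by_cases h1 : p.1 1 = 0
    · have h0 : p.1 0 ≠ 0 := by
        intro h0
        refine hp0 (funext fun i => ?_)
        fin_cases i
        · exact h0
        · exact h1
      refine ⟨![1, 0], Set.mem_insert _ _, (p.1 0)⁻¹ • p.2, ?_⟩
      have := hp.smul (inv_ne_zero h0)
      convert this using 1
      refine Prod.ext (funext fun i => ?_) rfl
      fin_cases i
      · simp [h0]
      · simp [h1]
    · have hp1 : (p.1 1)⁻¹ • p.1 = ![p.1 0 / p.1 1, 1] := by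
        funext i
        fin_cases i
        · simp [div_eq_inv_mul]
        · simp [h1]
      refine ⟨![p.1 0 / p.1 1, 1], Set.mem_insert_of_mem _ ⟨_, ?_, rfl⟩, (p.1 1)⁻¹ • p.2, ?_⟩
      · rw [Set.mem_ofPred_eq, ← hp1, binaryForm_smul, hg, hF]
        simp
        ring_nf
        simp
      · have := hp.smul (inv_ne_zero h1)
        convert this using 1
        exact Prod.ext hp1.symm rfl
  · intro Z _
    by_cases hZ : ∃ y ∈ τ.toEndo h.two_le ε₁ ε₂ ⁻¹' {x} ∩ openTube ε₁ ε₂ ρ,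
        ∃ S, IsCoord ε₁ ε₂ y (Z, S)
    swap
    · have : {y ∈ τ.toEndo h.two_le ε₁ ε₂ ⁻¹' {x} ∩ openTube ε₁ ε₂ ρ |
          ∃ S, IsCoord ε₁ ε₂ y (Z, S)} = ∅ := by
        refine Set.eq_empty_of_forall_notMem fun y hy => hZ ⟨y, hy⟩
      rw [this, Set.encard_empty]
      exact zero_le
    obtain ⟨y, hy, S, hyS⟩ := hZ
    obtain ⟨hZ0, s, hs, hps⟩ := hcoord y hy _ hyS
    have hF : τ.base Z = s • a.1 := congrArg Prod.fst hps
    let A : ℂ := (s * a.2.1 - τ.third Z) / ε₁ ^ (d - 1)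
    let B : ℂ := (s * a.2.2 - τ.base Z 1) / ε₂ ^ (d - 1) + Z 1 ^ d
    have hTT : ({S : ℂ | S ^ d = A} ×ˢ {V : ℂ | V ^ d = B}).encard ≤ (d * d : ℕ) := by
      rw [Set.encard_prod]
      push_cast
      exact mul_le_mul' (encard_pow_eq_le hd0 A) (encard_pow_eq_le hd0 B)
    rw [← mul_one (d * d)]
    refine encard_le_mul (fun y S => IsCoord ε₁ ε₂ y (Z, S)) hTT ?_ ?_
    · rintro y' ⟨hy', S', hyS'⟩
      obtain ⟨-, s', hs', hps'⟩ := hcoord y' hy' _ hyS'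
      have hF' : τ.base Z = s' • a.1 := congrArg Prod.fst hps'
      -- Once the lift of the base point is fixed, the scalar is determined, so all points over it
      -- solve the same two equations for `d`-th powers.
      have hss : s' = s := by
        have : (s' - s) • a.1 = 0 := by rw [sub_smul, ← hF, ← hF', sub_self]
        exact sub_eq_zero.1 ((smul_eq_zero.1 this).resolve_right ha0)
      subst hss
      have g1 : τ.third Z + ε₁ ^ (d - 1) * S'.1 ^ d = s' * a.2.1 := congrArg (fun r => r.2.1) hps'
      have g2 : τ.base Z 1 + ε₂ ^ (d - 1) * (S'.2 ^ d - Z 1 ^ d) = s' * a.2.2 :=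
        congrArg (fun r => r.2.2) hps'
      refine ⟨S', ⟨?_, ?_⟩, hyS'⟩
      · rw [Set.mem_ofPred_eq, eq_div_iff hδ₁]
        linear_combination g1
      · rw [Set.mem_ofPred_eq, ← sub_eq_iff_eq_add, eq_div_iff hδ₂]
        linear_combination g2
    · intro S' _
      rw [Nat.cast_one, Set.encard_le_one_iff]
      intro y₁ y₂ h₁ h₂
      exact h₁.2.unique h₂.2

theorem mapsTo (h : τ.Adapted c C ρ η m ε₁ ε₂) :
    Set.MapsTo (τ.toEndo h.two_le ε₁ ε₂) (openTube ε₁ ε₂ ρ) (openTube ε₁ ε₂ ρ) := fun _ hx =>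
  h.closure_image_subset (subset_closure (Set.mem_image_of_mem _ hx))

/-- A point of the second image of the trap with the same image as the second image of `x`. -/
theorem nearBad_of_apply_eq (h : τ.Adapted c C ρ η m ε₁ ε₂) {x y : PSpace 3}
    (hx : x ∈ openTube ε₁ ε₂ ρ) (hy : y ∈ (τ.toEndo h.two_le ε₁ ε₂)^[2] '' openTube ε₁ ε₂ ρ)
    (hne : y ≠ (τ.toEndo h.two_le ε₁ ε₂)^[2] x)
    (heq : τ.toEndo h.two_le ε₁ ε₂ y = (τ.toEndo h.two_le ε₁ ε₂)^[3] x) {p : Cone 1 × ℂ × ℂ}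
    (hp : IsCoord ε₁ ε₂ x p) :
    τ.NearBad η (τ.base^[2] p.1) ∨ τ.NearBad η (τ.base^[1] p.1) := by
  have hd0 : d ≠ 0 := by have := h.two_le; omega
  obtain ⟨x', hx', rfl⟩ := hy
  obtain ⟨q, hq⟩ := exists_isCoord h.ne_zero₁ h.ne_zero₂ x'
  obtain ⟨hmp, hp0⟩ := h.mem_of_isCoord hx hp
  have h3 := τ.isCoord_iterate h.two_le hp 3
  have h3' := τ.isCoord_iterate h.two_le hq 3
  rw [← Function.iterate_succ_apply' (τ.toEndo h.two_le ε₁ ε₂).toFun 2 x'] at heq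
  rw [heq] at h3'
  obtain ⟨s, hs, hqs⟩ := h3'.eq_smul h.ne_zero₁ h.ne_zero₂ h3
  -- The third iterate has degree `d ^ 3` in the lift, so a root of this order makes the third
  -- images of the two lifts equal and not merely proportional.
  obtain ⟨r, hr⟩ := exists_pow_eq (pow_ne_zero 3 hd0) s
  have hr0 : r ≠ 0 := by
    rintro rfl
    rw [zero_pow (pow_ne_zero 3 hd0)] at hr
    exact hs hr.symm
  have hq' := hq.smul hr0
  obtain ⟨hmq, hq0⟩ := h.mem_of_isCoord hx' hq'
  have hq3 : (τ.step ε₁ ε₂)^[3] (r • q) = (τ.step ε₁ ε₂)^[3] p := by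
    rw [step_iterate_smul, hr, hqs]
  have hb1 : (τ.step ε₁ ε₂ p).1 = τ.base p.1 := rfl
  rw [iterate_three_apply, iterate_three_apply, ← iterate_two_apply (τ.step ε₁ ε₂),
    ← iterate_two_apply (τ.step ε₁ ε₂)] at hq3
  rw [iterate_two_apply, Function.iterate_one, ← hb1]
  refine h.nearBad_of_iterate_eq (h.mem_step hmp) (h.mem_step hmq) (τ.base_ne_zero hp0) hq3 ?_
  intro t ht
  have i1 := τ.isCoord_iterate h.two_le hq' 2
  have i2 := τ.isCoord_iterate h.two_le hp 2
  have ht' : (τ.step ε₁ ε₂)^[2] (r • q) = t • (τ.step ε₁ ε₂)^[2] p := by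
    rw [iterate_two_apply, iterate_two_apply]
    exact ht
  have ht0 : t ≠ 0 := by
    rintro rfl
    rw [zero_smul] at ht'
    have := τ.base_iterate_ne_zero 2 hq0
    rw [← step_iterate_fst (ε₁ := ε₁) (ε₂ := ε₂), ht'] at this
    exact this rfl
  rw [ht'] at i1
  exact hne (i1.unique (i2.smul ht0))

/-- A window of nine steps contains at most two branchings, because each branching is caused by one
of two neighbouring base points being near the bad set, and this happens for at most one point of
the window. The resulting exponent eight is smaller than nine. -/
theorem encard_window_le (h : τ.Adapted c C ρ η m ε₁ ε₂)
    (hw : ∀ (j : ℕ) (Y : Cone 1), 1 ≤ j → j ≤ 9 → Y ≠ 0 → τ.NearBad η Y →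
      ¬ τ.NearBad η (τ.base^[j] Y)) (x : PSpace 3) :
    ((τ.toEndo h.two_le ε₁ ε₂)^[9] ⁻¹' {x} ∩
      (τ.toEndo h.two_le ε₁ ε₂)^[2] '' openTube ε₁ ε₂ ρ).encard ≤ ((d ^ 4) ^ 2 : ℕ) := by
  classical
  set f := τ.toEndo h.two_le ε₁ ε₂ with hf
  set U := openTube ε₁ ε₂ ρ with hU
  have hmaps : Set.MapsTo f U U := h.mapsTo
  have hsub : f^[2] '' U ⊆ U := by
    rintro _ ⟨y, hy, rfl⟩
    exact hmaps.iterate 2 hy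
  have hmaps' : Set.MapsTo f (f^[2] '' U) (f^[2] '' U) := by
    rintro _ ⟨y, hy, rfl⟩
    refine ⟨f y, hmaps hy, ?_⟩
    rw [← Function.iterate_succ_apply, Function.iterate_succ_apply']
  refine encard_preimage_iterate_le_pow hmaps' (Nat.one_le_pow _ _ (by have := h.two_le; omega))
    (fun x => (Set.encard_le_encard (Set.inter_subset_inter_right _ hsub)).trans
      (h.encard_fiber_le x)) 9 2 x ?_
  rintro _ ⟨y, hy, rfl⟩ -
  obtain ⟨p, hp⟩ := exists_isCoord h.ne_zero₁ h.ne_zero₂ y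
  have hp0 := (h.mem_of_isCoord hy hp).2
  -- A branching at time `i < 9` makes time `i + 1` or `i + 2` bad, and times between `1` and `10`
  -- differ by at most `9`.
  let J := (Finset.Icc 1 10).filter fun j => τ.NearBad η (τ.base^[j] p.1)
  have hJ : J.card ≤ 1 := by
    have key : ∀ i ∈ J, ∀ j ∈ J, ¬ i < j := by
      intro i hi j hj hij
      obtain ⟨hi1, hi2⟩ := Finset.mem_filter.1 hi
      obtain ⟨hj1, hj2⟩ := Finset.mem_filter.1 hj
      rw [Finset.mem_Icc] at hi1 hj1
      refine hw (j - i) _ (by omega) (by omega) (τ.base_iterate_ne_zero i hp0) hi2 ?_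
      rw [← Function.iterate_add_apply, Nat.sub_add_cancel hij.le]
      exact hj2
    refine Finset.card_le_one.2 fun i hi j hj => ?_
    exact le_antisymm (not_lt.1 (key j hj i hi)) (not_lt.1 (key i hi j hj))
  refine (Finset.card_le_card (t := J.image (fun j => j - 2) ∪ J.image (fun j => j - 1)) ?_).trans
    ((Finset.card_union_le _ _).trans (add_le_add (Finset.card_image_le.trans hJ)
      (Finset.card_image_le.trans hJ)))
  intro i hi
  obtain ⟨hi9, y', hy', hne, heq⟩ := Finset.mem_filter.1 hi
  rw [Finset.mem_range] at hi9
  have hcomm : ∀ n, f^[n] (f^[2] y) = f^[2] (f^[n] y) := fun n => by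
    rw [← Function.iterate_add_apply, ← Function.iterate_add_apply, add_comm]
  have hbad := h.nearBad_of_apply_eq (x := f^[i] y) (y := y') (hmaps.iterate i hy) hy'
    (by rw [← hf, ← hcomm]; exact hne)
    (by rw [← hf, heq, hcomm, ← Function.iterate_add_apply, ← Function.iterate_add_apply]; congr 1; omega)
    (τ.isCoord_iterate h.two_le hp i)
  rw [step_iterate_fst, ← Function.iterate_add_apply, ← Function.iterate_add_apply] at hbad
  rcases hbad with hb | hb
  · refine Finset.mem_union_left _ (Finset.mem_image.2 ⟨2 + i, Finset.mem_filter.2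
      ⟨Finset.mem_Icc.2 ⟨by omega, by omega⟩, hb⟩, by omega⟩)
  · refine Finset.mem_union_right _ (Finset.mem_image.2 ⟨1 + i, Finset.mem_filter.2
      ⟨Finset.mem_Icc.2 ⟨by omega, by omega⟩, hb⟩, by omega⟩)

/-- After two initial steps, which reach `f²(U)`, time is cut into windows of length nine. The two
initial steps and the at most eight leftover steps are estimated by the fibre bound, giving the
exponent `4 * 2 + 4 * 8 = 40`. -/
theorem isAsymptoticallySmallDegree (h : τ.Adapted c C ρ η m ε₁ ε₂)
    (hw : ∀ (j : ℕ) (Y : Cone 1), 1 ≤ j → j ≤ 9 → Y ≠ 0 → τ.NearBad η Y →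
      ¬ τ.NearBad η (τ.base^[j] Y)) :
    IsAsymptoticallySmallDegree (τ.toEndo h.two_le ε₁ ε₂) (openTube ε₁ ε₂ ρ) 1 := by
  intro x _
  rw [pow_one]
  refine limsup_rpow_lt h.two_le _ fun n => ?_
  have hwin := h.encard_window_le hw
  have hfib := h.encard_fiber_le
  have hd1 : 1 ≤ d := by have := h.two_le; omega
  have hM1 : 1 ≤ d ^ 4 := Nat.one_le_pow _ _ hd1
  have hmaps : Set.MapsTo (τ.toEndo h.two_le ε₁ ε₂) (openTube ε₁ ε₂ ρ) (openTube ε₁ ε₂ ρ) :=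
    h.mapsTo
  generalize (τ.toEndo h.two_le ε₁ ε₂).toFun = f at *
  generalize openTube ε₁ ε₂ ρ = U at *
  have hsub : f^[2] '' U ⊆ U := by
    rintro _ ⟨y, hy, rfl⟩
    exact hmaps.iterate 2 hy
  have hmaps' : Set.MapsTo f (f^[2] '' U) (f^[2] '' U) := by
    rintro _ ⟨y, hy, rfl⟩
    refine ⟨f y, hmaps hy, ?_⟩
    rw [← Function.iterate_succ_apply, Function.iterate_succ_apply']
  have hfib' : ∀ x, (f ⁻¹' {x} ∩ f^[2] '' U).encard ≤ (d ^ 4 : ℕ) := fun x =>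
    (Set.encard_le_encard (Set.inter_subset_inter_right _ hsub)).trans (hfib x)
  have hle : ∀ a b : ℕ, a ≤ b → (d ^ a : ℕ) ≤ d ^ b := fun a b hab => Nat.pow_le_pow_right hd1 hab
  rcases lt_or_ge n 2 with hn | hn
  · refine (encard_preimage_iterate_le hmaps hM1 hfib n x).trans (Nat.cast_le.2 ?_)
    rw [← pow_mul]
    exact hle _ _ (by omega)
  · obtain ⟨k, r, hr, hk⟩ : ∃ k r, r < 9 ∧ n = 2 + (r + 9 * k) :=
      ⟨(n - 2) / 9, (n - 2) % 9, Nat.mod_lt _ (by norm_num), by omega⟩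
    have h2 := encard_preimage_iterate_add_le (f := f) (m := 2) (n := r + 9 * k) (x := x)
      (fun y hy => Set.mem_image_of_mem _ hy)
      (encard_preimage_iterate_add_le (hmaps'.iterate r)
        (encard_preimage_iterate_mul_le hmaps' hwin k x)
        (encard_preimage_iterate_le hmaps' hM1 hfib' r))
      (encard_preimage_iterate_le hmaps hM1 hfib 2)
    rw [hk]
    refine h2.trans (Nat.cast_le.2 ?_)
    rw [← pow_mul, ← pow_mul, ← pow_mul, ← pow_mul, ← pow_add, ← pow_add]
    exact hle _ _ (by omega)

end Triple.Adapted

/-! ### The attracting set: fibres, dimension, non-algebraicity -/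

namespace Triple.Adapted

variable {d : ℕ} {τ : Triple d} {c C ρ η m : ℝ} {ε₁ ε₂ : ℂ}

/-- The attracting set. -/
def attractor (h : τ.Adapted c C ρ η m ε₁ ε₂) : Set (PSpace 3) :=
  ⋂ n, (τ.toEndo h.two_le ε₁ ε₂)^[n] '' openTube ε₁ ε₂ ρ

theorem isTrappingRegion (h : τ.Adapted c C ρ η m ε₁ ε₂) :
    IsTrappingRegion (τ.toEndo h.two_le ε₁ ε₂) (openTube ε₁ ε₂ ρ) h.attractor :=
  ⟨isOpen_openTube h.ne_zero₁ h.ne_zero₂ ρ, h.closure_image_subset, rfl⟩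

theorem attractor_subset (h : τ.Adapted c C ρ η m ε₁ ε₂) (n : ℕ) :
    h.attractor ⊆ (τ.toEndo h.two_le ε₁ ε₂)^[n] '' openTube ε₁ ε₂ ρ := Set.iInter_subset _ n

theorem attractor_subset_openTube (h : τ.Adapted c C ρ η m ε₁ ε₂) :
    h.attractor ⊆ openTube ε₁ ε₂ ρ := fun x hx => by
  obtain ⟨y, hy, rfl⟩ := h.attractor_subset 0 hx
  exact hy

theorem mapsTo_attractor (h : τ.Adapted c C ρ η m ε₁ ε₂) :
    Set.MapsTo (τ.toEndo h.two_le ε₁ ε₂) h.attractor h.attractor := by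
  intro x hx
  refine Set.mem_iInter.2 fun n => ?_
  cases n with
  | zero => exact ⟨_, h.mapsTo (h.attractor_subset_openTube hx), rfl⟩
  | succ n =>
    obtain ⟨y, hy, rfl⟩ := h.attractor_subset n hx
    exact ⟨y, hy, Function.iterate_succ_apply' _ _ _⟩

/-- The attracting set projects onto the projective line. -/
theorem exists_mem_attractor (h : τ.Adapted c C ρ η m ε₁ ε₂) {Y : Cone 1} (hY : Y ≠ 0) :
    ∃ x ∈ h.attractor, ∃ p, IsCoord ε₁ ε₂ x p ∧ p.1 = Y := by
  have hd0 : d ≠ 0 := by have := h.two_le; omega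
  set f := τ.toEndo h.two_le ε₁ ε₂ with hf
  set U := openTube ε₁ ε₂ ρ with hU
  let L : Set (PSpace 3) := {x | x.rep 0 * Y 1 - x.rep 1 * Y 0 = 0}
  have hLmk : ∀ x hx, Projectivization.mk ℂ x hx ∈ L ↔
      x ∈ {x : Cone 3 | x 0 * Y 1 - x 1 * Y 0 = 0} := by
    intro x hx
    obtain ⟨s, hs, hrep⟩ := PSpace.exists_rep_mk x hx
    have : (Projectivization.mk ℂ x hx).rep 0 * Y 1 - (Projectivization.mk ℂ x hx).rep 1 * Y 0 =
        s * (x 0 * Y 1 - x 1 * Y 0) := by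
      rw [hrep, Pi.smul_apply, Pi.smul_apply, smul_eq_mul, smul_eq_mul]
      ring
    simp only [L, Set.mem_ofPred_eq]
    rw [this, mul_eq_zero, or_iff_right hs]
  have hLclosed : IsClosed L :=
    PSpace.isClosed_of_cone (isClosed_eq (by fun_prop) continuous_const) hLmk
  have hLcoord : ∀ x p, IsCoord ε₁ ε₂ x p → (x ∈ L ↔ p.1 0 * Y 1 - p.1 1 * Y 0 = 0) := by
    rintro x p ⟨h0, rfl⟩
    exact hLmk _ h0
  have hpre : ∀ n : ℕ, ∃ Z : Cone 1, Z ≠ 0 ∧ τ.base^[n] Z = Y := by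
    intro n
    induction n with
    | zero => exact ⟨Y, hY, rfl⟩
    | succ n ih =>
      obtain ⟨Z, hZ, hZY⟩ := ih
      obtain ⟨W, hW, hWZ⟩ := τ.exists_base_eq hd0 Z hZ
      exact ⟨W, hW, by rw [Function.iterate_succ_apply, hWZ, hZY]⟩
  have hKinv : f '' closure (f '' U) ⊆ closure (f '' U) :=
    (Set.image_mono h.closure_image_subset).trans subset_closure
  have hanti := image_iterate_antitone hKinv
  have hcpt : ∀ n, IsCompact (f^[n] '' closure (f '' U)) := fun n =>
    isClosed_closure.isCompact.image (f.continuous_toFun.iterate n)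
  -- Cantor's intersection theorem. Each set is non-empty because `Y` has preimages of every order
  -- under the surjective base map, and the tube contains the point `(Z, 0, 0)` over each such
  -- preimage `Z`.
  have hne : (⋂ n, (f^[n] '' closure (f '' U) ∩ L)).Nonempty := by
    refine IsCompact.nonempty_iInter_of_sequence_nonempty_isCompact_isClosed _
      (fun n => Set.inter_subset_inter_left _ (hanti n.le_succ)) (fun n => ?_)
      ((hcpt 0).inter_right hLclosed) fun n => (hcpt n).isClosed.inter hLclosed
    obtain ⟨Z, hZ, hZY⟩ := hpre (n + 1)
    obtain ⟨x, hx⟩ := isCoord_mk (ε₁ := ε₁) (ε₂ := ε₂) (p := (Z, 0, 0)) hZ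
    have hxU : x ∈ U := by
      have : 0 < ρ * ‖Z‖ := mul_pos h.rho_pos (norm_pos_iff.2 hZ)
      exact ⟨_, by simpa using this, by simpa using this, hx⟩
    refine ⟨f^[n] (f x), Set.mem_image_of_mem _ (subset_closure (Set.mem_image_of_mem _ hxU)), ?_⟩
    rw [← Function.iterate_succ_apply]
    refine (hLcoord _ _ (τ.isCoord_iterate h.two_le hx (n + 1))).2 ?_
    rw [step_iterate_fst, hZY, mul_comm, sub_self]
  obtain ⟨x, hx⟩ := hne
  have hxA : x ∈ h.attractor := by
    rw [attractor, ← hf, ← hU, ← IsTrappingRegion.iInter_eq h.closure_image_subset]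
    exact Set.mem_iInter.2 fun n => (Set.mem_iInter.1 hx n).1
  obtain ⟨p, hp⟩ := exists_isCoord h.ne_zero₁ h.ne_zero₂ x
  have hp0 := (h.mem_of_isCoord (h.attractor_subset_openTube hxA) hp).2
  have hdet := (hLcoord x p hp).1 (Set.mem_iInter.1 hx 0).2
  obtain ⟨s, hs⟩ := exists_eq_smul_of_det_eq_zero hp0 hdet
  have hs0 : s ≠ 0 := by
    rintro rfl
    rw [zero_smul] at hs
    exact hY hs
  exact ⟨x, hxA, s • p, hp.smul hs0, hs.symm⟩

open Polynomial in
/-- An algebraic set which does not contain a line meets this line in a finite set. -/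
theorem _root_.AttractingSets.IsAlgebraicSet.finite_of_line {A : Set (PSpace 3)}
    (hA : IsAlgebraicSet A) {Y : Cone 1} {V : ℂ} (hY : Y ≠ 0)
    (hne : ∃ S, ∀ x, IsCoord ε₁ ε₂ x (Y, S, V) → x ∉ A) :
    {S : ℂ | ∃ x ∈ A, IsCoord ε₁ ε₂ x (Y, S, V)}.Finite := by
  obtain ⟨𝒮, hhom, rfl⟩ := hA
  let q : MvPolynomial (Fin (3 + 1)) ℂ → Polynomial ℂ := fun G =>
    MvPolynomial.aeval ![C (Y 0), C (Y 1), C ε₁ * X, C (ε₂ * V)] G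
  have hq : ∀ G S, (q G).eval S = MvPolynomial.eval (unscale ε₁ ε₂ (Y, S, V)) G := by
    intro G S
    induction G using MvPolynomial.induction_on with
    | C a => simp [q]
    | add G H hG hH =>
      simp only [q, map_add, Polynomial.eval_add] at hG hH ⊢
      rw [hG, hH]
    | mul_X G i hG =>
      simp only [q, map_mul, Polynomial.eval_mul, MvPolynomial.aeval_X,
        MvPolynomial.eval_X] at hG ⊢
      rw [hG]
      congr 1
      fin_cases i <;> simp [unscale]
  have hmem : ∀ S x, IsCoord ε₁ ε₂ x (Y, S, V) →
      ((∀ G ∈ 𝒮, MvPolynomial.eval x.rep G = 0) ↔ ∀ G ∈ 𝒮, (q G).eval S = 0) := by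
    rintro S x ⟨h0, rfl⟩
    obtain ⟨s, hs, hrep⟩ := PSpace.exists_rep_mk _ h0
    refine forall₂_congr fun G hG => ?_
    obtain ⟨n, hn⟩ := hhom G hG
    rw [hrep, eval_smul_of_isHomogeneous hn, hq, mul_eq_zero, or_iff_right (pow_ne_zero _ hs)]
  obtain ⟨S₀, hS₀⟩ := hne
  obtain ⟨x₀, hx₀⟩ := isCoord_mk (ε₁ := ε₁) (ε₂ := ε₂) (p := (Y, S₀, V)) hY
  have hnot := hS₀ x₀ hx₀
  rw [Set.mem_ofPred_eq, hmem S₀ x₀ hx₀] at hnot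
  push Not at hnot
  obtain ⟨G, hG, hGS⟩ := hnot
  have hG0 : q G ≠ 0 := by
    intro h
    rw [h, Polynomial.eval_zero] at hGS
    exact hGS rfl
  classical
  refine ((q G).roots.toFinset.finite_toSet).subset ?_
  rintro S ⟨x, hx, hxS⟩
  rw [Finset.mem_coe, Multiset.mem_toFinset, Polynomial.mem_roots hG0]
  exact (hmem S x hxS).1 hx G hG

/-- A contraction of a finite set has a fixed point on each orbit. -/
theorem exists_iterate_eq_of_finite {D : Set ℂ} (hD : D.Finite) {φ : ℂ → ℂ}
    (hφ : Set.MapsTo φ D D)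
    (hcon : ∀ a ∈ D, ∀ b ∈ D, ‖φ a - φ b‖ ≤ 1 / 2 * ‖a - b‖) {a : ℂ} (ha : a ∈ D) :
    ∃ n, φ (φ^[n] a) = φ^[n] a := by
  have hit : ∀ n, φ^[n] a ∈ D := fun n => hφ.iterate n ha
  have hle : ∀ n, ‖φ^[n + 1] a - φ^[n] a‖ ≤ (1 / 2) ^ n * ‖φ a - a‖ := by
    intro n
    induction n with
    | zero => simp
    | succ n ih =>
      rw [Function.iterate_succ_apply' φ (n + 1), Function.iterate_succ_apply' φ n]
      refine (hcon _ ?_ _ (hit n)).trans ?_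
      · rw [← Function.iterate_succ_apply' φ]
        exact hit (n + 1)
      · rw [← Function.iterate_succ_apply' φ, pow_succ]
        linarith
  by_contra hno
  push Not at hno
  -- Distinct points of a finite set are at distance bounded below, whereas successive points of the
  -- orbit approach each other geometrically.
  have hfin2 : {q : ℂ × ℂ | q.1 ∈ D ∧ q.2 ∈ D ∧ q.1 ≠ q.2}.Finite :=
    (hD.prod hD).subset fun q hq => ⟨hq.1, hq.2.1⟩
  obtain ⟨κ, hκ, hmin⟩ := hfin2.isCompact.exists_forall_le' (f := fun q : ℂ × ℂ => ‖q.1 - q.2‖)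
    (a := 0) (by fun_prop) fun q hq => norm_pos_iff.2 (sub_ne_zero.2 hq.2.2)
  have hlim : Filter.Tendsto (fun n : ℕ => (1 / 2 : ℝ) ^ n * ‖φ a - a‖) Filter.atTop
      (𝓝 (0 * ‖φ a - a‖)) :=
    (tendsto_pow_atTop_nhds_zero_of_lt_one (by norm_num) (by norm_num)).mul_const _
  rw [zero_mul] at hlim
  refine absurd (ge_of_tendsto' hlim fun n => (hmin (φ^[n + 1] a, φ^[n] a) ?_).trans (hle n))
    (not_le.2 hκ)
  refine ⟨hit _, hit _, ?_⟩
  simp only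
  rw [Function.iterate_succ_apply']
  exact hno n

/-- If the set were algebraic, its fibre over a fixed point `Y` would be finite, and the contraction
on it would send each point to a fixed point after finitely many steps. A point of the attracting
set over a conjugate `Z` would thus reach a fixed point of the endomorphism over `Y`, whose backward
orbit in the attracting set is trivial because `Y` is not near the bad set. Then `Z` would be
proportional to `Y`, which would itself make `Y` bad. -/
theorem not_isAlgebraicSet (h : τ.Adapted c C ρ η m ε₁ ε₂)
    (hw : ∀ (j : ℕ) (Y : Cone 1), 1 ≤ j → j ≤ 9 → Y ≠ 0 → τ.NearBad η Y →
      ¬ τ.NearBad η (τ.base^[j] Y)) : ¬ IsAlgebraicSet h.attractor := by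
  intro hA
  have hd0 : d ≠ 0 := by have := h.two_le; omega
  obtain ⟨Y, hY, hYF⟩ := τ.exists_base_eq_self h.two_le
  obtain ⟨Z, hZ, hYZ, hZF⟩ := τ.exists_conjugacy_eq_zero h.two_le Y hY
  -- A fixed point near the bad set would contradict the window condition with `j = 1`.
  have hgood : ¬ τ.NearBad η Y := by
    intro hb
    refine hw 1 Y le_rfl (by norm_num) hY hb ?_
    rw [Function.iterate_one, hYF]
    exact hb
  let D : Set ℂ := {S : ℂ | ∃ x ∈ h.attractor, IsCoord ε₁ ε₂ x (Y, S, Y 1)}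
  have hbd : ∀ S ∈ D, ‖S‖ ≤ ρ * ‖Y‖ := by
    rintro S ⟨x, hx, hxS⟩
    exact (h.mem_of_isCoord (h.attractor_subset_openTube hx) hxS).1.1
  have hDfin : D.Finite := by
    refine hA.finite_of_line hY ⟨((ρ * ‖Y‖ + 1 : ℝ) : ℂ), fun x hx hxA => ?_⟩
    have h1 := hbd _ ⟨x, hxA, hx⟩
    rw [Complex.norm_real, Real.norm_eq_abs] at h1
    have := le_abs_self (ρ * ‖Y‖ + 1)
    linarith
  let φ : ℂ → ℂ := fun S => τ.third Y + ε₁ ^ (d - 1) * S ^ d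
  have hstep : ∀ S, τ.step ε₁ ε₂ (Y, S, Y 1) = (Y, φ S, Y 1) := by
    intro S
    simp only [step, hYF, sub_self, mul_zero, add_zero, φ]
  have hφ : Set.MapsTo φ D D := by
    rintro S ⟨x, hx, hxS⟩
    refine ⟨_, h.mapsTo_attractor hx, ?_⟩
    rw [← hstep]
    exact τ.isCoord_step h.two_le hxS
  have hYn := norm_pos_iff.2 hY
  have hcon : ∀ a ∈ D, ∀ b ∈ D, ‖φ a - φ b‖ ≤ 1 / 2 * ‖a - b‖ := by
    intro a ha b hb
    have e1 : φ a - φ b = ε₁ ^ (d - 1) * (a ^ d - b ^ d) := by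
      simp only [φ]
      ring
    have e2 := norm_pow_sub_pow_le d (hbd a ha) (hbd b hb)
    have e3 : c * ‖Y‖ ^ (d - 1) ≤ 1 := by
      have h1 := (h.bounds Y).1
      have h2 : ‖Y‖ ^ d = ‖Y‖ ^ (d - 1) * ‖Y‖ := by
        rw [← pow_succ]
        congr 1
        omega
      rw [hYF, h2, ← mul_assoc] at h1
      exact le_of_mul_le_mul_right (by linarith) hYn
    rw [e1, norm_mul]
    calc ‖ε₁ ^ (d - 1)‖ * ‖a ^ d - b ^ d‖
        ≤ ‖ε₁ ^ (d - 1)‖ * (d * (ρ * ‖Y‖) ^ (d - 1) * ‖a - b‖) := by gcongr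
      _ = (‖ε₁ ^ (d - 1)‖ * (d * ρ ^ (d - 1))) * (‖Y‖ ^ (d - 1) * ‖a - b‖) := by ring
      _ ≤ c / 2 * (‖Y‖ ^ (d - 1) * ‖a - b‖) := by
        gcongr
        exact h.contracting₁
      _ = 1 / 2 * (c * ‖Y‖ ^ (d - 1)) * ‖a - b‖ := by ring
      _ ≤ 1 / 2 * 1 * ‖a - b‖ := by gcongr
      _ = 1 / 2 * ‖a - b‖ := by ring
  obtain ⟨x, hx, p, hp, hpZ⟩ := h.exists_mem_attractor hZ
  have hpV : p.2.2 = p.1 1 := h.snd_snd_eq hx hp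
  have hp' : τ.step ε₁ ε₂ p = (Y, τ.third Z + ε₁ ^ (d - 1) * p.2.1 ^ d, Y 1) := by
    simp only [step, hpV, sub_self, mul_zero, add_zero, hpZ, hZF, hYF]
  have hx1 := τ.isCoord_step h.two_le hp
  rw [hp'] at hx1
  set S₀ := τ.third Z + ε₁ ^ (d - 1) * p.2.1 ^ d
  have hS₀ : S₀ ∈ D := ⟨_, h.mapsTo_attractor hx, hx1⟩
  obtain ⟨n, hn⟩ := exists_iterate_eq_of_finite hDfin hφ hcon hS₀
  set S := φ^[n] S₀ with hS
  have hiter : ∀ n, (τ.step ε₁ ε₂)^[n] (Y, S₀, Y 1) = (Y, φ^[n] S₀, Y 1) := by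
    intro n
    induction n with
    | zero => rfl
    | succ n ih => rw [Function.iterate_succ_apply', Function.iterate_succ_apply', ih, hstep]
  obtain ⟨y, hy, hyS⟩ : S ∈ D := hφ.iterate n hS₀
  have hfix : τ.toEndo h.two_le ε₁ ε₂ y = y := by
    have := τ.isCoord_step h.two_le hyS
    rw [hstep, hn] at this
    exact this.unique hyS
  have hxy : (τ.toEndo h.two_le ε₁ ε₂)^[n + 1] x = y := by
    have := τ.isCoord_iterate h.two_le hx1 n
    rw [hiter] at this
    rw [Function.iterate_succ_apply]
    exact this.unique hyS
  -- A second preimage would lie in the second image of the tube and force a bad base point on the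
  -- orbit of `y`, which is constantly over `Y`.
  have huniq : ∀ z ∈ h.attractor, τ.toEndo h.two_le ε₁ ε₂ z = y → z = y := by
    intro z hz hzy
    by_contra hne
    have hfixn : ∀ n, (τ.toEndo h.two_le ε₁ ε₂)^[n] y = y := fun n =>
      Function.iterate_fixed hfix n
    have hb := h.nearBad_of_apply_eq (h.attractor_subset_openTube hy) (h.attractor_subset 2 hz)
      (by rw [hfixn]; exact hne) (by rw [hfixn]; exact hzy) hyS
    rw [Function.iterate_fixed hYF, Function.iterate_fixed hYF, or_self] at hb
    exact hgood hb
  have hback : ∀ n, ∀ z ∈ h.attractor, (τ.toEndo h.two_le ε₁ ε₂)^[n] z = y → z = y := by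
    intro n
    induction n with
    | zero => exact fun z _ hz => hz
    | succ n ih =>
      intro z hz hzy
      rw [Function.iterate_succ_apply] at hzy
      exact huniq z hz (ih _ (h.mapsTo_attractor hz) hzy)
  rw [hback _ x hx hxy] at hp
  obtain ⟨s, hs, hps⟩ := hyS.eq_smul h.ne_zero₁ h.ne_zero₂ hp
  have hZY : Z = s • Y := by
    rw [← hpZ, hps]
    rfl
  have hsd : s ^ d = 1 := pow_eq_one_of_base_eq hY (by rw [← hZY, hZF])
  refine hgood (Or.inr (Or.inr ⟨Z, 1, one_pow _, hZF, hYZ, ?_⟩))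
  rw [hZY, third_smul, hsd, one_mul, sub_self, norm_zero]
  have := h.eta_pos
  positivity

/-- The line `t = u = 0`, parametrized with degree one, lies in the trapping region and yields the
current; larger bidimensions are excluded since the attracting set lies in a closed tube contained
in `O`. -/
theorem hasDimension (h : τ.Adapted c C ρ η m ε₁ ε₂) {O : Set (PSpace 3)}
    (hO : ∀ K S, IsClosed K → K ⊆ O → S ⊆ K → ∀ l, 1 < l → ¬ SupportsPositiveClosedCurrent S l)
    (hsub : closedTube ε₁ ε₂ (ρ / 2) ⊆ O) : HasDimension h.attractor 1 := by
  have hd0 : d ≠ 0 := by have := h.two_le; omega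
  have hG : IsConeMap (fun Y : Cone 1 => unscale ε₁ ε₂ (Y, 0, 0)) 1 :=
    { contDiff := by
        refine contDiff_pi.2 fun i => ?_
        fin_cases i
        · exact contDiff_apply ℂ ℂ 0
        · exact contDiff_apply ℂ ℂ 1
        · change ContDiff ℂ ∞ fun _ : Cone 1 => ε₁ * 0
          exact contDiff_const
        · change ContDiff ℂ ∞ fun _ : Cone 1 => ε₂ * 0
          exact contDiff_const
      smul := fun s Y => by
        rw [pow_one, ← unscale_smul]
        congr 1
        simp
      ne_zero := fun Y hY h0 => hY (funext fun i => by
        fin_cases i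
        · exact congrFun h0 0
        · exact congrFun h0 1) }
  refine ⟨supportsPositiveClosedCurrent_one _ hd0 h.closure_image_subset one_ne_zero hG
    fun Y hY => ?_, ?_⟩
  · have : 0 < ρ * ‖Y‖ := mul_pos h.rho_pos (norm_pos_iff.2 hY)
    exact ⟨(Y, 0, 0), by simpa using this, by simpa using this, hG.ne_zero Y hY, rfl⟩
  · refine hO _ _ (isClosed_closedTube h.ne_zero₁ h.ne_zero₂ (ρ / 2)) hsub ?_
    intro x hx
    have := h.attractor_subset 1 hx
    rw [Function.iterate_one] at this
    exact h.image_subset this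

end Triple.Adapted

/-- The main theorem for a triple which satisfies the genericity condition. -/
theorem Triple.IsGeneric.exists_attractingSet {d : ℕ} {τ : Triple d} (hτ : τ.IsGeneric)
    (hd : 2 ≤ d) : ∃ e₁ e₂ : ℝ, 0 < e₁ ∧ 0 < e₂ ∧
      ∀ ε₁ ε₂ : ℂ, 0 < ‖ε₁‖ → ‖ε₁‖ < e₁ → 0 < ‖ε₂‖ → ‖ε₂‖ < e₂ →
        ∃ A : Set (PSpace 3),
          IsAttractingSet (τ.toEndo hd ε₁ ε₂) A ∧
          HasDimension A 1 ∧
          IsSmallTopologicalDegreeOn (τ.toEndo hd ε₁ ε₂) A ∧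
          A ⊆ {p : PSpace 3 | p.rep 3 = ε₂ * p.rep 1} ∧
          ¬ IsAlgebraicSet A := by
  obtain ⟨O, hO, hline, hcur⟩ := exists_isOpen_forall_not_supportsPositiveClosedCurrent
  obtain ⟨κ, hκ, hκO⟩ := exists_closedTube_subset hO hline
  obtain ⟨η, hη, hw⟩ := hτ.exists_nearBad hd
  obtain ⟨c, C, ρ, m, e₁, e₂, he₁, he₂, hadapted⟩ := τ.exists_adapted hd hη hκ
  refine ⟨e₁, e₂, he₁, he₂, fun ε₁ ε₂ h01 h1 h02 h2 => ?_⟩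
  obtain ⟨h, hr1, hr2⟩ := hadapted ε₁ ε₂ h01 h1 h02 h2
  have hρ := h.rho_pos
  have hdim := h.hasDimension hcur (hκO ε₁ ε₂ (ρ / 2) h.ne_zero₁ h.ne_zero₂
    (le_trans (by gcongr; linarith) hr1) (le_trans (by gcongr; linarith) hr2))
  refine ⟨h.attractor, ⟨_, h.isTrappingRegion⟩, hdim, ⟨1, _, hdim, h.isTrappingRegion,
    h.isAsymptoticallySmallDegree hw⟩, ?_, h.not_isAlgebraicSet hw⟩
  intro x hx
  obtain ⟨p, hp⟩ := exists_isCoord h.ne_zero₁ h.ne_zero₂ x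
  have hV := h.snd_snd_eq hx hp
  obtain ⟨h0, rfl⟩ := hp
  obtain ⟨s, -, hrep⟩ := PSpace.exists_rep_mk _ h0
  rw [Set.mem_ofPred_eq, hrep]
  simp only [Pi.smul_apply, smul_eq_mul, unscale, Matrix.cons_val, hV]
  ring

/-! ### Elimination -/

section Elimination

variable {σ V B ι : Type*} [Fintype V] [Fintype B] [DecidableEq B]

/-- The degree of a monomial in a block of variables. -/
def blockDegree (π : V → B) (ν : V →₀ ℕ) : B →₀ ℕ :=
  Finsupp.equivFunOnFinite.symm fun b => ∑ v with π v = b, ν v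

theorem finite_blockDegree_eq (π : V → B) (N : B →₀ ℕ) :
    {ν : V →₀ ℕ | blockDegree π ν = N}.Finite := by
  classical
  refine (Set.finite_Iic (∑ v : V, Finsupp.single v (N (π v)))).subset fun ν hν v => ?_
  have h1 : (∑ w : V, Finsupp.single w (N (π w))) v = N (π v) := by
    rw [Finsupp.finsetSum_apply, Finset.sum_eq_single v]
    · simp
    · intro w _ hw
      exact Finsupp.single_eq_of_ne hw.symm
    · simp
  have h2 : ν v ≤ N (π v) := by
    have h3 : blockDegree π ν (π v) = N (π v) := congrArg (fun q => q (π v)) hν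
    rw [← h3]
    exact Finset.single_le_sum (f := fun w => ν w) (fun _ _ => Nat.zero_le _)
      (Finset.mem_filter.2 ⟨Finset.mem_univ v, rfl⟩)
  exact h2.trans h1.ge

/-- A form of large degree in each block belongs to an ideal whose zeros all have a vanishing
block. -/
theorem exists_monomial_mem (π : V → B) (I : Ideal (MvPolynomial V ℂ))
    (hI : ∀ y ∈ MvPolynomial.zeroLocus ℂ I, ∃ b, ∀ v, π v = b → y v = 0) :
    ∃ N : ℕ, ∀ ν : V →₀ ℕ, (∀ b, blockDegree π ν b = N) → MvPolynomial.monomial ν (1 : ℂ) ∈ I := by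
  classical
  let J : B → Ideal (MvPolynomial V ℂ) := fun b => Ideal.span (MvPolynomial.X '' {v | π v = b})
  -- Nullstellensatz: a polynomial in the product of the ideals of the blocks vanishes wherever some
  -- block vanishes, hence at all zeros of `I`.
  have hJ : ∏ b, J b ≤ I.radical := by
    rw [← MvPolynomial.vanishingIdeal_zeroLocus_eq_radical (K := ℂ)]
    intro g hg
    rw [MvPolynomial.mem_vanishingIdeal_iff]
    intro y hy
    obtain ⟨b, hb⟩ := hI y hy
    have h1 : g ∈ J b := (Ideal.prod_le_inf.trans (Finset.inf_le (Finset.mem_univ b))) hg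
    have h2 : J b ≤ RingHom.ker (MvPolynomial.aeval y : MvPolynomial V ℂ →ₐ[ℂ] ℂ) := by
      refine Ideal.span_le.2 ?_
      rintro _ ⟨v, hv, rfl⟩
      rw [SetLike.mem_coe, RingHom.mem_ker, MvPolynomial.aeval_X]
      exact hb v hv
    exact h2 h1
  obtain ⟨N, hN⟩ := Ideal.exists_pow_le_of_le_radical_of_fg hJ (IsNoetherian.noetherian _)
  refine ⟨N, fun ν hν => hN ?_⟩
  have h1 : MvPolynomial.monomial ν (1 : ℂ) =
      ∏ b : B, ∏ v with π v = b, (MvPolynomial.X v : MvPolynomial V ℂ) ^ ν v := by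
    rw [Finset.prod_fiberwise, MvPolynomial.monomial_eq, MvPolynomial.C_1, one_mul,
      Finsupp.prod_fintype _ _ fun _ => pow_zero _]
  rw [h1, ← Finset.prod_pow]
  refine Ideal.prod_mem_prod fun b _ => ?_
  rw [← hν b]
  change _ ∈ J b ^ ∑ v with π v = b, ν v
  rw [← Finset.prod_pow_eq_pow_sum]
  refine Ideal.prod_mem_prod fun v hv => ?_
  have hvJ : MvPolynomial.X v ∈ J b := Ideal.subset_span ⟨v, (Finset.mem_filter.1 hv).2, rfl⟩
  exact Ideal.pow_mem_pow hvJ _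

/-- The part of given degrees in the blocks of a polynomial which vanishes on an orbit under the
rescaling of the blocks vanishes on this orbit. -/
theorem sum_blockDegree_eq_zero (π : V → B) (g : MvPolynomial V ℂ) (y : V → ℂ)
    (hg : ∀ t : B → ℂ, (∀ b, t b ≠ 0) → MvPolynomial.eval (fun v => t (π v) * y v) g = 0)
    (N : B →₀ ℕ) :
    ∑ ν ∈ (finite_blockDegree_eq π N).toFinset, g.coeff ν * ∏ v, y v ^ ν v = 0 := by
  classical
  let q : MvPolynomial B ℂ :=
    MvPolynomial.aeval (fun v => MvPolynomial.C (y v) * MvPolynomial.X (π v)) g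
  have hq : ∀ (G : MvPolynomial V ℂ) (t : B → ℂ), MvPolynomial.eval t (MvPolynomial.aeval (fun v =>
      MvPolynomial.C (y v) * MvPolynomial.X (π v) : V → MvPolynomial B ℂ) G) =
      MvPolynomial.eval (fun v => t (π v) * y v) G := by
    intro G t
    induction G using MvPolynomial.induction_on with
    | C a => simp
    | add G H hG hH => rw [map_add, map_add, map_add, hG, hH]
    | mul_X G v hG =>
      rw [map_mul, map_mul, map_mul, hG, MvPolynomial.aeval_X, MvPolynomial.eval_X, map_mul,
        MvPolynomial.eval_C, MvPolynomial.eval_X, mul_comm (y v)]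
  have hq0 : q = 0 := by
    -- The vanishing is known only for scalings without zero entries; the additional factor takes
    -- care of the others.
    have h1 : q * ∏ b, MvPolynomial.X b = 0 := by
      refine MvPolynomial.funext fun t => ?_
      rw [map_mul, map_zero, mul_eq_zero]
      by_cases ht : ∀ b, t b ≠ 0
      · left
        rw [hq, hg t ht]
      · right
        push Not at ht
        obtain ⟨b, hb⟩ := ht
        rw [map_prod]
        exact Finset.prod_eq_zero (Finset.mem_univ b) (by rw [MvPolynomial.eval_X, hb])
    refine (mul_eq_zero.1 h1).resolve_right ?_
    exact Finset.prod_ne_zero_iff.2 fun b _ => MvPolynomial.X_ne_zero b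
  have hexp : q = ∑ ν ∈ g.support,
      MvPolynomial.monomial (blockDegree π ν) (g.coeff ν * ∏ v, y v ^ ν v) := by
    conv_lhs => rw [show q = MvPolynomial.aeval _ g from rfl, MvPolynomial.aeval_def,
      MvPolynomial.eval₂_eq']
    refine Finset.sum_congr rfl fun ν _ => ?_
    rw [MvPolynomial.algebraMap_eq, MvPolynomial.monomial_eq]
    simp only [mul_pow, Finset.prod_mul_distrib, map_mul, map_prod, map_pow]
    rw [mul_assoc]
    congr 2
    rw [Finsupp.prod_fintype _ _ fun _ => pow_zero _, ← Finset.prod_fiberwise Finset.univ π]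
    refine Finset.prod_congr rfl fun b _ => ?_
    change _ = MvPolynomial.X b ^ ∑ v with π v = b, ν v
    rw [← Finset.prod_pow_eq_pow_sum]
    refine Finset.prod_congr rfl fun v hv => ?_
    rw [(Finset.mem_filter.1 hv).2]
  have hcoeff := congrArg (MvPolynomial.coeff N) hexp
  rw [hq0, MvPolynomial.coeff_zero, MvPolynomial.coeff_sum] at hcoeff
  rw [hcoeff]
  simp only [MvPolynomial.coeff_monomial]
  rw [← Finset.sum_filter]
  symm
  refine Finset.sum_subset_zero_on_sdiff ?_ ?_ fun _ _ => rfl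
  · intro ν hν
    rw [Set.Finite.mem_toFinset]
    exact (Finset.mem_filter.1 hν).2
  · intro ν hν
    rw [Finset.mem_sdiff, Set.Finite.mem_toFinset, Finset.mem_filter, MvPolynomial.mem_support_iff] at hν
    have : g.coeff ν = 0 := by
      by_contra h
      exact hν.2 ⟨h, hν.1⟩
    rw [this, zero_mul]

/-- Elimination of several blocks of homogeneous variables: the absence of common zeros with
non-vanishing blocks is a Zariski open condition on the parameters. -/
theorem exists_eval_ne_zero_of_forall_block [Fintype ι] (π : V → B)
    (P : ι → MvPolynomial V (MvPolynomial σ ℂ))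
    (hinv : ∀ i a y (t : B → ℂ), (∀ b, t b ≠ 0) →
      MvPolynomial.eval y (MvPolynomial.map (MvPolynomial.eval a) (P i)) = 0 →
      MvPolynomial.eval (fun v => t (π v) * y v)
        (MvPolynomial.map (MvPolynomial.eval a) (P i)) = 0)
    (a₀ : σ → ℂ)
    (h₀ : ∀ y, (∀ i, MvPolynomial.eval y (MvPolynomial.map (MvPolynomial.eval a₀) (P i)) = 0) →
      ∃ b, ∀ v, π v = b → y v = 0) :
    ∃ G : MvPolynomial σ ℂ, MvPolynomial.eval a₀ G ≠ 0 ∧ ∀ a, MvPolynomial.eval a G ≠ 0 →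
      ∀ y, (∀ i, MvPolynomial.eval y (MvPolynomial.map (MvPolynomial.eval a) (P i)) = 0) →
        ∃ b, ∀ v, π v = b → y v = 0 := by
  classical
  obtain ⟨N, hN⟩ := exists_monomial_mem π
    (Ideal.span (Set.range fun i => MvPolynomial.map (MvPolynomial.eval a₀) (P i))) fun y hy => by
      refine h₀ y fun i => ?_
      rw [MvPolynomial.mem_zeroLocus_iff] at hy
      exact hy _ (Ideal.subset_span ⟨i, rfl⟩)
  let N' : B →₀ ℕ := Finsupp.equivFunOnFinite.symm fun _ => N
  let 𝓜 := (finite_blockDegree_eq π N').toFinset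
  have h𝓜 : ∀ ν : V →₀ ℕ, ν ∈ 𝓜 ↔ ∀ b, blockDegree π ν b = N := by
    intro ν
    rw [Set.Finite.mem_toFinset, Set.mem_ofPred_eq, Finsupp.ext_iff]
    exact Iff.rfl
  have hA : ∀ μ : 𝓜, ∃ A : ι → MvPolynomial V ℂ,
      ∑ i, A i * MvPolynomial.map (MvPolynomial.eval a₀) (P i) =
        MvPolynomial.monomial μ.1 (1 : ℂ) := fun μ =>
    Ideal.mem_span_range_iff_exists_fun.1 (hN μ.1 ((h𝓜 _).1 μ.2))
  choose A hA using hA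
  -- The cofactors expressing each monomial at `a₀` are kept constant while the parameter varies.
  -- The matrix of coefficients in block degree `N` is the identity at `a₀`, and its determinant is
  -- the required polynomial.
  let g : 𝓜 → MvPolynomial V (MvPolynomial σ ℂ) := fun μ =>
    ∑ i, MvPolynomial.map MvPolynomial.C (A μ i) * P i
  have hg : ∀ a μ, MvPolynomial.map (MvPolynomial.eval a) (g μ) =
      ∑ i, A μ i * MvPolynomial.map (MvPolynomial.eval a) (P i) := by
    intro a μ
    rw [map_sum]
    refine Finset.sum_congr rfl fun i _ => ?_
    rw [map_mul, MvPolynomial.map_map]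
    congr 1
    have : (MvPolynomial.eval a).comp MvPolynomial.C = RingHom.id ℂ := by
      ext x
      simp
    rw [this, MvPolynomial.map_id]
  let M : Matrix 𝓜 𝓜 (MvPolynomial σ ℂ) := fun μ ν => (g μ).coeff ν.1
  have hdet : ∀ a, MvPolynomial.eval a M.det = Matrix.det (M.map (MvPolynomial.eval a)) := fun a =>
    RingHom.map_det _ _
  have hM : ∀ a, M.map (MvPolynomial.eval a) =
      fun μ ν => (MvPolynomial.map (MvPolynomial.eval a) (g μ)).coeff ν.1 := by
    intro a
    funext μ ν
    rw [MvPolynomial.coeff_map]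
    rfl
  refine ⟨M.det, ?_, ?_⟩
  · have h1 : M.map (MvPolynomial.eval a₀) = 1 := by
      rw [hM]
      funext μ ν
      rw [hg, hA, MvPolynomial.coeff_monomial, Matrix.one_apply]
      simp only [Subtype.ext_iff]
    rw [hdet, h1, Matrix.det_one]
    exact one_ne_zero
  · intro a ha y hy
    by_contra hno
    push Not at hno
    choose v hv hyv using hno
    rw [hdet] at ha
    -- The combinations vanish on the whole orbit of `y` under block scalings, hence so do their
    -- parts of block degree `N`. Where the determinant is non-zero, all monomials of this block
    -- degree must vanish at `y`.
    have hvec : (M.map (MvPolynomial.eval a)).mulVec (fun ν => ∏ w, y w ^ ν.1 w) = 0 := by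
      funext μ
      have h1 := sum_blockDegree_eq_zero π (MvPolynomial.map (MvPolynomial.eval a) (g μ)) y
        (fun t ht => by
          rw [hg, map_sum]
          refine Finset.sum_eq_zero fun i _ => ?_
          rw [map_mul, hinv i a y t ht (hy i), mul_zero]) N'
      rw [hM]
      rw [← Finset.sum_coe_sort] at h1
      exact h1
    have hz := Matrix.eq_zero_of_mulVec_eq_zero ha hvec
    -- The `N`-th powers of one non-vanishing coordinate in each block give a monomial which does
    -- not vanish at `y`.
    let ν : V →₀ ℕ := ∑ b, Finsupp.single (v b) N
    have hν : ν ∈ 𝓜 := by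
      refine (h𝓜 ν).2 fun b => ?_
      change ∑ w with π w = b, ν w = N
      simp only [ν, Finsupp.finsetSum_apply]
      rw [Finset.sum_comm, Finset.sum_eq_single b]
      · rw [Finset.sum_eq_single (v b)]
        · simp
        · intro w _ hw
          exact Finsupp.single_eq_of_ne hw
        · intro h
          exact (h (Finset.mem_filter.2 ⟨Finset.mem_univ _, hv b⟩)).elim
      · intro b' _ hb'
        refine Finset.sum_eq_zero fun w hw => Finsupp.single_eq_of_ne ?_
        rintro rfl
        exact hb' ((hv b').symm.trans (Finset.mem_filter.1 hw).2)
      · simp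
    have h2 := congrFun hz ⟨ν, hν⟩
    simp only [Pi.zero_apply] at h2
    obtain ⟨w, -, hw⟩ := Finset.prod_eq_zero_iff.1 h2
    have hνw : ν w ≠ 0 := by
      intro h0
      rw [h0, pow_zero] at hw
      exact one_ne_zero hw
    have hw0 := (pow_eq_zero_iff hνw).1 hw
    refine hνw ?_
    simp only [ν, Finsupp.finsetSum_apply]
    refine Finset.sum_eq_zero fun b _ => Finsupp.single_eq_of_ne ?_
    rintro rfl
    exact hyv b hw0

end Elimination

/-! ### Polynomial families of polynomial functions -/

/-- `F a y` is polynomial in the parameters `a` and in the variables `y`. -/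
def IsPolynomial {σ V : Type*} (F : (σ → ℂ) → (V → ℂ) → ℂ) : Prop :=
  ∃ P : MvPolynomial V (MvPolynomial σ ℂ), ∀ a y,
    MvPolynomial.eval y (MvPolynomial.map (MvPolynomial.eval a) P) = F a y

namespace IsPolynomial

variable {σ V : Type*} {F G : (σ → ℂ) → (V → ℂ) → ℂ}

theorem param (s : σ) : IsPolynomial fun (a : σ → ℂ) (_ : V → ℂ) => a s :=
  ⟨MvPolynomial.C (MvPolynomial.X s), fun a y => by simp⟩

theorem var (v : V) : IsPolynomial fun (_ : σ → ℂ) (y : V → ℂ) => y v :=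
  ⟨MvPolynomial.X v, fun a y => by simp⟩

theorem add (hF : IsPolynomial F) (hG : IsPolynomial G) :
    IsPolynomial fun a y => F a y + G a y := by
  obtain ⟨P, hP⟩ := hF
  obtain ⟨Q, hQ⟩ := hG
  exact ⟨P + Q, fun a y => by rw [map_add, map_add, hP, hQ]⟩

theorem mul (hF : IsPolynomial F) (hG : IsPolynomial G) :
    IsPolynomial fun a y => F a y * G a y := by
  obtain ⟨P, hP⟩ := hF
  obtain ⟨Q, hQ⟩ := hG
  exact ⟨P * Q, fun a y => by rw [map_mul, map_mul, hP, hQ]⟩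

theorem neg (hF : IsPolynomial F) : IsPolynomial fun a y => -F a y := by
  obtain ⟨P, hP⟩ := hF
  exact ⟨-P, fun a y => by rw [map_neg, map_neg, hP]⟩

theorem sub (hF : IsPolynomial F) (hG : IsPolynomial G) :
    IsPolynomial fun a y => F a y - G a y := by
  simpa only [sub_eq_add_neg] using hF.add hG.neg

theorem pow (hF : IsPolynomial F) (n : ℕ) : IsPolynomial fun a y => F a y ^ n := by
  obtain ⟨P, hP⟩ := hF
  exact ⟨P ^ n, fun a y => by rw [map_pow, map_pow, hP]⟩

theorem sum {α : Type*} (s : Finset α) {F : α → (σ → ℂ) → (V → ℂ) → ℂ}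
    (hF : ∀ i, IsPolynomial (F i)) : IsPolynomial fun a y => ∑ i ∈ s, F i a y := by
  choose P hP using hF
  exact ⟨∑ i ∈ s, P i, fun a y => by rw [map_sum, map_sum]; simp only [hP]⟩

variable {d : ℕ} {g h : Fin (d + 1) → (σ → ℂ) → (V → ℂ) → ℂ} {Y Z : (σ → ℂ) → (V → ℂ) → Cone 1}

theorem binaryForm (hg : ∀ i, IsPolynomial (g i)) (hY : ∀ i, IsPolynomial fun a y => Y a y i) :
    IsPolynomial fun a y => AttractingSets.binaryForm (fun i => g i a y) (Y a y) :=
  sum _ fun i => (hg i).mul (((hY 0).pow _).mul ((hY 1).pow _))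

theorem bezout (hg : ∀ i, IsPolynomial (g i)) (hh : ∀ i, IsPolynomial (h i))
    (hY : ∀ i, IsPolynomial fun a y => Y a y i) (hZ : ∀ i, IsPolynomial fun a y => Z a y i) :
    IsPolynomial fun a y =>
      AttractingSets.bezout (fun i => g i a y) (fun i => h i a y) (Y a y) (Z a y) := by
  have hgeom : ∀ n, IsPolynomial fun a y => geomPair n (Y a y 0 * Z a y 1) (Y a y 1 * Z a y 0) :=
    fun n => sum _ fun l => (((hY 0).mul (hZ 1)).pow _).mul (((hY 1).mul (hZ 0)).pow _)
  refine sum _ fun i => sum _ fun k => ((hg i).mul (hh k)).mul ?_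
  unfold monomialBezout
  split_ifs
  · exact ((((hY 0).mul (hZ 0)).pow _).mul (((hY 1).mul (hZ 1)).pow _)).mul (hgeom _)
  · exact (((((hY 0).mul (hZ 0)).pow _).mul (((hY 1).mul (hZ 1)).pow _)).mul (hgeom _)).neg

end IsPolynomial

/-! ### The genericity condition is Zariski open -/

section System

variable {d : ℕ}

/-- The map of the plane with given coefficients. -/
def baseAt (a : Fin 3 × Fin (d + 1) → ℂ) (Y : Cone 1) : Cone 1 :=
  ![binaryForm (fun i => a (0, i)) Y, binaryForm (fun i => a (1, i)) Y]

/-- The third form with given coefficients. -/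
def thirdAt (a : Fin 3 × Fin (d + 1) → ℂ) (Y : Cone 1) : ℂ := binaryForm (fun i => a (2, i)) Y

theorem baseAt_smul (a : Fin 3 × Fin (d + 1) → ℂ) (s : ℂ) (Y : Cone 1) :
    baseAt a (s • Y) = s ^ d • baseAt a Y := by
  funext i
  fin_cases i
  · exact binaryForm_smul _ _ _
  · exact binaryForm_smul _ _ _

theorem baseAt_iterate_smul (a : Fin 3 × Fin (d + 1) → ℂ) (n : ℕ) (s : ℂ) (Y : Cone 1) :
    (baseAt a)^[n] (s • Y) = s ^ d ^ n • (baseAt a)^[n] Y := by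
  induction n with
  | zero => simp
  | succ n ih =>
    rw [Function.iterate_succ_apply', Function.iterate_succ_apply', ih, baseAt_smul, ← pow_mul,
      pow_succ]

/-- The equations satisfied by a point of the bad set and a conjugate point. -/
def pairSystem (a : Fin 3 × Fin (d + 1) → ℂ) (Y Z : Cone 1) : Fin 3 → ℂ :=
  ![bezout (fun i => a (0, i)) (fun i => a (1, i)) Y Z,
    Y 1 * thirdAt a Y * (thirdAt a Y ^ d * baseAt a Z 0 ^ d - thirdAt a Z ^ d * baseAt a Y 0 ^ d),
    Y 1 * thirdAt a Y * (thirdAt a Y ^ d * baseAt a Z 1 ^ d - thirdAt a Z ^ d * baseAt a Y 1 ^ d)]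

/-- The two points may be scaled independently here. This is why the `d`-th powers of the third form
are cross-multiplied by those of the base map, instead of normalizing the lifts so that their base
images agree. -/
theorem pairSystem_smul_smul (a : Fin 3 × Fin (d + 1) → ℂ) (s t : ℂ) {Y Z : Cone 1} {k : Fin 3}
    (h : pairSystem a Y Z k = 0) : pairSystem a (s • Y) (t • Z) k = 0 := by
  have hthird : ∀ (s : ℂ) (Y : Cone 1), thirdAt a (s • Y) = s ^ d * thirdAt a Y := fun s Y =>
    binaryForm_smul _ _ _
  have aux : ∀ i : Fin 2,
      Y 1 * thirdAt a Y * (thirdAt a Y ^ d * baseAt a Z i ^ d - thirdAt a Z ^ d * baseAt a Y i ^ d)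
        = 0 → (s • Y) 1 * thirdAt a (s • Y) * (thirdAt a (s • Y) ^ d * baseAt a (t • Z) i ^ d -
          thirdAt a (t • Z) ^ d * baseAt a (s • Y) i ^ d) = 0 := by
    intro i hi
    rw [hthird, hthird, baseAt_smul, baseAt_smul]
    simp only [Pi.smul_apply, smul_eq_mul, mul_pow]
    linear_combination s * s ^ d * (s ^ d) ^ d * (t ^ d) ^ d * hi
  fin_cases k
  · change bezout _ _ _ _ = 0 at h
    change bezout _ _ _ _ = 0
    rw [bezout_smul_left, bezout_smul_right, h, mul_zero, mul_zero]
  · exact aux 0 h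
  · exact aux 1 h

/-- The equations of the pairs of bad points which are mapped to each other. -/
def windowSystem (j : ℕ) (k : Fin 3 ⊕ Fin 3) (a : Fin 3 × Fin (d + 1) → ℂ)
    (y : Fin 3 × Fin 2 → ℂ) : ℂ :=
  k.elim (pairSystem a (fun i => y (0, i)) (fun i => y (1, i)))
    (pairSystem a ((baseAt a)^[j] fun i => y (0, i)) (fun i => y (2, i)))

theorem isPolynomial_baseAt {V : Type*} {Y : (Fin 3 × Fin (d + 1) → ℂ) → (V → ℂ) → Cone 1}
    (hY : ∀ i, IsPolynomial fun a y => Y a y i) (i : Fin 2) :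
    IsPolynomial fun a y => baseAt a (Y a y) i := by
  fin_cases i
  · exact IsPolynomial.binaryForm (fun i => IsPolynomial.param (0, i)) hY
  · exact IsPolynomial.binaryForm (fun i => IsPolynomial.param (1, i)) hY

theorem isPolynomial_pairSystem {V : Type*} {Y Z : (Fin 3 × Fin (d + 1) → ℂ) → (V → ℂ) → Cone 1}
    (hY : ∀ i, IsPolynomial fun a y => Y a y i) (hZ : ∀ i, IsPolynomial fun a y => Z a y i)
    (k : Fin 3) : IsPolynomial fun a y => pairSystem a (Y a y) (Z a y) k := by
  have hR : ∀ {Y : (Fin 3 × Fin (d + 1) → ℂ) → (V → ℂ) → Cone 1},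
      (∀ i, IsPolynomial fun a y => Y a y i) → IsPolynomial fun a y => thirdAt a (Y a y) :=
    fun hY => IsPolynomial.binaryForm (fun i => IsPolynomial.param (2, i)) hY
  have aux : ∀ i : Fin 2, IsPolynomial fun a y => Y a y 1 * thirdAt a (Y a y) *
      (thirdAt a (Y a y) ^ d * baseAt a (Z a y) i ^ d -
        thirdAt a (Z a y) ^ d * baseAt a (Y a y) i ^ d) := fun i =>
    ((hY 1).mul (hR hY)).mul ((((hR hY).pow _).mul ((isPolynomial_baseAt hZ i).pow _)).sub
      (((hR hZ).pow _).mul ((isPolynomial_baseAt hY i).pow _)))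
  fin_cases k
  · exact IsPolynomial.bezout (fun i => IsPolynomial.param (0, i))
      (fun i => IsPolynomial.param (1, i)) hY hZ
  · exact aux 0
  · exact aux 1

theorem isPolynomial_windowSystem (j : ℕ) (k : Fin 3 ⊕ Fin 3) :
    IsPolynomial (windowSystem (d := d) j k) := by
  have hblock : ∀ (b : Fin 3) (i : Fin 2),
      IsPolynomial fun (_ : Fin 3 × Fin (d + 1) → ℂ) (y : Fin 3 × Fin 2 → ℂ) => y (b, i) :=
    fun b i => IsPolynomial.var (b, i)
  have hiter : ∀ (n : ℕ) (i : Fin 2), IsPolynomial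
      fun (a : Fin 3 × Fin (d + 1) → ℂ) (y : Fin 3 × Fin 2 → ℂ) =>
        (baseAt a)^[n] (fun i => y (0, i)) i := by
    intro n
    induction n with
    | zero => exact hblock 0
    | succ n ih =>
      intro i
      have := isPolynomial_baseAt (Y := fun a y => (baseAt a)^[n] fun i => y (0, i)) ih i
      simpa only [Function.iterate_succ_apply'] using this
  rcases k with k | k
  · exact isPolynomial_pairSystem (Y := fun _ y i => y (0, i)) (Z := fun _ y i => y (1, i))
      (hblock 0) (hblock 1) k
  · exact isPolynomial_pairSystem (Y := fun a y => (baseAt a)^[j] fun i => y (0, i))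
      (Z := fun _ y i => y (2, i)) (hiter j) (hblock 2) k

theorem windowSystem_smul (j : ℕ) (k : Fin 3 ⊕ Fin 3) (a : Fin 3 × Fin (d + 1) → ℂ)
    (y : Fin 3 × Fin 2 → ℂ) (t : Fin 3 → ℂ) (h : windowSystem j k a y = 0) :
    windowSystem j k a (fun v => t v.1 * y v) = 0 := by
  have hblock : ∀ b : Fin 3, (fun i : Fin 2 => t b * y (b, i)) = t b • fun i : Fin 2 => y (b, i) :=
    fun _ => rfl
  rcases k with k | k
  · change pairSystem _ _ _ k = 0 at h
    change pairSystem _ _ _ k = 0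
    rw [hblock, hblock]
    exact pairSystem_smul_smul a _ _ h
  · change pairSystem _ _ _ k = 0 at h
    change pairSystem _ _ _ k = 0
    rw [hblock, hblock, baseAt_iterate_smul]
    exact pairSystem_smul_smul a _ _ h

theorem Triple.baseAt_coeffs (τ : Triple d) : baseAt τ.coeffs = τ.base := by
  funext Y i
  fin_cases i
  · exact (τ.base_zero_eq Y).symm
  · exact (τ.base_one_eq Y).symm

theorem Triple.pairSystem_coeffs (τ : Triple d) {Y Z : Cone 1} (h : τ.base Z = τ.base Y)
    (hYZ : τ.conjugacy Y Z = 0) (hb : τ.badness Y Z = 0) (k : Fin 3) :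
    pairSystem τ.coeffs Y Z k = 0 := by
  have hthird : thirdAt τ.coeffs = τ.third := funext fun Y => (τ.third_eq Y).symm
  have aux : ∀ i : Fin 2, Y 1 * τ.third Y * (τ.third Y ^ d * τ.base Z i ^ d -
      τ.third Z ^ d * τ.base Y i ^ d) = 0 := by
    intro i
    rw [badness] at hb
    rw [h]
    linear_combination -(τ.base Y i ^ d) * hb
  fin_cases k
  · exact hYZ
  · have := aux 0
    rw [← hthird, ← τ.baseAt_coeffs] at this
    exact this
  · have := aux 1
    rw [← hthird, ← τ.baseAt_coeffs] at this
    exact this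

/-- Genericity is a Zariski open condition. -/
theorem Triple.exists_isZariskiOpen (hd : 2 ≤ d) {τ₀ : Triple d}
    (h₀ : ∀ j : ℕ, 1 ≤ j → ∀ y, (∀ k, windowSystem j k τ₀.coeffs y = 0) →
      ∃ b, ∀ v : Fin 3 × Fin 2, v.1 = b → y v = 0) :
    ∃ Ω : Set (Triple d), IsZariskiOpen Ω ∧ Ω.Nonempty ∧ ∀ τ ∈ Ω, τ.IsGeneric := by
  have hG : ∀ j : ℕ, ∃ G : MvPolynomial (Fin 3 × Fin (d + 1)) ℂ, 1 ≤ j →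
      MvPolynomial.eval τ₀.coeffs G ≠ 0 ∧ ∀ a, MvPolynomial.eval a G ≠ 0 →
      ∀ y, (∀ k, windowSystem j k a y = 0) → ∃ b, ∀ v : Fin 3 × Fin 2, v.1 = b → y v = 0 := by
    intro j
    by_cases hj : 1 ≤ j
    swap
    · exact ⟨0, fun h => absurd h hj⟩
    choose P hP using isPolynomial_windowSystem (d := d) j
    obtain ⟨G, h1, h2⟩ := exists_eval_ne_zero_of_forall_block Prod.fst P
      (fun k a y t _ h => by
        rw [hP] at h ⊢
        exact windowSystem_smul j k a y t h) τ₀.coeffs (fun y hy => h₀ j hj y fun k => by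
          rw [← hP]
          exact hy k)
    refine ⟨G, fun _ => ⟨h1, fun a ha y hy => h2 a ha y fun k => ?_⟩⟩
    rw [hP]
    exact hy k
  choose G hG using hG
  refine ⟨{τ | ∃ H ∈ ({∏ j ∈ Finset.Icc 1 9, G j} : Set (MvPolynomial (Fin 3 × Fin (d + 1)) ℂ)),
    MvPolynomial.eval τ.coeffs H ≠ 0}, ⟨_, rfl⟩, ⟨τ₀, _, rfl, ?_⟩, ?_⟩
  · rw [map_prod]
    exact Finset.prod_ne_zero_iff.2 fun j hj => (hG j (Finset.mem_Icc.1 hj).1).1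
  · rintro τ ⟨H, rfl, hH⟩ j Y Z Z' h1 h9 hY e2 e3 e4 e5 hb hb'
    rw [map_prod, Finset.prod_ne_zero_iff] at hH
    have hd0 : d ≠ 0 := by omega
    have hbase0 : τ.base 0 = 0 := by
      have := τ.base_smul 0 0
      rwa [zero_pow hd0, zero_smul, zero_smul] at this
    have hY' := τ.base_iterate_ne_zero j hY
    have hne : ∀ b : Fin 3, (![Y, Z, Z'] b : Cone 1) ≠ 0 := by
      intro b
      fin_cases b
      · exact hY
      · intro h0
        change Z = 0 at h0
        rw [h0, hbase0] at e2
        exact τ.base_ne_zero hY e2.symm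
      · intro h0
        change Z' = 0 at h0
        rw [h0, hbase0] at e4
        exact τ.base_ne_zero hY' e4.symm
    obtain ⟨b, hzero⟩ := (hG j h1).2 τ.coeffs (hH j (Finset.mem_Icc.2 ⟨h1, h9⟩))
      (fun v => (![Y, Z, Z'] v.1 : Cone 1) v.2) (by
        rintro (k | k)
        · exact τ.pairSystem_coeffs e2 e3 hb k
        · change pairSystem τ.coeffs ((baseAt τ.coeffs)^[j] Y) Z' k = 0
          rw [τ.baseAt_coeffs]
          exact τ.pairSystem_coeffs e4 e5 hb' k)
    exact hne b (funext fun i => hzero (b, i) rfl)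

end System

/-! ### A generic triple -/

section Example

variable {d : ℕ}

/-- The polynomial with given coefficients. -/
def formOfCoeffs (a : Fin (d + 1) → ℂ) : MvPolynomial (Fin 2) ℂ :=
  ∑ i : Fin (d + 1), MvPolynomial.monomial (Finsupp.single 0 i.1 + Finsupp.single 1 (d - i.1)) (a i)

theorem isHomogeneous_formOfCoeffs (a : Fin (d + 1) → ℂ) : (formOfCoeffs a).IsHomogeneous d := by
  refine MvPolynomial.IsHomogeneous.sum _ _ _ fun i _ => ?_
  refine MvPolynomial.isHomogeneous_monomial _ ?_
  rw [Finsupp.degree_eq_sum, Fin.sum_univ_two]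
  simp
  omega

theorem coeff_formOfCoeffs (a : Fin (d + 1) → ℂ) (i : Fin (d + 1)) :
    (formOfCoeffs a).coeff (Finsupp.single 0 i.1 + Finsupp.single 1 (d - i.1)) = a i := by
  rw [formOfCoeffs, MvPolynomial.coeff_sum, Finset.sum_eq_single i]
  · simp
  · intro j _ hj
    rw [MvPolynomial.coeff_monomial, if_neg]
    intro h
    have := DFunLike.congr_fun h 0
    exact hj (Fin.ext (by simpa using this))
  · simp

theorem exists_triple_coeffs_eq (a : Fin 3 × Fin (d + 1) → ℂ)
    (ha : ∀ Y, baseAt a Y = 0 → Y = 0) : ∃ τ : Triple d, τ.coeffs = a := by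
  have heval : ∀ (b : Fin (d + 1) → ℂ) (Y : Cone 1),
      MvPolynomial.eval Y (formOfCoeffs b) = binaryForm b Y := by
    intro b Y
    rw [eval_eq_binaryForm (isHomogeneous_formOfCoeffs b)]
    simp only [coeff_formOfCoeffs]
  refine ⟨⟨formOfCoeffs fun i => a (0, i), formOfCoeffs fun i => a (1, i),
    formOfCoeffs fun i => a (2, i), isHomogeneous_formOfCoeffs _, isHomogeneous_formOfCoeffs _,
    isHomogeneous_formOfCoeffs _, fun Y h0 h1 => ha Y (funext fun i => ?_)⟩, ?_⟩
  · fin_cases i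
    · exact (heval _ Y).symm.trans h0
    · exact (heval _ Y).symm.trans h1
  · funext ⟨k, i⟩
    fin_cases k
    · exact coeff_formOfCoeffs _ i
    · exact coeff_formOfCoeffs _ i
    · exact coeff_formOfCoeffs _ i

/-- The coefficients of `α z^d + β w^d`. -/
def twoTerm (α β : ℂ) : Fin (d + 1) → ℂ := fun i =>
  (if i = Fin.last d then α else 0) + if i = 0 then β else 0

theorem sum_twoTerm (α β : ℂ) (u : Fin (d + 1) → ℂ) :
    ∑ i, twoTerm α β i * u i = α * u (Fin.last d) + β * u 0 := by
  simp [twoTerm, add_mul, Finset.sum_add_distrib]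

theorem binaryForm_twoTerm (α β : ℂ) (Y : Cone 1) :
    binaryForm (twoTerm α β : Fin (d + 1) → ℂ) Y = α * Y 0 ^ d + β * Y 1 ^ d := by
  rw [binaryForm, sum_twoTerm α β fun i : Fin (d + 1) => Y 0 ^ i.1 * Y 1 ^ (d - i.1)]
  simp

/-- Only the pairing of `z^d` with `w^d` survives. For the example the determinant is `-1`, and the
conjugates of a point are obtained by multiplying `z / w` by roots of unity. -/
theorem bezout_twoTerm (hd : d ≠ 0) (α β α' β' : ℂ) (Y Z : Cone 1) :
    bezout (twoTerm α β : Fin (d + 1) → ℂ) (twoTerm α' β') Y Z =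
      (α * β' - β * α') * geomPair d (Y 0 * Z 1) (Y 1 * Z 0) := by
  have h : ∀ i : Fin (d + 1), ∑ k : Fin (d + 1), twoTerm α β i * twoTerm α' β' k *
      monomialBezout d i.1 k.1 Y Z = twoTerm α β i *
      (α' * monomialBezout d i.1 d Y Z + β' * monomialBezout d i.1 0 Y Z) := by
    intro i
    have := sum_twoTerm α' β' fun k : Fin (d + 1) => monomialBezout d i.1 k.1 Y Z
    rw [Fin.val_last, Fin.val_zero] at this
    rw [← this, Finset.mul_sum]
    refine Finset.sum_congr rfl fun k _ => ?_
    ring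
  rw [bezout, Finset.sum_congr rfl fun i _ => h i, sum_twoTerm α β fun i : Fin (d + 1) =>
    α' * monomialBezout d i.1 d Y Z + β' * monomialBezout d i.1 0 Y Z]
  rw [Fin.val_last, Fin.val_zero]
  have e1 : monomialBezout d d d Y Z = 0 := by simp [monomialBezout, geomPair]
  have e2 : monomialBezout d 0 0 Y Z = 0 := by simp [monomialBezout, geomPair]
  have e3 : monomialBezout d d 0 Y Z = geomPair d (Y 0 * Z 1) (Y 1 * Z 0) := by
    simp [monomialBezout, Nat.pos_of_ne_zero hd]
  have e4 : monomialBezout d 0 d Y Z = -geomPair d (Y 0 * Z 1) (Y 1 * Z 0) := by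
    simp [monomialBezout]
  rw [e1, e2, e3, e4]
  ring

/-- The coefficients of `z w^(d-1) + w^d`. -/
def shiftTerm (d : ℕ) : Fin (d + 1) → ℂ := fun i =>
  (if i.1 = 1 then 1 else 0) + if i.1 = 0 then 1 else 0

theorem binaryForm_shiftTerm (hd : d ≠ 0) (Y : Cone 1) :
    binaryForm (shiftTerm d) Y = Y 1 ^ (d - 1) * (Y 0 + Y 1) := by
  obtain ⟨n, rfl⟩ := Nat.exists_eq_succ_of_ne_zero hd
  rw [binaryForm, Fin.sum_univ_succ, Fin.sum_univ_succ, Finset.sum_eq_zero]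
  · simp [shiftTerm]
    ring
  · intro i _
    simp [shiftTerm]

/-- The coefficients of the triple `c (z^d - c w^d) + w^d`, `z^d - c w^d`, `z w^(d-1) + w^d`. -/
def exampleCoeffs (d : ℕ) (c : ℂ) : Fin 3 × Fin (d + 1) → ℂ := fun q =>
  ![twoTerm c (1 - c ^ 2), twoTerm 1 (-c), shiftTerm d] q.1 q.2

theorem baseAt_exampleCoeffs (c : ℂ) (Y : Cone 1) : baseAt (exampleCoeffs d c) Y =
    ![c * (Y 0 ^ d - c * Y 1 ^ d) + Y 1 ^ d, Y 0 ^ d - c * Y 1 ^ d] := by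
  funext i
  fin_cases i
  · refine (binaryForm_twoTerm c (1 - c ^ 2) Y).trans ?_
    simp
    ring
  · refine (binaryForm_twoTerm 1 (-c) Y).trans ?_
    simp
    ring

theorem thirdAt_exampleCoeffs (hd : d ≠ 0) (c : ℂ) (Y : Cone 1) :
    thirdAt (exampleCoeffs d c) Y = Y 1 ^ (d - 1) * (Y 0 + Y 1) := binaryForm_shiftTerm hd Y

/-- The bad points of the example. -/
def Peripheral (K : ℝ) (Y : Cone 1) : Prop := Y 1 = 0 ∨ ‖Y 0‖ ≤ K * ‖Y 1‖

/-- In the coordinate `x = z / w`, a conjugate of `x` is `ω x` with `ω ≠ 1` a root of unity. Badness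
away from `w = 0` and `x = -1` reads `ω x + 1 = ξ (x + 1)` with `ξ` a root of unity different from
`ω`, so `x = (ξ - 1) / (ω - ξ)` has modulus at most `2 / m`. -/
theorem peripheral_of_pairSystem (hd : 2 ≤ d) {m : ℝ} (hm0 : 0 < m) (hm1 : m ≤ 1)
    (hm : ∀ ζ ξ : ℂ, ζ ^ d = 1 → ξ ^ d = 1 → ζ ≠ ξ → m ≤ ‖ζ - ξ‖) (c : ℂ) {Y Z : Cone 1}
    (hZ : Z ≠ 0) (h : ∀ k, pairSystem (exampleCoeffs d c) Y Z k = 0) : Peripheral (2 / m) Y := by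
  have hd0 : d ≠ 0 := by omega
  by_contra hno
  rw [Peripheral, not_or, not_le] at hno
  obtain ⟨hw, hz⟩ := hno
  have hwn := norm_pos_iff.2 hw
  have hK : 1 ≤ 2 / m := by rw [le_div_iff₀ hm0]; linarith
  have hzw : ‖Y 1‖ < ‖Y 0‖ := (le_mul_of_one_le_left hwn.le hK).trans_lt hz
  have hz0 : Y 0 ≠ 0 := norm_pos_iff.1 (hwn.trans hzw)
  have hs : Y 0 + Y 1 ≠ 0 := by
    intro h0
    rw [add_eq_zero_iff_eq_neg.1 h0, norm_neg] at hzw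
    exact lt_irrefl _ hzw
  have hD : geomPair d (Y 0 * Z 1) (Y 1 * Z 0) = 0 := by
    have h1 := h 0
    change bezout (twoTerm c (1 - c ^ 2)) (twoTerm 1 (-c)) Y Z = 0 at h1
    rw [bezout_twoTerm hd0] at h1
    linear_combination -h1
  have hpow : (Y 0 * Z 1) ^ d = (Y 1 * Z 0) ^ d := by
    have := sub_mul_geomPair d (Y 0 * Z 1) (Y 1 * Z 0)
    rw [hD, mul_zero] at this
    exact (sub_eq_zero.1 this.symm)
  have hw' : Z 1 ≠ 0 := by
    intro h0
    rw [h0, mul_zero, zero_pow hd0] at hpow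
    have h1 := (mul_eq_zero.1 ((pow_eq_zero_iff hd0).1 hpow.symm)).resolve_left hw
    refine hZ (funext fun i => ?_)
    fin_cases i
    · exact h1
    · exact h0
  obtain ⟨ω', hω', hω⟩ := Triple.eq_root_mul hpow.symm (mul_ne_zero hz0 hw')
  have hω1 : ω' ≠ 1 := by
    rintro rfl
    rw [one_mul] at hω
    rw [hω, geomPair, Finset.sum_congr rfl fun l hl => by
      rw [← pow_add, show l + (d - 1 - l) = d - 1 by have := Finset.mem_range.1 hl; omega],
      Finset.sum_const, Finset.card_range, nsmul_eq_mul] at hD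
    exact mul_ne_zero (Nat.cast_ne_zero.2 hd0) (pow_ne_zero _ (mul_ne_zero hz0 hw')) hD
  obtain ⟨r, hr⟩ : ∃ r, Z 1 = r * Y 1 := ⟨Z 1 / Y 1, by field_simp⟩
  have hr0 : r ≠ 0 := by
    rintro rfl
    rw [zero_mul] at hr
    exact hw' hr
  have hzr : Z 0 = ω' * r * Y 0 := by
    rw [hr] at hω
    have : Y 1 * Z 0 = Y 1 * (ω' * r * Y 0) := by linear_combination hω
    exact mul_left_cancel₀ hw this
  have hzd : Z 0 ^ d = r ^ d * Y 0 ^ d := by rw [hzr, mul_pow, mul_pow, hω', one_mul]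
  have hwd : Z 1 ^ d = r ^ d * Y 1 ^ d := by rw [hr, mul_pow]
  have hbase : ∀ i, baseAt (exampleCoeffs d c) Z i = r ^ d * baseAt (exampleCoeffs d c) Y i := by
    intro i
    rw [baseAt_exampleCoeffs, baseAt_exampleCoeffs]
    fin_cases i
    · simp only [Fin.zero_eta, Matrix.cons_val, hzd, hwd]
      ring
    · simp only [Fin.mk_one, Matrix.cons_val, hzd, hwd]
      ring
  have hRY : thirdAt (exampleCoeffs d c) Y = Y 1 ^ (d - 1) * (Y 0 + Y 1) :=
    thirdAt_exampleCoeffs hd0 c Y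
  have hRY0 : thirdAt (exampleCoeffs d c) Y ≠ 0 := by
    rw [hRY]
    exact mul_ne_zero (pow_ne_zero _ hw) hs
  have hRZ : thirdAt (exampleCoeffs d c) Z = r ^ d * (Y 1 ^ (d - 1) * (ω' * Y 0 + Y 1)) := by
    rw [thirdAt_exampleCoeffs hd0, hr, hzr, mul_pow]
    have : r ^ d = r ^ (d - 1) * r := by
      rw [← pow_succ]
      congr 1
      omega
    rw [this]
    ring
  -- Only one of the two equations is needed, the one for which the component of the base map is
  -- non-zero; if the second component vanishes, the first equals `w ^ d`.
  have hR : (ω' * Y 0 + Y 1) ^ d = (Y 0 + Y 1) ^ d := by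
    have key : ∀ i : Fin 2, baseAt (exampleCoeffs d c) Y i ≠ 0 → Y 1 * thirdAt (exampleCoeffs d c) Y *
        (thirdAt (exampleCoeffs d c) Y ^ d * baseAt (exampleCoeffs d c) Z i ^ d -
          thirdAt (exampleCoeffs d c) Z ^ d * baseAt (exampleCoeffs d c) Y i ^ d) = 0 →
        (ω' * Y 0 + Y 1) ^ d = (Y 0 + Y 1) ^ d := by
      intro i hi h0
      have h1 := (mul_eq_zero.1 h0).resolve_left (mul_ne_zero hw hRY0)
      rw [hbase, hRZ, hRY] at h1
      have h2 : (r ^ d) ^ d * (Y 1 ^ (d - 1)) ^ d * baseAt (exampleCoeffs d c) Y i ^ d ≠ 0 :=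
        mul_ne_zero (mul_ne_zero (pow_ne_zero _ (pow_ne_zero _ hr0))
          (pow_ne_zero _ (pow_ne_zero _ hw))) (pow_ne_zero _ hi)
      refine mul_left_cancel₀ h2 ?_
      simp only [mul_pow] at h1 ⊢
      linear_combination -h1
    by_cases h1 : baseAt (exampleCoeffs d c) Y 1 = 0
    · refine key 0 ?_ (h 1)
      rw [baseAt_exampleCoeffs] at h1 ⊢
      simp only [Matrix.cons_val] at h1 ⊢
      rw [h1, mul_zero, zero_add]
      exact pow_ne_zero _ hw
    · exact key 1 h1 (h 2)
  obtain ⟨ξ, hξ, hξe⟩ := Triple.eq_root_mul hR hs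
  have hne : ω' ≠ ξ := by
    rintro rfl
    have : (1 - ω') * Y 1 = 0 := by linear_combination hξe
    exact hω1 (sub_eq_zero.1 ((mul_eq_zero.1 this).resolve_right hw)).symm
  have h1 := hm ω' ξ hω' hξ hne
  have h2 : (ω' - ξ) * Y 0 = (ξ - 1) * Y 1 := by linear_combination hξe
  have h3 : ‖ξ - 1‖ ≤ 2 := by
    refine (norm_sub_le _ _).trans ?_
    rw [Triple.Adapted.norm_eq_one hd0 hξ, norm_one]
    norm_num
  have h4 : m * ‖Y 0‖ ≤ 2 * ‖Y 1‖ := by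
    calc m * ‖Y 0‖ ≤ ‖ω' - ξ‖ * ‖Y 0‖ := by gcongr
      _ = ‖ξ - 1‖ * ‖Y 1‖ := by rw [← norm_mul, h2, norm_mul]
      _ ≤ 2 * ‖Y 1‖ := by gcongr
  refine absurd hz (not_lt.2 ?_)
  rw [div_mul_eq_mul_div, le_div_iff₀ hm0]
  linarith

/-- The invariant disc of the example. -/
def InDisc (c : ℝ) (Y : Cone 1) : Prop := Y 1 ≠ 0 ∧ ‖Y 0 - c * Y 1‖ ≤ ‖Y 1‖

/-- In the affine coordinate the map is `x ↦ c + 1 / (x ^ d - c)`, so the image lies in the unit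
disc about `c` as soon as `|x ^ d - c| ≥ 1`. -/
theorem inDisc_baseAt {c : ℝ} {Y : Cone 1} (h0 : Y 0 ^ d - c * Y 1 ^ d ≠ 0)
    (h : ‖Y 1‖ ^ d ≤ ‖Y 0 ^ d - c * Y 1 ^ d‖) : InDisc c (baseAt (exampleCoeffs d c) Y) := by
  rw [baseAt_exampleCoeffs]
  refine ⟨h0, ?_⟩
  simp only [Matrix.cons_val]
  rwa [add_sub_cancel_left, norm_pow]

theorem Peripheral.inDisc_baseAt (hd : d ≠ 0) {K c : ℝ} (hc : K ^ d + 1 ≤ c) (hc0 : 0 ≤ c)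
    {Y : Cone 1} (hY : Y ≠ 0) (h : Peripheral K Y) : InDisc c (baseAt (exampleCoeffs d c) Y) := by
  by_cases hw : Y 1 = 0
  · have hz : Y 0 ≠ 0 := by
      intro hz
      refine hY (funext fun i => ?_)
      fin_cases i
      · exact hz
      · exact hw
    refine AttractingSets.inDisc_baseAt ?_ ?_
    · rw [hw, zero_pow hd, mul_zero, sub_zero]
      exact pow_ne_zero _ hz
    · rw [hw, norm_zero, zero_pow hd]
      exact norm_nonneg _
  · have hz : ‖Y 0‖ ≤ K * ‖Y 1‖ := h.resolve_left hw
    have hwn : 0 < ‖Y 1‖ ^ d := pow_pos (norm_pos_iff.2 hw) d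
    have h1 : ‖Y 1‖ ^ d ≤ ‖Y 0 ^ d - c * Y 1 ^ d‖ := by
      have e1 := norm_sub_norm_le (c * Y 1 ^ d) (Y 0 ^ d)
      rw [norm_sub_rev, norm_mul, norm_pow, norm_pow, Complex.norm_real, Real.norm_eq_abs,
        abs_of_nonneg hc0] at e1
      have e2 : ‖Y 0‖ ^ d ≤ K ^ d * ‖Y 1‖ ^ d := by
        rw [← mul_pow]
        gcongr
      have e3 := mul_le_mul_of_nonneg_right hc hwn.le
      linarith
    exact AttractingSets.inDisc_baseAt (norm_pos_iff.1 (hwn.trans_le h1)) h1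

theorem InDisc.le_norm {c : ℝ} (hc : 0 ≤ c) {Y : Cone 1} (h : InDisc c Y) :
    (c - 1) * ‖Y 1‖ ≤ ‖Y 0‖ := by
  have e1 := norm_sub_norm_le ((c : ℂ) * Y 1) (Y 0)
  rw [norm_sub_rev, norm_mul, Complex.norm_real, Real.norm_eq_abs, abs_of_nonneg hc] at e1
  linarith [h.2]

theorem InDisc.not_peripheral {K c : ℝ} (hc : K + 1 < c) (hc0 : 0 ≤ c) {Y : Cone 1}
    (h : InDisc c Y) : ¬ Peripheral K Y := by
  rintro (h1 | h1)
  · exact h.1 h1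
  · have h2 := h.le_norm hc0
    have h3 := norm_pos_iff.2 h.1
    have : K * ‖Y 1‖ < (c - 1) * ‖Y 1‖ := mul_lt_mul_of_pos_right (by linarith) h3
    linarith

/-- In the disc `|x| ≥ c - 1`, and `(c - 1) ^ d ≥ (c - 1) ^ 2 ≥ c + 1` for `c ≥ 3`, whence `|x ^ d -
c| ≥ 1`. -/
theorem InDisc.inDisc_baseAt (hd : 2 ≤ d) {c : ℝ} (hc : 3 ≤ c) {Y : Cone 1} (h : InDisc c Y) :
    InDisc c (baseAt (exampleCoeffs d c) Y) := by
  have hwn : 0 < ‖Y 1‖ ^ d := pow_pos (norm_pos_iff.2 h.1) d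
  have h1 : ‖Y 1‖ ^ d ≤ ‖Y 0 ^ d - c * Y 1 ^ d‖ := by
    have e1 := norm_sub_norm_le (Y 0 ^ d) (c * Y 1 ^ d)
    rw [norm_mul, norm_pow, norm_pow, Complex.norm_real, Real.norm_eq_abs,
      abs_of_nonneg (by linarith)] at e1
    have e2 : (c - 1) ^ d * ‖Y 1‖ ^ d ≤ ‖Y 0‖ ^ d := by
      rw [← mul_pow]
      exact pow_le_pow_left₀ (mul_nonneg (by linarith) (norm_nonneg _)) (h.le_norm (by linarith)) d
    have e3 : c + 1 ≤ (c - 1) ^ d :=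
      le_trans (by nlinarith) (pow_le_pow_right₀ (by linarith : 1 ≤ c - 1) hd)
    have e4 := mul_le_mul_of_nonneg_right e3 hwn.le
    linarith
  exact AttractingSets.inDisc_baseAt (norm_pos_iff.1 (hwn.trans_le h1)) h1

/-- Every bad point of the example falls into the invariant disc after one step, and the disc
contains no bad point, so no later image is bad. -/
theorem Triple.exists_forall_windowSystem (hd : 2 ≤ d) : ∃ τ₀ : Triple d, ∀ j : ℕ, 1 ≤ j → ∀ y,
    (∀ k, windowSystem j k τ₀.coeffs y = 0) → ∃ b, ∀ v : Fin 3 × Fin 2, v.1 = b → y v = 0 := by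
  have hd0 : d ≠ 0 := by omega
  obtain ⟨m, hm0, hm1, hm⟩ := Triple.exists_le_norm_sub_of_pow_eq_one hd0
  have hK : 1 ≤ 2 / m := by rw [le_div_iff₀ hm0]; linarith
  set K := 2 / m with hKdef
  -- Large enough for the image of `|x| ≤ K` to lie in the disc, for the disc to be invariant, and
  -- for it to be disjoint from `|x| ≤ K`.
  set c : ℝ := K ^ d + 4 with hc
  have hKd : K ≤ K ^ d := le_self_pow₀ hK hd0
  obtain ⟨τ₀, hτ₀⟩ := exists_triple_coeffs_eq (exampleCoeffs d c) (fun Y h => by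
    rw [baseAt_exampleCoeffs] at h
    have h0 := congrFun h 0
    have h1 := congrFun h 1
    simp only [Matrix.cons_val, Pi.zero_apply] at h0 h1
    rw [h1, mul_zero, zero_add] at h0
    rw [h0, mul_zero, sub_zero] at h1
    funext i
    fin_cases i
    · exact (pow_eq_zero_iff hd0).1 h1
    · exact (pow_eq_zero_iff hd0).1 h0)
  refine ⟨τ₀, fun j hj y hy => ?_⟩
  rw [hτ₀] at hy
  by_contra hno
  have hne : ∀ b : Fin 3, (fun i => y (b, i) : Cone 1) ≠ 0 := by
    intro b hb
    refine hno ⟨b, ?_⟩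
    rintro ⟨b', i⟩ rfl
    exact congrFun hb i
  have hper := peripheral_of_pairSystem hd hm0 hm1 hm c (hne 1) fun k => hy (Sum.inl k)
  have hper' := peripheral_of_pairSystem hd hm0 hm1 hm c (hne 2) fun k => hy (Sum.inr k)
  have hdisc : ∀ n, InDisc c ((baseAt (exampleCoeffs d c))^[n + 1] fun i => y (0, i)) := by
    intro n
    induction n with
    | zero => exact hper.inDisc_baseAt hd0 (by linarith) (by linarith) (hne 0)
    | succ n ih =>
      rw [Function.iterate_succ_apply']
      exact ih.inDisc_baseAt hd (by linarith)
  obtain ⟨n, rfl⟩ : ∃ n, j = n + 1 := ⟨j - 1, by omega⟩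
  exact (hdisc n).not_peripheral (by linarith) (by linarith) hper'

end Example

end AttractingSets

end

open AttractingSets in
theorem mainTheorem5 (d : ℕ) (hd : 2 ≤ d) :
    ∃ Ω : Set (Triple d), Triple.IsZariskiOpen Ω ∧ Ω.Nonempty ∧
      ∀ τ ∈ Ω, ∃ e₁ e₂ : ℝ, 0 < e₁ ∧ 0 < e₂ ∧
        ∀ ε₁ ε₂ : ℂ, 0 < ‖ε₁‖ → ‖ε₁‖ < e₁ → 0 < ‖ε₂‖ → ‖ε₂‖ < e₂ →
          ∃ A : Set (PSpace 3),
            IsAttractingSet (τ.toEndo hd ε₁ ε₂) A ∧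
            HasDimension A 1 ∧
            IsSmallTopologicalDegreeOn (τ.toEndo hd ε₁ ε₂) A ∧
            A ⊆ {p : PSpace 3 | p.rep 3 = ε₂ * p.rep 1} ∧
            ¬ IsAlgebraicSet A := by
  obtain ⟨τ₀, h₀⟩ := Triple.exists_forall_windowSystem hd
  obtain ⟨Ω, hΩ, hne, hgen⟩ := Triple.exists_isZariskiOpen hd h₀
  exact ⟨Ω, hΩ, hne, fun τ hτ => (hgen τ hτ).exists_attractingSet hd⟩
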